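/- Let $M$ be the line $\mathbb R$ or the circle $\mathbb T=\mathbb R/\mathbb Z$, with unitary Fourier transform ($\xi\in\mathbb R$, resp. $\xi\in2\pi\mathbb Z$). For $\sigma\in\mathbb R$ let $H^\sigma=H^\sigma(M)$ have norm $\|f\|_{H^\sigma}^2=\int(|\xi|+1)^{2\sigma}|\hat f(\xi)|^2\,d\xi$ (a sum over $2\pi\mathbb Z$ on $\mathbb T$), and let $H^\infty=\bigcap_\sigma H^\sigma$. The Hilbert transform $\mathsf H$ has symbol $-i\,\mathrm{sgn}(\xi)$ with $\mathrm{sgn}(0)=0$, $C_+$ is the Fourier projection onto $\xi\ge0$, $H^\sigma_+=C_+H^\sigma$, $q_+=C_+q$ and $\langle g,f\rangle=\int\bar g f\,dx$. Fix $-\frac12<s<0$; implicit constants in $\lesssim$ depend only on $s$ (and on the choice of $M$). A bounded set $Q\subset H^s$ is *equicontinuous* if $\sup_{q\in Q}\sup_{|y|<\delta}\|q(\cdot+y)-q\|_{H^s}\to0$ as $\delta\downarrow0$. For real-valued $q\in H^s$ let $\mathcal L_qf=-if'-C_+(qf)$ be the semibounded selfadjoint Lax operator with form domain $H^{1/2}_+$,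 and let $\beta(z;q)=\langle q_+,(\mathcal L_q+z)^{-1}q_+\rangle$, a meromorphic function on $\{\operatorname{Re}z>0\}$. Let $B_A$ be the set of real-valued $q\in H^s$ with $\|q\|_{H^s}\le A$. For a set $Q$ of real-valued functions in $H^s$, let $Q_{**}$ be the set of endpoints $q(b)$ of continuous curves $q:[a,b]\to H^s$ of real-valued functions with $q(a)\in Q$ such that for all $t\in[a,b]$, $\beta(\cdot\,;q(t))=\beta(\cdot\,;q(a))$ as meromorphic functions on the right half-plane. Put $P(q)=\int\frac12q^2\,dx$, $H_{BO}(q)=\int\frac12q\mathsf Hq'-\frac13q^3\,dx$, and $$H_\kappa(q)=\kappa P(q)-\kappa^2\beta(\kappa;q)\ \text{ on }\mathbb R,\qquad H_\kappa(q)=\bigl[\kappa+\textstyle\int q\bigr]P(q)-\kappa^2\beta(\kappa;q)+\tfrac\kappa2\bigl[\int q\bigr]^2+\tfrac16\bigl[\int q\bigr]^3\ \text{ on }\mathbb T.$$ For $t_1,t_2\in\mathbb R$, $e^{J\nabla(t_1H_{BO}+t_2H_\kappa)}(q)$ denotes the value at time $1$ of the real-valued $H^\infty$ solution (continuous in time with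 values in $H^\infty$ and, if $t_2\ne0$, remaining in the domain $\{-\kappa\notin\mathrm{spec}\,\mathcal L_u\}$ of $H_\kappa$) of $\frac{d}{dt}u=\partial_x\frac{\delta}{\delta u}\bigl(t_1H_{BO}+t_2H_\kappa\bigr)$ with $u(0)=q$. **Corollary.** 1. For every $A>0$ there is $\kappa_0=\kappa_0(A)\ge1$ such that $-\kappa$ lies in the resolvent set of $\mathcal L_q$ for all $\kappa\ge\kappa_0$ and $q\in(B_A)_{**}$, and such that for every $Q\subset B_A\cap H^\infty$ the set $$Q_*=\bigl\{e^{J\nabla(t_1H_{BO}+t_2H_\kappa)}(q): q\in Q,\ t_1,t_2\in\mathbb R,\ \kappa\ge\kappa_0\bigr\}$$ satisfies $Q_*\subset Q_{**}$ and is bounded in $H^s$. If $Q$ is equicontinuous in $H^s$, then so is $Q_*$. 2. For every $A>0$, every $q_0\in B_A$ and every $q\in\{q_0\}_{**}$, with implicit constants independent of $A$, $$\bigl(1+\|q_0\|_{H^s}\bigr)^{-2|s|}\|q_0\|_{H^s}\lesssim\|q\|_{H^s}\lesssim\bigl(1+\|q_0\|_{H^s}\bigr)^{\frac{2|s|}{1-2|s|}}\|q_0\|_{H^s}.$$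 3. Consequently, if $q(t)$ is a global real-valued $H^\infty$ solution of the Benjamin–Ono equation $\frac{d}{dt}q=\mathsf Hq''-2qq'$ on $M$, then for all $t\in\mathbb R$ $$\bigl(1+\|q(0)\|_{H^s}\bigr)^{-2|s|}\|q(0)\|_{H^s}\lesssim\|q(t)\|_{H^s}\lesssim\bigl(1+\|q(0)\|_{H^s}\bigr)^{\frac{2|s|}{1-2|s|}}\|q(0)\|_{H^s}.$$ -/

import Mathlib

open MeasureTheory Filter Topology
open scoped ENNReal ComplexConjugate

noncomputable section

namespace BenjaminOno

/-- The two settings: the real line `ℝ` and the circle `𝕋 = ℝ / ℤ`. -/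
inductive Geometry
  | line
  | circle

/-- The Plancherel measure on frequency space: Lebesgue measure for the line, counting measure
on `2πℤ` for the circle. -/
def freq : Geometry → Measure ℝ
  | .line => volume
  | .circle => Measure.sum fun n : ℤ => Measure.dirac (2 * Real.pi * (n : ℝ))

/-- The physical space measure; functions on the circle are functions on `ℝ` of period one,
integrated over one period. -/
def space : Geometry → Measure ℝ
  | .line => volume
  | .circle => volume.restrict (Set.Ioc 0 1)

/-- The constant of the unitary Fourier transform: `f(x) = c ∫ e^{iξx} f̂(ξ) dν(ξ)` and
`(fg)^ = c · f̂ * ĝ`, with `c = 1/√(2π)` on the line and `c = 1` on the circle. -/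
def fourierConst : Geometry → ℝ
  | .line => (Real.sqrt (2 * Real.pi))⁻¹
  | .circle => 1

/-- The measure `(|ξ| + 1)^{2σ} dν(ξ)`. -/
def sobMeasure (G : Geometry) (σ : ℝ) : Measure ℝ :=
  (freq G).withDensity fun ξ => ENNReal.ofReal ((|ξ| + 1) ^ (2 * σ))

/-- The (complex) Sobolev space `H^σ`, the completion of the Schwartz functions (of the smooth
periodic functions) under `‖f‖² = ∫ (|ξ| + 1)^{2σ} |f̂(ξ)|² dν(ξ)`. An element is represented by
its Fourier transform, which identifies this completion with a weighted `L²` space; the norm of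
`Sob G σ` is the `H^σ` norm. -/
abbrev Sob (G : Geometry) (σ : ℝ) : Type := Lp ℂ 2 (sobMeasure G σ)

/-! ### Operations in Fourier variables -/

/-- Reality of the function with Fourier transform `φ`. -/
def IsReal (G : Geometry) (φ : ℝ → ℂ) : Prop :=
  ∀ᵐ ξ ∂(freq G), φ (-ξ) = conj (φ ξ)

/-- Membership in `H^∞ = ⋂_σ H^σ` of the function with Fourier transform `φ`. -/
def IsSmooth (G : Geometry) (φ : ℝ → ℂ) : Prop :=
  ∀ σ : ℝ, MemLp φ 2 (sobMeasure G σ)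

/-- Membership in the Hardy space: the Fourier transform is supported on `[0, ∞)`. -/
def IsHardy (G : Geometry) (φ : ℝ → ℂ) : Prop :=
  ∀ᵐ ξ ∂(freq G), ξ < 0 → φ ξ = 0

/-- The Hilbert transform, with symbol `-i sgn ξ` and `sgn 0 = 0`. -/
def hilbert (φ : ℝ → ℂ) : ℝ → ℂ := fun ξ => -Complex.I * (Real.sign ξ : ℂ) * φ ξ

/-- The derivative `d/dx`, with symbol `iξ`. -/
def dx (φ : ℝ → ℂ) : ℝ → ℂ := fun ξ => Complex.I * (ξ : ℂ) * φ ξ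

/-- Fourier inversion: the function of `x` with Fourier transform `φ`
(used for functions in `H^∞`, where the integral converges absolutely). -/
def synth (G : Geometry) (φ : ℝ → ℂ) (x : ℝ) : ℂ :=
  (fourierConst G : ℂ) * ∫ ξ, Complex.exp (Complex.I * ξ * x) * φ ξ ∂(freq G)

/-- The same as a real number; used for real-valued functions, where `synth` is already real. -/
def phys (G : Geometry) (φ : ℝ → ℂ) (x : ℝ) : ℝ := (synth G φ x).re

theorem memLp_translateBy {G : Geometry} {σ : ℝ} (y : ℝ) (q : Sob G σ) :
    MemLp (fun ξ : ℝ => Complex.exp (Complex.I * ξ * y) * q ξ) 2 (sobMeasure G σ) := by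
  refine (Lp.memLp q).of_le (g := fun ξ => q ξ) ?_ ?_
  · exact (by fun_prop : Continuous fun ξ : ℝ =>
      Complex.exp (Complex.I * ξ * y)).aestronglyMeasurable.mul (Lp.aestronglyMeasurable q)
  · refine Eventually.of_forall fun ξ => ?_
    have h : ‖Complex.exp (Complex.I * ξ * y)‖ = 1 := by
      rw [Complex.norm_exp]; simp
    simp [h]

/-- The translate `q(· + y)`. -/
def translateBy {G : Geometry} {σ : ℝ} (y : ℝ) (q : Sob G σ) : Sob G σ :=
  (memLp_translateBy y q).toLp

/-- A bounded set `Q ⊆ H^σ` is equicontinuous if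
`sup_{q ∈ Q} sup_{|y| < δ} ‖q(· + y) - q‖_{H^σ} → 0` as `δ ↓ 0`. -/
def IsEquicontinuous {G : Geometry} {σ : ℝ} (Q : Set (Sob G σ)) : Prop :=
  Bornology.IsBounded Q ∧
    Tendsto (fun δ : ℝ => ⨆ q ∈ Q, ⨆ y : ℝ, ⨆ _ : |y| < δ, ‖translateBy y q - q‖ₑ)
      (𝓝[>] 0) (𝓝 0)

/-! ### The Lax operator, the gauge `m` and the function `β` -/

/-- The `L²` pairing `⟨g, f⟩ = ∫ ḡ f dx` of `g` in the Hardy space with (the `C₊` part of) `f`. -/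
def pairPlus (G : Geometry) (g f : ℝ → ℂ) : ℂ :=
  ∫ ξ in Set.Ici 0, conj (g ξ) * f ξ ∂(freq G)

/-- The sesquilinear form `⟨g, -i f'⟩ - ∫ q f ḡ dx` on the form domain `H^{1/2}_+`; the Lax
operator `ℒ f = -i f' - C₊(q f)` is the operator associated to it. -/
def laxForm (G : Geometry) (q g f : ℝ → ℂ) : ℂ :=
  (∫ ξ in Set.Ici 0, (ξ : ℂ) * (conj (g ξ) * f ξ) ∂(freq G)) -
    (fourierConst G : ℂ) * ∫ ξ in Set.Ici 0, conj (g ξ) *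
      (∫ η in Set.Ici 0, q (ξ - η) * f η ∂(freq G)) ∂(freq G)

/-- `f ∈ H^{1/2}_+` solves `(ℒ + z) f = C₊ φ`, as an identity in `H^{-1/2}_+`, the dual of the
form domain. -/
def SolvesLax (G : Geometry) (q : ℝ → ℂ) (z : ℂ) (φ : ℝ → ℂ) (f : Sob G (1 / 2)) : Prop :=
  IsHardy G f ∧ ∀ g : Sob G (1 / 2), IsHardy G g →
    laxForm G q g f + z * pairPlus G g f = pairPlus G g φ

/-- `-z` lies in the resolvent set of `ℒ`: the map `ℒ + z : H^{1/2}_+ → H^{-1/2}_+` is a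
bijection. -/
def LaxInvertible (G : Geometry) (q : ℝ → ℂ) (z : ℂ) : Prop :=
  ∀ φ : Sob G (-(1 / 2)), IsHardy G φ → ∃! f : Sob G (1 / 2), SolvesLax G q z φ f

open Classical in
/-- `m(z; q) = (ℒ + z)⁻¹ q₊` (and `0` if `-z` is in the spectrum of `ℒ`). -/
def gaugeM (G : Geometry) (q : ℝ → ℂ) (z : ℂ) : Sob G (1 / 2) :=
  if h : LaxInvertible G q z ∧ ∃ f : Sob G (1 / 2), SolvesLax G q z q f then h.2.choose else 0

/-- `β(z; q) = ⟨q₊, (ℒ + z)⁻¹ q₊⟩`. For real `q ∈ H^s`, `s > -1/2`, this is a meromorphic function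
of `z` in the right half-plane. -/
def beta (G : Geometry) (q : ℝ → ℂ) (z : ℂ) : ℂ := pairPlus G q (gaugeM G q z)

/-- `β(z; q₁) ≡ β(z; q₂)`: equality as meromorphic functions on the right half-plane, that is,
off a subset of the half-plane without accumulation points in it. -/
def SameBeta (G : Geometry) (q₁ q₂ : ℝ → ℂ) : Prop :=
  beta G q₁ =ᶠ[codiscreteWithin {z : ℂ | 0 < z.re}] beta G q₂

/-- The ball `B_A` of real-valued `q ∈ H^s` with `‖q‖_{H^s} ≤ A`. -/
def realBall (G : Geometry) (s A : ℝ) : Set (Sob G s) := {q | IsReal G q ∧ ‖q‖ ≤ A}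

/-- The set `Q_{**}` of endpoints `q(b)` of continuous curves `q : [a, b] → H^s` of real-valued
functions with `q(a) ∈ Q` along which `β` is constant. -/
def betaOrbit (G : Geometry) {s : ℝ} (Q : Set (Sob G s)) : Set (Sob G s) :=
  {p | ∃ (a b : ℝ) (q : ℝ → Sob G s), a ≤ b ∧ ContinuousOn q (Set.Icc a b) ∧
    (∀ t ∈ Set.Icc a b, IsReal G (q t)) ∧ q a ∈ Q ∧
    (∀ t ∈ Set.Icc a b, SameBeta G (q t) (q a)) ∧ q b = p}

/-! ### The flows -/

/-- The momentum `P(q) = ∫ ½ q² dx`. -/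
def momentum (G : Geometry) (q : ℝ → ℂ) : ℝ := ∫ x, 1 / 2 * phys G q x ^ 2 ∂(space G)

/-- The Benjamin-Ono energy `∫ ½ q H q' - ⅓ q³ dx`. -/
def hamBO (G : Geometry) (q : ℝ → ℂ) : ℝ :=
  ∫ x, (1 / 2 * (phys G q x * phys G (hilbert (dx q)) x) - 1 / 3 * phys G q x ^ 3) ∂(space G)

/-- The regularized Hamiltonian `H_κ`. -/
def hamK (G : Geometry) (κ : ℝ) (q : ℝ → ℂ) : ℝ :=
  match G with
  | .line => κ * momentum .line q - κ ^ 2 * (beta .line q κ).re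
  | .circle =>
      (κ + ∫ x, phys .circle q x ∂(space .circle)) * momentum .circle q
        - κ ^ 2 * (beta .circle q κ).re
        + κ / 2 * (∫ x, phys .circle q x ∂(space .circle)) ^ 2
        + 1 / 6 * (∫ x, phys .circle q x ∂(space .circle)) ^ 3

/-- `γ` is the functional derivative `δF/δq` at `q`: it is a real `H^∞` function with
`d/dθ F(q + θ f) |_{θ = 0} = ∫ γ f dx` for all real `f ∈ H^∞`. -/
def IsGradient (G : Geometry) {s : ℝ} (F : (ℝ → ℂ) → ℝ) (q γ : Sob G s) : Prop :=
  IsReal G γ ∧ IsSmooth G γ ∧ ∀ f : Sob G s, IsReal G f → IsSmooth G f →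
    HasDerivAt (fun θ : ℝ => F (q + θ • f : Sob G s))
      (∫ x, phys G γ x * phys G f x ∂(space G)) 0

/-- A continuous curve in real-valued `H^∞` over the time interval `I`. -/
def IsSmoothCurve (G : Geometry) {s : ℝ} (I : Set ℝ) (u : ℝ → Sob G s) : Prop :=
  (∀ t ∈ I, IsReal G (u t)) ∧
    ∀ σ : ℝ, ∃ v : ℝ → Sob G σ, ContinuousOn v I ∧ ∀ t ∈ I, v t =ᵐ[freq G] u t

/-- `u` is an `H^∞` solution, over the time interval `I`, of the Hamiltonian evolution
`∂ₜ u = J ∇F(u)`, where `J = ∂ₓ`. -/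
def IsHamiltonianSolution (G : Geometry) {s : ℝ} (F : (ℝ → ℂ) → ℝ) (I : Set ℝ)
    (u : ℝ → Sob G s) : Prop :=
  IsSmoothCurve G I u ∧ ∀ t ∈ I, ∃ γ : Sob G s, IsGradient G F (u t) γ ∧
    ∀ x : ℝ, HasDerivWithinAt (fun τ => phys G (u τ) x) (deriv (phys G γ) x) I t

/-- `u` is an `H^∞` solution, over the time interval `I`, of the Benjamin-Ono equation
`∂ₜ u = H u'' - 2 u u'`. -/
def IsBOSolution (G : Geometry) {s : ℝ} (I : Set ℝ) (u : ℝ → Sob G s) : Prop :=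
  IsSmoothCurve G I u ∧ ∀ t ∈ I, ∀ x : ℝ,
    HasDerivWithinAt (fun τ => phys G (u τ) x)
      (phys G (hilbert (dx (dx (u t)))) x - 2 * phys G (u t) x * deriv (phys G (u t)) x) I t

/-- The set `Q_*` of all `e^{J∇(t₁ H_BO + t₂ H_κ)}(q)` with `q ∈ Q`, `t₁, t₂ ∈ ℝ`, `κ ≥ κ₀`: time
one values of `H^∞` solutions of the flow of the Hamiltonian `t₁ H_BO + t₂ H_κ` with initial data
`q`. As `β(κ; ·)`, hence `H_κ`, is not defined on all of `H^∞`, the trajectory has to remain in the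
domain of `H_κ` when this Hamiltonian takes part in the evolution. -/
def jointOrbit (G : Geometry) {s : ℝ} (κ₀ : ℝ) (Q : Set (Sob G s)) : Set (Sob G s) :=
  {p | ∃ q ∈ Q, ∃ t₁ t₂ κ : ℝ, κ₀ ≤ κ ∧ ∃ u : ℝ → Sob G s,
    IsHamiltonianSolution G (fun v => t₁ * hamBO G v + t₂ * hamK G κ v) (Set.Icc 0 1) u ∧
    (t₂ ≠ 0 → ∀ t ∈ Set.Icc (0 : ℝ) 1, LaxInvertible G (u t) κ) ∧ u 0 = q ∧ u 1 = p}

/-- The two-sided bound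
`(1 + ‖q₀‖)^{-2|s|} ‖q₀‖ ≤ C ‖q‖` and `‖q‖ ≤ C (1 + ‖q₀‖)^{2|s| / (1 - 2|s|)} ‖q₀‖` in `H^s`. -/
def TwoSidedBound {G : Geometry} {s : ℝ} (C : ℝ) (q₀ q : Sob G s) : Prop :=
  (1 + ‖q₀‖) ^ (-2 * |s|) * ‖q₀‖ ≤ C * ‖q‖ ∧
    ‖q‖ ≤ C * ((1 + ‖q₀‖) ^ (2 * |s| / (1 - 2 * |s|)) * ‖q₀‖)

end BenjaminOno

end

open BenjaminOno

open MeasureTheory Filter Topology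
open scoped ENNReal ComplexConjugate

noncomputable section

namespace BenjaminOno

/-! ### The frequency measure -/

/-! For large κ the potential is a small form perturbation of -i∂ + κ, so β(κ; q) agrees within a
factor two with its quadratic part `betaZero`, the integral of |q̂(ξ)|²/(ξ + κ) over ξ ≥ 0
(`IsSmall.beta_comparison`). Integrating κ^{2s} times this over κ > K gives, up to constants, the
squared norm `normK` with weight (|ξ| + K)^{2s}. Hence two real potentials with the same β, both
small at κ, have comparable `normK` for every K ≥ κ (`normK_le_of_sameBeta`).

Smallness is itself an upper bound on `normK` at κ: the Hilbert-Schmidt estimate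
`lintegral_kernel_le` carries the decaying factor κ^{-1-2s}. A continuity argument therefore
propagates smallness along any curve of constant β (`isSmall_along_curve`). Taking κ^{1+2s}
comparable to (1 + ‖q₀‖)² gives the upper bound on the norm, and running the curve backwards gives
the lower one. Equicontinuity of a bounded set means that `normK` tends to zero uniformly as K → ∞,
and this property passes to the orbit by the same comparison.

It remains to see that the flows preserve β. With m = m(z) and n the complex conjugate of m(z̄), the
functional derivative of β(z; ·) is the density m + n + mn (`hasDerivWithinAt_beta`), and one needs
its product with ∂ₓγ to integrate to zero when γ is the gradient of the Hamiltonian. The equations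
for m and n, read as statements about frequency supports, let this product be written as a finite
sum of terms with vanishing integral: total derivatives, and products whose frequencies cannot add
up to zero. This is carried out in `density_translation_mem`, `density_BO_mem` and
`density_gauge_mem`; no Lax pair enters. The computation is made at nonreal z, where the resolvent
always exists. Since the spectrum gives only finitely many exceptional points on each half-line [c,
∞), c > 0, `sameBeta_of_nonreal` extends the identity to the whole half-plane.

Throughout, conjugation with the weight (|ξ| + 1)^{1/2} replaces ℒ + z by the bounded operator
`laxT` on L²₊, which is the identity plus a multiple of a multiplier minus a Hilbert-Schmidt
operator. Invertibility, continuity and differentiability of the resolvent then take place in a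
Banach algebra. -/

theorem map_sum_dirac_equiv {α ι : Type*} [MeasurableSpace α] [Countable ι] (f : α → α)
    (hf : Measurable f) (x : ι → α) (e : ι ≃ ι) (h : ∀ i, f (x i) = x (e i)) :
    Measure.map f (Measure.sum fun i => Measure.dirac (x i)) =
      Measure.sum fun i => Measure.dirac (x i) := by
  rw [Measure.map_sum hf.aemeasurable]
  ext s hs
  rw [Measure.sum_apply _ hs, Measure.sum_apply _ hs]
  simp_rw [Measure.map_dirac' hf, h]
  exact e.tsum_eq fun i => Measure.dirac (x i) s

instance sFinite_freq (G : Geometry) : SFinite (freq G) := by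
  cases G
  · exact inferInstanceAs (SFinite (volume : Measure ℝ))
  · exact inferInstanceAs (SFinite (Measure.sum fun n : ℤ => Measure.dirac (2 * Real.pi * (n : ℝ))))

theorem measurePreserving_neg_freq (G : Geometry) :
    MeasurePreserving (fun ξ : ℝ => -ξ) (freq G) (freq G) := by
  cases G
  · exact Measure.measurePreserving_neg (volume : Measure ℝ)
  · exact ⟨measurable_neg, map_sum_dirac_equiv _ measurable_neg _ (Equiv.neg ℤ) (by simp)⟩

/-- Translation invariance of the frequency measure, in the form that convolution integrals use. On
the circle the product measure is a sum of point masses, which the shear of ℤ² permutes. -/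
theorem measurePreserving_shear_freq (G : Geometry) :
    MeasurePreserving (fun p : ℝ × ℝ => (p.1 - p.2, p.2)) ((freq G).prod (freq G))
      ((freq G).prod (freq G)) := by
  have hm : Measurable fun p : ℝ × ℝ => (p.1 - p.2, p.2) := by fun_prop
  cases G
  · exact measurePreserving_sub_prod (volume : Measure ℝ) (volume : Measure ℝ)
  · refine ⟨hm, ?_⟩
    have hp : (freq .circle).prod (freq .circle) = Measure.sum fun p : ℤ × ℤ =>
        Measure.dirac ((2 * Real.pi * (p.1 : ℝ), 2 * Real.pi * (p.2 : ℝ)) : ℝ × ℝ) := by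
      simp only [freq]
      rw [Measure.prod_sum]
      simp_rw [Measure.dirac_prod_dirac]
    rw [hp]
    refine map_sum_dirac_equiv _ hm _
      ⟨fun p => (p.1 - p.2, p.2), fun p => (p.1 + p.2, p.2), fun p => by simp, fun p => by simp⟩ ?_
    intro p
    simp only [Equiv.coe_fn_mk, Prod.mk.injEq, and_true]
    push_cast
    ring

/-- The difference map `(ξ, η) ↦ ξ - η` does not charge null sets. -/
theorem quasiMeasurePreserving_sub_freq (G : Geometry) :
    Measure.QuasiMeasurePreserving (fun p : ℝ × ℝ => p.1 - p.2) ((freq G).prod (freq G))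
      (freq G) :=
  Measure.quasiMeasurePreserving_fst.comp
    (measurePreserving_shear_freq G).quasiMeasurePreserving

theorem lintegral_freq_circle (f : ℝ → ℝ≥0∞) :
    ∫⁻ ξ, f ξ ∂(freq .circle) = ∑' n : ℤ, f (2 * Real.pi * (n : ℝ)) := by
  simp only [freq]
  rw [lintegral_sum_measure]
  simp_rw [lintegral_dirac]

theorem ae_freq_circle {p : ℝ → Prop} :
    (∀ᵐ ξ ∂(freq .circle), p ξ) ↔ ∀ n : ℤ, p (2 * Real.pi * (n : ℝ)) := by
  simp only [freq]
  rw [Measure.ae_sum_iff]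
  simp_rw [ae_dirac_eq]
  rfl

/-- The circle is sampled by the line. -/
theorem lintegral_circle_le_line {f g : ℝ → ℝ≥0∞}
    (h : ∀ n : ℤ, ∀ x ∈ Set.Ioc (2 * Real.pi * (n : ℝ)) (2 * Real.pi * (n : ℝ) + 1),
      f (2 * Real.pi * (n : ℝ)) ≤ g x) :
    ∫⁻ ξ, f ξ ∂(freq .circle) ≤ ∫⁻ ξ, g ξ := by
  rw [lintegral_freq_circle]
  have hpi := Real.pi_gt_three
  -- Lattice points are 2π > 3 apart, so the unit intervals to their right are disjoint, and each
  -- has measure one.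
  let I : ℤ → Set ℝ := fun n => Set.Ioc (2 * Real.pi * (n : ℝ)) (2 * Real.pi * (n : ℝ) + 1)
  have hd : Pairwise (Function.onFun Disjoint I) := by
    have key : ∀ a b : ℤ, a < b → Disjoint (I a) (I b) := by
      intro a b hab
      rw [Set.disjoint_left]
      rintro x ⟨_, h2⟩ ⟨h3, _⟩
      have : (a : ℝ) + 1 ≤ b := by exact_mod_cast hab
      nlinarith
    intro a b hab
    rcases lt_or_gt_of_ne hab with h' | h'
    · exact key a b h'
    · exact (key b a h').symm
  calc ∑' n : ℤ, f (2 * Real.pi * (n : ℝ)) ≤ ∑' n : ℤ, ∫⁻ x in I n, g x := by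
        refine ENNReal.tsum_le_tsum fun n => ?_
        calc f (2 * Real.pi * (n : ℝ)) = ∫⁻ _ in I n, f (2 * Real.pi * (n : ℝ)) := by
              simp [I]
          _ ≤ _ := setLIntegral_mono' measurableSet_Ioc fun x hx => h n x hx
    _ = ∫⁻ x in ⋃ n, I n, g x := (lintegral_iUnion (fun n => measurableSet_Ioc) hd g).symm
    _ ≤ _ := setLIntegral_le_lintegral _ _

/-- `∫_{η ≥ 0} (η + κ)^{-p} dν(η) ≲ κ^{1-p}` for `p > 1`, `κ ≥ 1`. -/
theorem lintegral_rpow_neg_le (G : Geometry) {p : ℝ} (hp : 1 < p) :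
    ∃ C : ℝ, 0 < C ∧ ∀ κ : ℝ, 1 ≤ κ →
      ∫⁻ η in Set.Ici 0, ENNReal.ofReal ((η + κ) ^ (-p)) ∂(freq G) ≤
        ENNReal.ofReal (C * κ ^ (1 - p)) := by
  have hline : ∀ κ : ℝ, 1 ≤ κ → ∫⁻ η in Set.Ici (0 : ℝ), ENNReal.ofReal ((η + κ) ^ (-p)) =
      ENNReal.ofReal (κ ^ (1 - p) / (p - 1)) := by
    intro κ hκ
    have hκ0 : 0 < κ := by linarith
    have hi := integrableOn_Ioi_rpow_of_lt (a := -p) (by linarith) hκ0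
    have ht : ∫⁻ η in Set.Ici (0 : ℝ), ENNReal.ofReal ((η + κ) ^ (-p)) =
        ∫⁻ x in Set.Ici κ, ENNReal.ofReal (x ^ (-p)) := by
      rw [← lintegral_indicator measurableSet_Ici, ← lintegral_indicator measurableSet_Ici,
        ← lintegral_add_right_eq_self
          ((Set.Ici κ).indicator fun x : ℝ => ENNReal.ofReal (x ^ (-p))) κ]
      refine lintegral_congr fun x => ?_
      simp only [Set.indicator, Set.mem_Ici, le_add_iff_nonneg_left]
    rw [ht, setLIntegral_congr Ioi_ae_eq_Ici.symm, ← ofReal_integral_eq_lintegral_ofReal hi,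
      integral_Ioi_rpow_of_lt (by linarith) hκ0]
    · rw [show -p + 1 = -(p - 1) by ring, show 1 - p = -(p - 1) by ring, neg_div_neg_eq]
    · filter_upwards [ae_restrict_mem measurableSet_Ioi] with x hx
      have : (0 : ℝ) < x := hκ0.trans hx
      positivity
  cases G with
  | line =>
    refine ⟨1 / (p - 1), by have : 0 < p - 1 := by linarith
                            positivity, fun κ hκ => ?_⟩
    have := hline κ hκ
    simp only [freq]
    rw [this]
    exact ENNReal.ofReal_le_ofReal (by rw [one_div_mul_eq_div])
  | circle =>
    refine ⟨2 ^ p / (p - 1), by have : 0 < p - 1 := by linarith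
                                positivity, fun κ hκ => ?_⟩
    have hpi := Real.pi_pos
    rw [← lintegral_indicator measurableSet_Ici]
    calc ∫⁻ η, (Set.Ici (0 : ℝ)).indicator (fun η => ENNReal.ofReal ((η + κ) ^ (-p))) η ∂(freq .circle)
        ≤ ∫⁻ x, (Set.Ici (0 : ℝ)).indicator
            (fun η => ENNReal.ofReal (2 ^ p) * ENNReal.ofReal ((η + κ) ^ (-p))) x := by
          refine lintegral_circle_le_line fun n x hx => ?_
          by_cases hn : 0 ≤ 2 * Real.pi * (n : ℝ)
          · have hx0 : 0 ≤ x := hn.trans hx.1.le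
            rw [Set.indicator_of_mem (show _ ∈ Set.Ici (0 : ℝ) from hn),
              Set.indicator_of_mem (show _ ∈ Set.Ici (0 : ℝ) from hx0),
              ← ENNReal.ofReal_mul (by positivity)]
            refine ENNReal.ofReal_le_ofReal ?_
            -- Because x ≤ 2πn + 1 and κ ≥ 1, passing from the lattice point to x at most doubles
            -- the base; this is the origin of the factor 2^p.
            have h1 : (x + κ) / 2 ≤ 2 * Real.pi * (n : ℝ) + κ := by
              have := hx.2; linarith
            calc (2 * Real.pi * (n : ℝ) + κ) ^ (-p) ≤ ((x + κ) / 2) ^ (-p) :=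
                  Real.rpow_le_rpow_of_nonpos (by linarith) h1 (by linarith)
              _ = 2 ^ p * (x + κ) ^ (-p) := by
                  rw [Real.div_rpow (by linarith) (by norm_num), Real.rpow_neg (x := 2) (by norm_num)]
                  field_simp
          · rw [Set.indicator_of_notMem (show _ ∉ Set.Ici (0 : ℝ) from hn)]
            exact zero_le
      _ = ENNReal.ofReal (2 ^ p) * ENNReal.ofReal (κ ^ (1 - p) / (p - 1)) := by
          rw [lintegral_indicator measurableSet_Ici, lintegral_const_mul' _ _ ENNReal.ofReal_ne_top,
            hline κ hκ]
      _ = _ := by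
          rw [← ENNReal.ofReal_mul (by positivity)]
          congr 1; ring

/-- `∫ (|ξ| + 1)^{-2} dν(ξ) < ∞`. -/
theorem lintegral_abs_rpow_neg_two_lt_top (G : Geometry) :
    ∫⁻ ξ, ENNReal.ofReal ((|ξ| + 1) ^ (-2 : ℝ)) ∂(freq G) < ∞ := by
  obtain ⟨C, -, hC⟩ := lintegral_rpow_neg_le G (p := 2) (by norm_num)
  have h1 := hC 1 le_rfl
  have hpos : ∫⁻ ξ in Set.Ici 0, ENNReal.ofReal ((|ξ| + 1) ^ (-2 : ℝ)) ∂(freq G) < ∞ := by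
    refine lt_of_le_of_lt (le_of_eq ?_) (h1.trans_lt ENNReal.ofReal_lt_top)
    refine setLIntegral_congr_fun measurableSet_Ici fun ξ hξ => ?_
    simp only [abs_of_nonneg (show (0 : ℝ) ≤ ξ from hξ)]
  have hneg : ∫⁻ ξ in Set.Iic 0, ENNReal.ofReal ((|ξ| + 1) ^ (-2 : ℝ)) ∂(freq G) < ∞ := by
    refine lt_of_le_of_lt (le_of_eq ?_) hpos
    rw [← lintegral_indicator measurableSet_Iic, ← lintegral_indicator measurableSet_Ici,
      ← (measurePreserving_neg_freq G).lintegral_comp_emb (Homeomorph.neg ℝ).measurableEmbedding]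
    refine lintegral_congr fun ξ => ?_
    simp only [Set.indicator, Set.mem_Iic, Set.mem_Ici, abs_neg, neg_nonpos]
  have hu : (Set.univ : Set ℝ) = Set.Ici 0 ∪ Set.Iic 0 := by
    ext x; simp
  rw [← setLIntegral_univ, hu]
  exact (lintegral_union_le _ _ _).trans_lt (ENNReal.add_lt_top.2 ⟨hpos, hneg⟩)

/-! ### Perturbation theory of selfadjoint operators -/

section Hilbert

variable {E : Type*} [NormedAddCommGroup E] [InnerProductSpace ℂ E] [CompleteSpace E]

/-- A form of Lax–Milgram. Cauchy–Schwarz turns the hypothesis into a lower bound for ‖T f‖, hence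
the range is closed; a vector orthogonal to the range is orthogonal to its own image, so it
vanishes. -/
theorem isUnit_of_numericalRange (T : E →L[ℂ] E) {c : ℝ} (hc : 0 < c)
    (h : ∀ f, c * ‖f‖ ^ 2 ≤ ‖inner ℂ f (T f)‖) : IsUnit T := by
  have hb : ∀ f, c * ‖f‖ ≤ ‖T f‖ := by
    intro f
    by_cases hf : f = 0
    · simp [hf]
    · have h1 := (h f).trans (norm_inner_le_norm f (T f))
      have hf' : 0 < ‖f‖ := norm_pos_iff.2 hf
      nlinarith
  have hanti : AntilipschitzWith (Real.toNNReal c⁻¹) T := by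
    refine AddMonoidHomClass.antilipschitz_of_bound T fun f => ?_
    rw [Real.coe_toNNReal _ (by positivity), inv_mul_eq_div, le_div_iff₀ hc, mul_comm]
    exact hb f
  rw [ContinuousLinearMap.isUnit_iff_bijective]
  refine ⟨hanti.injective, ?_⟩
  have hcl : IsClosed (LinearMap.range (T : E →ₗ[ℂ] E) : Set E) := by
    rw [LinearMap.coe_range]
    exact hanti.isClosed_range T.uniformContinuous
  have : CompleteSpace (LinearMap.range (T : E →ₗ[ℂ] E)) := hcl.completeSpace_coe
  have hbot : (LinearMap.range (T : E →ₗ[ℂ] E))ᗮ = ⊥ := by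
    rw [Submodule.eq_bot_iff]
    intro x hx
    have h0 : inner ℂ x (T x) = 0 := by
      have := (Submodule.mem_orthogonal' _ _).1 hx (T x) ⟨x, rfl⟩
      exact this
    have h1 := h x
    rw [h0, norm_zero] at h1
    by_contra hne
    have : 0 < ‖x‖ := norm_pos_iff.2 hne
    have : 0 < c * ‖x‖ ^ 2 := by positivity
    linarith
  have htop := (Submodule.orthogonal_eq_bot_iff).1 hbot
  intro y
  have : y ∈ LinearMap.range (T : E →ₗ[ℂ] E) := by rw [htop]; trivial
  obtain ⟨x, hx⟩ := this
  exact ⟨x, hx⟩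

/-- The Hilbert-Schmidt norm squared of `K` is at most `C`. -/
def HSBound (K : E →L[ℂ] E) (C : ℝ) : Prop :=
  ∀ (ι : Type) [Fintype ι] (e : ι → E), Orthonormal ℂ e → ∑ i, ‖K (e i)‖ ^ 2 ≤ C

/-- A finite orthonormal family that almost exhausts the supremum of the sums leaves little of K on
the orthogonal complement of its span. So K is a norm limit of finite-rank operators. -/
theorem HSBound.isCompactOperator {K : E →L[ℂ] E} {C : ℝ} (hK : HSBound K C) :
    IsCompactOperator K := by
  let S : Set ℝ := {x | ∃ (n : ℕ) (e : Fin n → E), Orthonormal ℂ e ∧ x = ∑ i, ‖K (e i)‖ ^ 2}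
  have hbd : BddAbove S := ⟨C, by rintro x ⟨n, e, he, rfl⟩; exact hK (Fin n) e he⟩
  have hne : S.Nonempty :=
    ⟨0, 0, fun _ => 0, ⟨fun i => i.elim0, fun i => i.elim0⟩, by simp⟩
  have key : ∀ ε : ℝ, 0 < ε → ∃ F : E →L[ℂ] E, IsCompactOperator F ∧ ‖K - F‖ ≤ ε := by
    intro ε hε
    obtain ⟨x, ⟨n, e, he, rfl⟩, hx⟩ := exists_lt_of_lt_csSup hne
      (show sSup S - ε ^ 2 < sSup S by have := pow_pos hε 2; linarith)
    let V : Submodule ℂ E := Submodule.span ℂ (Set.range e)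
    have : FiniteDimensional ℂ V := FiniteDimensional.span_of_finite ℂ (Set.finite_range e)
    have hunit : ∀ x ∈ Vᗮ, ‖x‖ = 1 → ‖K x‖ ≤ ε := by
      intro x hx' hx1
      have hxe : ∀ i, inner ℂ (e i) x = 0 := fun i =>
        (Submodule.mem_orthogonal _ _).1 hx' (e i) (Submodule.subset_span ⟨i, rfl⟩)
      have hxe' : ∀ i, inner ℂ x (e i) = 0 := fun i => by
        rw [← inner_conj_symm, hxe i, map_zero]
      -- Adjoining the unit vector x to the nearly optimal family can raise the sum by at most ε²,
      -- which bounds ‖K x‖.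
      have ho : Orthonormal ℂ (Fin.cons x e : Fin (n + 1) → E) := by
        rw [orthonormal_iff_ite] at he ⊢
        intro i j
        refine Fin.cases ?_ (fun i => ?_) i
        · refine Fin.cases ?_ (fun j => ?_) j
          · simp [hx1]
          · simp [hxe' j, (Fin.succ_ne_zero j).symm]
        · refine Fin.cases ?_ (fun j => ?_) j
          · simp [hxe i]
          · simp [he i j]
      have h1 : ∑ i, ‖K ((Fin.cons x e : Fin (n + 1) → E) i)‖ ^ 2 ≤ sSup S :=
        le_csSup hbd ⟨n + 1, _, ho, rfl⟩
      rw [Fin.sum_univ_succ] at h1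
      simp only [Fin.cons_zero, Fin.cons_succ] at h1
      have h2 : ‖K x‖ ^ 2 ≤ ε ^ 2 := by linarith
      exact (pow_le_pow_iff_left₀ (norm_nonneg _) hε.le two_ne_zero).1 h2
    have hall : ∀ x ∈ Vᗮ, ‖K x‖ ≤ ε * ‖x‖ := by
      intro x hx'
      by_cases h0 : x = 0
      · simp [h0]
      have hp : 0 < ‖x‖ := norm_pos_iff.2 h0
      have h1 := hunit ((‖x‖⁻¹ : ℂ) • x) (Vᗮ.smul_mem _ hx') (by
        rw [norm_smul]; simp [hp.ne'])
      rw [map_smul, norm_smul] at h1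
      simp only [norm_inv, Complex.norm_real, norm_norm] at h1
      rw [inv_mul_eq_div, div_le_iff₀ hp] at h1
      exact h1
    refine ⟨K ∘L (V.subtypeL ∘L V.orthogonalProjectionOnto), ?_, ?_⟩
    · have : ProperSpace V := FiniteDimensional.proper ℂ V
      have h1 : IsCompactOperator V.subtypeL :=
        isCompactOperator_of_locallyCompactSpace_rng V.subtypeL
      exact (h1.comp_clm V.orthogonalProjectionOnto).clm_comp K
    · refine ContinuousLinearMap.opNorm_le_bound _ hε.le fun x => ?_
      have hsub : x - V.starProjection x ∈ Vᗮ := V.sub_starProjection_mem_orthogonal x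
      have h2 := hall _ hsub
      have h3 : ‖x - V.starProjection x‖ ≤ ‖x‖ := by
        have hx' := V.norm_sq_eq_add_norm_sq_starProjection x
        have h4 : Vᗮ.starProjection x = x - V.starProjection x := by
          rw [Submodule.starProjection_orthogonal_val]
        rw [h4] at hx'
        have := sq_nonneg ‖V.starProjection x‖
        nlinarith [norm_nonneg x, norm_nonneg (x - V.starProjection x)]
      calc ‖(K - K ∘L (V.subtypeL ∘L V.orthogonalProjectionOnto)) x‖ = ‖K (x - V.starProjection x)‖ := by
            simp [map_sub]
        _ ≤ ε * ‖x - V.starProjection x‖ := h2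
        _ ≤ _ := by gcongr
  choose F hF hFK using fun n : ℕ => key (1 / ((n : ℝ) + 1)) (by positivity)
  refine isCompactOperator_of_tendsto (F := F) (l := atTop) ?_ (Eventually.of_forall hF)
  rw [tendsto_iff_norm_sub_tendsto_zero]
  refine squeeze_zero (fun _ => norm_nonneg _) (fun n => ?_) tendsto_one_div_add_atTop_nhds_zero_nat
  rw [norm_sub_rev]
  exact hFK n

/-- The Fredholm alternative for M - K = M (1 - M⁻¹K), where M⁻¹K is compact. -/
theorem IsCompactOperator.exists_ker_of_not_isUnit {M K : E →L[ℂ] E} (hM : IsUnit M)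
    (hK : IsCompactOperator K) (h : ¬ IsUnit (M - K)) : ∃ f, f ≠ 0 ∧ (M - K) f = 0 := by
  obtain ⟨u, rfl⟩ := hM
  let N : E →L[ℂ] E := ((u⁻¹ : (E →L[ℂ] E)ˣ) : E →L[ℂ] E)
  have hN : IsCompactOperator (N * K) := hK.clm_comp N
  have hfac : (u : E →L[ℂ] E) - K = u * (1 - N * K) := by
    rw [mul_sub, mul_one, ← mul_assoc, Units.mul_inv, one_mul]
  have hnot : ¬ IsUnit (1 - N * K) := fun h' => h (by rw [hfac]; exact u.isUnit.mul h')
  rcases IsCompactOperator.hasEigenvalue_or_mem_resolventSet (T := N * K) hN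
    (one_ne_zero (α := ℂ)) with h1 | h1
  · obtain ⟨f, hf⟩ := h1.exists_hasEigenvector
    refine ⟨f, hf.2, ?_⟩
    have h2 : (N * K) f = f := by
      have := hf.apply_eq_smul
      rw [one_smul] at this
      exact this
    rw [hfac]
    change u.val (f - (N * K) f) = 0
    rw [h2, sub_self, map_zero]
  · rw [spectrum.mem_resolventSet_iff, map_one] at h1
    exact absurd h1 hnot

/-- For `K` symmetric and Hilbert-Schmidt, `1 + (z - 1) D - K` is invertible for all but finitely
many real `z ≥ c > 0`. -/
theorem HSBound.finite_not_isUnit {D K : E →L[ℂ] E} {C : ℝ} (hK : HSBound K C)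
    (hDs : ∀ f g, inner ℂ (D f) g = inner ℂ f (D g))
    (hKs : ∀ f g, inner ℂ (K f) g = inner ℂ f (K g))
    (hD0 : ∀ f, f ≠ 0 → 0 < (inner ℂ f (D f)).re) (hD1 : ∀ f, (inner ℂ f (D f)).re ≤ ‖f‖ ^ 2)
    {c : ℝ} (hc : 0 < c) :
    {z : ℝ | c ≤ z ∧ ¬ IsUnit (1 + ((z : ℂ) - 1) • D - K)}.Finite := by
  have hD0' : ∀ f, 0 ≤ (inner ℂ f (D f)).re := fun f => by
    by_cases hf : f = 0
    · simp [hf]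
    · exact (hD0 f hf).le
  have hMlow : ∀ z : ℝ, 0 < z → ∀ f, min 1 z * ‖f‖ ^ 2 ≤
      (inner ℂ f ((1 + ((z : ℂ) - 1) • D) f)).re := by
    intro z hz f
    have h1 : (inner ℂ f ((1 + ((z : ℂ) - 1) • D) f)).re =
        ‖f‖ ^ 2 + (z - 1) * (inner ℂ f (D f)).re := by
      rw [add_apply, smul_apply, inner_add_right,
        inner_smul_right, one_apply_eq_self, inner_self_eq_norm_sq_to_K,
        Complex.add_re, Complex.mul_re]
      have : (((‖f‖ : ℝ) : ℂ) ^ 2).re = ‖f‖ ^ 2 := by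
        rw [← Complex.ofReal_pow, Complex.ofReal_re]
      simp [this]
    rw [h1]
    rcases le_total 1 z with h | h
    · rw [min_eq_left h]
      nlinarith [hD0' f]
    · rw [min_eq_right h]
      nlinarith [hD1 f, hD0' f]
  have hker : ∀ z : ℝ, c ≤ z → ¬ IsUnit (1 + ((z : ℂ) - 1) • D - K) →
      ∃ f, f ≠ 0 ∧ (1 + ((z : ℂ) - 1) • D - K) f = 0 := by
    intro z hz hu
    have hz0 : 0 < z := hc.trans_le hz
    refine IsCompactOperator.exists_ker_of_not_isUnit ?_ hK.isCompactOperator hu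
    refine isUnit_of_numericalRange _ (lt_min one_pos hz0) fun f => ?_
    exact (hMlow z hz0 f).trans (Complex.re_le_norm _)
  by_contra hinf
  -- From N exceptional points an N-dimensional space will be built on which K is bounded below by
  -- `min 1 c`. An orthonormal basis of it then contradicts the Hilbert-Schmidt bound, by the choice
  -- of N.
  obtain ⟨N, hN⟩ := exists_nat_gt (C / min 1 c ^ 2)
  obtain ⟨t, htS, htc⟩ := Set.Infinite.exists_subset_card_eq hinf N
  choose! f hf0 hfT using fun z (hz : z ∈ (t : Set ℝ)) => hker z (htS hz).1 (htS hz).2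
  have hfT' : ∀ z ∈ t, ∀ w : ℝ, (1 + ((w : ℂ) - 1) • D - K) (f z) = ((w : ℂ) - z) • D (f z) := by
    intro z hz w
    have h1 := hfT z hz
    have h2 : (1 + ((w : ℂ) - 1) • D - K) (f z) =
        (1 + ((z : ℂ) - 1) • D - K) (f z) + ((w : ℂ) - z) • D (f z) := by
      simp only [sub_apply, add_apply,
        smul_apply, one_apply_eq_self]
      module
    rw [h2, h1, zero_add]
  have hTs : ∀ w : ℝ, ∀ x y, inner ℂ ((1 + ((w : ℂ) - 1) • D - K) x) y =
      inner ℂ x ((1 + ((w : ℂ) - 1) • D - K) y) := by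
    intro w x y
    simp only [sub_apply, add_apply,
      smul_apply, one_apply_eq_self, inner_sub_left, inner_sub_right,
      inner_add_left, inner_add_right, inner_smul_left, inner_smul_right, hDs, hKs, map_sub,
      Complex.conj_ofReal, map_one]
  -- As for a symmetric eigenvalue problem, null vectors at distinct points are orthogonal, here for
  -- the form of D. This form is positive definite, so the null vectors are linearly independent.
  have horth : ∀ z ∈ t, ∀ w ∈ t, z ≠ w → inner ℂ (f z) (D (f w)) = 0 := by
    intro z hz w hw hzw
    have h1 := hTs z (f z) (f w)
    rw [hfT z hz, hfT' w hw z, inner_zero_left, inner_smul_right] at h1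
    rcases mul_eq_zero.1 h1.symm with h2 | h2
    · exact absurd (by exact_mod_cast sub_eq_zero.1 h2) hzw
    · exact h2
  have hlin : LinearIndependent ℂ (fun z : t => f z) := by
    rw [Fintype.linearIndependent_iff]
    intro a ha i
    have h1 : inner ℂ (f i) (D (∑ j : t, a j • f j)) = a i * inner ℂ (f i) (D (f i)) := by
      rw [map_sum, inner_sum, Finset.sum_eq_single i]
      · rw [map_smul, inner_smul_right]
      · intro j _ hji
        rw [map_smul, inner_smul_right, horth i i.2 j j.2 (fun h => hji (Subtype.ext h.symm)),
          mul_zero]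
      · simp
    rw [ha, map_zero, inner_zero_right] at h1
    rcases mul_eq_zero.1 h1.symm with h2 | h2
    · exact h2
    · have := hD0 (f i) (hf0 i i.2)
      rw [h2] at this
      simp at this
  let V : Submodule ℂ E := Submodule.span ℂ (Set.range fun z : t => f z)
  have : FiniteDimensional ℂ V := FiniteDimensional.span_of_finite ℂ (Set.finite_range _)
  have hdim : Module.finrank ℂ V = N := by
    rw [finrank_span_eq_card hlin, Fintype.card_coe, htc]
  -- On the span, the form at the endpoint c is diagonal with entries (c - z_j)⟨f_j, D f_j⟩ ≤ 0.
  -- Therefore K dominates 1 + (c - 1) D there, and the latter is at least `min 1 c`.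
  have hV : ∀ v ∈ V, min 1 c * ‖v‖ ^ 2 ≤ (inner ℂ v (K v)).re := by
    intro v hv
    obtain ⟨a, rfl⟩ := (Submodule.mem_span_range_iff_exists_fun ℂ).1 hv
    have h1 : inner ℂ (∑ j : t, a j • f j)
        ((1 + ((c : ℂ) - 1) • D - K) (∑ j : t, a j • f j)) =
        ((∑ j : t, (c - (j : ℝ)) * (‖a j‖ ^ 2 * (inner ℂ (f j) (D (f j))).re) : ℝ) : ℂ) := by
      rw [map_sum, sum_inner, Complex.ofReal_sum]
      refine Finset.sum_congr rfl fun i _ => ?_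
      rw [inner_sum, Finset.sum_eq_single i]
      · rw [map_smul, hfT' i i.2, inner_smul_left, inner_smul_right, inner_smul_right]
        have h2 : inner ℂ (f i) (D (f i)) = ((inner ℂ (f i) (D (f i))).re : ℂ) := by
          refine (Complex.conj_eq_iff_re.1 ?_).symm
          rw [inner_conj_symm, hDs]
        rw [h2]
        have h3 : conj (a i) * a i = ((‖a i‖ ^ 2 : ℝ) : ℂ) := by
          rw [Complex.conj_mul']; push_cast; rfl
        push_cast at h3 ⊢
        linear_combination ((c : ℂ) - (i : ℝ)) * ((inner ℂ (f i) (D (f i))).re : ℂ) * h3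
      · intro j _ hji
        rw [map_smul, hfT' j j.2, inner_smul_left, inner_smul_right, inner_smul_right,
          horth i i.2 j j.2 (fun h => hji (Subtype.ext h.symm))]
        simp
      · simp
    have h2 : (∑ j : t, (c - (j : ℝ)) * (‖a j‖ ^ 2 * (inner ℂ (f j) (D (f j))).re)) ≤ 0 := by
      refine Finset.sum_nonpos fun j _ => ?_
      have h3 : c ≤ j := (htS j.2).1
      have h4 := hD0' (f j)
      exact mul_nonpos_of_nonpos_of_nonneg (by linarith) (by positivity)
    have h5 := hMlow c hc (∑ j : t, a j • f j)
    have h6 := congrArg Complex.re h1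
    rw [Complex.ofReal_re, sub_apply, inner_sub_right, Complex.sub_re] at h6
    linarith
  let b := stdOrthonormalBasis ℂ V
  have hb : Orthonormal ℂ (fun i => (b i : E)) := b.orthonormal.comp_linearIsometry V.subtypeₗᵢ
  have h1 := hK _ _ hb
  have h2 : ∀ i, min 1 c ^ 2 ≤ ‖K (b i : E)‖ ^ 2 := by
    intro i
    have h3 := hV (b i) (b i).2
    have h4 : ‖(b i : E)‖ = 1 := hb.1 i
    have h5 := (Complex.re_le_norm _).trans (norm_inner_le_norm (𝕜 := ℂ) (b i : E) (K (b i)))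
    rw [h4] at h3 h5
    have h6 : min 1 c ≤ ‖K (b i : E)‖ := by linarith
    have h7 : 0 ≤ min 1 c := (lt_min one_pos hc).le
    exact pow_le_pow_left₀ h7 h6 2
  have h3 := (Finset.sum_le_sum fun i (_ : i ∈ Finset.univ) => h2 i).trans h1
  rw [Finset.sum_const, Finset.card_univ, Fintype.card_fin, hdim, nsmul_eq_mul] at h3
  have h4 : 0 < min 1 c ^ 2 := pow_pos (lt_min one_pos hc) 2
  rw [div_lt_iff₀ h4] at hN
  linarith

end Hilbert

/-- Comparison of `⟨w, (A - K)⁻¹ w⟩` with `⟨w, A⁻¹ w⟩` when `K` is small relative to `A`. -/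
theorem resolvent_pairing_comparison {E : Type*} [NormedAddCommGroup E] [InnerProductSpace ℂ E]
    {A K : E →L[ℂ] E} {f h w : E}
    (hA : ∀ x y, inner ℂ (A x) y = inner ℂ x (A y)) (hA0 : ∀ x, 0 ≤ (inner ℂ x (A x)).re)
    (hKs : ∀ x y, inner ℂ (K x) y = inner ℂ x (K y))
    (hK : ∀ x y, ‖inner ℂ x (K y)‖ ≤ 1 / 4 * ((inner ℂ x (A x)).re + (inner ℂ y (A y)).re))
    (hf : (A - K) f = w) (hh : A h = w) :
    (inner ℂ w f).re ≤ 2 * (inner ℂ w h).re ∧ (inner ℂ w h).re ≤ 2 * (inner ℂ w f).re := by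
  have hfe : A f = w + K f := by rw [← hf]; simp
  have h1 : (inner ℂ w f).re = (inner ℂ f (A f)).re - (inner ℂ f (K f)).re := by
    rw [← hf, sub_apply, inner_sub_left, hA, hKs, Complex.sub_re]
  have h2 : (inner ℂ w h).re = (inner ℂ h (A h)).re := by
    rw [← hA, hh]
  have h3 : (inner ℂ w f).re = (inner ℂ h (A f)).re := by rw [← hA, hh]
  have h4 : (inner ℂ w h).re = (inner ℂ f (A h)).re - (inner ℂ f (K h)).re := by
    rw [← hf, sub_apply, inner_sub_left, hA, hKs, Complex.sub_re]
  have h5 : (inner ℂ f (A h)).re = (inner ℂ h (A f)).re := by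
    rw [← hA, ← inner_conj_symm, Complex.conj_re]
  have hKff := (Complex.abs_re_le_norm _).trans (hK f f)
  have hKfh := (Complex.abs_re_le_norm _).trans (hK f h)
  -- Write H = ⟨h, A h⟩, F = ⟨f, A f⟩ and B = Re⟨w, f⟩ = Re⟨h, A f⟩. Positivity at 2h - f reads 4B ≤
  -- 4H + F, and F ≤ 2B by the smallness of K, whence B ≤ 2H. The reverse comes from H ≤ B + (F +
  -- H)/4.
  have h6 := hA0 ((2 : ℂ) • h - f)
  have h7 : (inner ℂ ((2 : ℂ) • h - f) (A ((2 : ℂ) • h - f))).re =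
      4 * (inner ℂ h (A h)).re - 2 * (inner ℂ f (A h)).re - 2 * (inner ℂ h (A f)).re +
        (inner ℂ f (A f)).re := by
    simp only [map_sub, map_smul, inner_sub_left, inner_sub_right, inner_smul_left,
      inner_smul_right, Complex.sub_re, Complex.mul_re, Complex.conj_re, Complex.conj_im]
    norm_num
    ring
  rw [abs_le] at hKff hKfh
  constructor <;> linarith

/-! ### Multipliers and integral operators on `L²` -/

section L2

variable {α : Type*} [MeasurableSpace α]

theorem eLpNorm_two_sq {μ : Measure α} (f : α → ℂ) :
    eLpNorm f 2 μ ^ 2 = ∫⁻ x, ‖f x‖ₑ ^ 2 ∂μ := by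
  have h := eLpNorm_nnreal_pow_eq_lintegral (f := f) (p := 2) (μ := μ) two_ne_zero
  simpa only [NNReal.coe_ofNat, ENNReal.coe_ofNat, ENNReal.rpow_ofNat] using h

theorem memLp_two_iff_lintegral {μ : Measure α} {f : α → ℂ} (hf : AEStronglyMeasurable f μ) :
    MemLp f 2 μ ↔ ∫⁻ x, ‖f x‖ₑ ^ 2 ∂μ < ∞ := by
  rw [← eLpNorm_two_sq]
  refine ⟨fun h => ENNReal.pow_lt_top h.2, fun h => ⟨hf, ?_⟩⟩
  by_contra h'
  rw [not_lt, top_le_iff] at h'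
  rw [h', ENNReal.top_pow two_ne_zero] at h
  exact lt_irrefl _ h

theorem Lp_enorm_sq {μ : Measure α} (f : Lp ℂ 2 μ) : ‖f‖ₑ ^ 2 = ∫⁻ x, ‖f x‖ₑ ^ 2 ∂μ := by
  rw [Lp.enorm_def, eLpNorm_two_sq]

theorem Lp_norm_le_of_lintegral_le {μ : Measure α} (f : Lp ℂ 2 μ) {C : ℝ} (hC : 0 ≤ C)
    (h : ∫⁻ x, ‖f x‖ₑ ^ 2 ∂μ ≤ ENNReal.ofReal C ^ 2) : ‖f‖ ≤ C := by
  rw [← Lp_enorm_sq] at h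
  have h1 : ‖f‖ₑ ≤ ENNReal.ofReal C := (ENNReal.pow_le_pow_left_iff two_ne_zero).1 h
  rwa [← ofReal_norm, ENNReal.ofReal_le_ofReal_iff hC] at h1

theorem lintegral_mul_sq_le {μ : Measure α} {f g : α → ℝ≥0∞} (hf : AEMeasurable f μ)
    (hg : AEMeasurable g μ) :
    (∫⁻ x, f x * g x ∂μ) ^ 2 ≤ (∫⁻ x, f x ^ 2 ∂μ) * ∫⁻ x, g x ^ 2 ∂μ := by
  have h := ENNReal.lintegral_mul_le_Lp_mul_Lq μ (p := 2) (q := 2)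
    ⟨by norm_num, by norm_num, by norm_num⟩ hf hg
  simp only [Pi.mul_apply, ENNReal.rpow_ofNat] at h
  calc (∫⁻ x, f x * g x ∂μ) ^ 2 ≤ ((∫⁻ x, f x ^ 2 ∂μ) ^ (1 / 2 : ℝ) *
        (∫⁻ x, g x ^ 2 ∂μ) ^ (1 / 2 : ℝ)) ^ 2 := by gcongr
    _ = _ := by
      rw [mul_pow, ← ENNReal.rpow_natCast, ← ENNReal.rpow_natCast, ← ENNReal.rpow_mul,
        ← ENNReal.rpow_mul]
      norm_num

/-- Multiplication by `a` maps `L²(μ₁)` to `L²(μ₂)` with norm at most `C`. -/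
structure IsMultiplier (μ₁ μ₂ : Measure α) (a : α → ℂ) (C : ℝ) : Prop where
  measurable : Measurable a
  nonneg : 0 ≤ C
  ac : ∀ p : α → Prop, (∀ᵐ x ∂μ₁, p x) → ∀ᵐ x ∂μ₂, a x ≠ 0 → p x
  bound : ∀ g : α → ℝ≥0∞, ∫⁻ x, ‖a x‖ₑ ^ 2 * g x ∂μ₂ ≤ ENNReal.ofReal C ^ 2 * ∫⁻ x, g x ∂μ₁

variable {μ₁ μ₂ : Measure α} {a : α → ℂ} {C : ℝ}

theorem IsMultiplier.lintegral_le (h : IsMultiplier μ₁ μ₂ a C) (f : α → ℂ) :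
    ∫⁻ x, ‖a x * f x‖ₑ ^ 2 ∂μ₂ ≤ ENNReal.ofReal C ^ 2 * ∫⁻ x, ‖f x‖ₑ ^ 2 ∂μ₁ := by
  simp_rw [enorm_mul, mul_pow]
  exact h.bound _

theorem IsMultiplier.memLp (h : IsMultiplier μ₁ μ₂ a C) {f : α → ℂ} (hf : MemLp f 2 μ₁) :
    MemLp (fun x => a x * f x) 2 μ₂ := by
  have hm : AEStronglyMeasurable (fun x => a x * f x) μ₂ := by
    refine ⟨fun x => a x * hf.1.mk f x,
      h.measurable.stronglyMeasurable.mul hf.1.stronglyMeasurable_mk, ?_⟩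
    filter_upwards [h.ac _ hf.1.ae_eq_mk] with x hx
    by_cases h0 : a x = 0
    · simp [h0]
    · rw [hx h0]
  rw [memLp_two_iff_lintegral hm]
  refine (h.lintegral_le f).trans_lt (ENNReal.mul_lt_top (by simp) ?_)
  exact (memLp_two_iff_lintegral hf.1).1 hf

/-- The multiplication operator. -/
def IsMultiplier.clm (h : IsMultiplier μ₁ μ₂ a C) : Lp ℂ 2 μ₁ →L[ℂ] Lp ℂ 2 μ₂ :=
  LinearMap.mkContinuous
    { toFun := fun f => (h.memLp (Lp.memLp f)).toLp
      map_add' := fun f g => by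
        ext1
        filter_upwards [(h.memLp (Lp.memLp (f + g))).coeFn_toLp, Lp.coeFn_add
          (h.memLp (Lp.memLp f)).toLp (h.memLp (Lp.memLp g)).toLp,
          (h.memLp (Lp.memLp f)).coeFn_toLp, (h.memLp (Lp.memLp g)).coeFn_toLp,
          h.ac _ (Lp.coeFn_add f g)] with x h1 h2 h3 h4 h5
        rw [h1, h2, Pi.add_apply, h3, h4]
        by_cases h0 : a x = 0
        · simp [h0]
        · rw [h5 h0, Pi.add_apply, mul_add]
      map_smul' := fun c f => by
        ext1
        filter_upwards [(h.memLp (Lp.memLp (c • f))).coeFn_toLp, Lp.coeFn_smul c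
          (h.memLp (Lp.memLp f)).toLp, (h.memLp (Lp.memLp f)).coeFn_toLp,
          h.ac _ (Lp.coeFn_smul c f)] with x h1 h2 h3 h4
        rw [h1, RingHom.id_apply, h2, Pi.smul_apply, h3]
        by_cases h0 : a x = 0
        · simp [h0]
        · rw [h4 h0, Pi.smul_apply, smul_eq_mul, smul_eq_mul]
          ring }
    C fun f => by
      refine Lp_norm_le_of_lintegral_le _ (mul_nonneg h.nonneg (norm_nonneg _)) ?_
      rw [lintegral_congr_ae (g := fun x => ‖a x * f x‖ₑ ^ 2)]
      · refine (h.lintegral_le f).trans (le_of_eq ?_)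
        rw [ENNReal.ofReal_mul h.nonneg, mul_pow, ofReal_norm, Lp_enorm_sq]
      · filter_upwards [(h.memLp (Lp.memLp f)).coeFn_toLp] with x hx
        change ‖((h.memLp (Lp.memLp f)).toLp : Lp ℂ 2 μ₂) x‖ₑ ^ 2 = _
        rw [hx]

theorem IsMultiplier.coeFn_clm (h : IsMultiplier μ₁ μ₂ a C) (f : Lp ℂ 2 μ₁) :
    h.clm f =ᵐ[μ₂] fun x => a x * f x :=
  (h.memLp (Lp.memLp f)).coeFn_toLp

theorem IsMultiplier.norm_clm_le (h : IsMultiplier μ₁ μ₂ a C) (f : Lp ℂ 2 μ₁) :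
    ‖h.clm f‖ ≤ C * ‖f‖ :=
  (h.clm.le_opNorm f).trans (by
    gcongr
    exact LinearMap.mkContinuous_norm_le _ h.nonneg _)

theorem isMultiplier_withDensity {ν : Measure α} {ρ₁ ρ₂ : α → ℝ} (h1 : Measurable ρ₁)
    (h2 : Measurable ρ₂) (hp : ∀ x, 0 < ρ₁ x) (ha : Measurable a) (hC : 0 ≤ C)
    (hle : ∀ x, ‖a x‖ ^ 2 * ρ₂ x ≤ C ^ 2 * ρ₁ x) :
    IsMultiplier (ν.withDensity fun x => ENNReal.ofReal (ρ₁ x))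
      (ν.withDensity fun x => ENNReal.ofReal (ρ₂ x)) a C where
  measurable := ha
  nonneg := hC
  ac := by
    intro p hp'
    have hac : ν.withDensity (fun x => ENNReal.ofReal (ρ₂ x)) ≪
        ν.withDensity (fun x => ENNReal.ofReal (ρ₁ x)) :=
      (withDensity_absolutelyContinuous _ _).trans
        (withDensity_absolutelyContinuous' h1.ennreal_ofReal.aemeasurable
          (Eventually.of_forall fun x => by simpa using hp x))
    filter_upwards [hac.ae_le hp'] with x hx _ using hx
  bound := fun g => by
    rw [lintegral_withDensity_eq_lintegral_mul_non_measurable _ h2.ennreal_ofReal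
      (Eventually.of_forall fun x => ENNReal.ofReal_lt_top),
      lintegral_withDensity_eq_lintegral_mul_non_measurable _ h1.ennreal_ofReal
      (Eventually.of_forall fun x => ENNReal.ofReal_lt_top),
      ← lintegral_const_mul' _ _ (by simp)]
    refine lintegral_mono fun x => ?_
    simp only [Pi.mul_apply]
    have h3 : ENNReal.ofReal (ρ₂ x) * ‖a x‖ₑ ^ 2 ≤
        ENNReal.ofReal C ^ 2 * ENNReal.ofReal (ρ₁ x) := by
      rw [← ofReal_norm, ← ENNReal.ofReal_pow (norm_nonneg _), ← ENNReal.ofReal_pow hC,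
        ← ENNReal.ofReal_mul' (by positivity), ← ENNReal.ofReal_mul (by positivity)]
      exact ENNReal.ofReal_le_ofReal (by rw [mul_comm]; exact hle x)
    calc _ = ENNReal.ofReal (ρ₂ x) * ‖a x‖ₑ ^ 2 * g x := by ring
      _ ≤ ENNReal.ofReal C ^ 2 * ENNReal.ofReal (ρ₁ x) * g x := by gcongr
      _ = _ := by ring

/-! #### Hilbert-Schmidt integral operators -/

variable {μ : Measure α} [SFinite μ]

/-- Cauchy–Schwarz in the second variable for almost every value of the first, followed by Tonelli.
-/
theorem lintegral_integral_kernel_le {k : α × α → ℂ} {f : α → ℂ}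
    (hk : AEStronglyMeasurable k (μ.prod μ)) (hf : AEStronglyMeasurable f μ) :
    ∫⁻ x, (∫⁻ y, ‖k (x, y) * f y‖ₑ ∂μ) ^ 2 ∂μ ≤
      (∫⁻ p, ‖k p‖ₑ ^ 2 ∂(μ.prod μ)) * ∫⁻ y, ‖f y‖ₑ ^ 2 ∂μ := by
  have hm : AEMeasurable (fun p => ‖k p‖ₑ ^ 2) (μ.prod μ) := hk.enorm.pow_const 2
  rw [lintegral_prod _ hm]
  refine le_trans ?_ (lintegral_mul_const'' _ hm.lintegral_prod_right').le
  refine lintegral_mono_ae ?_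
  filter_upwards [hk.prodMk_left] with x hx
  simp_rw [enorm_mul]
  exact lintegral_mul_sq_le hx.enorm hf.enorm

theorem ae_integrable_kernel {k : α × α → ℂ} {f : α → ℂ}
    (hk : MemLp k 2 (μ.prod μ)) (hf : MemLp f 2 μ) :
    ∀ᵐ x ∂μ, Integrable (fun y => k (x, y) * f y) μ := by
  have h1 := lintegral_integral_kernel_le hk.1 hf.1
  have h2 := ENNReal.mul_lt_top ((memLp_two_iff_lintegral hk.1).1 hk)
    ((memLp_two_iff_lintegral hf.1).1 hf)
  have hm : AEStronglyMeasurable (fun p : α × α => k p * f p.2) (μ.prod μ) :=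
    hk.1.mul hf.1.comp_snd
  have hm2 : AEMeasurable (fun x => (∫⁻ y, ‖k (x, y) * f y‖ₑ ∂μ) ^ 2) μ :=
    (hm.enorm.lintegral_prod_right' (ν := μ)).pow_const 2
  filter_upwards [ae_lt_top' hm2 (h1.trans_lt h2).ne, hm.prodMk_left] with x hx hx'
  refine ⟨hx', ?_⟩
  by_contra hc
  rw [hasFiniteIntegral_iff_enorm, not_lt, top_le_iff] at hc
  rw [hc, ENNReal.top_pow two_ne_zero] at hx
  exact lt_irrefl _ hx

theorem memLp_kernel {k : α × α → ℂ} {f : α → ℂ}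
    (hk : MemLp k 2 (μ.prod μ)) (hf : MemLp f 2 μ) :
    MemLp (fun x => ∫ y, k (x, y) * f y ∂μ) 2 μ := by
  have hm : AEStronglyMeasurable (fun p : α × α => k p * f p.2) (μ.prod μ) :=
    hk.1.mul hf.1.comp_snd
  rw [memLp_two_iff_lintegral (hm.integral_prod_right' (μ := μ) (ν := μ))]
  refine lt_of_le_of_lt (lintegral_mono fun x => ?_) ((lintegral_integral_kernel_le hk.1 hf.1).trans_lt
    (ENNReal.mul_lt_top ((memLp_two_iff_lintegral hk.1).1 hk)
    ((memLp_two_iff_lintegral hf.1).1 hf)))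
  exact pow_le_pow_left' (enorm_integral_le_lintegral_enorm _) 2

/-- The Hilbert-Schmidt operator with a given kernel, bilinear in the kernel and the argument. -/
def hsOp (μ : Measure α) [SFinite μ] :
    Lp ℂ 2 (μ.prod μ) →L[ℂ] Lp ℂ 2 μ →L[ℂ] Lp ℂ 2 μ :=
  LinearMap.mkContinuous₂
    (LinearMap.mk₂ ℂ (fun k f => (memLp_kernel (Lp.memLp k) (Lp.memLp f)).toLp)
      (fun k₁ k₂ f => by
        ext1
        filter_upwards [(memLp_kernel (Lp.memLp (k₁ + k₂)) (Lp.memLp f)).coeFn_toLp,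
          Lp.coeFn_add (memLp_kernel (Lp.memLp k₁) (Lp.memLp f)).toLp
            (memLp_kernel (Lp.memLp k₂) (Lp.memLp f)).toLp,
          (memLp_kernel (Lp.memLp k₁) (Lp.memLp f)).coeFn_toLp,
          (memLp_kernel (Lp.memLp k₂) (Lp.memLp f)).coeFn_toLp,
          ae_integrable_kernel (Lp.memLp k₁) (Lp.memLp f),
          ae_integrable_kernel (Lp.memLp k₂) (Lp.memLp f),
          Measure.ae_ae_of_ae_prod (Lp.coeFn_add k₁ k₂)] with x h1 h2 h3 h4 h5 h6 h7
        rw [h1, h2, Pi.add_apply, h3, h4, ← integral_add h5 h6]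
        refine integral_congr_ae ?_
        filter_upwards [h7] with y hy
        rw [hy, Pi.add_apply, add_mul])
      (fun c k f => by
        ext1
        filter_upwards [(memLp_kernel (Lp.memLp (c • k)) (Lp.memLp f)).coeFn_toLp,
          Lp.coeFn_smul c (memLp_kernel (Lp.memLp k) (Lp.memLp f)).toLp,
          (memLp_kernel (Lp.memLp k) (Lp.memLp f)).coeFn_toLp,
          Measure.ae_ae_of_ae_prod (Lp.coeFn_smul c k)] with x h1 h2 h3 h7
        rw [h1, h2, Pi.smul_apply, h3, smul_eq_mul, ← integral_const_mul]
        refine integral_congr_ae ?_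
        filter_upwards [h7] with y hy
        rw [hy, Pi.smul_apply, smul_eq_mul, mul_assoc])
      (fun k f₁ f₂ => by
        ext1
        filter_upwards [(memLp_kernel (Lp.memLp k) (Lp.memLp (f₁ + f₂))).coeFn_toLp,
          Lp.coeFn_add (memLp_kernel (Lp.memLp k) (Lp.memLp f₁)).toLp
            (memLp_kernel (Lp.memLp k) (Lp.memLp f₂)).toLp,
          (memLp_kernel (Lp.memLp k) (Lp.memLp f₁)).coeFn_toLp,
          (memLp_kernel (Lp.memLp k) (Lp.memLp f₂)).coeFn_toLp,
          ae_integrable_kernel (Lp.memLp k) (Lp.memLp f₁),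
          ae_integrable_kernel (Lp.memLp k) (Lp.memLp f₂)] with x h1 h2 h3 h4 h5 h6
        rw [h1, h2, Pi.add_apply, h3, h4, ← integral_add h5 h6]
        refine integral_congr_ae ?_
        filter_upwards [Lp.coeFn_add f₁ f₂] with y hy
        rw [hy, Pi.add_apply, mul_add])
      (fun c k f => by
        ext1
        filter_upwards [(memLp_kernel (Lp.memLp k) (Lp.memLp (c • f))).coeFn_toLp,
          Lp.coeFn_smul c (memLp_kernel (Lp.memLp k) (Lp.memLp f)).toLp,
          (memLp_kernel (Lp.memLp k) (Lp.memLp f)).coeFn_toLp] with x h1 h2 h3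
        rw [h1, h2, Pi.smul_apply, h3, smul_eq_mul, ← integral_const_mul]
        refine integral_congr_ae ?_
        filter_upwards [Lp.coeFn_smul c f] with y hy
        rw [hy, Pi.smul_apply, smul_eq_mul]
        ring))
    1 fun k f => by
      refine Lp_norm_le_of_lintegral_le _ (by positivity) ?_
      have hco : ∀ᵐ x ∂μ, ((memLp_kernel (Lp.memLp k) (Lp.memLp f)).toLp : Lp ℂ 2 μ) x =
        ∫ y, k (x, y) * f y ∂μ := (memLp_kernel (Lp.memLp k) (Lp.memLp f)).coeFn_toLp
      rw [one_mul, ENNReal.ofReal_mul (norm_nonneg _), ofReal_norm, ofReal_norm, mul_pow,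
        Lp_enorm_sq, Lp_enorm_sq]
      refine le_trans (lintegral_mono_ae ?_)
        (lintegral_integral_kernel_le (Lp.aestronglyMeasurable k) (Lp.aestronglyMeasurable f))
      filter_upwards [hco] with x hx
      change ‖((memLp_kernel (Lp.memLp k) (Lp.memLp f)).toLp : Lp ℂ 2 μ) x‖ₑ ^ 2 ≤ _
      rw [hx]
      exact pow_le_pow_left' (enorm_integral_le_lintegral_enorm _) 2

theorem coeFn_hsOp (k : Lp ℂ 2 (μ.prod μ)) (f : Lp ℂ 2 μ) :
    hsOp μ k f =ᵐ[μ] fun x => ∫ y, k (x, y) * f y ∂μ :=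
  (memLp_kernel (Lp.memLp k) (Lp.memLp f)).coeFn_toLp

theorem integrable_hsOp_pairing {k : α × α → ℂ} {f g : α → ℂ} (hk : MemLp k 2 (μ.prod μ))
    (hf : MemLp f 2 μ) (hg : MemLp g 2 μ) :
    Integrable (fun p : α × α => conj (g p.1) * (k p * f p.2)) (μ.prod μ) := by
  have hm : AEStronglyMeasurable (fun p : α × α => conj (g p.1) * (k p * f p.2)) (μ.prod μ) :=
    (Complex.continuous_conj.comp_aestronglyMeasurable hg.1.comp_fst).mul
      (hk.1.mul hf.1.comp_snd)
  refine ⟨hm, ?_⟩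
  rw [hasFiniteIntegral_iff_enorm, lintegral_prod _ hm.enorm]
  have h1 : ∀ x, ∫⁻ y, ‖conj (g x) * (k (x, y) * f y)‖ₑ ∂μ =
      ‖g x‖ₑ * ∫⁻ y, ‖k (x, y) * f y‖ₑ ∂μ := by
    intro x
    rw [← lintegral_const_mul' _ _ enorm_ne_top]
    refine lintegral_congr fun y => ?_
    rw [enorm_mul, RCLike.enorm_conj]
  simp_rw [h1]
  have hm' : AEStronglyMeasurable (fun p : α × α => k p * f p.2) (μ.prod μ) :=
    hk.1.mul hf.1.comp_snd
  have h2 := lintegral_mul_sq_le hg.1.enorm (hm'.enorm.lintegral_prod_right' (ν := μ))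
  have h3 : (∫⁻ x, ‖g x‖ₑ * ∫⁻ y, ‖k (x, y) * f y‖ₑ ∂μ ∂μ) ^ 2 < ∞ := by
    refine h2.trans_lt (ENNReal.mul_lt_top ((memLp_two_iff_lintegral hg.1).1 hg) ?_)
    exact (lintegral_integral_kernel_le hk.1 hf.1).trans_lt
      (ENNReal.mul_lt_top ((memLp_two_iff_lintegral hk.1).1 hk)
      ((memLp_two_iff_lintegral hf.1).1 hf))
  by_contra hc
  rw [not_lt, top_le_iff] at hc
  rw [hc, ENNReal.top_pow two_ne_zero] at h3
  exact lt_irrefl _ h3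

theorem inner_hsOp (k : Lp ℂ 2 (μ.prod μ)) (f g : Lp ℂ 2 μ) :
    inner ℂ g (hsOp μ k f) = ∫ x, conj (g x) * ∫ y, k (x, y) * f y ∂μ ∂μ := by
  rw [L2.inner_def]
  refine integral_congr_ae ?_
  filter_upwards [coeFn_hsOp k f] with x hx
  rw [RCLike.inner_apply', hx]

theorem inner_hsOp_prod (k : Lp ℂ 2 (μ.prod μ)) (f g : Lp ℂ 2 μ) :
    inner ℂ g (hsOp μ k f) = ∫ p, conj (g p.1) * (k p * f p.2) ∂(μ.prod μ) := by
  rw [inner_hsOp, integral_prod _ (integrable_hsOp_pairing (Lp.memLp k) (Lp.memLp f) (Lp.memLp g))]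
  simp_rw [integral_const_mul]

/-- Swapping the variables in the double integral exchanges the two sides for a Hermitian kernel. -/
theorem hsOp_symmetric {k : Lp ℂ 2 (μ.prod μ)}
    (hk : ∀ᵐ p ∂(μ.prod μ), k p.swap = conj (k p)) (f g : Lp ℂ 2 μ) :
    inner ℂ (hsOp μ k f) g = inner ℂ f (hsOp μ k g) := by
  rw [← inner_conj_symm, inner_hsOp_prod, inner_hsOp_prod, ← integral_conj,
    ← integral_prod_swap]
  refine integral_congr_ae ?_
  filter_upwards [hk] with p hp
  simp only [Prod.fst_swap, Prod.snd_swap, hp, map_mul, Complex.conj_conj]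
  ring

/-- For almost every x the values of the images at x are inner products of the section k(x, ·) with
an orthonormal family. Bessel's inequality bounds their square sum; integration in x gives ‖k‖². -/
theorem hsBound_hsOp (k : Lp ℂ 2 (μ.prod μ)) : HSBound (hsOp μ k) (‖k‖ ^ 2) := by
  intro ι _ e he
  have hkm := Lp.memLp k
  have hm : AEMeasurable (fun p => ‖k p‖ₑ ^ 2) (μ.prod μ) := hkm.1.enorm.pow_const 2
  have hfin : ∫⁻ x, ∫⁻ y, ‖k (x, y)‖ₑ ^ 2 ∂μ ∂μ < ∞ := by
    rw [← lintegral_prod _ hm]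
    exact (memLp_two_iff_lintegral hkm.1).1 hkm
  have hbes : ∀ᵐ x ∂μ, ∑ i, ‖hsOp μ k (e i) x‖ₑ ^ 2 ≤ ∫⁻ y, ‖k (x, y)‖ₑ ^ 2 ∂μ := by
    have hall : ∀ᵐ x ∂μ, ∀ i, hsOp μ k (e i) x = ∫ y, k (x, y) * e i y ∂μ :=
      ae_all_iff.2 fun i => coeFn_hsOp k (e i)
    filter_upwards [hall, hkm.1.prodMk_left, ae_lt_top' hm.lintegral_prod_right' hfin.ne]
      with x h1 h2 h3
    have hkx : MemLp (fun y => conj (k (x, y))) 2 μ := by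
      rw [memLp_two_iff_lintegral (Complex.continuous_conj.comp_aestronglyMeasurable h2)]
      simpa only [RCLike.enorm_conj] using h3
    have h4 : ∀ i, hsOp μ k (e i) x = inner ℂ hkx.toLp (e i) := by
      intro i
      rw [h1 i, L2.inner_def]
      refine integral_congr_ae ?_
      filter_upwards [hkx.coeFn_toLp] with y hy
      rw [RCLike.inner_apply', hy, Complex.conj_conj]
    have h5 := he.sum_inner_products_le hkx.toLp (s := Finset.univ)
    have h6 : ∀ i, ‖hsOp μ k (e i) x‖ₑ ^ 2 = ENNReal.ofReal (‖inner ℂ (e i) hkx.toLp‖ ^ 2) := by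
      intro i
      rw [h4 i, ← inner_conj_symm, RCLike.enorm_conj, ENNReal.ofReal_pow (norm_nonneg _),
        ofReal_norm]
    simp_rw [h6]
    rw [← ENNReal.ofReal_sum_of_nonneg fun i _ => by positivity]
    refine (ENNReal.ofReal_le_ofReal h5).trans (le_of_eq ?_)
    rw [ENNReal.ofReal_pow (norm_nonneg _), ofReal_norm, Lp_enorm_sq]
    refine lintegral_congr_ae ?_
    filter_upwards [hkx.coeFn_toLp] with y hy
    rw [hy, RCLike.enorm_conj]
  have h7 : ∑ i, ‖hsOp μ k (e i)‖ₑ ^ 2 ≤ ‖k‖ₑ ^ 2 := by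
    simp_rw [Lp_enorm_sq]
    rw [← lintegral_finsetSum' _ fun i _ => (Lp.aestronglyMeasurable _).enorm.pow_const 2,
      lintegral_prod _ hm]
    exact lintegral_mono_ae hbes
  have h8 : ENNReal.ofReal (∑ i, ‖hsOp μ k (e i)‖ ^ 2) ≤ ENNReal.ofReal (‖k‖ ^ 2) := by
    rw [ENNReal.ofReal_sum_of_nonneg fun i _ => by positivity]
    simpa only [ENNReal.ofReal_pow (norm_nonneg _), ofReal_norm] using h7
  exact (ENNReal.ofReal_le_ofReal_iff (by positivity)).1 h8

end L2

/-! ### Sobolev spaces and their multipliers -/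

theorem bracket_pos (ξ : ℝ) : 0 < |ξ| + 1 := by positivity

theorem sobMeasure_ac (G : Geometry) (σ : ℝ) : sobMeasure G σ ≪ freq G :=
  withDensity_absolutelyContinuous _ _

theorem ac_sobMeasure (G : Geometry) (σ : ℝ) : freq G ≪ sobMeasure G σ := by
  refine withDensity_absolutelyContinuous' (by fun_prop) (Eventually.of_forall fun ξ => ?_)
  have := bracket_pos ξ
  simp only [ne_eq, ENNReal.ofReal_eq_zero, not_le]
  positivity

/-- The weights are positive, so all Sobolev measures have the same null sets, and almost-everywhere
identities pass freely between the spaces H^σ. -/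
theorem ae_sobMeasure_iff {G : Geometry} {σ : ℝ} {p : ℝ → Prop} :
    (∀ᵐ ξ ∂(sobMeasure G σ), p ξ) ↔ ∀ᵐ ξ ∂(freq G), p ξ :=
  ⟨fun h => (ac_sobMeasure G σ).ae_le h, fun h => (sobMeasure_ac G σ).ae_le h⟩

theorem lintegral_sobMeasure (G : Geometry) (σ : ℝ) (f : ℝ → ℝ≥0∞) :
    ∫⁻ ξ, f ξ ∂(sobMeasure G σ) =
      ∫⁻ ξ, ENNReal.ofReal ((|ξ| + 1) ^ (2 * σ)) * f ξ ∂(freq G) :=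
  lintegral_withDensity_eq_lintegral_mul_non_measurable _ (by fun_prop)
    (Eventually.of_forall fun _ => ENNReal.ofReal_lt_top) f

theorem isMultiplier_sob {G : Geometry} {σ τ C : ℝ} {a : ℝ → ℂ} (ha : Measurable a) (hC : 0 ≤ C)
    (h : ∀ ξ, ‖a ξ‖ ≤ C * (|ξ| + 1) ^ (σ - τ)) :
    IsMultiplier (sobMeasure G σ) (sobMeasure G τ) a C := by
  refine isMultiplier_withDensity (by fun_prop) (by fun_prop)
    (fun ξ => by have := bracket_pos ξ; positivity) ha hC fun ξ => ?_
  have hb := bracket_pos ξ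
  calc ‖a ξ‖ ^ 2 * (|ξ| + 1) ^ (2 * τ) ≤ (C * (|ξ| + 1) ^ (σ - τ)) ^ 2 * (|ξ| + 1) ^ (2 * τ) := by
        gcongr; exact h ξ
    _ = C ^ 2 * (|ξ| + 1) ^ (2 * σ) := by
        rw [mul_pow, ← Real.rpow_natCast, ← Real.rpow_natCast, ← Real.rpow_mul hb.le, mul_assoc,
          ← Real.rpow_add hb]
        congr 2
        push_cast; ring

/-- The Plancherel measure on the nonnegative frequencies. -/
def posFreq (G : Geometry) : Measure ℝ := (freq G).restrict (Set.Ici 0)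

instance sFinite_posFreq (G : Geometry) : SFinite (posFreq G) :=
  inferInstanceAs (SFinite ((freq G).restrict (Set.Ici 0)))

/-- The Hardy space `L²₊`. -/
abbrev Hardy (G : Geometry) : Type := Lp ℂ 2 (posFreq G)

theorem ae_posFreq_of_ae {G : Geometry} {p : ℝ → Prop} (h : ∀ᵐ ξ ∂(freq G), p ξ) :
    ∀ᵐ ξ ∂(posFreq G), p ξ := ae_restrict_of_ae h

theorem ae_posFreq_mem (G : Geometry) : ∀ᵐ ξ ∂(posFreq G), 0 ≤ ξ :=
  ae_restrict_mem measurableSet_Ici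

theorem ae_posFreq_iff {G : Geometry} {p : ℝ → Prop} :
    (∀ᵐ ξ ∂(posFreq G), p ξ) ↔ ∀ᵐ ξ ∂(freq G), 0 ≤ ξ → p ξ :=
  ae_restrict_iff' measurableSet_Ici

theorem isMultiplier_toHardy {G : Geometry} {σ C : ℝ} {a : ℝ → ℂ} (ha : Measurable a) (hC : 0 ≤ C)
    (h : ∀ ξ, ‖a ξ‖ ≤ C * (|ξ| + 1) ^ σ) :
    IsMultiplier (sobMeasure G σ) (posFreq G) a C where
  measurable := ha
  nonneg := hC
  ac := fun p hp => by
    filter_upwards [ae_posFreq_of_ae (ae_sobMeasure_iff.1 hp)] with ξ hξ _ using hξ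
  bound := fun g => by
    rw [lintegral_sobMeasure, ← lintegral_const_mul' _ _ (by simp)]
    refine (setLIntegral_le_lintegral _ _).trans (lintegral_mono fun ξ => ?_)
    have hb := bracket_pos ξ
    rw [← mul_assoc]
    gcongr
    rw [← ofReal_norm, ← ENNReal.ofReal_pow (norm_nonneg _), ← ENNReal.ofReal_pow hC,
      ← ENNReal.ofReal_mul (by positivity)]
    refine ENNReal.ofReal_le_ofReal ?_
    calc ‖a ξ‖ ^ 2 ≤ (C * (|ξ| + 1) ^ σ) ^ 2 := by gcongr; exact h ξ
      _ = _ := by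
        rw [mul_pow, ← Real.rpow_natCast _ 2, ← Real.rpow_natCast _ 2, ← Real.rpow_mul hb.le]
        congr 2; push_cast; ring

/-- The absolute-continuity clause of `IsMultiplier` speaks only of points where the symbol is
nonzero. That is what admits extension by zero from the nonnegative frequencies to all of them. -/
theorem isMultiplier_ofHardy {G : Geometry} {σ C : ℝ} {a : ℝ → ℂ} (ha : Measurable a) (hC : 0 ≤ C)
    (h : ∀ ξ, ‖a ξ‖ ≤ C * (|ξ| + 1) ^ (-σ)) (h0 : ∀ ξ, ξ < 0 → a ξ = 0) :
    IsMultiplier (posFreq G) (sobMeasure G σ) a C where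
  measurable := ha
  nonneg := hC
  ac := fun p hp => by
    rw [ae_sobMeasure_iff]
    filter_upwards [ae_posFreq_iff.1 hp] with ξ hξ ha0
    exact hξ (not_lt.1 fun hlt => ha0 (h0 ξ hlt))
  bound := fun g => by
    rw [lintegral_sobMeasure, posFreq, ← lintegral_indicator measurableSet_Ici,
      ← lintegral_const_mul' _ _ (by simp)]
    refine lintegral_mono fun ξ => ?_
    have hb := bracket_pos ξ
    by_cases hξ : ξ < 0
    · simp [h0 ξ hξ]
    rw [Set.indicator_of_mem (show ξ ∈ Set.Ici (0 : ℝ) from not_lt.1 hξ), ← mul_assoc]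
    gcongr
    rw [← ofReal_norm, ← ENNReal.ofReal_pow (norm_nonneg _), ← ENNReal.ofReal_pow hC,
      ← ENNReal.ofReal_mul (by positivity)]
    refine ENNReal.ofReal_le_ofReal ?_
    calc (|ξ| + 1) ^ (2 * σ) * ‖a ξ‖ ^ 2 ≤ (|ξ| + 1) ^ (2 * σ) * (C * (|ξ| + 1) ^ (-σ)) ^ 2 := by
          gcongr; exact h ξ
      _ = _ := by
        rw [mul_pow, ← Real.rpow_natCast _ 2, ← Real.rpow_natCast _ 2, ← Real.rpow_mul hb.le,
          mul_left_comm, ← Real.rpow_add hb]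
        rw [show 2 * σ + -σ * ((2 : ℕ) : ℝ) = 0 by push_cast; ring, Real.rpow_zero, mul_one]

theorem isMultiplier_hardy {G : Geometry} {C : ℝ} {a : ℝ → ℂ} (ha : Measurable a) (hC : 0 ≤ C)
    (h : ∀ ξ, 0 ≤ ξ → ‖a ξ‖ ≤ C) : IsMultiplier (posFreq G) (posFreq G) a C where
  measurable := ha
  nonneg := hC
  ac := fun p hp => by filter_upwards [hp] with ξ hξ _ using hξ
  bound := fun g => by
    rw [← lintegral_const_mul' _ _ (by simp)]
    refine lintegral_mono_ae ?_
    filter_upwards [ae_posFreq_mem G] with ξ hξ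
    gcongr
    rw [← ofReal_norm]
    exact ENNReal.ofReal_le_ofReal (h ξ hξ)

theorem isMultiplier_restr (G : Geometry) (σ : ℝ) :
    IsMultiplier (sobMeasure G σ) (posFreq G) (fun ξ => (((|ξ| + 1) ^ σ : ℝ) : ℂ)) 1 := by
  refine isMultiplier_toHardy (by fun_prop) zero_le_one fun ξ => ?_
  have := bracket_pos ξ
  rw [Complex.norm_real, Real.norm_of_nonneg (by positivity), one_mul]

/-- The isometry from the Hardy subspace of `H^σ` to `L²₊`, extended by `0`. -/
def restr (G : Geometry) (σ : ℝ) : Sob G σ →L[ℂ] Hardy G := (isMultiplier_restr G σ).clm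

theorem coeFn_restr {G : Geometry} {σ : ℝ} (f : Sob G σ) :
    restr G σ f =ᵐ[posFreq G] fun ξ => (((|ξ| + 1) ^ σ : ℝ) : ℂ) * f ξ :=
  (isMultiplier_restr G σ).coeFn_clm f

theorem isMultiplier_lift (G : Geometry) (σ : ℝ) :
    IsMultiplier (posFreq G) (sobMeasure G σ)
      (Set.indicator (Set.Ici 0) fun ξ : ℝ => (((|ξ| + 1) ^ (-σ) : ℝ) : ℂ)) 1 := by
  refine isMultiplier_ofHardy
    (Measurable.indicator (by fun_prop) measurableSet_Ici) zero_le_one (fun ξ => ?_) fun ξ hξ => ?_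
  · have := bracket_pos ξ
    refine (norm_indicator_le_norm_self _ _).trans ?_
    rw [Complex.norm_real, Real.norm_of_nonneg (by positivity), one_mul]
  · exact Set.indicator_of_notMem (by simpa using hξ) _

/-- The isometry from `L²₊` onto the Hardy subspace of `H^σ`. -/
def lift (G : Geometry) (σ : ℝ) : Hardy G →L[ℂ] Sob G σ := (isMultiplier_lift G σ).clm

theorem coeFn_lift {G : Geometry} {σ : ℝ} (f : Hardy G) :
    lift G σ f =ᵐ[freq G]
      fun ξ => Set.indicator (Set.Ici 0) (fun ξ : ℝ => (((|ξ| + 1) ^ (-σ) : ℝ) : ℂ)) ξ * f ξ :=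
  ae_sobMeasure_iff.1 ((isMultiplier_lift G σ).coeFn_clm f)

theorem coeFn_lift_pos {G : Geometry} {σ : ℝ} (f : Hardy G) :
    lift G σ f =ᵐ[posFreq G] fun ξ => (((|ξ| + 1) ^ (-σ) : ℝ) : ℂ) * f ξ := by
  filter_upwards [ae_posFreq_of_ae (coeFn_lift (σ := σ) f), ae_posFreq_mem G] with ξ h1 h2
  rw [h1, Set.indicator_of_mem (show ξ ∈ Set.Ici (0 : ℝ) from h2)]

theorem isHardy_lift {G : Geometry} {σ : ℝ} (f : Hardy G) : IsHardy G (lift G σ f) := by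
  filter_upwards [coeFn_lift (σ := σ) f] with ξ h1 h2
  rw [h1, Set.indicator_of_notMem (by simpa using h2), zero_mul]

theorem ofReal_rpow_mul_neg (ξ σ : ℝ) :
    (((|ξ| + 1) ^ σ : ℝ) : ℂ) * (((|ξ| + 1) ^ (-σ) : ℝ) : ℂ) = 1 := by
  rw [← Complex.ofReal_mul, ← Real.rpow_add (bracket_pos ξ), add_neg_cancel, Real.rpow_zero,
    Complex.ofReal_one]

theorem restr_lift {G : Geometry} {σ : ℝ} (f : Hardy G) : restr G σ (lift G σ f) = f := by
  ext1
  filter_upwards [coeFn_restr (lift G σ f), coeFn_lift_pos (σ := σ) f] with ξ h1 h2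
  rw [h1, h2, ← mul_assoc, ofReal_rpow_mul_neg, one_mul]

theorem lift_restr {G : Geometry} {σ : ℝ} (f : Sob G σ) (hf : IsHardy G f) :
    lift G σ (restr G σ f) = f := by
  ext1
  rw [EventuallyEq, ae_sobMeasure_iff]
  filter_upwards [coeFn_lift (σ := σ) (restr G σ f), ae_posFreq_iff.1 (coeFn_restr f), hf]
    with ξ h1 h2 h3
  rw [h1]
  by_cases hξ : 0 ≤ ξ
  · rw [Set.indicator_of_mem (show ξ ∈ Set.Ici (0 : ℝ) from hξ), h2 hξ, ← mul_assoc,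
      mul_comm (((|ξ| + 1) ^ (-σ) : ℝ) : ℂ), ofReal_rpow_mul_neg, one_mul]
  · rw [Set.indicator_of_notMem (by simpa using hξ), zero_mul, h3 (not_le.1 hξ)]

theorem isMultiplier_incl {G : Geometry} {σ τ : ℝ} (h : τ ≤ σ) :
    IsMultiplier (sobMeasure G σ) (sobMeasure G τ) (fun _ => 1) 1 := by
  refine isMultiplier_sob measurable_const zero_le_one fun ξ => ?_
  rw [norm_one, one_mul]
  exact Real.one_le_rpow (by simp) (by linarith)

/-- The embedding `H^σ ⊆ H^τ` for `τ ≤ σ`. -/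
def incl {G : Geometry} {σ τ : ℝ} (h : τ ≤ σ) : Sob G σ →L[ℂ] Sob G τ := (isMultiplier_incl h).clm

theorem coeFn_incl {G : Geometry} {σ τ : ℝ} (h : τ ≤ σ) (f : Sob G σ) :
    incl h f =ᵐ[freq G] f := by
  filter_upwards [ae_sobMeasure_iff.1 ((isMultiplier_incl (G := G) h).coeFn_clm f)] with ξ hξ
  rw [incl, hξ, one_mul]

/-! ### The kernel of the potential -/

/-- For η ≤ ξ write (ξ + κ)⁻¹ = (ξ + κ)^{2s} (ξ + κ)^{-(1+2s)}. Both exponents are negative, so the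
first base may be lowered to |ξ - η| + κ and the second to η + κ. Each resulting term is a function
of ξ - η times a function of one variable, hence its integral factorizes. -/
theorem one_div_mul_le_weights {s κ ξ η : ℝ} (hs : -(1 / 2) < s) (hs0 : s < 0) (hκ : 0 < κ)
    (hξ : 0 ≤ ξ) (hη : 0 ≤ η) :
    ((ξ + κ) * (η + κ))⁻¹ ≤
      (|ξ - η| + κ) ^ (2 * s) * ((ξ + κ) ^ (-(2 + 2 * s)) + (η + κ) ^ (-(2 + 2 * s))) := by
  wlog h : η ≤ ξ generalizing ξ η
  · have := this hη hξ (le_of_not_ge h)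
    rw [abs_sub_comm, mul_comm (ξ + κ), add_comm ((ξ + κ) ^ _)]
    exact this
  have ha : 0 < ξ + κ := by linarith
  have hb : 0 < η + κ := by linarith
  have hL : 0 < |ξ - η| + κ := by positivity
  have hL' : |ξ - η| + κ ≤ ξ + κ := by rw [abs_of_nonneg (by linarith)]; linarith
  have h1 : (ξ + κ)⁻¹ ≤ (|ξ - η| + κ) ^ (2 * s) * (η + κ) ^ (-(1 + 2 * s)) := by
    calc (ξ + κ)⁻¹ = (ξ + κ) ^ (2 * s) * (ξ + κ) ^ (-(1 + 2 * s)) := by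
          rw [← Real.rpow_add ha, ← Real.rpow_neg_one]; congr 1; ring
      _ ≤ _ := by
          gcongr ?_ * ?_
          · exact Real.rpow_le_rpow_of_nonpos hL hL' (by linarith)
          · exact Real.rpow_le_rpow_of_nonpos hb (by linarith) (by linarith)
  calc ((ξ + κ) * (η + κ))⁻¹ = (ξ + κ)⁻¹ * (η + κ)⁻¹ := mul_inv _ _
    _ ≤ (|ξ - η| + κ) ^ (2 * s) * (η + κ) ^ (-(1 + 2 * s)) * (η + κ)⁻¹ := by gcongr
    _ = (|ξ - η| + κ) ^ (2 * s) * (η + κ) ^ (-(2 + 2 * s)) := by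
        rw [mul_assoc, ← Real.rpow_neg_one (η + κ), ← Real.rpow_add hb]
        congr 2; ring
    _ ≤ _ := by
        gcongr
        have := Real.rpow_nonneg ha.le (-(2 + 2 * s))
        linarith

theorem lintegral_comp_measurePreserving {α β : Type*} [MeasurableSpace α] [MeasurableSpace β]
    {μ : Measure α} {ν : Measure β} {φ : α → β} (h : MeasurePreserving φ μ ν) {f : β → ℝ≥0∞}
    (hf : AEMeasurable f ν) : ∫⁻ x, f (φ x) ∂μ = ∫⁻ y, f y ∂ν := by
  rw [← h.map_eq] at hf ⊢
  exact (lintegral_map' hf h.aemeasurable).symm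

theorem lintegral_shear_mul (G : Geometry) {H A : ℝ → ℝ≥0∞} (hH : AEMeasurable H (freq G))
    (hA : AEMeasurable A (freq G)) :
    ∫⁻ p : ℝ × ℝ, H (p.1 - p.2) * A p.2 ∂((freq G).prod (freq G)) =
      (∫⁻ ξ, H ξ ∂(freq G)) * ∫⁻ ξ, A ξ ∂(freq G) := by
  rw [← lintegral_prod_mul hH hA]
  have hm : AEMeasurable (fun p : ℝ × ℝ => H p.1 * A p.2) ((freq G).prod (freq G)) :=
    hH.comp_fst.mul hA.comp_snd
  exact lintegral_comp_measurePreserving (measurePreserving_shear_freq G) hm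

theorem posFreq_prod (G : Geometry) : (posFreq G).prod (posFreq G) =
    ((freq G).prod (freq G)).restrict (Set.Ici 0 ×ˢ Set.Ici 0) := Measure.prod_restrict _ _

/-- The exponent 2 + 2s exceeds one exactly because s > -1/2, and the one-variable integral
contributes κ^{-1-2s}. This negative power of κ makes the potential a small perturbation at high
energy. -/
theorem lintegral_kernel_le (G : Geometry) {s : ℝ} (hs : -(1 / 2) < s) (hs0 : s < 0) :
    ∃ C : ℝ, 0 < C ∧ ∀ κ : ℝ, 1 ≤ κ → ∀ g : ℝ → ℝ≥0∞, AEMeasurable g (freq G) →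
      ∫⁻ p : ℝ × ℝ, g (p.1 - p.2) * ENNReal.ofReal (((p.1 + κ) * (p.2 + κ))⁻¹)
        ∂((posFreq G).prod (posFreq G)) ≤
      ENNReal.ofReal (C * κ ^ (-1 - 2 * s)) *
        ∫⁻ ζ, ENNReal.ofReal ((|ζ| + κ) ^ (2 * s)) * g ζ ∂(freq G) := by
  obtain ⟨C, hC0, hC⟩ := lintegral_rpow_neg_le G (p := 2 + 2 * s) (by linarith)
  refine ⟨2 * C, by positivity, fun κ hκ g hg => ?_⟩
  have hκ0 : 0 < κ := by linarith
  let H : ℝ → ℝ≥0∞ := fun ζ => ENNReal.ofReal ((|ζ| + κ) ^ (2 * s)) * g ζ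
  let A : ℝ → ℝ≥0∞ := Set.indicator (Set.Ici 0) fun η =>
    ENNReal.ofReal ((η + κ) ^ (-(2 + 2 * s)))
  have hH : AEMeasurable H (freq G) := by
    have : Measurable fun ζ : ℝ => ENNReal.ofReal ((|ζ| + κ) ^ (2 * s)) := by fun_prop
    exact this.aemeasurable.mul hg
  have hA : Measurable A := Measurable.indicator (by fun_prop) measurableSet_Ici
  have hAi : ∫⁻ ξ, A ξ ∂(freq G) ≤ ENNReal.ofReal (C * κ ^ (-1 - 2 * s)) := by
    rw [lintegral_indicator measurableSet_Ici]
    refine (hC κ hκ).trans (le_of_eq ?_)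
    congr 3; ring
  have h1 := lintegral_shear_mul G hH hA.aemeasurable
  have hmp := measurePreserving_neg_freq G
  have hHn : AEMeasurable (fun ζ => H (-ζ)) (freq G) :=
    hH.comp_quasiMeasurePreserving hmp.quasiMeasurePreserving
  -- Swapping the variables replaces H by its reflection; since the frequency measure is even, the
  -- term weighted in the first variable has the same integral as the one weighted in the second.
  have h2 := lintegral_shear_mul G hHn hA.aemeasurable
  have h3 : ∫⁻ ζ, H (-ζ) ∂(freq G) = ∫⁻ ζ, H ζ ∂(freq G) := lintegral_comp_measurePreserving hmp hH
  have hHs : AEMeasurable (fun p : ℝ × ℝ => H (p.1 - p.2)) ((freq G).prod (freq G)) :=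
    hH.comp_quasiMeasurePreserving (quasiMeasurePreserving_sub_freq G)
  have h4 : ∫⁻ p : ℝ × ℝ, H (p.1 - p.2) * A p.1 ∂((freq G).prod (freq G)) =
      (∫⁻ ξ, H ξ ∂(freq G)) * ∫⁻ ξ, A ξ ∂(freq G) := by
    rw [← h3, ← h2, ← lintegral_prod_swap]
    refine lintegral_congr fun p => ?_
    simp only [Prod.fst_swap, Prod.snd_swap, neg_sub]
  have hHA : AEMeasurable (fun p : ℝ × ℝ => H (p.1 - p.2) * A p.1) ((freq G).prod (freq G)) :=
    hHs.mul hA.aemeasurable.comp_fst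
  calc _ ≤ ∫⁻ p : ℝ × ℝ, (H (p.1 - p.2) * A p.1 + H (p.1 - p.2) * A p.2)
        ∂((posFreq G).prod (posFreq G)) := by
        rw [posFreq_prod]
        refine setLIntegral_mono' (measurableSet_Ici.prod measurableSet_Ici) fun p hp => ?_
        have hp1 : 0 ≤ p.1 := hp.1
        have hp2 : 0 ≤ p.2 := hp.2
        have h5 := one_div_mul_le_weights hs hs0 hκ0 hp1 hp2
        simp only [H, A]
        rw [Set.indicator_of_mem hp.1, Set.indicator_of_mem hp.2, ← mul_add,
          ← ENNReal.ofReal_add (by positivity) (by positivity),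
          mul_comm (ENNReal.ofReal _) (g _), mul_assoc, ← ENNReal.ofReal_mul (by positivity)]
        gcongr
    _ ≤ ∫⁻ p : ℝ × ℝ, (H (p.1 - p.2) * A p.1 + H (p.1 - p.2) * A p.2)
        ∂((freq G).prod (freq G)) := by
        rw [posFreq_prod]; exact setLIntegral_le_lintegral _ _
    _ = 2 * ((∫⁻ ξ, H ξ ∂(freq G)) * ∫⁻ ξ, A ξ ∂(freq G)) := by
        rw [lintegral_add_left' hHA, h4, h1, two_mul]
    _ ≤ 2 * ((∫⁻ ξ, H ξ ∂(freq G)) * ENNReal.ofReal (C * κ ^ (-1 - 2 * s))) := by gcongr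
    _ = _ := by
        rw [mul_assoc 2 C, ENNReal.ofReal_mul (by norm_num : (0 : ℝ) ≤ 2), ENNReal.ofReal_ofNat]
        ring

/-! ### The Lax operator as a bounded operator on `L²₊` -/

theorem fourierConst_pos (G : Geometry) : 0 < fourierConst G := by
  cases G
  · simp only [fourierConst]; positivity
  · simp [fourierConst]

theorem fourierConst_le_one (G : Geometry) : fourierConst G ≤ 1 := by
  cases G
  · simp only [fourierConst]
    refine inv_le_one_of_one_le₀ (Real.one_le_sqrt.2 ?_)
    linarith [Real.pi_gt_three]
  · simp [fourierConst]

/-- The kernel of the potential on `L²₊`, symmetrized with the weights of `H^{1/2}`. -/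
def kerFn (G : Geometry) (q : ℝ → ℂ) (p : ℝ × ℝ) : ℂ :=
  (fourierConst G : ℂ) * q (p.1 - p.2) *
    ((((|p.1| + 1) ^ (-(1 / 2) : ℝ) : ℝ) : ℂ) * (((|p.2| + 1) ^ (-(1 / 2) : ℝ) : ℝ) : ℂ))

/-- The squared `H^s` norm with weight `(|ξ| + κ)^{2s}`. -/
def normK (G : Geometry) (s κ : ℝ) (q : ℝ → ℂ) : ℝ≥0∞ :=
  ∫⁻ ζ, ENNReal.ofReal ((|ζ| + κ) ^ (2 * s)) * ‖q ζ‖ₑ ^ 2 ∂(freq G)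

theorem quasiMeasurePreserving_sub_posFreq (G : Geometry) :
    Measure.QuasiMeasurePreserving (fun p : ℝ × ℝ => p.1 - p.2)
      ((posFreq G).prod (posFreq G)) (freq G) := by
  refine (quasiMeasurePreserving_sub_freq G).mono_left ?_
  rw [posFreq_prod]
  exact Measure.absolutelyContinuous_restrict

theorem aestronglyMeasurable_kerFn {G : Geometry} {q : ℝ → ℂ}
    (hq : AEStronglyMeasurable q (freq G)) :
    AEStronglyMeasurable (kerFn G q) ((posFreq G).prod (posFreq G)) := by
  have h1 : AEStronglyMeasurable (fun p : ℝ × ℝ => q (p.1 - p.2))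
      ((posFreq G).prod (posFreq G)) :=
    hq.comp_quasiMeasurePreserving (quasiMeasurePreserving_sub_posFreq G)
  have h2 : Measurable fun p : ℝ × ℝ => ((((|p.1| + 1) ^ (-(1 / 2) : ℝ) : ℝ) : ℂ) *
    (((|p.2| + 1) ^ (-(1 / 2) : ℝ) : ℝ) : ℂ)) := by fun_prop
  exact (h1.const_mul _).mul h2.aestronglyMeasurable

theorem enorm_ofReal_sq (x : ℝ) : ‖(x : ℂ)‖ₑ ^ 2 = ENNReal.ofReal (x ^ 2) := by
  rw [← ofReal_norm, Complex.norm_real, ← ENNReal.ofReal_pow (norm_nonneg _), Real.norm_eq_abs,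
    sq_abs]

theorem rpow_neg_half_sq {x : ℝ} (hx : 0 < x) : (x ^ (-(1 / 2) : ℝ)) ^ 2 = x⁻¹ := by
  rw [← Real.rpow_natCast, ← Real.rpow_mul hx.le, ← Real.rpow_neg_one]
  norm_num

theorem enorm_kerFn_sq_le (G : Geometry) (q : ℝ → ℂ) (p : ℝ × ℝ) :
    ‖kerFn G q p‖ₑ ^ 2 ≤ ‖q (p.1 - p.2)‖ₑ ^ 2 *
      ENNReal.ofReal (((|p.1| + 1) * (|p.2| + 1))⁻¹) := by
  have h1 : ‖(fourierConst G : ℂ)‖ₑ ^ 2 ≤ 1 := by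
    rw [enorm_ofReal_sq, ← ENNReal.ofReal_one]
    refine ENNReal.ofReal_le_ofReal ?_
    have := fourierConst_pos G
    have := fourierConst_le_one G
    nlinarith
  rw [kerFn, enorm_mul, enorm_mul, mul_pow, mul_pow, ← Complex.ofReal_mul,
    enorm_ofReal_sq (_ * _), mul_pow,
    rpow_neg_half_sq (bracket_pos _), rpow_neg_half_sq (bracket_pos _), mul_inv]
  calc _ ≤ 1 * ‖q (p.1 - p.2)‖ₑ ^ 2 * ENNReal.ofReal ((|p.1| + 1)⁻¹ * (|p.2| + 1)⁻¹) := by gcongr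
    _ = _ := by rw [one_mul]

variable {G : Geometry} {s : ℝ} [hs : Fact (-(1 / 2) < s ∧ s < 0)]

variable (G s) in
/-- The constant in the Hilbert-Schmidt estimate for the potential. -/
def hsConst : ℝ := (lintegral_kernel_le G hs.out.1 hs.out.2).choose

variable (G s) in
theorem hsConst_pos : 0 < hsConst G s := (lintegral_kernel_le G hs.out.1 hs.out.2).choose_spec.1

theorem lintegral_kerFn_weighted_le {κ : ℝ} (hκ : 1 ≤ κ) {q : ℝ → ℂ}
    (hq : AEStronglyMeasurable q (freq G)) :
    ∫⁻ p : ℝ × ℝ, ‖q (p.1 - p.2)‖ₑ ^ 2 * ENNReal.ofReal (((|p.1| + κ) * (|p.2| + κ))⁻¹)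
        ∂((posFreq G).prod (posFreq G)) ≤
      ENNReal.ofReal (hsConst G s * κ ^ (-1 - 2 * s)) * normK G s κ q := by
  refine le_trans (le_of_eq ?_) ((lintegral_kernel_le G hs.out.1 hs.out.2).choose_spec.2 κ hκ
    (fun ζ => ‖q ζ‖ₑ ^ 2) (hq.enorm.pow_const 2))
  rw [posFreq_prod]
  refine setLIntegral_congr_fun (measurableSet_Ici.prod measurableSet_Ici) fun p hp => ?_
  rw [abs_of_nonneg (show 0 ≤ p.1 from hp.1), abs_of_nonneg (show 0 ≤ p.2 from hp.2)]

theorem Sob.aestronglyMeasurable {G : Geometry} {σ : ℝ} (q : Sob G σ) :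
    AEStronglyMeasurable q (freq G) := (Lp.aestronglyMeasurable q).mono_ac (ac_sobMeasure G σ)

omit hs in
theorem normK_one (q : Sob G s) : normK G s 1 q = ‖q‖ₑ ^ 2 := by
  rw [Lp_enorm_sq, lintegral_sobMeasure, normK]

theorem lintegral_kerFn_le (q : Sob G s) :
    ∫⁻ p, ‖kerFn G q p‖ₑ ^ 2 ∂((posFreq G).prod (posFreq G)) ≤
      ENNReal.ofReal (hsConst G s) * ‖q‖ₑ ^ 2 := by
  have h := lintegral_kerFn_weighted_le (G := G) (s := s) le_rfl q.aestronglyMeasurable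
  rw [Real.one_rpow, mul_one, normK_one] at h
  exact (lintegral_mono fun p => enorm_kerFn_sq_le G q p).trans h

theorem memLp_kerFn (q : Sob G s) : MemLp (kerFn G q) 2 ((posFreq G).prod (posFreq G)) := by
  rw [memLp_two_iff_lintegral (aestronglyMeasurable_kerFn q.aestronglyMeasurable)]
  exact (lintegral_kerFn_le q).trans_lt (ENNReal.mul_lt_top (by simp) (by simp))

/-- The kernel as a continuous function of the potential. -/
def kerCLM (G : Geometry) (s : ℝ) [hs : Fact (-(1 / 2) < s ∧ s < 0)] :
    Sob G s →L[ℂ] Lp ℂ 2 ((posFreq G).prod (posFreq G)) :=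
  LinearMap.mkContinuous
    { toFun := fun q => (memLp_kerFn q).toLp
      map_add' := fun f g => by
        ext1
        filter_upwards [(memLp_kerFn (f + g)).coeFn_toLp, Lp.coeFn_add
          (memLp_kerFn f).toLp (memLp_kerFn g).toLp, (memLp_kerFn f).coeFn_toLp,
          (memLp_kerFn g).coeFn_toLp, (quasiMeasurePreserving_sub_posFreq G).ae
            (ae_sobMeasure_iff.1 (Lp.coeFn_add f g))] with x h1 h2 h3 h4 h5
        rw [h1, h2, Pi.add_apply, h3, h4, kerFn, kerFn, kerFn, h5, Pi.add_apply]
        ring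
      map_smul' := fun c f => by
        ext1
        filter_upwards [(memLp_kerFn (c • f)).coeFn_toLp, Lp.coeFn_smul c
          (memLp_kerFn f).toLp, (memLp_kerFn f).coeFn_toLp,
          (quasiMeasurePreserving_sub_posFreq G).ae
            (ae_sobMeasure_iff.1 (Lp.coeFn_smul c f))] with x h1 h2 h3 h4
        rw [h1, RingHom.id_apply, h2, Pi.smul_apply, h3, kerFn, kerFn, h4, Pi.smul_apply,
          smul_eq_mul, smul_eq_mul]
        ring }
    (Real.sqrt (hsConst G s)) fun q => by
      refine Lp_norm_le_of_lintegral_le _ (by positivity) ?_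
      rw [lintegral_congr_ae (g := fun p => ‖kerFn G q p‖ₑ ^ 2)]
      · refine (lintegral_kerFn_le q).trans (le_of_eq ?_)
        rw [ENNReal.ofReal_mul (Real.sqrt_nonneg _), mul_pow, ofReal_norm,
          ← ENNReal.ofReal_pow (Real.sqrt_nonneg _), Real.sq_sqrt (hsConst_pos G s).le]
      · filter_upwards [(memLp_kerFn q).coeFn_toLp] with x hx
        change ‖((memLp_kerFn q).toLp : Lp ℂ 2 ((posFreq G).prod (posFreq G))) x‖ₑ ^ 2 = _
        rw [hx]

theorem coeFn_kerCLM (q : Sob G s) :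
    kerCLM G s q =ᵐ[(posFreq G).prod (posFreq G)] kerFn G q := (memLp_kerFn q).coeFn_toLp

/-- The potential `C₊ q` on `L²₊`, symmetrized with the weights of `H^{1/2}`. -/
def potOp (G : Geometry) (s : ℝ) [hs : Fact (-(1 / 2) < s ∧ s < 0)] :
    Sob G s →L[ℂ] Hardy G →L[ℂ] Hardy G := (hsOp (posFreq G)).comp (kerCLM G s)

theorem hsBound_potOp (q : Sob G s) : HSBound (potOp G s q) (‖kerCLM G s q‖ ^ 2) :=
  hsBound_hsOp _

theorem ae_kerFn_swap {q : ℝ → ℂ} (hq : IsReal G q) :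
    ∀ᵐ p ∂((posFreq G).prod (posFreq G)), kerFn G q p.swap = conj (kerFn G q p) := by
  filter_upwards [(quasiMeasurePreserving_sub_posFreq G).ae hq] with p hp
  simp only [kerFn, Prod.fst_swap, Prod.snd_swap, map_mul, Complex.conj_ofReal]
  rw [← hp, neg_sub]
  ring

theorem potOp_symmetric {q : Sob G s} (hq : IsReal G q) (f g : Hardy G) :
    inner ℂ (potOp G s q f) g = inner ℂ f (potOp G s q g) := by
  refine hsOp_symmetric ?_ f g
  have hsw : Measure.QuasiMeasurePreserving Prod.swap ((posFreq G).prod (posFreq G))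
      ((posFreq G).prod (posFreq G)) := Measure.measurePreserving_swap.quasiMeasurePreserving
  filter_upwards [coeFn_kerCLM q, hsw.ae (coeFn_kerCLM q), ae_kerFn_swap hq] with p h1 h2 h3
  exact h2.trans (h3.trans (congrArg _ h1.symm))

theorem isMultiplier_weight (G : Geometry) :
    IsMultiplier (posFreq G) (posFreq G) (fun ξ => (((|ξ| + 1)⁻¹ : ℝ) : ℂ)) 1 := by
  refine isMultiplier_hardy (by fun_prop) zero_le_one fun ξ _ => ?_
  rw [Complex.norm_real, Real.norm_of_nonneg (by positivity)]
  exact inv_le_one_of_one_le₀ (by simp)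

/-- The identity operator, symmetrized with the weights of `H^{1/2}`. -/
def weightOp (G : Geometry) : Hardy G →L[ℂ] Hardy G := (isMultiplier_weight G).clm

theorem coeFn_weightOp {G : Geometry} (f : Hardy G) :
    weightOp G f =ᵐ[posFreq G] fun ξ => (((|ξ| + 1)⁻¹ : ℝ) : ℂ) * f ξ :=
  (isMultiplier_weight G).coeFn_clm f

/-- The operator `ℒ + z`, symmetrized with the weights of `H^{1/2}`. -/
def laxT (q : Sob G s) (z : ℂ) : Hardy G →L[ℂ] Hardy G :=
  1 + (z - 1) • weightOp G - potOp G s q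

theorem coeFn_potOp (q : Sob G s) (f : Hardy G) :
    potOp G s q f =ᵐ[posFreq G] fun ξ => ∫ η, kerFn G q (ξ, η) * f η ∂(posFreq G) := by
  filter_upwards [coeFn_hsOp (kerCLM G s q) f, Measure.ae_ae_of_ae_prod (coeFn_kerCLM q)]
    with ξ h1 h2
  change hsOp (posFreq G) (kerCLM G s q) f ξ = _
  rw [h1]
  refine integral_congr_ae ?_
  filter_upwards [h2] with η hη
  rw [hη]

theorem kerFn_integral_eq (q : ℝ → ℂ) (f F : ℝ → ℂ) (ξ : ℝ)
    (hF : ∀ᵐ η ∂(posFreq G), f η = (((|η| + 1) ^ (-(1 / 2) : ℝ) : ℝ) : ℂ) * F η) :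
    ∫ η, kerFn G q (ξ, η) * F η ∂(posFreq G) = (((|ξ| + 1) ^ (-(1 / 2) : ℝ) : ℝ) : ℂ) *
      ((fourierConst G : ℂ) * ∫ η, q (ξ - η) * f η ∂(posFreq G)) := by
  rw [← mul_assoc, ← integral_const_mul]
  refine integral_congr_ae ?_
  filter_upwards [hF] with η hη
  rw [hη, kerFn]
  ring

theorem coeFn_laxT (q : Sob G s) (z : ℂ) (f : Hardy G) :
    laxT q z f =ᵐ[posFreq G] fun ξ => f ξ + (z - 1) * ((((|ξ| + 1)⁻¹ : ℝ) : ℂ) * f ξ) -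
      potOp G s q f ξ := by
  have h0 : laxT q z f = f + (z - 1) • weightOp G f - potOp G s q f := by
    simp [laxT]
  rw [h0]
  filter_upwards [Lp.coeFn_sub (f + (z - 1) • weightOp G f) (potOp G s q f),
    Lp.coeFn_add f ((z - 1) • weightOp G f), Lp.coeFn_smul (z - 1) (weightOp G f),
    coeFn_weightOp f] with ξ h1 h2 h3 h4
  rw [h1, Pi.sub_apply, h2, Pi.add_apply, h3, Pi.smul_apply, h4, smul_eq_mul]

theorem restr_half_eq {f : Sob G (1 / 2)} :
    ∀ᵐ ξ ∂(posFreq G), f ξ = (((|ξ| + 1) ^ (-(1 / 2) : ℝ) : ℝ) : ℂ) * restr G (1 / 2) f ξ := by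
  filter_upwards [coeFn_restr f] with ξ h
  rw [h, ← mul_assoc, mul_comm (((|ξ| + 1) ^ (-(1 / 2) : ℝ) : ℝ) : ℂ), ofReal_rpow_mul_neg, one_mul]

theorem pairPlus_eq_inner (g : Sob G (1 / 2)) {φ : ℝ → ℂ} {Φ : Hardy G}
    (hΦ : ∀ᵐ ξ ∂(posFreq G), Φ ξ = (((|ξ| + 1) ^ (-(1 / 2) : ℝ) : ℝ) : ℂ) * φ ξ) :
    pairPlus G g φ = inner ℂ (restr G (1 / 2) g) Φ := by
  rw [L2.inner_def]
  refine integral_congr_ae ?_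
  change ∀ᵐ ξ ∂(posFreq G), _
  filter_upwards [hΦ, restr_half_eq (f := g)] with ξ h1 h2
  rw [RCLike.inner_apply', h1, h2, map_mul, Complex.conj_ofReal]
  ring

/-- On nonnegative frequencies ξ = (|ξ| + 1) - 1. After division by the weights of H^{1/2} the
operator -i∂ becomes 1 - D, with D the multiplier 1/(|ξ| + 1), and -i∂ + z becomes 1 + (z - 1) D. -/
theorem laxForm_eq_inner (q : Sob G s) (z : ℂ) (f g : Sob G (1 / 2)) :
    laxForm G q g f + z * pairPlus G g f =
      inner ℂ (restr G (1 / 2) g) (laxT q z (restr G (1 / 2) f)) := by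
  set F := restr G (1 / 2) f
  set H := restr G (1 / 2) g
  have h0 : laxT q z F = F + (z - 1) • weightOp G F - potOp G s q F := by
    simp [laxT]
  have hsq : ∀ ξ : ℝ, (((|ξ| + 1) ^ (-(1 / 2) : ℝ) : ℝ) : ℂ) *
      (((|ξ| + 1) ^ (-(1 / 2) : ℝ) : ℝ) : ℂ) = (((|ξ| + 1)⁻¹ : ℝ) : ℂ) := by
    intro ξ
    rw [← Complex.ofReal_mul, ← sq, rpow_neg_half_sq (bracket_pos ξ)]
  have h1 : inner ℂ H (weightOp G F) = pairPlus G g f := by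
    symm
    refine pairPlus_eq_inner g ?_
    filter_upwards [coeFn_weightOp F, restr_half_eq (f := f)] with ξ h1 h2
    rw [h1, h2, ← mul_assoc, hsq]
  have h2 : (∫ ξ in Set.Ici 0, (ξ : ℂ) * (conj (g ξ) * f ξ) ∂(freq G)) =
      inner ℂ H F - inner ℂ H (weightOp G F) := by
    rw [L2.inner_def, L2.inner_def, ← integral_sub (L2.integrable_inner _ _)
      (L2.integrable_inner _ _)]
    refine integral_congr_ae ?_
    change ∀ᵐ ξ ∂(posFreq G), _
    filter_upwards [coeFn_weightOp F, restr_half_eq (f := f), restr_half_eq (f := g),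
      ae_posFreq_mem G] with ξ h1 h2 h3 h4
    rw [RCLike.inner_apply', RCLike.inner_apply', h1, h2, h3, map_mul, Complex.conj_ofReal]
    have hb : ((|ξ| : ℝ) : ℂ) + 1 ≠ 0 := by
      exact_mod_cast (bracket_pos ξ).ne'
    have h5 : (ξ : ℂ) = ((|ξ| : ℝ) : ℂ) := by rw [abs_of_nonneg h4]
    have h6 := hsq ξ
    push_cast at h6
    have h7 : (ξ : ℂ) * (((|ξ| : ℝ) : ℂ) + 1)⁻¹ = 1 - (((|ξ| : ℝ) : ℂ) + 1)⁻¹ := by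
      rw [h5]; field_simp; ring
    push_cast
    linear_combination (ξ : ℂ) * conj (H ξ) * F ξ * h6 + conj (H ξ) * F ξ * h7
  have h3 : (fourierConst G : ℂ) * (∫ ξ in Set.Ici 0, conj (g ξ) *
      (∫ η in Set.Ici 0, q (ξ - η) * f η ∂(freq G)) ∂(freq G)) = inner ℂ H (potOp G s q F) := by
    rw [L2.inner_def, ← integral_const_mul]
    refine integral_congr_ae ?_
    change ∀ᵐ ξ ∂(posFreq G), _
    filter_upwards [coeFn_potOp q F, restr_half_eq (f := g)] with ξ h1 h3
    rw [RCLike.inner_apply', h1, h3, map_mul, Complex.conj_ofReal,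
      kerFn_integral_eq q f F ξ restr_half_eq]
    simp only [posFreq]
    ring
  rw [laxForm, h2, h3, ← h1, h0, inner_sub_right, inner_add_right, inner_smul_right]
  ring

/-- The Hardy test functions in H^{1/2} are precisely the lifts of elements of L²₊, so the weak
equation is an equation in L²₊. -/
theorem solvesLax_iff (q : Sob G s) (z : ℂ) {φ : ℝ → ℂ} {Φ : Hardy G}
    (hΦ : ∀ᵐ ξ ∂(posFreq G), Φ ξ = (((|ξ| + 1) ^ (-(1 / 2) : ℝ) : ℝ) : ℂ) * φ ξ)
    (f : Sob G (1 / 2)) :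
    SolvesLax G q z φ f ↔ IsHardy G f ∧ laxT q z (restr G (1 / 2) f) = Φ := by
  refine and_congr_right fun _ => ⟨fun h => ?_, fun h g _ => ?_⟩
  · refine ext_inner_left ℂ fun v => ?_
    have h1 := h (lift G (1 / 2) v) (isHardy_lift v)
    rw [laxForm_eq_inner, pairPlus_eq_inner _ hΦ, restr_lift] at h1
    exact h1
  · rw [laxForm_eq_inner, pairPlus_eq_inner _ hΦ, h]

/-- Reduces the spectrum of the unbounded operator to invertibility in the algebra of bounded
operators; the open mapping theorem supplies boundedness of the inverse. -/
theorem laxInvertible_iff (q : Sob G s) (z : ℂ) : LaxInvertible G q z ↔ IsUnit (laxT q z) := by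
  rw [ContinuousLinearMap.isUnit_iff_bijective]
  have hrestr : ∀ φ : Sob G (-(1 / 2)), ∀ᵐ ξ ∂(posFreq G),
      restr G (-(1 / 2)) φ ξ = (((|ξ| + 1) ^ (-(1 / 2) : ℝ) : ℝ) : ℂ) * φ ξ :=
    fun φ => coeFn_restr φ
  constructor
  · intro h
    rw [Function.bijective_iff_existsUnique]
    intro Φ
    obtain ⟨f, hf, huniq⟩ := h (lift G _ Φ) (isHardy_lift Φ)
    have hΦ := hrestr (lift G _ Φ)
    rw [restr_lift] at hΦ
    simp only [solvesLax_iff q z hΦ] at hf huniq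
    refine ⟨restr G (1 / 2) f, hf.2, fun F hF => ?_⟩
    rw [← huniq (lift G (1 / 2) F) ⟨isHardy_lift F, by rw [restr_lift]; exact hF⟩, restr_lift]
  · intro h φ _
    simp only [solvesLax_iff q z (hrestr φ)]
    obtain ⟨F, hF⟩ := h.2 (restr G _ φ)
    refine ⟨lift G (1 / 2) F, ⟨isHardy_lift F, by rw [restr_lift]; exact hF⟩, fun f hf => ?_⟩
    rw [← lift_restr f hf.1]
    congr 1
    exact h.1 (hf.2.trans hF.symm)

theorem isMultiplier_source (G : Geometry) (s : ℝ) [hs : Fact (-(1 / 2) < s ∧ s < 0)] :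
    IsMultiplier (sobMeasure G s) (posFreq G)
      (fun ξ => (((|ξ| + 1) ^ (-(1 / 2) : ℝ) : ℝ) : ℂ)) 1 := by
  refine isMultiplier_toHardy (by fun_prop) zero_le_one fun ξ => ?_
  have := bracket_pos ξ
  rw [Complex.norm_real, Real.norm_of_nonneg (by positivity), one_mul]
  exact Real.rpow_le_rpow_of_exponent_le (by simp) hs.out.1.le

/-- `q₊`, symmetrized with the weights of `H^{1/2}`. -/
def source (G : Geometry) (s : ℝ) [hs : Fact (-(1 / 2) < s ∧ s < 0)] : Sob G s →L[ℂ] Hardy G :=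
  (isMultiplier_source G s).clm

theorem coeFn_source (q : Sob G s) : ∀ᵐ ξ ∂(posFreq G),
    source G s q ξ = (((|ξ| + 1) ^ (-(1 / 2) : ℝ) : ℝ) : ℂ) * q ξ :=
  (isMultiplier_source G s).coeFn_clm q

/-- `(ℒ + z)⁻¹ q₊`, symmetrized with the weights of `H^{1/2}`. -/
def gaugeH (q : Sob G s) (z : ℂ) : Hardy G := Ring.inverse (laxT q z) (source G s q)

theorem laxT_gaugeH {q : Sob G s} {z : ℂ} (h : IsUnit (laxT q z)) :
    laxT q z (gaugeH q z) = source G s q := by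
  have := Ring.mul_inverse_cancel _ h
  rw [gaugeH, ← mul_apply_eq_comp, this, one_apply_eq_self]

theorem gaugeH_eq_of_laxT {q : Sob G s} {z : ℂ} (h : IsUnit (laxT q z)) {F : Hardy G}
    (hF : laxT q z F = source G s q) : F = gaugeH q z := by
  have := Ring.inverse_mul_cancel _ h
  rw [gaugeH, ← hF, ← mul_apply_eq_comp, this, one_apply_eq_self]

/-- At spectral points both definitions take the default value zero, so no invertibility is needed.
-/
theorem gaugeM_eq (q : Sob G s) (z : ℂ) : gaugeM G q z = lift G (1 / 2) (gaugeH q z) := by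
  by_cases h : IsUnit (laxT q z)
  · have hl := (laxInvertible_iff q z).2 h
    have he : ∃ f : Sob G (1 / 2), SolvesLax G q z q f := by
      refine ⟨lift G (1 / 2) (gaugeH q z), (solvesLax_iff q z (coeFn_source q) _).2
        ⟨isHardy_lift _, ?_⟩⟩
      rw [restr_lift, laxT_gaugeH h]
    rw [gaugeM, dif_pos ⟨hl, he⟩]
    have h1 := (solvesLax_iff q z (coeFn_source q) _).1 he.choose_spec
    rw [← gaugeH_eq_of_laxT h h1.2, lift_restr _ h1.1]
  · rw [gaugeM, dif_neg fun h' => h ((laxInvertible_iff q z).1 h'.1), gaugeH,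
      Ring.inverse_non_unit _ h]
    simp

theorem pairPlus_left_eq_inner {φ : ℝ → ℂ} {Φ : Hardy G} (F : Hardy G)
    (hΦ : ∀ᵐ ξ ∂(posFreq G), Φ ξ = (((|ξ| + 1) ^ (-(1 / 2) : ℝ) : ℝ) : ℂ) * φ ξ) :
    pairPlus G φ (lift G (1 / 2) F) = inner ℂ Φ F := by
  rw [L2.inner_def]
  refine integral_congr_ae ?_
  change ∀ᵐ ξ ∂(posFreq G), _
  filter_upwards [hΦ, coeFn_lift_pos (σ := 1 / 2) F] with ξ h1 h2
  rw [RCLike.inner_apply', h1, h2, map_mul, Complex.conj_ofReal]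
  ring

theorem beta_eq (q : Sob G s) (z : ℂ) : beta G q z = inner ℂ (source G s q) (gaugeH q z) := by
  rw [beta, gaugeM_eq]
  exact pairPlus_left_eq_inner _ (coeFn_source q)

/-! ### Smallness of the potential at high energy -/

theorem inner_real_multiplier {G : Geometry} {b : ℝ → ℝ} {C : ℝ}
    (h : IsMultiplier (posFreq G) (posFreq G) (fun ξ => (b ξ : ℂ)) C) (f : Hardy G) :
    Integrable (fun ξ => b ξ * ‖f ξ‖ ^ 2) (posFreq G) ∧
      inner ℂ f (h.clm f) = ((∫ ξ, b ξ * ‖f ξ‖ ^ 2 ∂(posFreq G) : ℝ) : ℂ) := by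
  have h1 : ∀ᵐ ξ ∂(posFreq G), inner ℂ (f ξ) (h.clm f ξ) = ((b ξ * ‖f ξ‖ ^ 2 : ℝ) : ℂ) := by
    filter_upwards [h.coeFn_clm f] with ξ hξ
    rw [RCLike.inner_apply', hξ]
    push_cast
    rw [← Complex.conj_mul']
    ring
  constructor
  · have h2 := (L2.integrable_inner (𝕜 := ℂ) f (h.clm f)).re
    refine h2.congr ?_
    filter_upwards [h1] with ξ hξ
    rw [hξ]
    exact Complex.ofReal_re _
  · rw [L2.inner_def, integral_congr_ae h1]
    exact integral_ofReal

theorem real_multiplier_symmetric {G : Geometry} {b : ℝ → ℝ} {C : ℝ}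
    (h : IsMultiplier (posFreq G) (posFreq G) (fun ξ => (b ξ : ℂ)) C) (f g : Hardy G) :
    inner ℂ (h.clm f) g = inner ℂ f (h.clm g) := by
  rw [L2.inner_def, L2.inner_def]
  refine integral_congr_ae ?_
  filter_upwards [h.coeFn_clm f, h.coeFn_clm g] with ξ h1 h2
  rw [RCLike.inner_apply', RCLike.inner_apply', h1, h2, map_mul, Complex.conj_ofReal]
  ring

theorem ofReal_inner_real_multiplier {G : Geometry} {b : ℝ → ℝ} {C : ℝ}
    (h : IsMultiplier (posFreq G) (posFreq G) (fun ξ => (b ξ : ℂ)) C) (hb : ∀ ξ, 0 ≤ b ξ)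
    (f : Hardy G) : ENNReal.ofReal (inner ℂ f (h.clm f)).re =
      ∫⁻ ξ, ENNReal.ofReal (b ξ) * ‖f ξ‖ₑ ^ 2 ∂(posFreq G) := by
  obtain ⟨h1, h2⟩ := inner_real_multiplier h f
  rw [h2, Complex.ofReal_re, ofReal_integral_eq_lintegral_ofReal h1
    (Eventually.of_forall fun ξ => mul_nonneg (hb ξ) (by positivity))]
  refine lintegral_congr fun ξ => ?_
  rw [ENNReal.ofReal_mul (hb ξ), ENNReal.ofReal_pow (norm_nonneg _), ofReal_norm]

theorem inner_real_multiplier_nonneg {G : Geometry} {b : ℝ → ℝ} {C : ℝ}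
    (h : IsMultiplier (posFreq G) (posFreq G) (fun ξ => (b ξ : ℂ)) C) (hb : ∀ ξ, 0 ≤ b ξ)
    (f : Hardy G) : 0 ≤ (inner ℂ f (h.clm f)).re := by
  rw [(inner_real_multiplier h f).2, Complex.ofReal_re]
  exact integral_nonneg fun ξ => mul_nonneg (hb ξ) (by positivity)

theorem weightOp_symmetric {G : Geometry} (f g : Hardy G) :
    inner ℂ (weightOp G f) g = inner ℂ f (weightOp G g) :=
  real_multiplier_symmetric (isMultiplier_weight G) f g

theorem inner_weightOp_nonneg {G : Geometry} (f : Hardy G) :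
    0 ≤ (inner ℂ f (weightOp G f)).re :=
  inner_real_multiplier_nonneg (isMultiplier_weight G) (fun ξ => by positivity) f

theorem inner_weightOp_im {G : Geometry} (f : Hardy G) : (inner ℂ f (weightOp G f)).im = 0 := by
  rw [weightOp, (inner_real_multiplier (isMultiplier_weight G) f).2, Complex.ofReal_im]

theorem inner_weightOp_pos {G : Geometry} (f : Hardy G) (hf : f ≠ 0) :
    0 < (inner ℂ f (weightOp G f)).re := by
  rw [← ENNReal.ofReal_pos, weightOp, ofReal_inner_real_multiplier (isMultiplier_weight G)
    (fun ξ => by positivity), pos_iff_ne_zero]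
  intro h0
  have hm : AEMeasurable (fun ξ => ENNReal.ofReal ((|ξ| + 1)⁻¹) * ‖f ξ‖ₑ ^ 2) (posFreq G) := by
    have : Measurable fun ξ : ℝ => ENNReal.ofReal ((|ξ| + 1)⁻¹) := by fun_prop
    exact this.aemeasurable.mul ((Lp.aestronglyMeasurable f).enorm.pow_const 2)
  rw [lintegral_eq_zero_iff' hm] at h0
  refine hf (Lp.ext ?_)
  filter_upwards [h0, Lp.coeFn_zero ℂ 2 (posFreq G)] with ξ h1 h2
  rw [h2]
  have h3 : ENNReal.ofReal ((|ξ| + 1)⁻¹) ≠ 0 := by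
    have := bracket_pos ξ
    rw [ne_eq, ENNReal.ofReal_eq_zero, not_le]
    positivity
  simpa [h3] using h1

theorem inner_weightOp_le {G : Geometry} (f : Hardy G) :
    (inner ℂ f (weightOp G f)).re ≤ ‖f‖ ^ 2 := by
  have h1 := (Complex.re_le_norm _).trans (norm_inner_le_norm (𝕜 := ℂ) f (weightOp G f))
  have h2 := (isMultiplier_weight G).norm_clm_le f
  rw [one_mul] at h2
  calc _ ≤ ‖f‖ * ‖weightOp G f‖ := h1
    _ ≤ ‖f‖ * ‖f‖ := by gcongr; exact h2
    _ = _ := by ring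

theorem isMultiplier_energy (G : Geometry) {κ : ℝ} (hκ : 1 ≤ κ) :
    IsMultiplier (posFreq G) (posFreq G) (fun ξ => (((|ξ| + κ) / (|ξ| + 1) : ℝ) : ℂ)) κ := by
  refine isMultiplier_hardy (by fun_prop) (by linarith) fun ξ _ => ?_
  rw [Complex.norm_real, Real.norm_of_nonneg (by positivity), div_le_iff₀ (bracket_pos ξ)]
  nlinarith [abs_nonneg ξ]

theorem energy_clm_eq (G : Geometry) {κ : ℝ} (hκ : 1 ≤ κ) :
    (isMultiplier_energy G hκ).clm = 1 + ((κ : ℂ) - 1) • weightOp G := by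
  ext1 f
  ext1
  have h0 : (1 + ((κ : ℂ) - 1) • weightOp G) f = f + ((κ : ℂ) - 1) • weightOp G f := by simp
  rw [h0]
  filter_upwards [(isMultiplier_energy G hκ).coeFn_clm f, Lp.coeFn_add f (((κ : ℂ) - 1) • weightOp G f),
    Lp.coeFn_smul ((κ : ℂ) - 1) (weightOp G f), coeFn_weightOp f] with ξ h1 h2 h3 h4
  rw [h1, h2, Pi.add_apply, h3, Pi.smul_apply, h4, smul_eq_mul]
  have hb : ((|ξ| : ℝ) : ℂ) + 1 ≠ 0 := by exact_mod_cast (bracket_pos ξ).ne'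
  push_cast
  field_simp
  ring

/-- The quadratic form of `-i∂ + κ`. -/
def energy {G : Geometry} (κ : ℝ) (f : Hardy G) : ℝ :=
  (inner ℂ f ((1 + ((κ : ℂ) - 1) • weightOp G) f)).re

theorem ofReal_energy {G : Geometry} {κ : ℝ} (hκ : 1 ≤ κ) (f : Hardy G) :
    ENNReal.ofReal (energy κ f) =
      ∫⁻ ξ, ENNReal.ofReal ((|ξ| + κ) / (|ξ| + 1)) * ‖f ξ‖ₑ ^ 2 ∂(posFreq G) := by
  rw [energy, ← energy_clm_eq G hκ, ofReal_inner_real_multiplier _ fun ξ => by positivity]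

theorem energy_nonneg {G : Geometry} {κ : ℝ} (hκ : 1 ≤ κ) (f : Hardy G) : 0 ≤ energy κ f := by
  rw [energy, ← energy_clm_eq G hκ]
  exact inner_real_multiplier_nonneg _ (fun ξ => by positivity) f

theorem energy_eq {G : Geometry} (κ : ℝ) (f : Hardy G) :
    energy κ f = ‖f‖ ^ 2 + (κ - 1) * (inner ℂ f (weightOp G f)).re := by
  rw [energy, add_apply, smul_apply, inner_add_right, inner_smul_right, one_apply_eq_self,
    inner_self_eq_norm_sq_to_K, Complex.add_re, Complex.mul_re]
  have : (((‖f‖ : ℝ) : ℂ) ^ 2).re = ‖f‖ ^ 2 := by rw [← Complex.ofReal_pow, Complex.ofReal_re]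
  simp [this]

theorem norm_sq_le_energy {G : Geometry} {κ : ℝ} (hκ : 1 ≤ κ) (f : Hardy G) :
    ‖f‖ ^ 2 ≤ energy κ f := by
  rw [energy_eq]
  nlinarith [inner_weightOp_nonneg f]

variable {G : Geometry} {s : ℝ} [hs : Fact (-(1 / 2) < s ∧ s < 0)]

/-- Insert σρ = 1 in both variables, σ² being (|ξ| + κ)/(|ξ| + 1). The factors ρ turn the weights of
the kernel from |ξ| + 1 into |ξ| + κ, the factors σ turn f and g into their energies, and
Cauchy–Schwarz on the product space concludes. -/
theorem enorm_inner_potOp_sq_le {κ : ℝ} (hκ : 1 ≤ κ) (q : Sob G s) (f g : Hardy G) :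
    ‖inner ℂ g (potOp G s q f)‖ₑ ^ 2 ≤
      (ENNReal.ofReal (hsConst G s * κ ^ (-1 - 2 * s)) * normK G s κ q) *
        (ENNReal.ofReal (energy κ g) * ENNReal.ofReal (energy κ f)) := by
  let σ : ℝ → ℝ≥0∞ := fun ξ => ENNReal.ofReal (Real.sqrt ((|ξ| + κ) / (|ξ| + 1)))
  let ρ : ℝ → ℝ≥0∞ := fun ξ => ENNReal.ofReal (Real.sqrt ((|ξ| + 1) / (|ξ| + κ)))
  have hσ : Measurable σ := by fun_prop
  have hρ : Measurable ρ := by fun_prop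
  have hσρ : ∀ ξ, ρ ξ * σ ξ = 1 := by
    intro ξ
    have := bracket_pos ξ
    simp only [σ, ρ]
    rw [← ENNReal.ofReal_mul (Real.sqrt_nonneg _), ← Real.sqrt_mul (by positivity),
      div_mul_div_cancel₀ (by positivity), div_self (by positivity), Real.sqrt_one,
      ENNReal.ofReal_one]
  have hσ2 : ∀ ξ, σ ξ ^ 2 = ENNReal.ofReal ((|ξ| + κ) / (|ξ| + 1)) := fun ξ => by
    simp only [σ]
    rw [← ENNReal.ofReal_pow (Real.sqrt_nonneg _), Real.sq_sqrt (by positivity)]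
  have hρ2 : ∀ ξ, ρ ξ ^ 2 = ENNReal.ofReal ((|ξ| + 1) / (|ξ| + κ)) := fun ξ => by
    simp only [ρ]
    rw [← ENNReal.ofReal_pow (Real.sqrt_nonneg _), Real.sq_sqrt (by positivity)]
  have hk := aestronglyMeasurable_kerFn (G := G) q.aestronglyMeasurable
  have hf := Lp.aestronglyMeasurable f
  have hg := Lp.aestronglyMeasurable g
  let Φ : ℝ × ℝ → ℝ≥0∞ := fun p => ‖kerFn G q p‖ₑ * (ρ p.1 * ρ p.2)
  let Ψ : ℝ × ℝ → ℝ≥0∞ := fun p => (σ p.1 * ‖g p.1‖ₑ) * (σ p.2 * ‖f p.2‖ₑ)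
  have hΦ : AEMeasurable Φ ((posFreq G).prod (posFreq G)) :=
    hk.enorm.mul ((hρ.comp measurable_fst).mul (hρ.comp measurable_snd)).aemeasurable
  have hΨ : AEMeasurable Ψ ((posFreq G).prod (posFreq G)) :=
    ((hσ.comp measurable_fst).aemeasurable.mul hg.enorm.comp_fst).mul
      ((hσ.comp measurable_snd).aemeasurable.mul hf.enorm.comp_snd)
  have h1 : ‖inner ℂ g (potOp G s q f)‖ₑ ≤
      ∫⁻ p, Φ p * Ψ p ∂((posFreq G).prod (posFreq G)) := by
    change ‖inner ℂ g (hsOp (posFreq G) (kerCLM G s q) f)‖ₑ ≤ _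
    rw [inner_hsOp_prod]
    refine (enorm_integral_le_lintegral_enorm _).trans (le_of_eq (lintegral_congr_ae ?_))
    filter_upwards [coeFn_kerCLM q] with p hp
    simp only [Φ, Ψ]
    rw [enorm_mul, enorm_mul, hp, RCLike.enorm_conj]
    calc _ = ‖kerFn G q p‖ₑ * ‖g p.1‖ₑ * ‖f p.2‖ₑ * 1 * 1 := by ring
      _ = ‖kerFn G q p‖ₑ * ‖g p.1‖ₑ * ‖f p.2‖ₑ * (ρ p.1 * σ p.1) * (ρ p.2 * σ p.2) := by
          rw [hσρ, hσρ]
      _ = _ := by ring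
  have h2 : ∫⁻ p, Φ p ^ 2 ∂((posFreq G).prod (posFreq G)) ≤
      ENNReal.ofReal (hsConst G s * κ ^ (-1 - 2 * s)) * normK G s κ q := by
    refine le_trans (lintegral_mono fun p => ?_)
      (lintegral_kerFn_weighted_le hκ q.aestronglyMeasurable)
    simp only [Φ]
    rw [mul_pow, mul_pow, hρ2, hρ2]
    have hb1 := bracket_pos p.1
    have hb2 := bracket_pos p.2
    calc _ ≤ ‖q (p.1 - p.2)‖ₑ ^ 2 * ENNReal.ofReal (((|p.1| + 1) * (|p.2| + 1))⁻¹) *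
          (ENNReal.ofReal ((|p.1| + 1) / (|p.1| + κ)) *
            ENNReal.ofReal ((|p.2| + 1) / (|p.2| + κ))) := by
          gcongr; exact enorm_kerFn_sq_le G q p
      _ = _ := by
          rw [mul_assoc, ← ENNReal.ofReal_mul (by positivity), ← ENNReal.ofReal_mul (by positivity)]
          congr 2
          have : 0 < |p.1| + κ := by positivity
          have : 0 < |p.2| + κ := by positivity
          field_simp
  have h3 : ∫⁻ p, Ψ p ^ 2 ∂((posFreq G).prod (posFreq G)) =
      ENNReal.ofReal (energy κ g) * ENNReal.ofReal (energy κ f) := by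
    rw [ofReal_energy hκ, ofReal_energy hκ, ← lintegral_prod_mul]
    · refine lintegral_congr fun p => ?_
      simp only [Ψ]
      rw [mul_pow, mul_pow, mul_pow, hσ2, hσ2]
    · have : Measurable fun ξ : ℝ => ENNReal.ofReal ((|ξ| + κ) / (|ξ| + 1)) := by fun_prop
      exact this.aemeasurable.mul (hg.enorm.pow_const 2)
    · have : Measurable fun ξ : ℝ => ENNReal.ofReal ((|ξ| + κ) / (|ξ| + 1)) := by fun_prop
      exact this.aemeasurable.mul (hf.enorm.pow_const 2)
  calc _ ≤ (∫⁻ p, Φ p * Ψ p ∂((posFreq G).prod (posFreq G))) ^ 2 := by gcongr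
    _ ≤ _ := lintegral_mul_sq_le hΦ hΨ
    _ ≤ _ := by rw [h3]; gcongr

/-- The potential is small relative to `-i∂ + κ`. -/
def IsSmall (κ : ℝ) (q : Sob G s) : Prop :=
  ENNReal.ofReal (hsConst G s * κ ^ (-1 - 2 * s)) * normK G s κ q ≤ ENNReal.ofReal (1 / 4)

/-- The bound 1/4 on the square gives half the geometric mean of the energies, hence a quarter of
their sum. This is the hypothesis of `resolvent_pairing_comparison`. -/
theorem IsSmall.norm_inner_le {κ : ℝ} (hκ : 1 ≤ κ) {q : Sob G s} (h : IsSmall κ q)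
    (f g : Hardy G) : ‖inner ℂ g (potOp G s q f)‖ ≤ 1 / 4 * (energy κ g + energy κ f) := by
  have h1 : ‖inner ℂ g (potOp G s q f)‖ₑ ^ 2 ≤
      ENNReal.ofReal (1 / 4 * (energy κ g * energy κ f)) := by
    refine (enorm_inner_potOp_sq_le hκ q f g).trans ?_
    rw [ENNReal.ofReal_mul (by norm_num : (0 : ℝ) ≤ 1 / 4),
      ENNReal.ofReal_mul (energy_nonneg hκ g)]
    exact mul_le_mul_left h _
  have hg := energy_nonneg hκ g
  have hf := energy_nonneg hκ f
  rw [← ofReal_norm, ← ENNReal.ofReal_pow (norm_nonneg _),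
    ENNReal.ofReal_le_ofReal_iff (by positivity)] at h1
  refine abs_le_of_sq_le_sq' ?_ (by positivity) |>.2
  nlinarith [sq_nonneg (energy κ g - energy κ f)]

omit hs in
theorem normK_anti {κ₁ κ₂ : ℝ} (h1 : 0 < κ₁) (h : κ₁ ≤ κ₂) (hs : s ≤ 0) (q : ℝ → ℂ) :
    normK G s κ₂ q ≤ normK G s κ₁ q := by
  refine lintegral_mono fun ξ => ?_
  gcongr ENNReal.ofReal ?_ * _
  exact Real.rpow_le_rpow_of_nonpos (by positivity) (by linarith) (by linarith)

/-- Both κ^{-1-2s} and the weight (|ξ| + κ)^{2s} decrease in κ, so smallness need only be checked at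
one energy. -/
theorem IsSmall.mono {κ₁ κ₂ : ℝ} (h1 : 0 < κ₁) (h : κ₁ ≤ κ₂) {q : Sob G s} (hq : IsSmall κ₁ q) :
    IsSmall κ₂ q := by
  refine le_trans ?_ hq
  have hc := hsConst_pos G s
  refine mul_le_mul' (ENNReal.ofReal_le_ofReal ?_) (normK_anti h1 h hs.out.2.le q)
  exact mul_le_mul_of_nonneg_left (Real.rpow_le_rpow_of_nonpos h1 h (by linarith [hs.out.1])) hc.le

theorem isSmall_of_normK_le {κ N : ℝ} (hκ : 0 < κ) {q : Sob G s}
    (h : normK G s κ q ≤ ENNReal.ofReal N) (hle : 4 * hsConst G s * N ≤ κ ^ (1 + 2 * s)) :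
    IsSmall κ q := by
  have hc := hsConst_pos G s
  unfold IsSmall
  calc _ ≤ ENNReal.ofReal (hsConst G s * κ ^ (-1 - 2 * s)) * ENNReal.ofReal N := by gcongr
    _ ≤ _ := by
      rw [← ENNReal.ofReal_mul (by positivity)]
      refine ENNReal.ofReal_le_ofReal ?_
      have h1 : κ ^ (-1 - 2 * s) = (κ ^ (1 + 2 * s))⁻¹ := by
        rw [← Real.rpow_neg hκ.le]; congr 1; ring
      have h2 : 0 < κ ^ (1 + 2 * s) := by positivity
      rw [h1, mul_right_comm, ← div_eq_mul_inv, div_le_iff₀ h2]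
      linarith

omit hs in
theorem normK_le_norm {κ : ℝ} (hκ : 1 ≤ κ) (hs : s ≤ 0) (q : Sob G s) :
    normK G s κ q ≤ ENNReal.ofReal (‖q‖ ^ 2) := by
  refine (normK_anti one_pos hκ hs q).trans (le_of_eq ?_)
  rw [normK_one, ENNReal.ofReal_pow (norm_nonneg _), ofReal_norm]

theorem exists_isSmall (q : Sob G s) : ∃ κ : ℝ, 1 ≤ κ ∧ IsSmall κ q := by
  have h1 : Tendsto (fun κ : ℝ => κ ^ (1 + 2 * s)) atTop atTop :=
    tendsto_rpow_atTop (by linarith [hs.out.1])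
  obtain ⟨κ, hκ1, hκ⟩ := ((h1.eventually_ge_atTop (4 * hsConst G s * ‖q‖ ^ 2)).and
    (eventually_ge_atTop 1)).exists
  exact ⟨κ, hκ, isSmall_of_normK_le (by linarith)
    (normK_le_norm hκ hs.out.2.le q) hκ1⟩

theorem laxT_ofReal (q : Sob G s) (κ : ℝ) :
    laxT q (κ : ℂ) = (1 + ((κ : ℂ) - 1) • weightOp G) - potOp G s q := rfl

theorem IsSmall.half_norm_sq_le {κ : ℝ} (hκ : 1 ≤ κ) {q : Sob G s} (h : IsSmall κ q)
    (f : Hardy G) : 1 / 2 * ‖f‖ ^ 2 ≤ (inner ℂ f (laxT q κ f)).re := by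
  rw [laxT_ofReal, sub_apply, inner_sub_right, Complex.sub_re]
  have h1 := (Complex.re_le_norm _).trans (h.norm_inner_le hκ f f)
  have h2 := norm_sq_le_energy hκ f
  rw [energy] at h1 h2
  linarith

theorem IsSmall.isUnit_laxT {κ : ℝ} (hκ : 1 ≤ κ) {q : Sob G s} (h : IsSmall κ q) :
    IsUnit (laxT q (κ : ℂ)) :=
  isUnit_of_numericalRange _ one_half_pos fun f =>
    (h.half_norm_sq_le hκ f).trans (Complex.re_le_norm _)

/-- Let d = ⟨f, D f⟩ and fix κ at which q is small. The imaginary part of the form at z is d Im z,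
so d is controlled by the modulus of the form. The real part is at least ‖f‖²/2 - (κ - Re z) d, and
together they bound the form from below. -/
theorem isUnit_laxT_of_im_ne_zero {q : Sob G s} (hq : IsReal G q) {z : ℂ} (hz : z.im ≠ 0) :
    IsUnit (laxT q z) := by
  obtain ⟨κ, hκ, hsm⟩ := exists_isSmall q
  have hden : 0 < 1 + |κ - z.re| / |z.im| := by positivity
  refine isUnit_of_numericalRange _ (c := 1 / 2 / (1 + |κ - z.re| / |z.im|)) (by positivity)
    fun f => ?_
  set d := (inner ℂ f (weightOp G f)).re
  have hd0 : 0 ≤ d := inner_weightOp_nonneg f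
  have hd : inner ℂ f (weightOp G f) = (d : ℂ) :=
    Complex.ext rfl (by rw [inner_weightOp_im, Complex.ofReal_im])
  have h1 := hsm.half_norm_sq_le hκ f
  have hT : laxT q z f = laxT q κ f + (z - κ) • weightOp G f := by
    simp only [laxT, sub_apply, add_apply, smul_apply]
    module
  have him : (inner ℂ f (laxT q κ f)).im = 0 := by
    have h2 : conj (inner ℂ f (laxT q κ f)) = inner ℂ f (laxT q κ f) := by
      rw [inner_conj_symm]
      simp only [laxT, sub_apply, add_apply, smul_apply, one_apply_eq_self, inner_sub_left,
        inner_sub_right, inner_add_left, inner_add_right, inner_smul_left, inner_smul_right,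
        weightOp_symmetric, potOp_symmetric hq, map_sub, Complex.conj_ofReal, map_one]
    exact Complex.conj_eq_iff_im.1 h2
  have h3 : inner ℂ f (laxT q z f) = inner ℂ f (laxT q κ f) + (z - κ) * d := by
    rw [hT, inner_add_right, inner_smul_right, hd]
  have hre : (inner ℂ f (laxT q z f)).re = (inner ℂ f (laxT q κ f)).re + (z.re - κ) * d := by
    rw [h3]; simp
  have him' : (inner ℂ f (laxT q z f)).im = z.im * d := by
    rw [h3]; simp [him]
  set N := ‖inner ℂ f (laxT q z f)‖
  have hN1 : (inner ℂ f (laxT q z f)).re ≤ N := Complex.re_le_norm _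
  have hN2 : |(inner ℂ f (laxT q z f)).im| ≤ N := Complex.abs_im_le_norm _
  rw [him', abs_mul, abs_of_nonneg hd0] at hN2
  have hzim : 0 < |z.im| := abs_pos.2 hz
  have h4 : d ≤ N / |z.im| := by rw [le_div_iff₀ hzim]; linarith
  have h5 : (κ - z.re) * d ≤ |κ - z.re| * (N / |z.im|) :=
    mul_le_mul (le_abs_self _) h4 hd0 (abs_nonneg _)
  rw [div_mul_eq_mul_div, div_le_iff₀ hden]
  have h6 : N * (1 + |κ - z.re| / |z.im|) = N + |κ - z.re| * (N / |z.im|) := by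
    field_simp
  rw [h6]
  linarith

theorem finite_real_spectrum {q : Sob G s} (hq : IsReal G q) {c : ℝ} (hc : 0 < c) :
    {z : ℝ | c ≤ z ∧ ¬ IsUnit (laxT q (z : ℂ))}.Finite :=
  (hsBound_potOp q).finite_not_isUnit weightOp_symmetric (potOp_symmetric hq)
    (fun f hf => inner_weightOp_pos f hf) inner_weightOp_le hc

/-- The quadratic part `⟨q₊, (-i∂ + κ)⁻¹ q₊⟩` of `β(κ; q)`. -/
def betaZero (G : Geometry) (κ : ℝ) (q : ℝ → ℂ) : ℝ≥0∞ :=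
  ∫⁻ ξ, ENNReal.ofReal ((|ξ| + κ)⁻¹) * ‖q ξ‖ₑ ^ 2 ∂(posFreq G)

/-- An instance of `resolvent_pairing_comparison`, with A the free operator -i∂ + κ in symmetrized
form and h the free resolvent applied to q₊, whose pairing with q₊ is the quadratic part of β. -/
theorem IsSmall.beta_comparison {κ : ℝ} (hκ : 1 ≤ κ) {q : Sob G s} (h : IsSmall κ q)
    (hq : IsReal G q) :
    ENNReal.ofReal (beta G q κ).re ≤ 2 * betaZero G κ q ∧
      betaZero G κ q ≤ 2 * ENNReal.ofReal (beta G q κ).re := by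
  have hm : IsMultiplier (posFreq G) (posFreq G)
      (fun ξ => (((|ξ| + 1) / (|ξ| + κ) : ℝ) : ℂ)) 1 := by
    refine isMultiplier_hardy (by fun_prop) zero_le_one fun ξ _ => ?_
    rw [Complex.norm_real, Real.norm_of_nonneg (by positivity), div_le_one (by positivity)]
    linarith
  set w := source G s q
  have hAh : (isMultiplier_energy G hκ).clm (hm.clm w) = w := by
    ext1
    filter_upwards [(isMultiplier_energy G hκ).coeFn_clm (hm.clm w), hm.coeFn_clm w] with ξ h1 h2
    rw [h1, h2, ← mul_assoc, ← Complex.ofReal_mul]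
    have := bracket_pos ξ
    have : 0 < |ξ| + κ := by positivity
    rw [div_mul_div_cancel₀ (by positivity), div_self (by positivity), Complex.ofReal_one, one_mul]
  have h0 : betaZero G κ q = ENNReal.ofReal (inner ℂ w (hm.clm w)).re := by
    rw [ofReal_inner_real_multiplier hm fun ξ => by positivity]
    refine lintegral_congr_ae ?_
    filter_upwards [coeFn_source q] with ξ h1
    rw [h1, enorm_mul, mul_pow, enorm_ofReal_sq, rpow_neg_half_sq (bracket_pos ξ), ← mul_assoc,
      ← ENNReal.ofReal_mul (by positivity)]
    congr 2
    have := bracket_pos ξ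
    have : 0 < |ξ| + κ := by positivity
    field_simp
  have hcmp := resolvent_pairing_comparison (A := (isMultiplier_energy G hκ).clm)
    (K := potOp G s q) (f := gaugeH q κ) (h := hm.clm w) (w := w)
    (real_multiplier_symmetric _)
    (fun x => inner_real_multiplier_nonneg _ (fun ξ => by positivity) x)
    (potOp_symmetric hq)
    (fun x y => by
      have := h.norm_inner_le hκ y x
      rw [energy, energy, ← energy_clm_eq G hκ] at this
      exact this)
    (by rw [energy_clm_eq G hκ]; exact laxT_gaugeH (h.isUnit_laxT hκ)) hAh
  rw [h0, beta_eq]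
  have key : ∀ x y : ℝ, x ≤ 2 * y → ENNReal.ofReal x ≤ 2 * ENNReal.ofReal y := by
    intro x y hxy
    refine (ENNReal.ofReal_le_ofReal hxy).trans (le_of_eq ?_)
    rw [ENNReal.ofReal_mul (by norm_num), ENNReal.ofReal_ofNat]
  exact ⟨key _ _ hcmp.1, key _ _ hcmp.2⟩

/-! ### Continuity of `β` -/

theorem continuous_laxT : Continuous fun p : Sob G s × ℂ => laxT p.1 p.2 := by
  unfold laxT
  fun_prop

theorem continuousAt_gaugeH {q : Sob G s} {z : ℂ} (h : IsUnit (laxT q z)) :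
    ContinuousAt (fun p : Sob G s × ℂ => gaugeH p.1 p.2) (q, z) := by
  unfold gaugeH
  obtain ⟨u, hu⟩ := h
  have h1 : ContinuousAt Ring.inverse (laxT q z) := by
    rw [← hu]; exact NormedRing.inverse_continuousAt u
  have h2 : ContinuousAt (fun p : Sob G s × ℂ => Ring.inverse (laxT p.1 p.2)) (q, z) :=
    ContinuousAt.comp (f := fun p : Sob G s × ℂ => laxT p.1 p.2) (x := (q, z)) h1
      continuous_laxT.continuousAt
  exact h2.clm_apply (by fun_prop)

theorem continuousAt_beta {q : Sob G s} {z : ℂ} (h : IsUnit (laxT q z)) :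
    ContinuousAt (fun w : ℂ => beta G q w) z := by
  simp_rw [beta_eq]
  have h1 : ContinuousAt (fun w : ℂ => gaugeH q w) z :=
    ContinuousAt.comp (f := fun w : ℂ => (q, w)) (x := z) (continuousAt_gaugeH h)
      (by fun_prop)
  exact continuousAt_const.inner h1

theorem isOpen_rightHalfPlane : IsOpen {z : ℂ | 0 < z.re} :=
  isOpen_lt continuous_const Complex.continuous_re

/-- Equality holds on a punctured neighbourhood of z, and both functions are continuous at a regular
point. -/
theorem SameBeta.eq_of_isUnit {q₁ q₂ : Sob G s} (h : SameBeta G q₁ q₂) {z : ℂ} (hz : 0 < z.re)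
    (h1 : IsUnit (laxT q₁ z)) (h2 : IsUnit (laxT q₂ z)) : beta G q₁ z = beta G q₂ z := by
  have h3 := mem_codiscreteWithin.1 h z hz
  rw [disjoint_principal_right] at h3
  have h4 : ∀ᶠ w in 𝓝[≠] z, beta G q₁ w = beta G q₂ w := by
    filter_upwards [h3, mem_nhdsWithin_of_mem_nhds (isOpen_rightHalfPlane.mem_nhds hz)]
      with w hw hw'
    by_contra hc
    exact hw ⟨hw', hc⟩
  exact tendsto_nhds_unique_of_eventuallyEq
    ((continuousAt_beta h1).tendsto.mono_left nhdsWithin_le_nhds)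
    ((continuousAt_beta h2).tendsto.mono_left nhdsWithin_le_nhds) h4

/-- Only finitely many real points near x are spectral, and these are discarded. At every other real
point both functions are continuous, so the identity follows by approach from the upper half-plane.
-/
theorem sameBeta_of_nonreal {q₁ q₂ : Sob G s} (hq₁ : IsReal G q₁) (hq₂ : IsReal G q₂)
    (h : ∀ z : ℂ, z.im ≠ 0 → 0 < z.re → beta G q₁ z = beta G q₂ z) : SameBeta G q₁ q₂ := by
  refine mem_codiscreteWithin.2 fun x hx => ?_
  rw [disjoint_principal_right]
  have hx0 : 0 < x.re / 2 := half_pos hx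
  -- Finiteness of the real spectrum is known only away from zero, hence the restriction to
  -- abscissas of at least Re x / 2.
  let F : Set ℂ := (fun r : ℝ => (r : ℂ)) ''
    ({z : ℝ | x.re / 2 ≤ z ∧ ¬ IsUnit (laxT q₁ (z : ℂ))} ∪
      {z : ℝ | x.re / 2 ≤ z ∧ ¬ IsUnit (laxT q₂ (z : ℂ))})
  have hF : F.Finite := ((finite_real_spectrum hq₁ hx0).union (finite_real_spectrum hq₂ hx0)).image _
  have h1 : ∀ᶠ y in 𝓝[≠] x, y ∉ F := by
    have h2 : ∀ᶠ y in 𝓝 x, y ∉ F \ {x} :=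
      (hF.subset Set.sdiff_subset).isClosed.isOpen_compl.mem_nhds (by simp)
    filter_upwards [mem_nhdsWithin_of_mem_nhds h2, self_mem_nhdsWithin] with y hy hyx hyF
    exact hy ⟨hyF, hyx⟩
  have h2 : ∀ᶠ y in 𝓝[≠] x, x.re / 2 < y.re := by
    refine mem_nhdsWithin_of_mem_nhds ?_
    exact (isOpen_lt continuous_const Complex.continuous_re).mem_nhds (by
      change x.re / 2 < x.re
      linarith)
  filter_upwards [h1, h2] with y hyF hyre hy
  refine hy.2 ?_
  change beta G q₁ y = beta G q₂ y
  by_cases him : y.im ≠ 0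
  · exact h y him (by linarith)
  · rw [not_not] at him
    have hyr : y = (y.re : ℂ) := Complex.ext rfl (by simp [him])
    have hu : ∀ q : Sob G s, q = q₁ ∨ q = q₂ → IsUnit (laxT q y) := by
      intro q hq
      by_contra hn
      refine hyF ⟨y.re, ?_, hyr.symm⟩
      rw [hyr] at hn
      rcases hq with rfl | rfl
      · exact Or.inl ⟨hyre.le, hn⟩
      · exact Or.inr ⟨hyre.le, hn⟩
    have ht : Tendsto (fun n : ℕ => y + Complex.I * ((1 / ((n : ℝ) + 1) : ℝ) : ℂ)) atTop (𝓝 y) := by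
      have h3 : Tendsto (fun n : ℕ => ((1 / ((n : ℝ) + 1) : ℝ) : ℂ)) atTop (𝓝 ((0 : ℝ) : ℂ)) :=
        (Complex.continuous_ofReal.tendsto 0).comp tendsto_one_div_add_atTop_nhds_zero_nat
      have h4 := (h3.const_mul Complex.I).const_add y
      simpa using h4
    refine tendsto_nhds_unique ((continuousAt_beta (hu q₁ (Or.inl rfl))).tendsto.comp ht)
      (((continuousAt_beta (hu q₂ (Or.inr rfl))).tendsto.comp ht).congr fun n => ?_)
    simp only [Function.comp]
    refine (h _ ?_ ?_).symm
    · have : (0 : ℝ) < 1 / ((n : ℝ) + 1) := by positivity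
      rw [Complex.add_im, him, Complex.mul_im, Complex.ofReal_re, Complex.ofReal_im]
      simp only [Complex.I_re, Complex.I_im]
      linarith
    · rw [Complex.add_re, Complex.mul_re, Complex.ofReal_re, Complex.ofReal_im]
      simp only [Complex.I_re, Complex.I_im]
      linarith

/-! ### A priori bounds along curves of constant `β` -/

theorem lintegral_Ioi_rpow {a L : ℝ} (ha : a < -1) (hL : 0 < L) :
    ∫⁻ κ in Set.Ioi L, ENNReal.ofReal (κ ^ a) = ENNReal.ofReal (-L ^ (a + 1) / (a + 1)) := by
  rw [← integral_Ioi_rpow_of_lt ha hL,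
    ofReal_integral_eq_lintegral_ofReal (integrableOn_Ioi_rpow_of_lt ha hL)]
  filter_upwards [ae_restrict_mem measurableSet_Ioi] with x hx
  have : (0 : ℝ) < x := hL.trans hx
  positivity

theorem lintegral_Ioc_rpow {a L : ℝ} (ha : -1 < a) (hL : 0 < L) :
    ∫⁻ κ in Set.Ioc 0 L, ENNReal.ofReal (κ ^ a) = ENNReal.ofReal (L ^ (a + 1) / (a + 1)) := by
  have hi : IntervalIntegrable (fun x : ℝ => x ^ a) volume 0 L :=
    intervalIntegral.intervalIntegrable_rpow' ha
  have hv : ∫ x in Set.Ioc 0 L, x ^ a = L ^ (a + 1) / (a + 1) := by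
    rw [← intervalIntegral.integral_of_le hL.le, integral_rpow (Or.inl ha),
      Real.zero_rpow (by linarith), sub_zero]
  rw [← hv, ofReal_integral_eq_lintegral_ofReal ((intervalIntegrable_iff_integrableOn_Ioc_of_le hL.le).1 hi)]
  filter_upwards [ae_restrict_mem measurableSet_Ioc] with x hx
  have : (0 : ℝ) < x := hx.1
  positivity

/-- Only κ > x + K is used: there x + κ ≤ 2κ, and the tail of κ^{2s-1}/2 integrates to (x +
K)^{2s}/(-4s). -/
theorem lintegral_rpow_div_lower {s K x : ℝ} (hs0 : s < 0) (hK : 0 < K) (hx : 0 ≤ x) :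
    ENNReal.ofReal ((x + K) ^ (2 * s)) ≤
      ENNReal.ofReal (-4 * s) * ∫⁻ κ in Set.Ioi K, ENNReal.ofReal (κ ^ (2 * s) * (x + κ)⁻¹) := by
  have hL : 0 < x + K := by linarith
  have h1 : ∫⁻ κ in Set.Ioi (x + K), ENNReal.ofReal (1 / 2) * ENNReal.ofReal (κ ^ (2 * s - 1)) ≤
      ∫⁻ κ in Set.Ioi K, ENNReal.ofReal (κ ^ (2 * s) * (x + κ)⁻¹) := by
    refine le_trans (setLIntegral_mono' measurableSet_Ioi fun κ hκ => ?_)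
      (lintegral_mono_set (Set.Ioi_subset_Ioi (by linarith)))
    have hκ' : x + K < κ := hκ
    have hκ0 : 0 < κ := by linarith
    rw [← ENNReal.ofReal_mul (by norm_num)]
    refine ENNReal.ofReal_le_ofReal ?_
    rw [Real.rpow_sub_one hκ0.ne', mul_div_assoc', div_eq_mul_inv, mul_comm (1 / 2 : ℝ), mul_assoc]
    gcongr
    rw [← div_eq_mul_inv, div_div, one_div]
    exact inv_anti₀ (by linarith) (by linarith)
  rw [lintegral_const_mul' _ _ ENNReal.ofReal_ne_top, lintegral_Ioi_rpow (by linarith) hL,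
    ← ENNReal.ofReal_mul (by norm_num)] at h1
  refine le_trans (le_of_eq ?_) (mul_le_mul_right h1 _)
  rw [← ENNReal.ofReal_mul (by linarith)]
  congr 1
  rw [show 2 * s - 1 + 1 = 2 * s by ring]
  have := hs0.ne
  field_simp
  norm_num

/-- Split at κ = x + K. Below, (x + κ)⁻¹ ≤ (x + K)⁻¹ and κ^{2s} is integrable at zero because 2s >
-1; above, (x + κ)⁻¹ ≤ κ⁻¹. -/
theorem lintegral_rpow_div_upper {s K x : ℝ} (hs : -(1 / 2) < s) (hs0 : s < 0) (hK : 0 < K)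
    (hx : 0 ≤ x) :
    ∫⁻ κ in Set.Ioi K, ENNReal.ofReal (κ ^ (2 * s) * (x + κ)⁻¹) ≤
      ENNReal.ofReal (1 / (2 * s + 1) - 1 / (2 * s)) * ENNReal.ofReal ((x + K) ^ (2 * s)) := by
  have hL : 0 < x + K := by linarith
  have h1 : ∫⁻ κ in Set.Ioc K (x + K), ENNReal.ofReal (κ ^ (2 * s) * (x + κ)⁻¹) ≤
      ENNReal.ofReal (1 / (2 * s + 1)) * ENNReal.ofReal ((x + K) ^ (2 * s)) := by
    calc _ ≤ ∫⁻ κ in Set.Ioc K (x + K),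
          ENNReal.ofReal ((x + K)⁻¹) * ENNReal.ofReal (κ ^ (2 * s)) := by
          refine setLIntegral_mono' measurableSet_Ioc fun κ hκ => ?_
          have h2 : K < κ := hκ.1
          rw [← ENNReal.ofReal_mul (by positivity)]
          refine ENNReal.ofReal_le_ofReal ?_
          have : 0 < κ := by linarith
          rw [mul_comm]
          gcongr
      _ ≤ ENNReal.ofReal ((x + K)⁻¹) * ∫⁻ κ in Set.Ioc 0 (x + K), ENNReal.ofReal (κ ^ (2 * s)) := by
          rw [lintegral_const_mul' _ _ ENNReal.ofReal_ne_top]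
          gcongr
      _ = _ := by
          rw [lintegral_Ioc_rpow (by linarith) hL, ← ENNReal.ofReal_mul (by positivity),
            ← ENNReal.ofReal_mul (by
              have : 0 < 2 * s + 1 := by linarith
              positivity)]
          congr 1
          rw [Real.rpow_add hL, Real.rpow_one]
          field_simp
  have h2 : ∫⁻ κ in Set.Ioi (x + K), ENNReal.ofReal (κ ^ (2 * s) * (x + κ)⁻¹) ≤
      ENNReal.ofReal (-1 / (2 * s)) * ENNReal.ofReal ((x + K) ^ (2 * s)) := by
    calc _ ≤ ∫⁻ κ in Set.Ioi (x + K), ENNReal.ofReal (κ ^ (2 * s - 1)) := by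
          refine setLIntegral_mono' measurableSet_Ioi fun κ hκ => ?_
          have h2 : x + K < κ := hκ
          have h0 : 0 < κ := by linarith
          refine ENNReal.ofReal_le_ofReal ?_
          rw [Real.rpow_sub_one h0.ne', div_eq_mul_inv]
          gcongr
          linarith
      _ = _ := by
          have h3 : 0 ≤ -1 / (2 * s) := div_nonneg_of_nonpos (by norm_num) (by linarith)
          rw [lintegral_Ioi_rpow (by linarith) hL, ← ENNReal.ofReal_mul h3]
          congr 1
          rw [show 2 * s - 1 + 1 = 2 * s by ring]
          ring
  rw [← Set.Ioc_union_Ioi_eq_Ioi (show K ≤ x + K by linarith)]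
  refine (lintegral_union_le _ _ _).trans ((add_le_add h1 h2).trans (le_of_eq ?_))
  have h3 : 0 ≤ -1 / (2 * s) := div_nonneg_of_nonpos (by norm_num) (by linarith)
  have h4 : 0 ≤ 1 / (2 * s + 1) := by
    have : 0 < 2 * s + 1 := by linarith
    positivity
  rw [← add_mul, ← ENNReal.ofReal_add h4 h3]
  congr 2
  ring

/-- For real q the modulus of the Fourier transform is even. The zero mode may be counted twice,
hence an inequality. -/
theorem normK_le_two_mul {G : Geometry} {s K : ℝ} {q : ℝ → ℂ} (hq : IsReal G q)
    (hm : AEStronglyMeasurable q (freq G)) :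
    normK G s K q ≤
      2 * ∫⁻ ξ, ENNReal.ofReal ((|ξ| + K) ^ (2 * s)) * ‖q ξ‖ₑ ^ 2 ∂(posFreq G) := by
  set F : ℝ → ℝ≥0∞ := fun ξ => ENNReal.ofReal ((|ξ| + K) ^ (2 * s)) * ‖q ξ‖ₑ ^ 2 with hF
  have hFm : AEMeasurable F (freq G) := by
    have : Measurable fun ξ : ℝ => ENNReal.ofReal ((|ξ| + K) ^ (2 * s)) := by fun_prop
    exact this.aemeasurable.mul (hm.enorm.pow_const 2)
  have hneg : ∫⁻ ξ in Set.Iic 0, F ξ ∂(freq G) = ∫⁻ ξ in Set.Ici 0, F ξ ∂(freq G) := by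
    rw [← lintegral_indicator measurableSet_Iic, ← lintegral_indicator measurableSet_Ici,
      ← lintegral_comp_measurePreserving (measurePreserving_neg_freq G)
        (hFm.indicator measurableSet_Iic)]
    refine lintegral_congr_ae ?_
    filter_upwards [hq] with ξ hξ
    simp only [Set.indicator, Set.mem_Iic, Set.mem_Ici, hF, abs_neg, hξ, RCLike.enorm_conj,
      neg_nonpos]
  have hu : (Set.univ : Set ℝ) = Set.Ici 0 ∪ Set.Iic 0 := by ext x; simp
  change ∫⁻ ξ, F ξ ∂(freq G) ≤ 2 * ∫⁻ ξ in Set.Ici 0, F ξ ∂(freq G)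
  rw [← setLIntegral_univ, hu]
  refine (lintegral_union_le _ _ _).trans (le_of_eq ?_)
  rw [hneg, ← two_mul]

theorem lintegral_betaZero {G : Geometry} {s K : ℝ} {q : ℝ → ℂ} (hK : 0 < K)
    (hm : AEStronglyMeasurable q (freq G)) :
    ∫⁻ κ in Set.Ioi K, ENNReal.ofReal (κ ^ (2 * s)) * betaZero G κ q =
      ∫⁻ ξ, (∫⁻ κ in Set.Ioi K, ENNReal.ofReal (κ ^ (2 * s) * (|ξ| + κ)⁻¹)) * ‖q ξ‖ₑ ^ 2
        ∂(posFreq G) := by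
  have hmp : AEStronglyMeasurable q (posFreq G) := hm.restrict
  have h1 : ∀ κ, ENNReal.ofReal (κ ^ (2 * s)) * betaZero G κ q =
      ∫⁻ ξ, ENNReal.ofReal (κ ^ (2 * s)) * (ENNReal.ofReal ((|ξ| + κ)⁻¹) * ‖q ξ‖ₑ ^ 2)
        ∂(posFreq G) := fun κ => by
    rw [betaZero, lintegral_const_mul' _ _ ENNReal.ofReal_ne_top]
  simp_rw [h1]
  rw [lintegral_lintegral_swap]
  · refine lintegral_congr fun ξ => ?_
    rw [← lintegral_mul_const' _ _ (by simp)]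
    refine setLIntegral_congr_fun measurableSet_Ioi fun κ hκ => ?_
    have : 0 < κ := hK.trans hκ
    rw [← mul_assoc, ← ENNReal.ofReal_mul (by positivity)]
  · have h2 : Measurable fun p : ℝ × ℝ => ENNReal.ofReal (p.1 ^ (2 * s)) := by fun_prop
    have h3 : Measurable fun p : ℝ × ℝ => ENNReal.ofReal ((|p.2| + p.1)⁻¹) := by fun_prop
    exact h2.aemeasurable.mul (h3.aemeasurable.mul (hmp.enorm.pow_const 2).comp_snd)

/-! ### Comparison of weighted norms and the continuity argument on an orbit. -/

section Orbit

variable {G : Geometry} {s : ℝ} [hs : Fact (-(1 / 2) < s ∧ s < 0)]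

variable (s) in
/-- The constant in the comparison of `H^s` norms of potentials with the same `β`. -/
def cmpConst : ℝ := 1 + 8 * (-4 * s) * (1 / (2 * s + 1) - 1 / (2 * s))

theorem one_le_cmpConst : 1 ≤ cmpConst s := by
  have h1 := hs.out.1
  have h2 := hs.out.2
  have h3 : 0 ≤ 1 / (2 * s + 1) := by
    have : 0 < 2 * s + 1 := by linarith
    positivity
  have h4 : 1 / (2 * s) ≤ 0 := div_nonpos_of_nonneg_of_nonpos (by norm_num) (by linarith)
  have h5 : 0 ≤ -4 * s := by linarith
  have : 0 ≤ 8 * (-4 * s) * (1 / (2 * s + 1) - 1 / (2 * s)) :=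
    mul_nonneg (by linarith) (by linarith)
  unfold cmpConst
  linarith

/-- By Tonelli, the integral of κ^{2s} `betaZero` over κ > K is equivalent to the
nonnegative-frequency half of `normK` at K. The 8 in `cmpConst` is 2 from reality times 4 from the
hypothesis. -/
theorem normK_le_of_betaZero_le {K : ℝ} (hK : 0 < K) {q p : Sob G s} (hq : IsReal G q)
    (h : ∀ κ, K < κ → betaZero G κ q ≤ 4 * betaZero G κ p) :
    normK G s K q ≤ ENNReal.ofReal (cmpConst s) * normK G s K p := by
  have h1 := hs.out.1
  have h2 := hs.out.2
  have hc : 0 ≤ 1 / (2 * s + 1) - 1 / (2 * s) := by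
    have h3 : 0 ≤ 1 / (2 * s + 1) := by
      have : 0 < 2 * s + 1 := by linarith
      positivity
    have h4 : 1 / (2 * s) ≤ 0 := div_nonpos_of_nonneg_of_nonpos (by norm_num) (by linarith)
    linarith
  calc normK G s K q ≤
        2 * ∫⁻ ξ, ENNReal.ofReal ((|ξ| + K) ^ (2 * s)) * ‖q ξ‖ₑ ^ 2 ∂(posFreq G) :=
        normK_le_two_mul hq q.aestronglyMeasurable
    _ ≤ 2 * ∫⁻ ξ, ENNReal.ofReal (-4 * s) *
          ((∫⁻ κ in Set.Ioi K, ENNReal.ofReal (κ ^ (2 * s) * (|ξ| + κ)⁻¹)) * ‖q ξ‖ₑ ^ 2)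
          ∂(posFreq G) := by
        refine mul_le_mul_right (lintegral_mono fun ξ => ?_) _
        rw [← mul_assoc]
        exact mul_le_mul_left (lintegral_rpow_div_lower h2 hK (abs_nonneg ξ)) _
    _ = 2 * (ENNReal.ofReal (-4 * s) *
          ∫⁻ κ in Set.Ioi K, ENNReal.ofReal (κ ^ (2 * s)) * betaZero G κ q) := by
        rw [lintegral_const_mul' _ _ ENNReal.ofReal_ne_top,
          lintegral_betaZero hK q.aestronglyMeasurable]
    _ ≤ 2 * (ENNReal.ofReal (-4 * s) *
          ∫⁻ κ in Set.Ioi K, 4 * (ENNReal.ofReal (κ ^ (2 * s)) * betaZero G κ p)) := by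
        gcongr 2 * (_ * ?_)
        refine setLIntegral_mono' measurableSet_Ioi fun κ hκ => ?_
        rw [mul_left_comm]
        gcongr
        exact h κ hκ
    _ = 8 * ENNReal.ofReal (-4 * s) * ∫⁻ ξ,
          (∫⁻ κ in Set.Ioi K, ENNReal.ofReal (κ ^ (2 * s) * (|ξ| + κ)⁻¹)) * ‖p ξ‖ₑ ^ 2
          ∂(posFreq G) := by
        rw [lintegral_const_mul' _ _ (by simp), lintegral_betaZero hK p.aestronglyMeasurable]
        ring
    _ ≤ 8 * ENNReal.ofReal (-4 * s) * ∫⁻ ξ,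
          ENNReal.ofReal (1 / (2 * s + 1) - 1 / (2 * s)) *
            (ENNReal.ofReal ((|ξ| + K) ^ (2 * s)) * ‖p ξ‖ₑ ^ 2) ∂(posFreq G) := by
        refine mul_le_mul_right (lintegral_mono fun ξ => ?_) _
        rw [← mul_assoc]
        exact mul_le_mul_left (lintegral_rpow_div_upper h1 h2 hK (abs_nonneg ξ)) _
    _ ≤ 8 * ENNReal.ofReal (-4 * s) *
          (ENNReal.ofReal (1 / (2 * s + 1) - 1 / (2 * s)) * normK G s K p) := by
        rw [lintegral_const_mul' _ _ ENNReal.ofReal_ne_top]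
        gcongr
        exact setLIntegral_le_lintegral _ _
    _ = ENNReal.ofReal (8 * (-4 * s) * (1 / (2 * s + 1) - 1 / (2 * s))) * normK G s K p := by
        rw [ENNReal.ofReal_mul (show (0 : ℝ) ≤ 8 * (-4 * s) by linarith),
          ENNReal.ofReal_mul (show (0 : ℝ) ≤ 8 by norm_num), ENNReal.ofReal_ofNat]
        ring
    _ ≤ _ := by
        gcongr
        unfold cmpConst
        linarith

/-- The conserved value β(κ) mediates: each of the two comparisons with the quadratic part costs a
factor two. -/
theorem betaZero_le_of_sameBeta {κ : ℝ} (hκ : 1 ≤ κ) {q p : Sob G s} (hq : IsReal G q)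
    (hp : IsReal G p) (hqs : IsSmall κ q) (hps : IsSmall κ p) (h : SameBeta G q p) :
    betaZero G κ q ≤ 4 * betaZero G κ p := by
  have h1 := h.eq_of_isUnit (z := (κ : ℂ)) (by rw [Complex.ofReal_re]; linarith)
    (hqs.isUnit_laxT hκ) (hps.isUnit_laxT hκ)
  calc _ ≤ 2 * ENNReal.ofReal (beta G q κ).re := (hqs.beta_comparison hκ hq).2
    _ ≤ 2 * (2 * betaZero G κ p) := by
        rw [h1]; gcongr; exact (hps.beta_comparison hκ hp).1
    _ = _ := by ring

theorem normK_le_of_sameBeta {κ K : ℝ} (hκ : 1 ≤ κ) (hK : κ ≤ K) {q p : Sob G s} (hq : IsReal G q)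
    (hp : IsReal G p) (hqs : IsSmall κ q) (hps : IsSmall κ p) (h : SameBeta G q p) :
    normK G s K q ≤ ENNReal.ofReal (cmpConst s) * normK G s K p := by
  refine normK_le_of_betaZero_le (by linarith) hq fun κ' hκ' => ?_
  have h0 : 0 < κ := by linarith
  exact betaZero_le_of_sameBeta (by linarith) hq hp (hqs.mono h0 (by linarith))
    (hps.mono h0 (by linarith)) h

omit hs in
theorem normK_ne_top {κ : ℝ} (hκ : 1 ≤ κ) (hs : s ≤ 0) (q : Sob G s) : normK G s κ q ≠ ∞ :=
  ((normK_le_norm hκ hs q).trans_lt ENNReal.ofReal_lt_top).ne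

omit hs in
-- The quantity is the squared norm of the image of q under a bounded inclusion of H^s into the L²
-- space with weight (|ξ| + κ)^{2s}.
theorem continuous_normK_toReal {κ : ℝ} (hκ : 1 ≤ κ) (hs : s ≤ 0) :
    Continuous fun q : Sob G s => (normK G s κ q).toReal := by
  have hm : IsMultiplier (sobMeasure G s)
      ((freq G).withDensity fun ξ => ENNReal.ofReal ((|ξ| + κ) ^ (2 * s))) (fun _ => 1) 1 := by
    refine isMultiplier_withDensity (by fun_prop) (by fun_prop)
      (fun ξ => by have := bracket_pos ξ; positivity) measurable_const zero_le_one fun ξ => ?_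
    have := bracket_pos ξ
    simp only [norm_one, one_pow, one_mul]
    exact Real.rpow_le_rpow_of_nonpos this (by linarith) (by linarith)
  have h1 : ∀ q : Sob G s, (normK G s κ q).toReal = ‖hm.clm q‖ ^ 2 := by
    intro q
    have h2 : normK G s κ q = ‖hm.clm q‖ₑ ^ 2 := by
      rw [Lp_enorm_sq, lintegral_withDensity_eq_lintegral_mul_non_measurable _ (by fun_prop)
        (Eventually.of_forall fun _ => ENNReal.ofReal_lt_top)]
      refine lintegral_congr_ae ?_
      have h3 := hm.coeFn_clm q
      have hac : freq G ≪ (freq G).withDensity fun ξ => ENNReal.ofReal ((|ξ| + κ) ^ (2 * s)) := by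
        refine withDensity_absolutelyContinuous' (by fun_prop) (Eventually.of_forall fun ξ => ?_)
        have : 0 < |ξ| + κ := by positivity
        simp only [ne_eq, ENNReal.ofReal_eq_zero, not_le]
        positivity
      filter_upwards [hac.ae_le h3] with ξ hξ
      rw [Pi.mul_apply, hξ, one_mul]
    rw [h2, ENNReal.toReal_pow, toReal_enorm]
  simp_rw [h1]
  fun_prop

/-- A continuity argument. Let `thr` be the level of `normK` below which smallness holds. At a time
where the curve is still small, constancy of β gives `normK` ≤ `cmpConst` times its initial value,
which is at most `thr / 2`. The continuous function `normK` thus cannot cross the gap up to `thr`.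
-/
theorem isSmall_along_curve {κ : ℝ} (hκ : 1 ≤ κ) {a b : ℝ} {q : ℝ → Sob G s}
    (hc : ContinuousOn q (Set.Icc a b)) (hr : ∀ t ∈ Set.Icc a b, IsReal G (q t))
    (hβ : ∀ t ∈ Set.Icc a b, SameBeta G (q t) (q a))
    (h0 : 8 * hsConst G s * cmpConst s * ‖q a‖ ^ 2 ≤ κ ^ (1 + 2 * s)) :
    ∀ t ∈ Set.Icc a b, IsSmall κ (q t) := by
  have hκ0 : 0 < κ := by linarith
  have hh := hsConst_pos G s
  have hcm : 1 ≤ cmpConst s := one_le_cmpConst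
  have hs2 := hs.out.2.le
  set thr := κ ^ (1 + 2 * s) / (4 * hsConst G s) with hthr
  have hthr0 : 0 < thr := by positivity
  set n : ℝ → ℝ := fun t => (normK G s κ (q t)).toReal with hn
  have hnc : ContinuousOn n (Set.Icc a b) :=
    (continuous_normK_toReal hκ hs2).comp_continuousOn hc
  have hsm : ∀ t, n t ≤ thr → IsSmall κ (q t) := by
    intro t ht
    refine isSmall_of_normK_le (N := thr) hκ0 ?_ (le_of_eq ?_)
    · rw [← ENNReal.ofReal_toReal (normK_ne_top hκ hs2 (q t))]
      exact ENNReal.ofReal_le_ofReal ht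
    · rw [hthr]; field_simp
  have hna : cmpConst s * n a ≤ thr / 2 := by
    have h1 : n a ≤ ‖q a‖ ^ 2 := by
      refine ENNReal.toReal_le_of_le_ofReal (by positivity) ?_
      exact normK_le_norm hκ hs2 (q a)
    have h2 : cmpConst s * ‖q a‖ ^ 2 ≤ thr / 2 := by
      rw [hthr, div_div, le_div_iff₀ (by positivity)]
      linarith
    have h3 : cmpConst s * n a ≤ cmpConst s * ‖q a‖ ^ 2 := by gcongr
    linarith
  have hn0 : ∀ t, 0 ≤ n t := fun t => ENNReal.toReal_nonneg
  have hna' : n a ≤ thr / 2 := by nlinarith [hn0 a]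
  intro t ht
  refine hsm t (not_lt.1 fun hlt => ?_)
  have hat : a ≤ t := ht.1
  have hsub : Set.Icc a t ⊆ Set.Icc a b := Set.Icc_subset_Icc_right ht.2
  -- At level 3/4 the curve is still small, yet above the half that conservation of β permits.
  obtain ⟨t', ht', hnt'⟩ := intermediate_value_Icc hat (hnc.mono hsub)
    (show 3 / 4 * thr ∈ Set.Icc (n a) (n t) from ⟨by linarith, by linarith⟩)
  have haI : a ∈ Set.Icc a b := ⟨le_rfl, hat.trans ht.2⟩
  have h1 := normK_le_of_sameBeta hκ le_rfl (hr t' (hsub ht')) (hr a haI)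
    (hsm t' (by linarith)) (hsm a (by linarith)) (hβ t' (hsub ht'))
  have h2 : n t' ≤ cmpConst s * n a := by
    have h3 := ENNReal.toReal_mono (ENNReal.mul_ne_top ENNReal.ofReal_ne_top
      (normK_ne_top hκ hs2 (q a))) h1
    rwa [ENNReal.toReal_mul, ENNReal.toReal_ofReal (by linarith)] at h3
  linarith

omit hs in
theorem mem_betaOrbit_iff {Q : Set (Sob G s)} {p : Sob G s} :
    p ∈ betaOrbit G Q ↔ ∃ q₀ ∈ Q, p ∈ betaOrbit G {q₀} := by
  constructor
  · rintro ⟨a, b, q, hab, hc, hr, hQ, hβ, hp⟩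
    exact ⟨q a, hQ, a, b, q, hab, hc, hr, rfl, hβ, hp⟩
  · rintro ⟨q₀, hQ, a, b, q, hab, hc, hr, h0, hβ, hp⟩
    refine ⟨a, b, q, hab, hc, hr, ?_, hβ, hp⟩
    rw [Set.mem_singleton_iff.1 h0]
    exact hQ

omit hs in
-- Run the curve backwards. Through this, every upper bound on an orbit yields a lower bound.
theorem betaOrbit_symm {p q₀ : Sob G s} (h : p ∈ betaOrbit G {q₀}) : q₀ ∈ betaOrbit G {p} := by
  obtain ⟨a, b, q, hab, hc, hr, hQ, hβ, rfl⟩ := h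
  have hmap : ∀ t ∈ Set.Icc a b, a + b - t ∈ Set.Icc a b := fun t ht =>
    ⟨by linarith [ht.2], by linarith [ht.1]⟩
  have hbI : b ∈ Set.Icc a b := ⟨hab, le_rfl⟩
  refine ⟨a, b, fun t => q (a + b - t), hab, hc.comp (by fun_prop) hmap,
    fun t ht => hr _ (hmap t ht), ?_, fun t ht => ?_, ?_⟩
  · simp
  · simp only [add_sub_cancel_left]
    exact (hβ _ (hmap t ht)).trans (hβ b hbI).symm
  · simp only [add_sub_cancel_right]
    exact hQ

theorem isSmall_of_mem_betaOrbit {κ : ℝ} (hκ : 1 ≤ κ) {q₀ p : Sob G s} (h : p ∈ betaOrbit G {q₀})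
    (h0 : 8 * hsConst G s * cmpConst s * ‖q₀‖ ^ 2 ≤ κ ^ (1 + 2 * s)) :
    IsSmall κ p ∧ ∀ K, κ ≤ K → normK G s K p ≤ ENNReal.ofReal (cmpConst s) * normK G s K q₀ := by
  obtain ⟨a, b, q, hab, hc, hr, hQ, hβ, rfl⟩ := h
  rw [Set.mem_singleton_iff] at hQ
  rw [← hQ] at h0 ⊢
  have haI : a ∈ Set.Icc a b := ⟨le_rfl, hab⟩
  have hbI : b ∈ Set.Icc a b := ⟨hab, le_rfl⟩
  have hsm := isSmall_along_curve hκ hc hr hβ h0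
  exact ⟨hsm b hbI, fun K hK => normK_le_of_sameBeta hκ hK (hr b hbI) (hr a haI) (hsm b hbI)
    (hsm a haI) (hβ b hbI)⟩

omit hs in
-- Since |ξ| + κ ≤ κ (|ξ| + 1), returning from the weight at κ to the H^s weight costs κ^{-2s}.
theorem enorm_sq_le_normK {κ : ℝ} (hκ : 1 ≤ κ) (hs : s ≤ 0) (q : Sob G s) :
    ‖q‖ₑ ^ 2 ≤ ENNReal.ofReal (κ ^ (-2 * s)) * normK G s κ q := by
  rw [← normK_one, normK, normK, ← lintegral_const_mul' _ _ ENNReal.ofReal_ne_top]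
  refine lintegral_mono fun ξ => ?_
  have hb := bracket_pos ξ
  have hκ0 : 0 < κ := by linarith
  rw [← mul_assoc, ← ENNReal.ofReal_mul (by positivity)]
  gcongr ENNReal.ofReal ?_ * _
  have h1 : |ξ| + κ ≤ κ * (|ξ| + 1) := by nlinarith [abs_nonneg ξ]
  have h2 : (κ * (|ξ| + 1)) ^ (2 * s) ≤ (|ξ| + κ) ^ (2 * s) :=
    Real.rpow_le_rpow_of_nonpos (by positivity) h1 (by linarith)
  rw [Real.mul_rpow hκ0.le hb.le] at h2
  calc (|ξ| + 1) ^ (2 * s) = κ ^ (-2 * s) * (κ ^ (2 * s) * (|ξ| + 1) ^ (2 * s)) := by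
        rw [← mul_assoc, ← Real.rpow_add hκ0, show -2 * s + 2 * s = 0 by ring, Real.rpow_zero,
          one_mul]
    _ ≤ _ := by gcongr

variable (G s) in
/-- The constant in the upper bound for the `H^s` norm. -/
def upperConst : ℝ :=
  (1 + 8 * hsConst G s * cmpConst s) ^ (-s / (1 + 2 * s)) * cmpConst s

theorem one_le_upperConst : 1 ≤ upperConst G s := by
  have h1 := hs.out.1
  have h2 := hs.out.2
  have hh := hsConst_pos G s
  have hcm : 1 ≤ cmpConst s := one_le_cmpConst
  have h3 : 0 ≤ -s / (1 + 2 * s) := div_nonneg (by linarith) (by linarith)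
  have h4 : 1 ≤ 1 + 8 * hsConst G s * cmpConst s := by
    have : 0 ≤ 8 * hsConst G s * cmpConst s := by positivity
    linarith
  exact one_le_mul_of_one_le_of_one_le (Real.one_le_rpow h4 h3) hcm

/-- Choose κ with κ^{1+2s} = D (1 + ‖q₀‖)², large enough for the continuity argument. The loss
κ^{-2s} in the squared norm is then a constant times (1 + ‖q₀‖) to twice the power -2s/(1 + 2s). -/
theorem norm_le_of_mem_betaOrbit {q₀ p : Sob G s} (h : p ∈ betaOrbit G {q₀}) :
    ‖p‖ ≤ upperConst G s * ((1 + ‖q₀‖) ^ (-2 * s / (1 + 2 * s)) * ‖q₀‖) := by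
  have h1 := hs.out.1
  have h2 := hs.out.2
  have hh := hsConst_pos G s
  have hcm : 1 ≤ cmpConst s := one_le_cmpConst
  have hd : 0 < 1 + 2 * s := by linarith
  set D := 1 + 8 * hsConst G s * cmpConst s with hD
  have hD1 : 1 ≤ D := by
    have : 0 ≤ 8 * hsConst G s * cmpConst s := by positivity
    linarith
  have hn := norm_nonneg q₀
  set X := D * (1 + ‖q₀‖) ^ 2 with hX
  have hX1 : 1 ≤ X := by
    have : (1 : ℝ) ≤ (1 + ‖q₀‖) ^ 2 := by nlinarith
    exact one_le_mul_of_one_le_of_one_le hD1 this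
  have hX0 : 0 < X := by linarith
  set κ := X ^ (1 / (1 + 2 * s)) with hκd
  have hκ : 1 ≤ κ := Real.one_le_rpow hX1 (by positivity)
  have hκp : κ ^ (1 + 2 * s) = X := by
    rw [hκd, ← Real.rpow_mul hX0.le, one_div_mul_cancel hd.ne', Real.rpow_one]
  have h0 : 8 * hsConst G s * cmpConst s * ‖q₀‖ ^ 2 ≤ κ ^ (1 + 2 * s) := by
    rw [hκp, hX]
    have h3 : ‖q₀‖ ^ 2 ≤ (1 + ‖q₀‖) ^ 2 := by gcongr; linarith
    calc _ ≤ D * ‖q₀‖ ^ 2 := by gcongr; rw [hD]; linarith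
      _ ≤ _ := by gcongr
  obtain ⟨_, hK⟩ := isSmall_of_mem_betaOrbit hκ h h0
  have h4 : ‖p‖ₑ ^ 2 ≤ ENNReal.ofReal (κ ^ (-2 * s) * (cmpConst s * ‖q₀‖ ^ 2)) := by
    refine (enorm_sq_le_normK hκ h2.le p).trans ?_
    rw [ENNReal.ofReal_mul (by positivity), ENNReal.ofReal_mul (by linarith)]
    gcongr
    exact (hK κ le_rfl).trans (by gcongr; exact normK_le_norm hκ h2.le q₀)
  rw [← ofReal_norm, ← ENNReal.ofReal_pow (norm_nonneg _),
    ENNReal.ofReal_le_ofReal_iff (by positivity)] at h4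
  have h5 : κ ^ (-2 * s) = (D ^ (-s / (1 + 2 * s)) * (1 + ‖q₀‖) ^ (-2 * s / (1 + 2 * s))) ^ 2 := by
    rw [hκd, hX, ← Real.rpow_mul (by positivity), Real.mul_rpow (by linarith) (by positivity),
      mul_pow, ← Real.rpow_natCast (1 + ‖q₀‖) 2, ← Real.rpow_natCast (D ^ _) 2,
      ← Real.rpow_natCast ((1 + ‖q₀‖) ^ (-2 * s / (1 + 2 * s))) 2, ← Real.rpow_mul (by linarith),
      ← Real.rpow_mul (by linarith), ← Real.rpow_mul (by linarith)]
    congr 2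
    · push_cast; ring
    · push_cast; ring
  rw [h5] at h4
  refine (abs_le_of_sq_le_sq' (h4.trans ?_) (by
    have : 0 ≤ upperConst G s := zero_le_one.trans one_le_upperConst
    positivity)).2
  rw [upperConst, ← hD]
  have h6 : cmpConst s ≤ cmpConst s ^ 2 := by nlinarith
  calc _ ≤ (D ^ (-s / (1 + 2 * s)) * (1 + ‖q₀‖) ^ (-2 * s / (1 + 2 * s))) ^ 2 *
        (cmpConst s ^ 2 * ‖q₀‖ ^ 2) := by gcongr
    _ = _ := by ring

/-- The lower bound is the upper bound with the endpoints exchanged, solved for the other norm. With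
x and y the norms of p and q₀, y ≤ C (1 + x)^P x. For x ≤ 1 this is already linear in x. For x ≥ 1
it gives y ≤ C 2^P x^{P+1}, and raising to the power 1 + 2s turns the right side into a multiple of
x, while (1 + y)^{-2|s|} y ≤ y^{1+2s}. -/
theorem twoSidedBound_of_mem_betaOrbit {q₀ p : Sob G s} (h : p ∈ betaOrbit G {q₀}) :
    TwoSidedBound (upperConst G s * 2 ^ (-2 * s / (1 + 2 * s))) q₀ p := by
  have h1 := hs.out.1
  have h2 := hs.out.2
  have hd : 0 < 1 + 2 * s := by linarith
  set P := -2 * s / (1 + 2 * s) with hP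
  have hP0 : 0 ≤ P := div_nonneg (by linarith) hd.le
  set C := upperConst G s
  have hC : 1 ≤ C := one_le_upperConst
  have h2P : 1 ≤ (2 : ℝ) ^ P := Real.one_le_rpow (by norm_num) hP0
  have habs : |s| = -s := abs_of_neg h2
  have hexp : 2 * |s| / (1 - 2 * |s|) = P := by
    rw [habs, hP]; congr 1 <;> ring
  have hup := norm_le_of_mem_betaOrbit h
  have hlo := norm_le_of_mem_betaOrbit (betaOrbit_symm h)
  have hy0 := norm_nonneg q₀
  have hx0 := norm_nonneg p
  constructor
  · rw [habs]
    set y := ‖q₀‖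
    set x := ‖p‖
    have hw : (1 + y) ^ (-2 * -s) ≤ 1 := Real.rpow_le_one_of_one_le_of_nonpos (by linarith) (by linarith)
    rcases le_total x 1 with hx | hx
    · calc (1 + y) ^ (-2 * -s) * y ≤ 1 * y := by gcongr
        _ ≤ C * ((1 + x) ^ P * x) := by rw [one_mul]; exact hlo
        _ ≤ C * (2 ^ P * x) := by gcongr; linarith
        _ = _ := by ring
    · have hlo' : y ≤ C * 2 ^ P * x ^ (P + 1) := by
        have hxp : 0 < x := by linarith
        calc y ≤ C * ((1 + x) ^ P * x) := hlo
          _ ≤ C * ((2 * x) ^ P * x) := by gcongr; linarith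
          _ = _ := by
            rw [Real.mul_rpow (by norm_num) hx0, Real.rpow_add hxp, Real.rpow_one]; ring
      rcases hy0.eq_or_lt with hy | hy
      · rw [← hy, mul_zero]; positivity
      have hCP : 1 ≤ C * 2 ^ P := one_le_mul_of_one_le_of_one_le hC h2P
      calc (1 + y) ^ (-2 * -s) * y ≤ y ^ (-2 * -s) * y := by
            have : (1 + y) ^ (-2 * -s) ≤ y ^ (-2 * -s) :=
              Real.rpow_le_rpow_of_nonpos hy (by linarith) (by linarith)
            gcongr
        _ = y ^ (1 + 2 * s) := by
            rw [← Real.rpow_add_one hy.ne']; congr 1; ring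
        _ ≤ (C * 2 ^ P * x ^ (P + 1)) ^ (1 + 2 * s) := by gcongr
        _ = (C * 2 ^ P) ^ (1 + 2 * s) * x := by
            rw [Real.mul_rpow (by positivity) (by positivity), ← Real.rpow_mul hx0]
            -- Since P = -2s/(1 + 2s), one has P + 1 = 1/(1 + 2s); the exponents of the two bounds
            -- are matched by this identity.
            have : (P + 1) * (1 + 2 * s) = 1 := by rw [hP]; field_simp; ring
            rw [this, Real.rpow_one]
        _ ≤ C * 2 ^ P * x := by
            gcongr
            calc (C * 2 ^ P) ^ (1 + 2 * s) ≤ (C * 2 ^ P) ^ (1 : ℝ) :=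
                  Real.rpow_le_rpow_of_exponent_le hCP (by linarith)
              _ = _ := Real.rpow_one _
  · rw [hexp]
    refine hup.trans ?_
    have hC0 : 0 ≤ C := by linarith
    exact mul_le_mul_of_nonneg_right (le_mul_of_one_le_right hC0 h2P) (by positivity)

end Orbit

/-! ### Equicontinuity and tightness -/

/-- Tightness of a family of potentials in Fourier variables. -/
def IsTight (G : Geometry) {s : ℝ} (Q : Set (Sob G s)) : Prop :=
  ∀ ε : ℝ≥0∞, 0 < ε → ∃ K : ℝ, 1 ≤ K ∧ ∀ q ∈ Q, normK G s K q ≤ ε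

theorem norm_exp_sub_one_sq (θ : ℝ) :
    ‖Complex.exp (Complex.I * θ) - 1‖ ^ 2 = 2 - 2 * Real.cos θ := by
  rw [mul_comm, ← Complex.normSq_eq_norm_sq, Complex.normSq_apply, Complex.sub_re, Complex.sub_im,
    Complex.exp_ofReal_mul_I_re, Complex.exp_ofReal_mul_I_im, Complex.one_re, Complex.one_im]
  linarith [Real.sin_sq_add_cos_sq θ]

theorem enorm_translateBy_sub_sq {G : Geometry} {s : ℝ} (y : ℝ) (q : Sob G s) :
    ‖translateBy y q - q‖ₑ ^ 2 = ∫⁻ ξ, ENNReal.ofReal (2 - 2 * Real.cos (ξ * y)) *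
      (ENNReal.ofReal ((|ξ| + 1) ^ (2 * s)) * ‖q ξ‖ₑ ^ 2) ∂(freq G) := by
  rw [Lp_enorm_sq, lintegral_sobMeasure]
  refine lintegral_congr_ae ?_
  have h1 : translateBy y q =ᵐ[freq G] fun ξ : ℝ => Complex.exp (Complex.I * ξ * y) * q ξ :=
    ae_sobMeasure_iff.1 (memLp_translateBy y q).coeFn_toLp
  have h2 : (translateBy y q - q : Sob G s) =ᵐ[freq G] translateBy y q - q :=
    ae_sobMeasure_iff.1 (Lp.coeFn_sub _ _)
  filter_upwards [h1, h2] with ξ h1 h2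
  rw [h2, Pi.sub_apply, h1, mul_left_comm]
  congr 1
  rw [show Complex.exp (Complex.I * ξ * y) * q ξ - q ξ =
    (Complex.exp (Complex.I * ((ξ * y : ℝ) : ℂ)) - 1) * q ξ by push_cast; ring_nf, enorm_mul,
    mul_pow]
  congr 1
  rw [← norm_exp_sub_one_sq, ← ofReal_norm, ENNReal.ofReal_pow (norm_nonneg _)]

/-- The integral equals 2δ - 2 sin(ξδ)/ξ, and |sin(ξδ)/ξ| ≤ 1/|ξ| ≤ δ/2. -/
theorem le_lintegral_two_sub_cos {δ ξ : ℝ} (hδ : 0 < δ) (hξ : 2 / δ ≤ |ξ|) :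
    ENNReal.ofReal δ ≤ ∫⁻ y in Set.Ioc 0 δ, ENNReal.ofReal (2 - 2 * Real.cos (ξ * y)) := by
  have hξ0 : 0 < |ξ| := lt_of_lt_of_le (by positivity) hξ
  have hξ1 : ξ ≠ 0 := abs_pos.1 hξ0
  have hc : Continuous fun y : ℝ => 2 - 2 * Real.cos (ξ * y) := by fun_prop
  rw [← ofReal_integral_eq_lintegral_ofReal
    ((intervalIntegrable_iff_integrableOn_Ioc_of_le hδ.le).1 (hc.intervalIntegrable 0 δ))
    (Eventually.of_forall fun y => by
      have := Real.cos_le_one (ξ * y)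
      simp only [Pi.zero_apply]; linarith)]
  refine ENNReal.ofReal_le_ofReal ?_
  rw [← intervalIntegral.integral_of_le hδ.le]
  have hd : ∀ y ∈ Set.uIcc 0 δ, HasDerivAt (fun y : ℝ => 2 * y - 2 * (Real.sin (ξ * y) / ξ))
      (2 - 2 * Real.cos (ξ * y)) y := by
    intro y _
    have h1 : HasDerivAt (fun y : ℝ => ξ * y) ξ y := by
      simpa using (hasDerivAt_id y).const_mul ξ
    have h2 := (h1.sin.div_const ξ).const_mul 2
    have h3 := ((hasDerivAt_id y).const_mul 2).sub h2
    refine h3.congr_deriv ?_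
    rw [mul_div_cancel_right₀ _ hξ1, mul_one]
  rw [intervalIntegral.integral_eq_sub_of_hasDerivAt hd (hc.intervalIntegrable 0 δ)]
  have h4 : Real.sin (ξ * δ) / ξ ≤ δ / 2 := by
    refine (le_abs_self _).trans ?_
    rw [abs_div, div_le_iff₀ hξ0]
    have h5 := Real.abs_sin_le_one (ξ * δ)
    have h6 : 2 ≤ |ξ| * δ := by rwa [div_le_iff₀ hδ] at hξ
    linarith
  simp only [mul_zero, Real.sin_zero, zero_div, sub_zero]
  linarith

/-- Averaging the squared translation difference over 0 < y ≤ δ bounds every frequency |ξ| ≥ 2/δ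
from below by the previous lemma. The range 2δ in the hypothesis leaves room for the endpoint y = δ.
-/
theorem tail_le_of_translateBy {G : Geometry} {s δ : ℝ} {ε : ℝ≥0∞} (hδ : 0 < δ) (q : Sob G s)
    (h : ∀ y, |y| < 2 * δ → ‖translateBy y q - q‖ₑ ≤ ε) :
    ∫⁻ ξ in {ξ : ℝ | 2 / δ ≤ |ξ|}, ENNReal.ofReal ((|ξ| + 1) ^ (2 * s)) * ‖q ξ‖ₑ ^ 2 ∂(freq G) ≤
      ε ^ 2 := by
  set F : ℝ → ℝ≥0∞ := fun ξ => ENNReal.ofReal ((|ξ| + 1) ^ (2 * s)) * ‖q ξ‖ₑ ^ 2 with hF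
  have hFm : AEMeasurable F (freq G) := by
    have : Measurable fun ξ : ℝ => ENNReal.ofReal ((|ξ| + 1) ^ (2 * s)) := by fun_prop
    exact this.aemeasurable.mul (q.aestronglyMeasurable.enorm.pow_const 2)
  have hS : MeasurableSet {ξ : ℝ | 2 / δ ≤ |ξ|} := measurableSet_le (by fun_prop) (by fun_prop)
  have h1 : ENNReal.ofReal δ * ∫⁻ ξ in {ξ : ℝ | 2 / δ ≤ |ξ|}, F ξ ∂(freq G) ≤
      ENNReal.ofReal δ * ε ^ 2 := by
    calc _ = ∫⁻ ξ in {ξ : ℝ | 2 / δ ≤ |ξ|}, ENNReal.ofReal δ * F ξ ∂(freq G) := by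
          rw [lintegral_const_mul' _ _ ENNReal.ofReal_ne_top]
      _ ≤ ∫⁻ ξ in {ξ : ℝ | 2 / δ ≤ |ξ|}, (∫⁻ y in Set.Ioc 0 δ,
            ENNReal.ofReal (2 - 2 * Real.cos (ξ * y))) * F ξ ∂(freq G) :=
          setLIntegral_mono_ae' hS (Eventually.of_forall fun ξ hξ =>
            mul_le_mul_left (le_lintegral_two_sub_cos hδ hξ) _)
      _ ≤ ∫⁻ ξ, (∫⁻ y in Set.Ioc 0 δ, ENNReal.ofReal (2 - 2 * Real.cos (ξ * y))) * F ξ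
            ∂(freq G) := setLIntegral_le_lintegral _ _
      _ = ∫⁻ ξ, (∫⁻ y in Set.Ioc 0 δ, ENNReal.ofReal (2 - 2 * Real.cos (ξ * y)) * F ξ)
            ∂(freq G) := by
          refine lintegral_congr fun ξ => ?_
          rw [lintegral_mul_const _ (by fun_prop)]
      _ = ∫⁻ y in Set.Ioc 0 δ, ∫⁻ ξ, ENNReal.ofReal (2 - 2 * Real.cos (ξ * y)) * F ξ
            ∂(freq G) := by
          refine lintegral_lintegral_swap ?_
          have h2 : Measurable fun p : ℝ × ℝ => ENNReal.ofReal (2 - 2 * Real.cos (p.1 * p.2)) := by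
            fun_prop
          exact h2.aemeasurable.mul hFm.comp_fst
      _ ≤ ∫⁻ _ in Set.Ioc 0 δ, ε ^ 2 := by
          refine setLIntegral_mono' measurableSet_Ioc fun y hy => ?_
          rw [← enorm_translateBy_sub_sq]
          have := h y (by rw [abs_of_pos hy.1]; linarith [hy.2])
          gcongr
      _ = _ := by
          rw [setLIntegral_const, Real.volume_Ioc, sub_zero, mul_comm]
  rwa [ENNReal.mul_le_mul_iff_right (by simpa using hδ) ENNReal.ofReal_ne_top] at h1

/-- Frequencies above R are controlled uniformly by translation. Below R the weight (|ξ| + K)^{2s}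
is at most (K/(R + 1))^{2s} times the H^s weight, and this factor tends to zero as K → ∞. -/
theorem IsEquicontinuous.isTight {G : Geometry} {s : ℝ} (hs0 : s < 0) {Q : Set (Sob G s)}
    (h : IsEquicontinuous Q) : IsTight G Q := by
  obtain ⟨hb, ht⟩ := h
  obtain ⟨A, hA0, hA⟩ := hb.exists_pos_norm_le
  intro ε hε
  obtain ⟨ε', hε', hεε⟩ : ∃ ε' : ℝ≥0∞, 0 < ε' ∧ ε' ^ 2 ≤ ε / 2 := by
    have hc : Tendsto (fun x : ℝ≥0∞ => x ^ 2) (𝓝[>] 0) (𝓝 0) := by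
      have : Continuous fun x : ℝ≥0∞ => x ^ 2 := by fun_prop
      have h0 := this.tendsto 0
      simp only [ne_eq, OfNat.ofNat_ne_zero, not_false_eq_true, zero_pow] at h0
      exact h0.mono_left nhdsWithin_le_nhds
    have h2 := hc.eventually_le_const (show (0 : ℝ≥0∞) < ε / 2 from ENNReal.half_pos hε.ne')
    obtain ⟨x, hx, hx0⟩ := (h2.and self_mem_nhdsWithin).exists
    exact ⟨x, hx0, hx⟩
  obtain ⟨δ, hδ, hδ0⟩ := ((ht.eventually_le_const hε').and self_mem_nhdsWithin).exists
  have hδ0 : 0 < δ := hδ0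
  -- The tail estimate is applied with δ/2, so that only translations with |y| < δ occur.
  set R := 2 / (δ / 2) with hR
  have hR0 : 0 < R := by positivity
  have htail : ∀ q ∈ Q, ∫⁻ ξ in {ξ : ℝ | R ≤ |ξ|},
      ENNReal.ofReal ((|ξ| + 1) ^ (2 * s)) * ‖q ξ‖ₑ ^ 2 ∂(freq G) ≤ ε / 2 := by
    intro q hq
    refine (tail_le_of_translateBy (ε := ε') (half_pos hδ0) q fun y hy => ?_).trans hεε
    refine le_trans ?_ hδ
    refine le_trans ?_ (le_iSup₂ q hq)
    exact le_iSup₂ (f := fun y (_ : |y| < δ) => ‖translateBy y q - q‖ₑ) y (by linarith)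
  have hlim : Tendsto (fun K : ℝ => ENNReal.ofReal ((K / (R + 1)) ^ (2 * s) * A ^ 2)) atTop
      (𝓝 0) := by
    have h1 : Tendsto (fun K : ℝ => (K / (R + 1)) ^ (2 * s)) atTop (𝓝 0) := by
      have h2 := tendsto_rpow_neg_atTop (show 0 < -(2 * s) by linarith)
      rw [neg_neg] at h2
      exact h2.comp (tendsto_id.atTop_div_const (by positivity))
    have h3 := ENNReal.tendsto_ofReal (h1.mul_const (A ^ 2))
    rwa [zero_mul, ENNReal.ofReal_zero] at h3
  obtain ⟨K, hK, hK1⟩ := ((hlim.eventually_le_const (ENNReal.half_pos hε.ne')).and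
    (eventually_ge_atTop 1)).exists
  have hK0 : 0 < K := by linarith
  refine ⟨K, hK1, fun q hq => ?_⟩
  have hS : MeasurableSet {ξ : ℝ | R ≤ |ξ|} := measurableSet_le (by fun_prop) (by fun_prop)
  rw [normK, ← lintegral_add_compl _ hS, ← ENNReal.add_halves ε]
  refine add_le_add (le_trans (lintegral_mono fun ξ => ?_) (htail q hq)) ?_
  · gcongr ENNReal.ofReal ?_ * _
    exact Real.rpow_le_rpow_of_nonpos (bracket_pos ξ) (by linarith) (by linarith)
  · calc _ ≤ ∫⁻ ξ in {ξ : ℝ | R ≤ |ξ|}ᶜ, ENNReal.ofReal ((K / (R + 1)) ^ (2 * s)) *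
          (ENNReal.ofReal ((|ξ| + 1) ^ (2 * s)) * ‖q ξ‖ₑ ^ 2) ∂(freq G) := by
          refine setLIntegral_mono_ae' hS.compl (Eventually.of_forall fun ξ hξ => ?_)
          have hξ' : |ξ| < R := not_le.1 hξ
          have hb := bracket_pos ξ
          rw [← mul_assoc, ← ENNReal.ofReal_mul (by positivity),
            ← Real.mul_rpow (by positivity) hb.le]
          gcongr ENNReal.ofReal ?_ * _
          refine Real.rpow_le_rpow_of_nonpos (by positivity) ?_ (by linarith)
          rw [div_mul_eq_mul_div, div_le_iff₀ (by positivity)]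
          nlinarith [abs_nonneg ξ]
      _ ≤ ENNReal.ofReal ((K / (R + 1)) ^ (2 * s)) * ‖q‖ₑ ^ 2 := by
          rw [lintegral_const_mul' _ _ ENNReal.ofReal_ne_top, ← normK_one]
          gcongr
          exact setLIntegral_le_lintegral _ _
      _ ≤ ENNReal.ofReal ((K / (R + 1)) ^ (2 * s) * A ^ 2) := by
          rw [ENNReal.ofReal_mul (by positivity), ← ofReal_norm,
            ← ENNReal.ofReal_pow (norm_nonneg _)]
          gcongr
          exact hA q hq
      _ ≤ _ := hK

/-- For |ξ| ≤ K use 1 - cos θ ≤ θ²/2. For |ξ| ≥ K bound the left factor by 4 and use |ξ| + K ≤ 2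
(|ξ| + 1) with 2^{2s} ≥ 1/2, which explains the 8. -/
theorem two_sub_cos_mul_le {s K ξ y : ℝ} (hs : -(1 / 2) < s) (hs0 : s < 0) (hK : 1 ≤ K) :
    (2 - 2 * Real.cos (ξ * y)) * (|ξ| + 1) ^ (2 * s) ≤
      K ^ 2 * y ^ 2 * (|ξ| + 1) ^ (2 * s) + 8 * (|ξ| + K) ^ (2 * s) := by
  have hb := bracket_pos ξ
  have hx := abs_nonneg ξ
  rcases le_total |ξ| K with h | h
  · have h1 : 2 - 2 * Real.cos (ξ * y) ≤ K ^ 2 * y ^ 2 := by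
      have h2 := Real.one_sub_sq_div_two_le_cos (x := ξ * y)
      have h3 : ξ ^ 2 ≤ K ^ 2 := by rw [← sq_abs]; gcongr
      nlinarith [mul_le_mul_of_nonneg_right h3 (sq_nonneg y)]
    have h4 : 0 ≤ 8 * (|ξ| + K) ^ (2 * s) := by positivity
    have h5 : 0 ≤ (|ξ| + 1) ^ (2 * s) := by positivity
    nlinarith
  · have h1 : (2 * (|ξ| + 1)) ^ (2 * s) ≤ (|ξ| + K) ^ (2 * s) :=
      Real.rpow_le_rpow_of_nonpos (by positivity) (by linarith) (by linarith)
    rw [Real.mul_rpow (by norm_num) hb.le] at h1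
    have h2 : (2 : ℝ) ^ (-1 : ℝ) ≤ 2 ^ (2 * s) :=
      Real.rpow_le_rpow_of_exponent_le (by norm_num) (by linarith)
    rw [Real.rpow_neg_one] at h2
    have h3 : 0 ≤ (|ξ| + 1) ^ (2 * s) := by positivity
    have h4 := Real.neg_one_le_cos (ξ * y)
    have h5 : 0 ≤ K ^ 2 * y ^ 2 * (|ξ| + 1) ^ (2 * s) := by positivity
    nlinarith

/-- First K is fixed by tightness, which handles the second term of `two_sub_cos_mul_le`; then δ is
taken small depending on K and on the bound for the norms. -/
theorem IsTight.isEquicontinuous {G : Geometry} {s : ℝ} (hs : -(1 / 2) < s) (hs0 : s < 0)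
    {Q : Set (Sob G s)} (hb : Bornology.IsBounded Q) (h : IsTight G Q) : IsEquicontinuous Q := by
  refine ⟨hb, ?_⟩
  obtain ⟨A, hA0, hA⟩ := hb.exists_pos_norm_le
  rw [ENNReal.tendsto_nhds_zero]
  intro ε hε
  rcases eq_or_ne ε ∞ with rfl | hεt
  · exact Eventually.of_forall fun _ => le_top
  have he2 : 0 < ε ^ 2 / 2 := ENNReal.half_pos (pow_ne_zero _ hε.ne')
  obtain ⟨K, hK1, hK⟩ := h (ε ^ 2 / 2 / 8)
    (ENNReal.div_pos he2.ne' (by simp))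
  have hlim : Tendsto (fun δ : ℝ => ENNReal.ofReal (K ^ 2 * δ ^ 2 * A ^ 2)) (𝓝[>] 0) (𝓝 0) := by
    have : Continuous fun δ : ℝ => ENNReal.ofReal (K ^ 2 * δ ^ 2 * A ^ 2) :=
      ENNReal.continuous_ofReal.comp (by fun_prop)
    have h0 := this.tendsto 0
    simp only [ne_eq, OfNat.ofNat_ne_zero, not_false_eq_true, zero_pow, mul_zero, zero_mul,
      ENNReal.ofReal_zero] at h0
    exact h0.mono_left nhdsWithin_le_nhds
  filter_upwards [hlim.eventually_le_const he2] with δ hδ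
  refine iSup₂_le fun q hq => iSup₂_le fun y hy => ?_
  rw [← ENNReal.pow_le_pow_left_iff two_ne_zero, enorm_translateBy_sub_sq]
  calc _ ≤ ∫⁻ ξ, (ENNReal.ofReal (K ^ 2 * δ ^ 2) *
        (ENNReal.ofReal ((|ξ| + 1) ^ (2 * s)) * ‖q ξ‖ₑ ^ 2) +
        8 * (ENNReal.ofReal ((|ξ| + K) ^ (2 * s)) * ‖q ξ‖ₑ ^ 2)) ∂(freq G) := by
        refine lintegral_mono fun ξ => ?_
        have hb := bracket_pos ξ
        have hk : 0 < |ξ| + K := by linarith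
        rw [← mul_assoc, ← mul_assoc, ← mul_assoc, ← add_mul,
          ← ENNReal.ofReal_mul (by linarith [Real.cos_le_one (ξ * y)]),
          ← ENNReal.ofReal_mul (by positivity),
          show (8 : ℝ≥0∞) = ENNReal.ofReal 8 from (ENNReal.ofReal_ofNat 8).symm,
          ← ENNReal.ofReal_mul (by norm_num), ← ENNReal.ofReal_add (by positivity) (by positivity)]
        gcongr ENNReal.ofReal ?_ * _
        refine (two_sub_cos_mul_le hs hs0 hK1).trans ?_
        have : y ^ 2 ≤ δ ^ 2 := by rw [← sq_abs]; gcongr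
        gcongr
    _ = ENNReal.ofReal (K ^ 2 * δ ^ 2) * ‖q‖ₑ ^ 2 + 8 * normK G s K q := by
        rw [← normK_one, normK, normK, lintegral_add_left', lintegral_const_mul' _ _ (by simp),
          lintegral_const_mul' _ _ (by simp)]
        have : Measurable fun ξ : ℝ => ENNReal.ofReal ((|ξ| + 1) ^ (2 * s)) := by fun_prop
        exact (this.aemeasurable.mul (q.aestronglyMeasurable.enorm.pow_const 2)).const_mul _
    _ ≤ ENNReal.ofReal (K ^ 2 * δ ^ 2) * ENNReal.ofReal (A ^ 2) + 8 * (ε ^ 2 / 2 / 8) := by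
        gcongr
        · rw [← ofReal_norm, ← ENNReal.ofReal_pow (norm_nonneg _)]
          gcongr
          exact hA q hq
        · exact hK q hq
    _ ≤ ε ^ 2 / 2 + ε ^ 2 / 2 := by
        rw [← ENNReal.ofReal_mul (by positivity),
          ENNReal.mul_div_cancel (by norm_num) (by norm_num)]
        gcongr
    _ = ε ^ 2 := ENNReal.add_halves _

theorem IsTight.subset {G : Geometry} {s : ℝ} {Q Q' : Set (Sob G s)} (h : IsTight G Q)
    (hs : Q' ⊆ Q) : IsTight G Q' := fun ε hε => by
  obtain ⟨K, hK, hq⟩ := h ε hε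
  exact ⟨K, hK, fun q hq' => hq q (hs hq')⟩

/-! ### Boundedness and equicontinuity of orbits of bounded sets. -/

section Orbit

variable {G : Geometry} {s : ℝ} [hs : Fact (-(1 / 2) < s ∧ s < 0)]

omit hs in
theorem exists_threshold (hs : -(1 / 2) < s) (X : ℝ) : ∃ κ : ℝ, 1 ≤ κ ∧ ∀ K, κ ≤ K →
    X ≤ K ^ (1 + 2 * s) := by
  have h1 : Tendsto (fun κ : ℝ => κ ^ (1 + 2 * s)) atTop atTop :=
    tendsto_rpow_atTop (by linarith)
  obtain ⟨κ, hκ⟩ := eventually_atTop.1 ((h1.eventually_ge_atTop X).and (eventually_ge_atTop 1))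
  exact ⟨κ, (hκ κ le_rfl).2, fun K hK => (hκ K hK).1⟩

theorem isBounded_betaOrbit {Q : Set (Sob G s)} (hQ : Bornology.IsBounded Q) :
    Bornology.IsBounded (betaOrbit G Q) := by
  obtain ⟨A, hA0, hA⟩ := hQ.exists_pos_norm_le
  have hC : 0 ≤ upperConst G s := zero_le_one.trans one_le_upperConst
  have hd : 0 < 1 + 2 * s := by linarith [hs.out.1]
  have hP : 0 ≤ -2 * s / (1 + 2 * s) := div_nonneg (by linarith [hs.out.2]) hd.le
  refine isBounded_iff_forall_norm_le.2 ⟨upperConst G s *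
    ((1 + A) ^ (-2 * s / (1 + 2 * s)) * A), fun p hp => ?_⟩
  obtain ⟨q₀, hq₀, hp⟩ := mem_betaOrbit_iff.1 hp
  refine (norm_le_of_mem_betaOrbit hp).trans ?_
  have := hA q₀ hq₀
  have := norm_nonneg q₀
  gcongr

/-- The threshold κ depends only on a bound for Q. Beyond it, `normK` of every orbit point is at
most a constant times `normK` of its starting point, so tightness is inherited. -/
theorem isEquicontinuous_betaOrbit {Q : Set (Sob G s)} (hQ : IsEquicontinuous Q) :
    IsEquicontinuous (betaOrbit G Q) := by
  refine IsTight.isEquicontinuous hs.out.1 hs.out.2 (isBounded_betaOrbit hQ.1) ?_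
  obtain ⟨A, hA0, hA⟩ := hQ.1.exists_pos_norm_le
  obtain ⟨κ, hκ1, hκ⟩ := exists_threshold (s := s) hs.out.1
    (8 * hsConst G s * cmpConst s * A ^ 2)
  have hcm : 1 ≤ cmpConst s := one_le_cmpConst
  have hh := hsConst_pos G s
  intro ε hε
  have hc0 : ENNReal.ofReal (cmpConst s) ≠ 0 := by simp; linarith
  obtain ⟨K₁, hK₁, hK⟩ := hQ.isTight hs.out.2 (ε / ENNReal.ofReal (cmpConst s))
    (ENNReal.div_pos hε.ne' ENNReal.ofReal_ne_top)
  refine ⟨max κ K₁, le_max_of_le_left hκ1, fun p hp => ?_⟩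
  obtain ⟨q₀, hq₀, hp⟩ := mem_betaOrbit_iff.1 hp
  have h0 : 8 * hsConst G s * cmpConst s * ‖q₀‖ ^ 2 ≤ κ ^ (1 + 2 * s) := by
    refine le_trans ?_ (hκ κ le_rfl)
    have := hA q₀ hq₀
    gcongr
  calc _ ≤ ENNReal.ofReal (cmpConst s) * normK G s (max κ K₁) q₀ :=
        (isSmall_of_mem_betaOrbit hκ1 hp h0).2 _ (le_max_left _ _)
    _ ≤ ENNReal.ofReal (cmpConst s) * (ε / ENNReal.ofReal (cmpConst s)) := by
        gcongr
        exact (normK_anti (by linarith) (le_max_right _ _) hs.out.2.le _).trans (hK q₀ hq₀)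
    _ = ε := ENNReal.mul_div_cancel hc0 ENNReal.ofReal_ne_top

theorem IsEquicontinuous.subset {Q Q' : Set (Sob G s)} (h : IsEquicontinuous Q) (hQ : Q' ⊆ Q) :
    IsEquicontinuous Q' :=
  IsTight.isEquicontinuous hs.out.1 hs.out.2 (h.1.subset hQ) ((h.isTight hs.out.2).subset hQ)

end Orbit

/-! ### Products and convolution -/

theorem fourierConst_enorm_le (G : Geometry) : ‖(fourierConst G : ℂ)‖ₑ ≤ 1 := by
  rw [← ofReal_norm, Complex.norm_real, Real.norm_of_nonneg (fourierConst_pos G).le]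
  exact ENNReal.ofReal_le_one.2 (fourierConst_le_one G)

/-- The Fourier transform of a product, in terms of the Fourier transforms of the factors. -/
def conv (G : Geometry) (φ ψ : ℝ → ℂ) (ξ : ℝ) : ℂ :=
  (fourierConst G : ℂ) * ∫ η, φ (ξ - η) * ψ η ∂(freq G)

/-- Only for almost every ξ: on the circle the map η ↦ ξ - η preserves the lattice just for ξ in it.
-/
theorem ae_lintegral_sub_left_freq (G : Geometry) (H : ℝ → ℝ≥0∞) :
    ∀ᵐ ξ ∂(freq G), ∫⁻ η, H (ξ - η) ∂(freq G) = ∫⁻ η, H η ∂(freq G) := by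
  cases G
  · exact Eventually.of_forall fun ξ => lintegral_sub_left_eq_self (μ := (volume : Measure ℝ)) H ξ
  · rw [ae_freq_circle]
    intro n
    rw [lintegral_freq_circle, lintegral_freq_circle,
      ← (Equiv.subLeft n).tsum_eq fun k : ℤ => H (2 * Real.pi * (k : ℝ))]
    refine tsum_congr fun k => ?_
    rw [Equiv.subLeft_apply]
    push_cast
    rw [mul_sub]

theorem aemeasurable_sub {G : Geometry} {H : ℝ → ℝ≥0∞} (hH : AEMeasurable H (freq G)) :
    AEMeasurable (fun p : ℝ × ℝ => H (p.1 - p.2)) ((freq G).prod (freq G)) :=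
  hH.comp_quasiMeasurePreserving (quasiMeasurePreserving_sub_freq G)

theorem aestronglyMeasurable_sub {G : Geometry} {φ : ℝ → ℂ}
    (hφ : AEStronglyMeasurable φ (freq G)) :
    AEStronglyMeasurable (fun p : ℝ × ℝ => φ (p.1 - p.2)) ((freq G).prod (freq G)) :=
  hφ.comp_quasiMeasurePreserving (quasiMeasurePreserving_sub_freq G)

/-- Young's inequality L¹ * L² → L²: Cauchy–Schwarz with Φ split into two square roots, then Tonelli
and translation invariance. -/
theorem lintegral_conv_le {G : Geometry} {Φ Ψ : ℝ → ℝ≥0∞} (hΦ : AEMeasurable Φ (freq G))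
    (hΨ : AEMeasurable Ψ (freq G)) :
    ∫⁻ ξ, (∫⁻ η, Φ (ξ - η) * Ψ η ∂(freq G)) ^ 2 ∂(freq G) ≤
      (∫⁻ ξ, Φ ξ ∂(freq G)) ^ 2 * ∫⁻ ξ, Ψ ξ ^ 2 ∂(freq G) := by
  have hm := aemeasurable_sub hΦ
  have hsec := (hm.aestronglyMeasurable).prodMk_left
  have hm2 : AEMeasurable (fun p : ℝ × ℝ => Φ (p.1 - p.2) * Ψ p.2 ^ 2)
      ((freq G).prod (freq G)) := hm.mul (hΨ.pow_const 2).comp_snd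
  calc _ ≤ ∫⁻ ξ, (∫⁻ η, Φ η ∂(freq G)) * ∫⁻ η, Φ (ξ - η) * Ψ η ^ 2 ∂(freq G) ∂(freq G) := by
        refine lintegral_mono_ae ?_
        filter_upwards [hsec, ae_lintegral_sub_left_freq G Φ] with ξ h1 h2
        have h1 : AEMeasurable (fun η => Φ (ξ - η)) (freq G) := h1.aemeasurable
        have hr : AEMeasurable (fun η => Φ (ξ - η) ^ (1 / 2 : ℝ)) (freq G) := h1.pow_const _
        have hsq : ∀ x : ℝ≥0∞, x ^ (1 / 2 : ℝ) * x ^ (1 / 2 : ℝ) = x := fun x => by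
          rw [← ENNReal.rpow_add_of_nonneg _ _ (by norm_num) (by norm_num)]
          norm_num
        have h3 := lintegral_mul_sq_le hr (hr.mul hΨ)
        simp only [Pi.mul_apply, mul_pow, ← mul_assoc, hsq, sq (_ ^ (1 / 2 : ℝ))] at h3
        rwa [h2] at h3
    _ = (∫⁻ η, Φ η ∂(freq G)) * ((∫⁻ ξ, Φ ξ ∂(freq G)) * ∫⁻ ξ, Ψ ξ ^ 2 ∂(freq G)) := by
        rw [lintegral_const_mul'' _ hm2.lintegral_prod_right', ← lintegral_prod _ hm2,
          lintegral_shear_mul G hΦ (hΨ.pow_const 2)]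
    _ = _ := by ring

theorem bracket_le_mul (ξ η : ℝ) : |ξ| + 1 ≤ (|ξ - η| + 1) * (|η| + 1) := by
  have := abs_add_le (ξ - η) η
  rw [sub_add_cancel] at this
  nlinarith [abs_nonneg (ξ - η), abs_nonneg η]

/-- For σ ≥ 0 the weight is submultiplicative (`bracket_le_mul`), so it can be distributed over both
factors before applying Young's inequality. -/
theorem lintegral_conv_sob_le {G : Geometry} {σ : ℝ} (hσ : 0 ≤ σ) {φ ψ : ℝ → ℂ}
    (hφ : AEStronglyMeasurable φ (freq G)) (hψ : AEStronglyMeasurable ψ (freq G)) :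
    ∫⁻ ξ, ENNReal.ofReal ((|ξ| + 1) ^ (2 * σ)) * (∫⁻ η, ‖φ (ξ - η) * ψ η‖ₑ ∂(freq G)) ^ 2
        ∂(freq G) ≤
      (∫⁻ ξ, ENNReal.ofReal ((|ξ| + 1) ^ σ) * ‖φ ξ‖ₑ ∂(freq G)) ^ 2 *
        ∫⁻ ξ, ‖ψ ξ‖ₑ ^ 2 ∂(sobMeasure G σ) := by
  have hw : Measurable fun ξ : ℝ => ENNReal.ofReal ((|ξ| + 1) ^ σ) := by fun_prop
  have hsq : ∀ ξ : ℝ, ENNReal.ofReal ((|ξ| + 1) ^ (2 * σ)) =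
      ENNReal.ofReal ((|ξ| + 1) ^ σ) ^ 2 := fun ξ => by
    have := bracket_pos ξ
    rw [← ENNReal.ofReal_pow (by positivity), ← Real.rpow_natCast, ← Real.rpow_mul this.le]
    congr 2
    push_cast; ring
  refine le_trans (lintegral_mono fun ξ => ?_)
    ((lintegral_conv_le (hw.aemeasurable.mul hφ.enorm) (hw.aemeasurable.mul hψ.enorm)).trans
      (le_of_eq ?_))
  · rw [hsq, ← mul_pow, ← lintegral_const_mul' _ _ ENNReal.ofReal_ne_top]
    refine pow_le_pow_left' (lintegral_mono fun η => ?_) 2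
    have h1 := bracket_pos ξ
    have h2 := bracket_pos (ξ - η)
    have h3 := bracket_pos η
    simp only [Pi.mul_apply]
    rw [enorm_mul, mul_mul_mul_comm, ← ENNReal.ofReal_mul (by positivity),
      ← Real.mul_rpow h2.le h3.le]
    gcongr
    exact bracket_le_mul ξ η
  · rw [lintegral_sobMeasure]
    simp only [Pi.mul_apply, mul_pow, hsq]

variable (G : Geometry) in
/-- The square of the norm of the embedding of `H^1` in the Wiener algebra. -/
def wienerConst : ℝ := (∫⁻ ξ, ENNReal.ofReal ((|ξ| + 1) ^ (-2 : ℝ)) ∂(freq G)).toReal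

/-- Cauchy–Schwarz against (|ξ| + 1)^{-1}, which is square integrable; one derivative thus buys the
weighted L¹ norm of the Fourier transform. -/
theorem lintegral_weight_le {G : Geometry} {σ : ℝ} {φ : ℝ → ℂ}
    (hφ : AEStronglyMeasurable φ (freq G)) :
    (∫⁻ ξ, ENNReal.ofReal ((|ξ| + 1) ^ σ) * ‖φ ξ‖ₑ ∂(freq G)) ^ 2 ≤
      ENNReal.ofReal (wienerConst G) * ∫⁻ ξ, ‖φ ξ‖ₑ ^ 2 ∂(sobMeasure G (σ + 1)) := by
  have h := lintegral_mul_sq_le (μ := freq G) (f := fun ξ => ENNReal.ofReal ((|ξ| + 1) ^ (-1 : ℝ)))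
    (g := fun ξ => ENNReal.ofReal ((|ξ| + 1) ^ (σ + 1)) * ‖φ ξ‖ₑ) (by fun_prop)
    ((by fun_prop : Measurable fun ξ : ℝ => ENNReal.ofReal ((|ξ| + 1) ^ (σ + 1))).aemeasurable.mul
      hφ.enorm)
  refine le_trans (le_of_eq ?_) (h.trans (le_of_eq ?_))
  · congr 1
    refine lintegral_congr fun ξ => ?_
    have := bracket_pos ξ
    rw [← mul_assoc, ← ENNReal.ofReal_mul (by positivity), ← Real.rpow_add this]
    congr 3
    ring
  · rw [lintegral_sobMeasure, wienerConst,
      ENNReal.ofReal_toReal (lintegral_abs_rpow_neg_two_lt_top G).ne]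
    congr 1
    · refine lintegral_congr fun ξ => ?_
      have := bracket_pos ξ
      rw [← ENNReal.ofReal_pow (by positivity), ← Real.rpow_natCast, ← Real.rpow_mul this.le]
      norm_num
    · refine lintegral_congr fun ξ => ?_
      have := bracket_pos ξ
      rw [mul_pow, ← ENNReal.ofReal_pow (by positivity), ← Real.rpow_natCast,
        ← Real.rpow_mul this.le]
      congr 3
      push_cast; ring

theorem sobMeasure_zero (G : Geometry) : sobMeasure G 0 = freq G := by
  simp [sobMeasure]

theorem aestronglyMeasurable_freq {G : Geometry} {σ : ℝ} {φ : ℝ → ℂ}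
    (h : AEStronglyMeasurable φ (sobMeasure G σ)) : AEStronglyMeasurable φ (freq G) :=
  h.mono_ac (ac_sobMeasure G σ)

theorem memLp_sob_mono {G : Geometry} {σ τ : ℝ} (h : τ ≤ σ) {φ : ℝ → ℂ}
    (hφ : MemLp φ 2 (sobMeasure G σ)) : MemLp φ 2 (sobMeasure G τ) := by
  simpa only [one_mul] using (isMultiplier_incl h).memLp hφ

theorem integrable_of_memLp_sob {G : Geometry} {φ : ℝ → ℂ} (hφ : MemLp φ 2 (sobMeasure G 1)) :
    Integrable φ (freq G) := by
  have hm := aestronglyMeasurable_freq hφ.1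
  refine ⟨hm, ?_⟩
  have h := lintegral_weight_le (σ := 0) hm
  rw [zero_add] at h
  simp only [Real.rpow_zero, ENNReal.ofReal_one, one_mul] at h
  have h2 := h.trans_lt (ENNReal.mul_lt_top ENNReal.ofReal_lt_top
    ((memLp_two_iff_lintegral hφ.1).1 hφ))
  rw [hasFiniteIntegral_iff_enorm]
  by_contra h3
  rw [not_lt, top_le_iff] at h3
  rw [h3, ENNReal.top_pow two_ne_zero] at h2
  exact lt_irrefl _ h2

theorem ae_integrable_conv {G : Geometry} {φ ψ : ℝ → ℂ} (hφ : Integrable φ (freq G))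
    (hψ : MemLp ψ 2 (freq G)) :
    ∀ᵐ ξ ∂(freq G), Integrable (fun η => φ (ξ - η) * ψ η) (freq G) := by
  have h := lintegral_conv_le hφ.1.enorm hψ.1.enorm
  have hfin := h.trans_lt (ENNReal.mul_lt_top (ENNReal.pow_lt_top (hasFiniteIntegral_iff_enorm.1 hφ.2))
    ((memLp_two_iff_lintegral hψ.1).1 hψ))
  have hm : AEStronglyMeasurable (fun p : ℝ × ℝ => φ (p.1 - p.2) * ψ p.2)
      ((freq G).prod (freq G)) := (aestronglyMeasurable_sub hφ.1).mul hψ.1.comp_snd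
  have hm1 : AEMeasurable (fun ξ => (∫⁻ η, ‖φ (ξ - η)‖ₑ * ‖ψ η‖ₑ ∂(freq G)) ^ 2) (freq G) := by
    have := hm.enorm.lintegral_prod_right'
    simp only [enorm_mul] at this
    exact this.pow_const 2
  filter_upwards [hm.prodMk_left, ae_lt_top' hm1 hfin.ne] with ξ h1 h2
  refine ⟨h1, ?_⟩
  rw [hasFiniteIntegral_iff_enorm]
  simp only [enorm_mul]
  by_contra h3
  rw [not_lt, top_le_iff] at h3
  rw [h3, ENNReal.top_pow two_ne_zero] at h2
  exact lt_irrefl _ h2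

theorem aestronglyMeasurable_conv {G : Geometry} {φ ψ : ℝ → ℂ}
    (hφ : AEStronglyMeasurable φ (freq G)) (hψ : AEStronglyMeasurable ψ (freq G)) :
    AEStronglyMeasurable (conv G φ ψ) (freq G) := by
  have hm : AEStronglyMeasurable (fun p : ℝ × ℝ => φ (p.1 - p.2) * ψ p.2)
      ((freq G).prod (freq G)) := (aestronglyMeasurable_sub hφ).mul hψ.comp_snd
  exact hm.integral_prod_right'.const_mul _

theorem enorm_conv_le {G : Geometry} (φ ψ : ℝ → ℂ) (ξ : ℝ) :
    ‖conv G φ ψ ξ‖ₑ ≤ ∫⁻ η, ‖φ (ξ - η) * ψ η‖ₑ ∂(freq G) := by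
  rw [conv, enorm_mul]
  calc _ ≤ 1 * ∫⁻ η, ‖φ (ξ - η) * ψ η‖ₑ ∂(freq G) :=
        mul_le_mul' (fourierConst_enorm_le G) (enorm_integral_le_lintegral_enorm _)
    _ = _ := one_mul _

theorem lintegral_conv_sq_le {G : Geometry} {σ : ℝ} (hσ : 0 ≤ σ) {φ ψ : ℝ → ℂ}
    (hφ : AEStronglyMeasurable φ (freq G)) (hψ : AEStronglyMeasurable ψ (freq G)) :
    ∫⁻ ξ, ‖conv G φ ψ ξ‖ₑ ^ 2 ∂(sobMeasure G σ) ≤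
      ENNReal.ofReal (wienerConst G) * (∫⁻ ξ, ‖φ ξ‖ₑ ^ 2 ∂(sobMeasure G (σ + 1))) *
        ∫⁻ ξ, ‖ψ ξ‖ₑ ^ 2 ∂(sobMeasure G σ) := by
  rw [lintegral_sobMeasure]
  calc _ ≤ ∫⁻ ξ, ENNReal.ofReal ((|ξ| + 1) ^ (2 * σ)) *
        (∫⁻ η, ‖φ (ξ - η) * ψ η‖ₑ ∂(freq G)) ^ 2 ∂(freq G) := by
        gcongr with ξ
        exact enorm_conv_le φ ψ ξ
    _ ≤ _ := lintegral_conv_sob_le hσ hφ hψ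
    _ ≤ _ := by gcongr; exact lintegral_weight_le hφ

theorem memLp_conv {G : Geometry} {σ : ℝ} (hσ : 0 ≤ σ) {φ ψ : ℝ → ℂ}
    (hφ : MemLp φ 2 (sobMeasure G (σ + 1))) (hψ : MemLp ψ 2 (sobMeasure G σ)) :
    MemLp (conv G φ ψ) 2 (sobMeasure G σ) := by
  have h1 := aestronglyMeasurable_freq hφ.1
  have h2 := aestronglyMeasurable_freq hψ.1
  rw [memLp_two_iff_lintegral ((aestronglyMeasurable_conv h1 h2).mono_ac (sobMeasure_ac G σ))]
  exact (lintegral_conv_sq_le hσ h1 h2).trans_lt (ENNReal.mul_lt_top (ENNReal.mul_lt_top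
    ENNReal.ofReal_lt_top ((memLp_two_iff_lintegral hφ.1).1 hφ))
    ((memLp_two_iff_lintegral hψ.1).1 hψ))

theorem conv_congr {G : Geometry} {φ φ' ψ ψ' : ℝ → ℂ} (hφ : φ =ᵐ[freq G] φ')
    (hψ : ψ =ᵐ[freq G] ψ') : conv G φ ψ =ᵐ[freq G] conv G φ' ψ' := by
  have h1 : ∀ᵐ p : ℝ × ℝ ∂((freq G).prod (freq G)), φ (p.1 - p.2) = φ' (p.1 - p.2) :=
    (quasiMeasurePreserving_sub_freq G).ae hφ
  filter_upwards [Measure.ae_ae_of_ae_prod h1] with ξ hξ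
  rw [conv, conv]
  congr 1
  refine integral_congr_ae ?_
  filter_upwards [hξ, hψ] with η h2 h3
  rw [h2, h3]

theorem conv_add_left {G : Geometry} {φ φ' ψ : ℝ → ℂ} (hφ : Integrable φ (freq G))
    (hφ' : Integrable φ' (freq G)) (hψ : MemLp ψ 2 (freq G)) :
    conv G (φ + φ') ψ =ᵐ[freq G] conv G φ ψ + conv G φ' ψ := by
  filter_upwards [ae_integrable_conv hφ hψ, ae_integrable_conv hφ' hψ] with ξ h1 h2
  simp only [conv, Pi.add_apply, add_mul]
  rw [integral_add h1 h2, mul_add]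

theorem conv_add_right {G : Geometry} {φ ψ ψ' : ℝ → ℂ} (hφ : Integrable φ (freq G))
    (hψ : MemLp ψ 2 (freq G)) (hψ' : MemLp ψ' 2 (freq G)) :
    conv G φ (ψ + ψ') =ᵐ[freq G] conv G φ ψ + conv G φ ψ' := by
  filter_upwards [ae_integrable_conv hφ hψ, ae_integrable_conv hφ hψ'] with ξ h1 h2
  simp only [conv, Pi.add_apply, mul_add]
  rw [integral_add h1 h2, mul_add]

theorem conv_smul_left {G : Geometry} (c : ℂ) (φ ψ : ℝ → ℂ) :
    conv G (c • φ) ψ = c • conv G φ ψ := by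
  funext ξ
  simp only [conv, Pi.smul_apply, smul_eq_mul, mul_assoc]
  rw [integral_const_mul, mul_left_comm]

theorem conv_smul_right {G : Geometry} (c : ℂ) (φ ψ : ℝ → ℂ) :
    conv G φ (c • ψ) = c • conv G φ ψ := by
  funext ξ
  simp only [conv, Pi.smul_apply, smul_eq_mul, mul_left_comm _ c]
  rw [integral_const_mul, mul_left_comm]

theorem memLp_freq_of_sob {G : Geometry} {σ : ℝ} (hσ : 0 ≤ σ) {φ : ℝ → ℂ}
    (h : MemLp φ 2 (sobMeasure G σ)) : MemLp φ 2 (freq G) := by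
  rw [← sobMeasure_zero]
  exact memLp_sob_mono hσ h

theorem Sob.integrable {G : Geometry} {σ : ℝ} (hσ : 1 ≤ σ) (φ : Sob G σ) :
    Integrable φ (freq G) := integrable_of_memLp_sob (memLp_sob_mono hσ (Lp.memLp φ))

theorem Sob.ae_eq {G : Geometry} {σ : ℝ} {φ ψ : Sob G σ} (h : φ =ᵐ[freq G] ψ) : φ = ψ :=
  Lp.ext (ae_sobMeasure_iff.2 h)

theorem Sob.coeFn_add {G : Geometry} {σ : ℝ} (φ ψ : Sob G σ) :
    (φ + ψ : Sob G σ) =ᵐ[freq G] ⇑φ + ⇑ψ := ae_sobMeasure_iff.1 (Lp.coeFn_add φ ψ)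

theorem Sob.coeFn_smul {G : Geometry} {σ : ℝ} (c : ℂ) (φ : Sob G σ) :
    (c • φ : Sob G σ) =ᵐ[freq G] c • ⇑φ := ae_sobMeasure_iff.1 (Lp.coeFn_smul c φ)

theorem Sob.coeFn_toLp {G : Geometry} {σ : ℝ} {φ : ℝ → ℂ} (h : MemLp φ 2 (sobMeasure G σ)) :
    (h.toLp : Sob G σ) =ᵐ[freq G] φ := ae_sobMeasure_iff.1 h.coeFn_toLp

/-- Multiplication `H^{σ+1} × H^σ → H^σ`. -/
def convCLM (G : Geometry) {σ : ℝ} (hσ : 0 ≤ σ) : Sob G (σ + 1) →L[ℂ] Sob G σ →L[ℂ] Sob G σ :=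
  LinearMap.mkContinuous₂
    (LinearMap.mk₂ ℂ (fun φ ψ => (memLp_conv hσ (Lp.memLp φ) (Lp.memLp ψ)).toLp)
      (fun φ φ' ψ => by
        refine Sob.ae_eq ?_
        have h1 := φ.integrable (by linarith)
        have h2 := φ'.integrable (by linarith)
        have h3 := memLp_freq_of_sob hσ (Lp.memLp ψ)
        refine (Sob.coeFn_toLp _).trans ((conv_congr (Sob.coeFn_add φ φ') (ae_eq_refl _)).trans
          ((conv_add_left h1 h2 h3).trans ?_))
        exact ((Sob.coeFn_add _ _).trans
          ((Sob.coeFn_toLp _).add (Sob.coeFn_toLp _))).symm)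
      (fun c φ ψ => by
        refine Sob.ae_eq ((Sob.coeFn_toLp _).trans
          ((conv_congr (Sob.coeFn_smul c φ) (ae_eq_refl _)).trans ?_))
        rw [conv_smul_left]
        exact ((Sob.coeFn_smul _ _).trans ((Sob.coeFn_toLp _).const_smul c)).symm)
      (fun φ ψ ψ' => by
        refine Sob.ae_eq ?_
        have h1 := φ.integrable (by linarith)
        have h2 := memLp_freq_of_sob hσ (Lp.memLp ψ)
        have h3 := memLp_freq_of_sob hσ (Lp.memLp ψ')
        refine (Sob.coeFn_toLp _).trans ((conv_congr (ae_eq_refl _) (Sob.coeFn_add ψ ψ')).trans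
          ((conv_add_right h1 h2 h3).trans ?_))
        exact ((Sob.coeFn_add _ _).trans
          ((Sob.coeFn_toLp _).add (Sob.coeFn_toLp _))).symm)
      (fun c φ ψ => by
        refine Sob.ae_eq ((Sob.coeFn_toLp _).trans
          ((conv_congr (ae_eq_refl _) (Sob.coeFn_smul c ψ)).trans ?_))
        rw [conv_smul_right]
        exact ((Sob.coeFn_smul _ _).trans ((Sob.coeFn_toLp _).const_smul c)).symm))
    (Real.sqrt (wienerConst G))
    (fun φ ψ => by
      refine Lp_norm_le_of_lintegral_le _ (by positivity) ?_
      have h1 := memLp_conv hσ (Lp.memLp φ) (Lp.memLp ψ)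
      have h2 : ∫⁻ ξ, ‖(h1.toLp : Sob G σ) ξ‖ₑ ^ 2 ∂(sobMeasure G σ) =
          ∫⁻ ξ, ‖conv G φ ψ ξ‖ₑ ^ 2 ∂(sobMeasure G σ) := by
        refine lintegral_congr_ae ?_
        filter_upwards [h1.coeFn_toLp] with ξ hξ
        rw [hξ]
      refine h2.trans_le ((lintegral_conv_sq_le hσ φ.aestronglyMeasurable
        ψ.aestronglyMeasurable).trans (le_of_eq ?_))
      rw [← Lp_enorm_sq, ← Lp_enorm_sq, ENNReal.ofReal_mul (by positivity),
        ENNReal.ofReal_mul (by positivity), ofReal_norm, ofReal_norm, mul_pow, mul_pow,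
        ← ENNReal.ofReal_pow (by positivity), Real.sq_sqrt (show 0 ≤ wienerConst G from ENNReal.toReal_nonneg)])

theorem coeFn_convCLM {G : Geometry} {σ : ℝ} (hσ : 0 ≤ σ) (φ : Sob G (σ + 1)) (ψ : Sob G σ) :
    convCLM G hσ φ ψ =ᵐ[freq G] conv G φ ψ :=
  Sob.coeFn_toLp (memLp_conv hσ (Lp.memLp φ) (Lp.memLp ψ))

/-! ### Smooth functions -/

section Smooth

variable {G : Geometry} {φ ψ : ℝ → ℂ}

theorem IsSmooth.aestronglyMeasurable (h : IsSmooth G φ) : AEStronglyMeasurable φ (freq G) :=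
  aestronglyMeasurable_freq (h 0).1

theorem IsSmooth.memLp (h : IsSmooth G φ) : MemLp φ 2 (freq G) := memLp_freq_of_sob le_rfl (h 0)

theorem IsSmooth.integrable (h : IsSmooth G φ) : Integrable φ (freq G) :=
  integrable_of_memLp_sob (h 1)

theorem IsSmooth.congr (h : IsSmooth G φ) (he : φ =ᵐ[freq G] ψ) : IsSmooth G ψ := fun σ =>
  (h σ).ae_eq (ae_sobMeasure_iff.2 he)

theorem isSmooth_of_nonneg (h : ∀ σ : ℝ, 0 ≤ σ → MemLp φ 2 (sobMeasure G σ)) : IsSmooth G φ :=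
  fun σ => memLp_sob_mono (le_max_left σ 0) (h _ (le_max_right σ 0))

theorem IsSmooth.add (hφ : IsSmooth G φ) (hψ : IsSmooth G ψ) : IsSmooth G (φ + ψ) := fun σ =>
  (hφ σ).add (hψ σ)

theorem IsSmooth.sub (hφ : IsSmooth G φ) (hψ : IsSmooth G ψ) : IsSmooth G (φ - ψ) := fun σ =>
  (hφ σ).sub (hψ σ)

theorem IsSmooth.smul (c : ℂ) (hφ : IsSmooth G φ) : IsSmooth G (c • φ) := fun σ =>
  (hφ σ).const_smul c

theorem IsSmooth.conv (hφ : IsSmooth G φ) (hψ : IsSmooth G ψ) : IsSmooth G (conv G φ ψ) :=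
  isSmooth_of_nonneg fun σ hσ => memLp_conv hσ (hφ (σ + 1)) (hψ σ)

theorem IsSmooth.mul_of_le (hφ : IsSmooth G φ) {a : ℝ → ℂ} (ha : Measurable a) {C k : ℝ}
    (hC : 0 ≤ C) (h : ∀ ξ, ‖a ξ‖ ≤ C * (|ξ| + 1) ^ k) : IsSmooth G fun ξ => a ξ * φ ξ := fun σ =>
  (isMultiplier_sob (σ := σ + k) ha hC (by simpa using h)).memLp (hφ _)

theorem IsSmooth.mul_id (hφ : IsSmooth G φ) : IsSmooth G fun ξ => (ξ : ℂ) * φ ξ := by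
  refine hφ.mul_of_le (C := 1) (k := 1) (by fun_prop) zero_le_one fun ξ => ?_
  rw [Real.rpow_one, Complex.norm_real, Real.norm_eq_abs]
  linarith

theorem IsSmooth.dx (hφ : IsSmooth G φ) : IsSmooth G (dx φ) := by
  refine (hφ.mul_id.smul Complex.I).congr (Eventually.of_forall fun ξ => ?_)
  simp only [BenjaminOno.dx, Pi.smul_apply, smul_eq_mul, mul_assoc]

theorem IsSmooth.indicator (hφ : IsSmooth G φ) {S : Set ℝ} (hS : MeasurableSet S) :
    IsSmooth G (S.indicator φ) := by
  refine (hφ.mul_of_le (a := S.indicator 1) (measurable_one.indicator hS) (C := 1) (k := 0)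
    zero_le_one fun ξ => ?_).congr (Eventually.of_forall fun ξ => ?_)
  · rw [Real.rpow_zero, mul_one]
    refine (norm_indicator_le_norm_self _ _).trans (by simp)
  · by_cases h : ξ ∈ S <;> simp [h]

theorem measurable_sign : Measurable Real.sign := by
  unfold Real.sign
  exact Measurable.ite (measurableSet_lt measurable_id measurable_const) measurable_const
    (Measurable.ite (measurableSet_lt measurable_const measurable_id) measurable_const
      measurable_const)

theorem measurable_hilbertSymbol : Measurable fun ξ : ℝ => -Complex.I * (Real.sign ξ : ℂ) := by
  have := measurable_sign
  fun_prop

theorem norm_hilbertSymbol_le (ξ : ℝ) :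
    ‖-Complex.I * (Real.sign ξ : ℂ)‖ ≤ 1 * (|ξ| + 1) ^ (0 : ℝ) := by
  rw [Real.rpow_zero, mul_one, norm_mul, norm_neg, Complex.norm_I, one_mul, Complex.norm_real]
  rcases lt_trichotomy ξ 0 with h | h | h
  · simp [Real.sign_of_neg h]
  · simp [h]
  · simp [Real.sign_of_pos h]

theorem IsSmooth.hilbert (hφ : IsSmooth G φ) : IsSmooth G (hilbert φ) :=
  hφ.mul_of_le measurable_hilbertSymbol zero_le_one norm_hilbertSymbol_le

/-- The Fourier transform of the complex conjugate. -/
def reflConj (φ : ℝ → ℂ) : ℝ → ℂ := fun ξ => conj (φ (-ξ))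

theorem IsSmooth.reflConj (hφ : IsSmooth G φ) : IsSmooth G (reflConj φ) := by
  intro σ
  have hneg := measurePreserving_neg_freq G
  have hm : AEStronglyMeasurable (BenjaminOno.reflConj φ) (freq G) :=
    Complex.continuous_conj.comp_aestronglyMeasurable
      (hφ.aestronglyMeasurable.comp_measurePreserving hneg)
  rw [memLp_two_iff_lintegral (hm.mono_ac (sobMeasure_ac G σ)), lintegral_sobMeasure]
  have hw : Measurable fun ξ : ℝ => ENNReal.ofReal ((|ξ| + 1) ^ (2 * σ)) := by fun_prop
  have h := lintegral_comp_measurePreserving hneg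
    (f := fun ξ => ENNReal.ofReal ((|ξ| + 1) ^ (2 * σ)) * ‖φ ξ‖ₑ ^ 2)
    (hw.aemeasurable.mul (hφ.aestronglyMeasurable.enorm.pow_const 2))
  simp only [abs_neg] at h
  simp only [BenjaminOno.reflConj, RCLike.enorm_conj]
  rw [h, ← lintegral_sobMeasure]
  exact (memLp_two_iff_lintegral (hφ σ).1).1 (hφ σ)

theorem isReal_iff : IsReal G φ ↔ BenjaminOno.reflConj φ =ᵐ[freq G] φ := by
  constructor
  · intro h
    filter_upwards [h] with ξ hξ
    rw [BenjaminOno.reflConj, hξ, Complex.conj_conj]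
  · intro h
    filter_upwards [h] with ξ hξ
    rw [← hξ, BenjaminOno.reflConj, Complex.conj_conj]

end Smooth

/-! ### Plancherel's theorem on the line -/

section Plancherel

open FourierTransform

/-- The Fourier transform on L² and the Fourier integral agree as distributions: tested against a
compactly supported smooth function, both transfer the transform to the test function. -/
theorem fourier_toLp_ae {f : ℝ → ℂ} (h1 : Integrable f) (h2 : MemLp f 2 volume) :
    (𝓕 (h2.toLp) : Lp ℂ 2 (volume : Measure ℝ)) =ᵐ[volume] 𝓕 f := by
  have hc : Continuous (𝓕 f) := VectorFourier.fourierIntegral_continuous (L := innerₗ ℝ)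
    Real.continuous_fourierChar (by exact continuous_inner) h1
  refine ae_eq_of_integral_contDiff_smul_eq ((Lp.memLp _).locallyIntegrable (by norm_num))
    hc.locallyIntegrable fun g hg hgs => ?_
  have hg' := Complex.ofRealCLM.contDiff.comp hg
  have hgs' : HasCompactSupport (Complex.ofRealCLM ∘ g) := hgs.comp_left rfl
  set S : SchwartzMap ℝ ℂ := hgs'.toSchwartzMap hg' with hS
  have h3 := congrArg (fun T : TemperedDistribution ℝ ℂ => T S)
    (Lp.fourier_toTemperedDistribution_eq h2.toLp)
  simp only [TemperedDistribution.fourier_apply, Lp.toTemperedDistribution_apply] at h3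
  have h4 : ∫ x, g x • (𝓕 (h2.toLp) : Lp ℂ 2 (volume : Measure ℝ)) x =
      ∫ x, (𝓕 S) x • (h2.toLp) x := by
    rw [h3]; rfl
  rw [h4]
  have h5 : ∫ x, (𝓕 S) x • (h2.toLp) x = ∫ x, 𝓕 (S : ℝ → ℂ) x • f x := by
    refine integral_congr_ae ?_
    filter_upwards [h2.coeFn_toLp] with x hx
    rw [hx, SchwartzMap.fourier_coe]
  rw [h5]
  have h6 := VectorFourier.integral_fourierIntegral_smul_eq_flip (L := innerₗ ℝ) (μ := volume)
    (ν := volume) (f := S) (g := f) Real.continuous_fourierChar (by exact continuous_inner)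
    S.integrable h1
  rw [flip_innerₗ] at h6
  exact h6

theorem plancherel_fourier {f g : ℝ → ℂ} (hf1 : Integrable f) (hf2 : MemLp f 2 volume)
    (hg1 : Integrable g) (hg2 : MemLp g 2 volume) :
    Integrable (fun x => conj (𝓕 f x) * 𝓕 g x) ∧
      ∫ x, conj (𝓕 f x) * 𝓕 g x = ∫ x, conj (f x) * g x := by
  have h := Lp.inner_fourier_eq hf2.toLp hg2.toLp
  have hi := L2.integrable_inner (𝕜 := ℂ) (𝓕 hf2.toLp : Lp ℂ 2 (volume : Measure ℝ))
    (𝓕 hg2.toLp : Lp ℂ 2 (volume : Measure ℝ))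
  rw [L2.inner_def, L2.inner_def] at h
  have hl : (fun x => inner ℂ ((𝓕 hf2.toLp : Lp ℂ 2 (volume : Measure ℝ)) x)
      ((𝓕 hg2.toLp : Lp ℂ 2 (volume : Measure ℝ)) x)) =ᵐ[volume]
      fun x => conj (𝓕 f x) * 𝓕 g x := by
    filter_upwards [fourier_toLp_ae hf1 hf2, fourier_toLp_ae hg1 hg2] with x h1 h2
    rw [h1, h2, RCLike.inner_apply']
  have hr : (fun x => inner ℂ ((MemLp.toLp f hf2) x) ((MemLp.toLp g hg2) x)) =ᵐ[volume] fun x => conj (f x) * g x := by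
    filter_upwards [hf2.coeFn_toLp, hg2.coeFn_toLp] with x h1 h2
    rw [h1, h2, RCLike.inner_apply']
  exact ⟨hi.congr hl, by rw [← integral_congr_ae hl, h, integral_congr_ae hr]⟩

theorem synth_line_eq (φ : ℝ → ℂ) (x : ℝ) :
    synth .line φ x = (fourierConst .line : ℂ) * 𝓕 φ (-(2 * Real.pi)⁻¹ * x) := by
  rw [synth, Real.fourier_real_eq_integral_exp_smul]
  congr 1
  refine integral_congr_ae (Eventually.of_forall fun ξ => ?_)
  have hpi := Real.pi_pos.ne'
  simp only [smul_eq_mul]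
  congr 2
  rw [show -2 * Real.pi * ξ * (-(2 * Real.pi)⁻¹ * x) = ξ * x by field_simp]
  push_cast; ring

/-- The unitary convention here differs from 𝓕 by x ↦ -x/(2π). The Jacobian 2π of this dilation
cancels the square of `fourierConst`. -/
theorem plancherel_line {φ ψ : ℝ → ℂ} (hφ1 : Integrable φ) (hφ2 : MemLp φ 2 volume)
    (hψ1 : Integrable ψ) (hψ2 : MemLp ψ 2 volume) :
    Integrable (fun x => conj (synth .line φ x) * synth .line ψ x) ∧
      ∫ x, conj (synth .line φ x) * synth .line ψ x = ∫ ξ, conj (φ ξ) * ψ ξ := by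
  obtain ⟨h1, h2⟩ := plancherel_fourier hφ1 hφ2 hψ1 hψ2
  have hpi := Real.pi_pos
  have he : ∀ x, conj (synth .line φ x) * synth .line ψ x = (((2 * Real.pi)⁻¹ : ℝ) : ℂ) *
      (conj (𝓕 φ (-(2 * Real.pi)⁻¹ * x)) * 𝓕 ψ (-(2 * Real.pi)⁻¹ * x)) := by
    intro x
    rw [synth_line_eq, synth_line_eq, map_mul, Complex.conj_ofReal, mul_mul_mul_comm,
      ← Complex.ofReal_mul]
    congr 2
    rw [fourierConst, ← mul_inv, Real.mul_self_sqrt (by positivity)]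
  simp_rw [he]
  have h3 : -(2 * Real.pi)⁻¹ ≠ 0 := by
    rw [neg_ne_zero]; positivity
  refine ⟨(h1.comp_mul_left' h3).const_mul _, ?_⟩
  rw [integral_const_mul,
    Measure.integral_comp_mul_left (fun y => conj (𝓕 φ y) * 𝓕 ψ y) (-(2 * Real.pi)⁻¹), h2,
    inv_neg, inv_inv, abs_neg, abs_of_pos (by positivity), Complex.real_smul, ← mul_assoc,
    ← Complex.ofReal_mul, inv_mul_cancel₀ (by positivity), Complex.ofReal_one, one_mul]

end Plancherel

/-! ### Functions with a given Fourier transform -/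

section Synth

variable {G : Geometry} {φ ψ : ℝ → ℂ}

theorem norm_exp_mul (ξ x : ℝ) : ‖Complex.exp (Complex.I * ξ * x)‖ = 1 := by
  rw [Complex.norm_exp]; simp

theorem integrable_exp_mul (hφ : Integrable φ (freq G)) (x : ℝ) :
    Integrable (fun ξ : ℝ => Complex.exp (Complex.I * ξ * x) * φ ξ) (freq G) := by
  refine hφ.norm.mono' ((by fun_prop : Continuous fun ξ : ℝ =>
    Complex.exp (Complex.I * ξ * x)).aestronglyMeasurable.mul hφ.1)
    (Eventually.of_forall fun ξ => ?_)
  simp only [norm_mul, norm_exp_mul, one_mul, le_refl]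

theorem synth_congr (h : φ =ᵐ[freq G] ψ) : synth G φ = synth G ψ := by
  funext x
  rw [synth, synth]
  congr 1
  refine integral_congr_ae ?_
  filter_upwards [h] with ξ hξ
  rw [hξ]

theorem synth_add (hφ : Integrable φ (freq G)) (hψ : Integrable ψ (freq G)) :
    synth G (φ + ψ) = synth G φ + synth G ψ := by
  funext x
  simp only [synth, Pi.add_apply, mul_add]
  rw [integral_add (integrable_exp_mul hφ x) (integrable_exp_mul hψ x), mul_add]

theorem synth_smul (c : ℂ) (φ : ℝ → ℂ) : synth G (c • φ) = c • synth G φ := by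
  funext x
  simp only [synth, Pi.smul_apply, smul_eq_mul, mul_left_comm _ c]
  rw [integral_const_mul, mul_left_comm]

theorem synth_sub (hφ : Integrable φ (freq G)) (hψ : Integrable ψ (freq G)) :
    synth G (φ - ψ) = synth G φ - synth G ψ := by
  funext x
  simp only [synth, Pi.sub_apply, mul_sub]
  rw [integral_sub (integrable_exp_mul hφ x) (integrable_exp_mul hψ x), mul_sub]

theorem conj_synth (φ : ℝ → ℂ) (x : ℝ) : conj (synth G φ x) = synth G (reflConj φ) x := by
  rw [synth, synth, map_mul, Complex.conj_ofReal, ← integral_conj,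
    ← (measurePreserving_neg_freq G).integral_comp (Homeomorph.neg ℝ).measurableEmbedding
      fun ξ : ℝ => Complex.exp (Complex.I * ξ * x) * reflConj φ ξ]
  congr 1
  refine integral_congr_ae (Eventually.of_forall fun ξ => ?_)
  simp only [reflConj, map_mul, ← Complex.exp_conj, Complex.conj_I, Complex.conj_ofReal]
  push_cast
  ring_nf

/-- Fubini after the shear (ξ, η) ↦ (ξ - η, η), under which the exponential factorizes. -/
theorem synth_conv (hφ : Integrable φ (freq G)) (hψ : Integrable ψ (freq G)) (x : ℝ) :
    synth G (conv G φ ψ) x = synth G φ x * synth G ψ x := by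
  have h1 := integrable_exp_mul hφ x
  have h2 := integrable_exp_mul hψ x
  have hpm := measurePreserving_shear_freq G
  have hi : Integrable (fun p : ℝ × ℝ => (Complex.exp (Complex.I * p.1 * x) * φ p.1) *
      (Complex.exp (Complex.I * p.2 * x) * ψ p.2)) ((freq G).prod (freq G)) := h1.mul_prod h2
  have h3 : ∫ p : ℝ × ℝ, (Complex.exp (Complex.I * (p.1 - p.2 : ℝ) * x) * φ (p.1 - p.2)) *
      (Complex.exp (Complex.I * p.2 * x) * ψ p.2) ∂((freq G).prod (freq G)) =
      (∫ ξ, Complex.exp (Complex.I * ξ * x) * φ ξ ∂(freq G)) *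
        ∫ ξ, Complex.exp (Complex.I * ξ * x) * ψ ξ ∂(freq G) := by
    rw [← integral_prod_mul]
    conv_rhs => rw [← hpm.map_eq]
    rw [integral_map hpm.measurable.aemeasurable (by rw [hpm.map_eq]; exact hi.1)]
  have hi' : Integrable (fun p : ℝ × ℝ => (Complex.exp (Complex.I * (p.1 - p.2 : ℝ) * x) *
      φ (p.1 - p.2)) * (Complex.exp (Complex.I * p.2 * x) * ψ p.2))
      ((freq G).prod (freq G)) := hpm.integrable_comp_of_integrable hi
  rw [integral_prod _ hi'] at h3
  simp only [synth]
  rw [mul_mul_mul_comm, ← h3, mul_assoc]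
  congr 1
  rw [← integral_const_mul (fourierConst G : ℂ)]
  refine integral_congr_ae (Eventually.of_forall fun ξ => ?_)
  simp only [conv]
  rw [mul_left_comm, ← integral_const_mul (Complex.exp (Complex.I * ξ * x))]
  congr 1
  refine integral_congr_ae (Eventually.of_forall fun η => ?_)
  simp only
  rw [mul_mul_mul_comm, ← Complex.exp_add]
  congr 2
  push_cast; ring

theorem hasDerivAt_synth (hφ : Integrable φ (freq G)) (hd : Integrable (dx φ) (freq G)) (x : ℝ) :
    HasDerivAt (synth G φ) (synth G (dx φ) x) x := by
  refine (hasDerivAt_integral_of_dominated_loc_of_deriv_le (𝕜 := ℝ) (E := ℂ) (μ := freq G)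
    (x₀ := x)
    (F := fun (x : ℝ) (ξ : ℝ) => Complex.exp (Complex.I * ξ * x) * φ ξ)
    (F' := fun (x : ℝ) (ξ : ℝ) => Complex.exp (Complex.I * ξ * x) * dx φ ξ)
    (bound := fun ξ => ‖dx φ ξ‖) (s := Set.univ) univ_mem
    (Eventually.of_forall fun y => (integrable_exp_mul hφ y).1) (integrable_exp_mul hφ x)
    (integrable_exp_mul hd x).1 (Eventually.of_forall fun ξ y _ => ?_) hd.norm
    (Eventually.of_forall fun ξ y _ => ?_)).2.const_mul _
  · simp only [norm_mul, norm_exp_mul, one_mul, le_refl]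
  · have h1 : HasDerivAt (fun y : ℝ => Complex.I * ξ * (y : ℂ)) (Complex.I * ξ) y := by
      simpa using (Complex.ofRealCLM.hasDerivAt (x := y)).const_mul (Complex.I * ξ)
    refine (h1.cexp.mul_const (φ ξ)).congr_deriv ?_
    simp only [dx]
    ring

theorem IsSmooth.hasDerivAt_synth (hφ : IsSmooth G φ) (x : ℝ) :
    HasDerivAt (synth G φ) (synth G (BenjaminOno.dx φ) x) x :=
  BenjaminOno.hasDerivAt_synth hφ.integrable hφ.dx.integrable x

theorem IsSmooth.deriv_synth (hφ : IsSmooth G φ) :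
    deriv (synth G φ) = synth G (BenjaminOno.dx φ) := funext fun x => (hφ.hasDerivAt_synth x).deriv

theorem IsSmooth.continuous_synth (hφ : IsSmooth G φ) : Continuous (synth G φ) :=
  continuous_iff_continuousAt.2 fun x => (hφ.hasDerivAt_synth x).continuousAt

theorem IsReal.conj_synth (h : IsReal G φ) (x : ℝ) : conj (synth G φ x) = synth G φ x := by
  rw [BenjaminOno.conj_synth, synth_congr (isReal_iff.1 h)]

theorem IsReal.ofReal_phys (h : IsReal G φ) (x : ℝ) : (phys G φ x : ℂ) = synth G φ x :=
  Complex.conj_eq_iff_re.1 (h.conj_synth x)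

/-- Every exponential with nonzero frequency in 2πℤ integrates to zero over a period, so only the
zero mode survives. -/
theorem integral_synth_circle {χ : ℝ → ℂ} (hχ : Integrable χ (freq .circle)) :
    ∫ x, synth .circle χ x ∂(space .circle) = χ 0 := by
  have hs : IsFiniteMeasure (space .circle) := by
    unfold space; infer_instance
  simp only [synth, fourierConst, Complex.ofReal_one, one_mul]
  have hi : Integrable (Function.uncurry fun x ξ : ℝ => Complex.exp (Complex.I * ξ * x) * χ ξ)
      ((space .circle).prod (freq .circle)) := by
    have h1 : Integrable (fun p : ℝ × ℝ => (1 : ℂ) * χ p.2) ((space .circle).prod (freq .circle)) :=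
      (integrable_const (1 : ℂ)).mul_prod hχ
    refine h1.mono ((by fun_prop : Continuous fun p : ℝ × ℝ =>
      Complex.exp (Complex.I * p.2 * p.1)).aestronglyMeasurable.mul hχ.1.comp_snd)
      (Eventually.of_forall fun p => ?_)
    simp only [Function.uncurry, norm_mul, norm_exp_mul, norm_one, le_refl]
  rw [integral_integral_swap hi]
  have h2 : (fun ξ : ℝ => ∫ x, Complex.exp (Complex.I * ξ * x) * χ ξ ∂(space .circle))
      =ᵐ[freq .circle] Set.indicator {0} χ := by
    rw [EventuallyEq, ae_freq_circle]
    intro n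
    rw [integral_mul_const, space, ← intervalIntegral.integral_of_le zero_le_one]
    rcases eq_or_ne n 0 with rfl | hn
    · simp
    · have hc : Complex.I * ((2 * Real.pi * (n : ℝ) : ℝ) : ℂ) ≠ 0 := by
        refine mul_ne_zero Complex.I_ne_zero (Complex.ofReal_ne_zero.2 ?_)
        have := Real.pi_ne_zero
        have : (n : ℝ) ≠ 0 := Int.cast_ne_zero.2 hn
        positivity
      have hne : (2 * Real.pi * (n : ℝ)) ∉ ({0} : Set ℝ) := by
        intro h
        rw [Set.mem_singleton_iff] at h
        rw [h] at hc
        simp at hc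
      have h3 := integral_exp_mul_complex (a := 0) (b := 1) hc
      rw [Set.indicator_of_notMem hne, h3]
      have h4 : Complex.exp (Complex.I * ((2 * Real.pi * (n : ℝ) : ℝ) : ℂ)) = 1 := by
        rw [Complex.exp_eq_one_iff]
        exact ⟨n, by push_cast; ring⟩
      rw [Complex.ofReal_one, Complex.ofReal_zero, mul_one, mul_zero, h4, Complex.exp_zero, sub_self,
        zero_div, zero_mul]
  rw [integral_congr_ae h2, integral_indicator (measurableSet_singleton 0)]
  have h3 : (freq .circle).restrict {0} = Measure.dirac 0 := by
    ext S hS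
    rw [Measure.restrict_apply hS, freq, Measure.sum_apply _ (hS.inter (measurableSet_singleton 0)),
      tsum_eq_single 0]
    · rw [Measure.dirac_apply' _ (hS.inter (measurableSet_singleton 0)), Measure.dirac_apply' _ hS]
      by_cases h : (0 : ℝ) ∈ S <;> simp [h]
    · intro n hn
      rw [Measure.dirac_apply' _ (hS.inter (measurableSet_singleton 0))]
      have := Real.pi_ne_zero
      simp [hn, this]
  rw [h3, integral_dirac]

/-- On the circle the product is itself the function with Fourier transform `conv (reflConj φ) ψ`,
whose zero mode is the pairing of φ and ψ. -/
theorem plancherel (hφ : IsSmooth G φ) (hψ : IsSmooth G ψ) :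
    Integrable (fun x => conj (synth G φ x) * synth G ψ x) (space G) ∧
      ∫ x, conj (synth G φ x) * synth G ψ x ∂(space G) = ∫ ξ, conj (φ ξ) * ψ ξ ∂(freq G) := by
  cases G
  · exact plancherel_line hφ.integrable hφ.memLp hψ.integrable hψ.memLp
  · have hr := hφ.reflConj
    have he : ∀ x, conj (synth .circle φ x) * synth .circle ψ x =
        synth .circle (conv .circle (reflConj φ) ψ) x := fun x => by
      rw [conj_synth, synth_conv hr.integrable hψ.integrable]
    simp_rw [he]
    have hc := hr.conv hψ
    constructor
    · unfold space
      exact hc.continuous_synth.continuousOn.integrableOn_compact isCompact_Icc |>.mono_set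
        Set.Ioc_subset_Icc_self
    · rw [integral_synth_circle hc.integrable, conv, fourierConst, Complex.ofReal_one, one_mul]
      simp only [reflConj, zero_sub, neg_neg]

theorem integrable_synth_mul (hφ : IsSmooth G φ) (hψ : IsSmooth G ψ) :
    Integrable (fun x => synth G φ x * synth G ψ x) (space G) := by
  refine (plancherel hφ.reflConj hψ).1.congr (Eventually.of_forall fun x => ?_)
  simp only
  rw [← conj_synth, Complex.conj_conj]

theorem integral_synth_mul (hφ : IsSmooth G φ) (hψ : IsSmooth G ψ) :
    ∫ x, synth G φ x * synth G ψ x ∂(space G) = ∫ ξ, φ (-ξ) * ψ ξ ∂(freq G) := by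
  have h := (plancherel hφ.reflConj hψ).2
  simp only [← conj_synth, Complex.conj_conj] at h
  rw [h]
  simp only [reflConj, Complex.conj_conj]

theorem ae_eq_zero_of_synth (hφ : IsSmooth G φ) (h : ∀ x, synth G φ x = 0) : φ =ᵐ[freq G] 0 := by
  have h1 := (plancherel hφ hφ).2
  simp only [h, mul_zero, integral_zero] at h1
  have h2 : ∀ ξ, conj (φ ξ) * φ ξ = ((‖φ ξ‖ ^ 2 : ℝ) : ℂ) := fun ξ => by
    rw [mul_comm, Complex.mul_conj, Complex.normSq_eq_norm_sq]
  simp only [h2] at h1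
  rw [integral_complex_ofReal] at h1
  have h3 := (Complex.ofReal_eq_zero.1 h1.symm)
  rw [integral_eq_zero_iff_of_nonneg (fun ξ => by positivity)
    (hφ.memLp.integrable_norm_pow two_ne_zero)] at h3
  filter_upwards [h3] with ξ hξ
  simpa using hξ

theorem ae_eq_of_synth (hφ : IsSmooth G φ) (hψ : IsSmooth G ψ)
    (h : ∀ x, synth G φ x = synth G ψ x) : φ =ᵐ[freq G] ψ := by
  have h1 := ae_eq_zero_of_synth (hφ.sub hψ) fun x => by
    rw [synth_sub hφ.integrable hψ.integrable, Pi.sub_apply, h, sub_self]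
  filter_upwards [h1] with ξ hξ
  simpa [sub_eq_zero] using hξ

end Synth

/-! ### Smooth functions with restricted spectrum, and functions of mean zero -/

/-- `F` is the function with Fourier transform in `H^∞`, supported in `S`. -/
def HasSpectrum (G : Geometry) (S : Set ℝ) (F : ℝ → ℂ) : Prop :=
  ∃ φ : ℝ → ℂ, IsSmooth G φ ∧ (∀ᵐ ξ ∂(freq G), ξ ∉ S → φ ξ = 0) ∧ F = synth G φ

/-- A constant function. -/
abbrev cst (c : ℂ) : ℝ → ℂ := fun _ => c

/-- The integrable functions with integral zero. -/
def meanZero (G : Geometry) : Submodule ℂ (ℝ → ℂ) where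
  carrier := {F | Integrable F (space G) ∧ ∫ x, F x ∂(space G) = 0}
  add_mem' := fun {F H} hF hH => ⟨hF.1.add hH.1, by
    simp only [Pi.add_apply]
    rw [integral_add hF.1 hH.1, hF.2, hH.2, add_zero]⟩
  zero_mem' := ⟨integrable_zero _ _ _, by simp⟩
  smul_mem' := fun c F hF => ⟨hF.1.smul c, by
    simp only [Pi.smul_apply]
    rw [integral_smul, hF.2, smul_zero]⟩

section Spectrum

variable {G : Geometry} {S T U : Set ℝ} {F H : ℝ → ℂ}

theorem HasSpectrum.mono (hF : HasSpectrum G S F) (h : S ⊆ T) : HasSpectrum G T F := by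
  obtain ⟨φ, h1, h2, rfl⟩ := hF
  refine ⟨φ, h1, ?_, rfl⟩
  filter_upwards [h2] with ξ hξ hT using hξ fun hS => hT (h hS)

theorem HasSpectrum.add (hF : HasSpectrum G S F) (hH : HasSpectrum G S H) :
    HasSpectrum G S (F + H) := by
  obtain ⟨φ, h1, h2, rfl⟩ := hF
  obtain ⟨ψ, h3, h4, rfl⟩ := hH
  refine ⟨φ + ψ, h1.add h3, ?_, (synth_add h1.integrable h3.integrable).symm⟩
  filter_upwards [h2, h4] with ξ h5 h6 hS
  rw [Pi.add_apply, h5 hS, h6 hS, add_zero]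

theorem HasSpectrum.sub (hF : HasSpectrum G S F) (hH : HasSpectrum G S H) :
    HasSpectrum G S (F - H) := by
  obtain ⟨φ, h1, h2, rfl⟩ := hF
  obtain ⟨ψ, h3, h4, rfl⟩ := hH
  refine ⟨φ - ψ, h1.sub h3, ?_, (synth_sub h1.integrable h3.integrable).symm⟩
  filter_upwards [h2, h4] with ξ h5 h6 hS
  rw [Pi.sub_apply, h5 hS, h6 hS, sub_zero]

theorem HasSpectrum.cst_mul (hF : HasSpectrum G S F) (c : ℂ) : HasSpectrum G S (cst c * F) := by
  obtain ⟨φ, h1, h2, rfl⟩ := hF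
  refine ⟨c • φ, h1.smul c, ?_, ?_⟩
  · filter_upwards [h2] with ξ h5 hS
    rw [Pi.smul_apply, h5 hS, smul_zero]
  · rw [synth_smul]
    rfl

theorem HasSpectrum.mul (hF : HasSpectrum G S F) (hH : HasSpectrum G T H)
    (h : ∀ x ∈ S, ∀ y ∈ T, x + y ∈ U) : HasSpectrum G U (F * H) := by
  obtain ⟨φ, h1, h2, rfl⟩ := hF
  obtain ⟨ψ, h3, h4, rfl⟩ := hH
  refine ⟨conv G φ ψ, h1.conv h3, ?_, ?_⟩
  · have h5 : ∀ᵐ p : ℝ × ℝ ∂((freq G).prod (freq G)), p.1 - p.2 ∉ S → φ (p.1 - p.2) = 0 :=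
      (quasiMeasurePreserving_sub_freq G).ae h2
    filter_upwards [Measure.ae_ae_of_ae_prod h5] with ξ h6 hU
    rw [conv, integral_eq_zero_of_ae, mul_zero]
    filter_upwards [h6, h4] with η h7 h8
    by_cases hη : η ∈ T
    · have : ξ - η ∉ S := fun hS => hU (by simpa using h _ hS _ hη)
      rw [h7 this, zero_mul, Pi.zero_apply]
    · rw [h8 hη, mul_zero, Pi.zero_apply]
  · funext x
    rw [Pi.mul_apply, synth_conv h1.integrable h3.integrable]

theorem HasSpectrum.differentiable (hF : HasSpectrum G S F) : Differentiable ℝ F := by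
  obtain ⟨φ, h1, h2, rfl⟩ := hF
  exact fun x => (h1.hasDerivAt_synth x).differentiableAt

theorem HasSpectrum.deriv (hF : HasSpectrum G S F) (h : S \ {0} ⊆ T) :
    HasSpectrum G T (deriv F) := by
  obtain ⟨φ, h1, h2, rfl⟩ := hF
  refine HasSpectrum.mono ⟨dx φ, h1.dx, ?_, h1.deriv_synth⟩ h
  filter_upwards [h2] with ξ h3 h4
  by_cases hS : ξ ∈ S
  · have : ξ = 0 := by
      by_contra h0
      exact h4 ⟨hS, h0⟩
    simp [dx, this]
  · simp [dx, h3 hS]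

theorem HasSpectrum.star (hF : HasSpectrum G S F) (h : ∀ x ∈ S, -x ∈ T) :
    HasSpectrum G T (star F) := by
  obtain ⟨φ, h1, h2, rfl⟩ := hF
  refine ⟨reflConj φ, h1.reflConj, ?_, funext fun x => conj_synth φ x⟩
  filter_upwards [(measurePreserving_neg_freq G).quasiMeasurePreserving.ae h2] with ξ h3 hT
  rw [reflConj, h3 fun hS => hT (by simpa using h _ hS), map_zero]

theorem HasSpectrum.split (hF : HasSpectrum G T F) (hS : MeasurableSet S) :
    ∃ F₁ F₂, HasSpectrum G S F₁ ∧ HasSpectrum G Sᶜ F₂ ∧ F = F₁ + F₂ := by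
  obtain ⟨φ, h1, h2, rfl⟩ := hF
  refine ⟨_, _, ⟨S.indicator φ, h1.indicator hS, Eventually.of_forall fun ξ hξ =>
    Set.indicator_of_notMem hξ _, rfl⟩, ⟨Sᶜ.indicator φ, h1.indicator hS.compl,
    Eventually.of_forall fun ξ hξ => Set.indicator_of_notMem hξ _, rfl⟩, ?_⟩
  rw [← synth_add (h1.indicator hS).integrable (h1.indicator hS.compl).integrable,
    Set.indicator_self_add_compl]

/-- On the circle the constant is the zero mode; on the line a single frequency is null and the
constant is zero. The two geometries can thus be treated together below. -/
theorem HasSpectrum.exists_mode (hF : HasSpectrum G S F) (h : S \ {0} ⊆ T) :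
    ∃ c : ℂ, HasSpectrum G {0} (cst c) ∧ HasSpectrum G T (F - cst c) := by
  obtain ⟨φ, h1, h2, rfl⟩ := hF
  have h0 : MeasurableSet ({0} : Set ℝ) := measurableSet_singleton 0
  have h3 : synth G (Set.indicator {0} φ) = cst (synth G (Set.indicator {0} φ) 0) := by
    funext x
    simp only [synth]
    congr 1
    refine integral_congr_ae (Eventually.of_forall fun ξ => ?_)
    by_cases hξ : ξ = 0
    · simp [hξ]
    · simp [hξ]
  have h4 : HasSpectrum G {0} (cst (synth G (Set.indicator {0} φ) 0)) :=
    ⟨_, h1.indicator h0, Eventually.of_forall fun ξ hξ => Set.indicator_of_notMem hξ _, h3.symm⟩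
  refine ⟨_, h4, ?_⟩
  rw [← h3, ← synth_sub h1.integrable (h1.indicator h0).integrable]
  refine HasSpectrum.mono ⟨_, h1.sub (h1.indicator h0), ?_, rfl⟩ h
  filter_upwards [h2] with ξ h5 h6
  by_cases hξ : ξ = 0
  · simp [hξ]
  · have : ξ ∉ S := fun hS => h6 ⟨hS, hξ⟩
    simp [hξ, h5 this]

theorem HasSpectrum.eq_zero (hF : HasSpectrum G S F) (hF' : HasSpectrum G T F)
    (h : Disjoint S T) : F = 0 := by
  obtain ⟨φ, h1, h2, rfl⟩ := hF
  obtain ⟨ψ, h3, h4, h5⟩ := hF'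
  have h6 := ae_eq_of_synth h1 h3 fun x => congrFun h5 x
  have h7 : φ =ᵐ[freq G] 0 := by
    filter_upwards [h2, h4, h6] with ξ h8 h9 h10
    by_cases hS : ξ ∈ S
    · rw [h10, h9 (h.notMem_of_mem_left hS), Pi.zero_apply]
    · rw [h8 hS, Pi.zero_apply]
  rw [synth_congr h7]
  funext x
  simp [synth]

theorem HasSpectrum.deriv_mul (hF : HasSpectrum G S F) (hH : HasSpectrum G T H) :
    _root_.deriv (F * H) = _root_.deriv F * H + F * _root_.deriv H := funext fun x => by
  rw [_root_.deriv_mul (hF.differentiable x) (hH.differentiable x)]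
  rfl

theorem HasSpectrum.deriv_add (hF : HasSpectrum G S F) (hH : HasSpectrum G T H) :
    _root_.deriv (F + H) = _root_.deriv F + _root_.deriv H := funext fun x => by
  rw [_root_.deriv_add (hF.differentiable x) (hH.differentiable x)]
  rfl

theorem HasSpectrum.deriv_sub (hF : HasSpectrum G S F) (hH : HasSpectrum G T H) :
    _root_.deriv (F - H) = _root_.deriv F - _root_.deriv H := funext fun x => by
  rw [_root_.deriv_sub (hF.differentiable x) (hH.differentiable x)]
  rfl

theorem HasSpectrum.integrable_mul (hF : HasSpectrum G S F) (hH : HasSpectrum G T H) :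
    Integrable (F * H) (space G) := by
  obtain ⟨φ, h1, h2, rfl⟩ := hF
  obtain ⟨ψ, h3, h4, rfl⟩ := hH
  exact integrable_synth_mul h1 h3

/-- By Plancherel the integral pairs the frequency -ξ of one factor with ξ of the other, and no such
pair lies in the two supports. -/
theorem HasSpectrum.mul_mem (hF : HasSpectrum G S F) (hH : HasSpectrum G T H)
    (h : ∀ x ∈ S, ∀ y ∈ T, x + y ≠ 0) : F * H ∈ meanZero G := by
  refine ⟨hF.integrable_mul hH, ?_⟩
  obtain ⟨φ, h1, h2, rfl⟩ := hF
  obtain ⟨ψ, h3, h4, rfl⟩ := hH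
  simp only [Pi.mul_apply]
  rw [integral_synth_mul h1 h3, integral_eq_zero_of_ae]
  filter_upwards [(measurePreserving_neg_freq G).quasiMeasurePreserving.ae h2, h4] with ξ h5 h6
  by_cases hS : -ξ ∈ S
  · by_cases hT : ξ ∈ T
    · exact absurd (by ring) (h _ hS _ hT)
    · rw [h6 hT, mul_zero, Pi.zero_apply]
  · rw [h5 hS, zero_mul, Pi.zero_apply]

/-- Integration by parts on the Fourier side, where the symbol iξ is odd and no boundary term
appears. -/
theorem HasSpectrum.deriv_mul_mem (hF : HasSpectrum G S F) (hH : HasSpectrum G T H) :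
    _root_.deriv F * H + F * _root_.deriv H ∈ meanZero G := by
  have hF' := hF.deriv Set.sdiff_subset
  have hH' := hH.deriv Set.sdiff_subset
  refine ⟨(hF'.integrable_mul hH).add (hF.integrable_mul hH'), ?_⟩
  have e1 : ∫ x, (_root_.deriv F * H + F * _root_.deriv H) x ∂(space G) =
      (∫ x, (_root_.deriv F * H) x ∂(space G)) + ∫ x, (F * _root_.deriv H) x ∂(space G) :=
    integral_add (hF'.integrable_mul hH) (hF.integrable_mul hH')
  rw [e1]
  obtain ⟨φ, h1, h2, rfl⟩ := hF
  obtain ⟨ψ, h3, h4, rfl⟩ := hH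
  simp only [Pi.mul_apply, h1.deriv_synth, h3.deriv_synth]
  rw [integral_synth_mul h1.dx h3, integral_synth_mul h1 h3.dx, ← eq_neg_iff_add_eq_zero,
    ← integral_neg]
  congr 1
  funext ξ
  simp only [dx]
  push_cast; ring

theorem cst_mul_mem (c : ℂ) (hF : F ∈ meanZero G) : cst c * F ∈ meanZero G :=
  (meanZero G).smul_mem c hF

theorem cst_mul_mem_iff {c : ℂ} (hc : c ≠ 0) : cst c * F ∈ meanZero G ↔ F ∈ meanZero G :=
  (meanZero G).smul_mem_iff (x := F) hc

/-- On the line a nonzero constant is not integrable; on the circle its integral is a nonzero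
multiple of it. -/
theorem eq_zero_of_cst_mem {c : ℂ} (h : cst c ∈ meanZero G) : c = 0 := by
  obtain ⟨h1, h2⟩ := h
  rcases integrable_const_iff.1 h1 with h3 | h3
  · exact h3
  · rw [integral_const, smul_eq_zero] at h2
    refine h2.resolve_left fun h4 => ?_
    have h5 : space G Set.univ ≠ 0 := by
      cases G <;> simp [space]
    rw [measureReal_eq_zero_iff h3.measure_univ_lt_top.ne] at h4
    exact h5 h4

end Spectrum

/-! ### The commutation relations -/

section Commutation

variable {G : Geometry} {F H : ℝ → ℂ}

theorem HasSpectrum.neg_nonpos (h : HasSpectrum G (Set.Iio 0) F) : HasSpectrum G (Set.Iic 0) F :=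
  h.mono Set.Iio_subset_Iic_self

theorem HasSpectrum.pos_nonneg (h : HasSpectrum G (Set.Ioi 0) F) : HasSpectrum G (Set.Ici 0) F :=
  h.mono Set.Ioi_subset_Ici_self

theorem HasSpectrum.toUniv {S : Set ℝ} (h : HasSpectrum G S F) : HasSpectrum G Set.univ F :=
  h.mono (Set.subset_univ _)

theorem HasSpectrum.mul_neg (hF : HasSpectrum G (Set.Iio 0) F) (hH : HasSpectrum G (Set.Iic 0) H) :
    HasSpectrum G (Set.Iio 0) (F * H) :=
  hF.mul hH fun x hx y hy => by
    simp only [Set.mem_Iio, Set.mem_Iic] at *; linarith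

theorem HasSpectrum.mul_pos (hF : HasSpectrum G (Set.Ioi 0) F) (hH : HasSpectrum G (Set.Ici 0) H) :
    HasSpectrum G (Set.Ioi 0) (F * H) :=
  hF.mul hH fun x hx y hy => by
    simp only [Set.mem_Ioi, Set.mem_Ici] at *; linarith

theorem HasSpectrum.mul_nonneg (hF : HasSpectrum G (Set.Ici 0) F)
    (hH : HasSpectrum G (Set.Ici 0) H) : HasSpectrum G (Set.Ici 0) (F * H) :=
  hF.mul hH fun x hx y hy => by
    simp only [Set.mem_Ici] at *; linarith

theorem HasSpectrum.mul_univ {S T : Set ℝ} (hF : HasSpectrum G S F) (hH : HasSpectrum G T H) :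
    HasSpectrum G Set.univ (F * H) := hF.mul hH fun _ _ _ _ => Set.mem_univ _

theorem mem_of_neg (hF : HasSpectrum G (Set.Iio 0) F) (hH : HasSpectrum G (Set.Iic 0) H) :
    F * H ∈ meanZero G :=
  hF.mul_mem hH fun x hx y hy => by
    simp only [Set.mem_Iio, Set.mem_Iic] at *; linarith

theorem mem_of_pos (hF : HasSpectrum G (Set.Ioi 0) F) (hH : HasSpectrum G (Set.Ici 0) H) :
    F * H ∈ meanZero G :=
  hF.mul_mem hH fun x hx y hy => by
    simp only [Set.mem_Ioi, Set.mem_Ici] at *; linarith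

theorem HasSpectrum.deriv_nonneg (hF : HasSpectrum G (Set.Ici 0) F) :
    HasSpectrum G (Set.Ioi 0) (_root_.deriv F) :=
  hF.deriv fun _ hx => lt_of_le_of_ne hx.1 (Ne.symm hx.2)

theorem HasSpectrum.deriv_nonpos (hF : HasSpectrum G (Set.Iic 0) F) :
    HasSpectrum G (Set.Iio 0) (_root_.deriv F) :=
  hF.deriv fun _ hx => lt_of_le_of_ne hx.1 hx.2

theorem HasSpectrum.exists_mode_nonneg (hF : HasSpectrum G (Set.Ici 0) F) :
    ∃ c : ℂ, HasSpectrum G {0} (cst c) ∧ HasSpectrum G (Set.Ioi 0) (F - cst c) :=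
  hF.exists_mode fun _ hx => lt_of_le_of_ne hx.1 (Ne.symm hx.2)

theorem HasSpectrum.exists_mode_nonpos (hF : HasSpectrum G (Set.Iic 0) F) :
    ∃ c : ℂ, HasSpectrum G {0} (cst c) ∧ HasSpectrum G (Set.Iio 0) (F - cst c) :=
  hF.exists_mode fun _ hx => lt_of_le_of_ne hx.1 hx.2

/-- `m = (ℒ_u + z)⁻¹ u₊`, as a smooth function, with `g` the negative frequencies of `u (1 + m)`. -/
structure IsGauge (G : Geometry) (u : ℝ → ℂ) (z : ℂ) (m g : ℝ → ℂ) : Prop where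
  spec : HasSpectrum G (Set.Ici 0) m
  rest : HasSpectrum G (Set.Iio 0) g
  eq : u * (1 + m) = -(cst Complex.I * deriv m) + cst z * m + g

/-- The complex conjugate of the equation for the gauge. -/
structure IsCogauge (G : Geometry) (u : ℝ → ℂ) (z : ℂ) (n h : ℝ → ℂ) : Prop where
  spec : HasSpectrum G (Set.Iic 0) n
  rest : HasSpectrum G (Set.Ioi 0) h
  eq : u * (1 + n) = cst Complex.I * deriv n + cst z * n + h

theorem IsGauge.isCogauge {u m g : ℝ → ℂ} {z : ℂ} (hu : star u = u) (h : IsGauge G u (conj z) m g) :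
    IsCogauge G u z (star m) (star g) where
  spec := h.spec.star fun x hx => by simpa using hx
  rest := h.rest.star fun x hx => by simpa using hx
  eq := by
    have h1 := congrArg star h.eq
    have h2 : deriv (star m) = star (deriv m) := funext fun x => by
      have := (h.spec.differentiable x).hasDerivAt.star
      exact this.deriv
    funext x
    have h3 := congrFun h1 x
    have h4 := congrFun hu x
    simp only [Pi.star_apply, Pi.mul_apply, Pi.add_apply, Pi.one_apply, Pi.neg_apply, star_mul',
      star_add, star_neg, star_one, RCLike.star_def, Complex.conj_I, Complex.conj_conj] at h3 h4 ⊢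
    rw [h2, Pi.star_apply, RCLike.star_def]
    rw [h4] at h3
    linear_combination h3

variable {u m g n h : ℝ → ℂ} {z : ℂ}

/-- Multiplying each equation by the other unknown and subtracting cancels z m n and leaves a total
derivative together with products of one-signed spectrum. -/
theorem pairing_sub_mem (hm : IsGauge G u z m g) (hn : IsCogauge G u z n h) :
    u * (m - n) ∈ meanZero G := by
  have e : u * (m - n) = cst Complex.I * (deriv m * n + m * deriv n) + h * m - g * n := by
    linear_combination m * hn.eq - n * hm.eq
  rw [e]
  exact sub_mem (add_mem (cst_mul_mem _ (hm.spec.deriv_mul_mem hn.spec))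
    (mem_of_pos hn.rest hm.spec)) (mem_of_neg hm.rest hn.spec)

/-- The density `m + n̄ + m n̄` of the derivative of `β`. -/
def density (m n : ℝ → ℂ) : ℝ → ℂ := m + n + m * n

theorem hasSpectrum_density (hm : IsGauge G u z m g) (hn : IsCogauge G u z n h) :
    HasSpectrum G Set.univ (density m n) :=
  (hm.spec.toUniv.add hn.spec.toUniv).add (hm.spec.mul_univ hn.spec)

theorem deriv_density (hm : IsGauge G u z m g) (hn : IsCogauge G u z n h) :
    deriv (density m n) = deriv m * (1 + n) + (1 + m) * deriv n := by
  rw [density, (hm.spec.toUniv.add hn.spec.toUniv).deriv_add (hm.spec.mul_univ hn.spec),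
    hm.spec.toUniv.deriv_add hn.spec.toUniv, hm.spec.deriv_mul hn.spec]
  ring

/-- Multiplying the equations by 1 + n and 1 + m and subtracting eliminates the potential. -/
theorem deriv_density_eq (hm : IsGauge G u z m g) (hn : IsCogauge G u z n h) :
    cst Complex.I * deriv (density m n) = cst z * (m - n) + g * (1 + n) - h * (1 + m) := by
  rw [deriv_density hm hn]
  linear_combination (1 + n) * hm.eq - (1 + m) * hn.eq

/-- Integration by parts puts the derivative on the density, which `deriv_density_eq` then expresses
without derivatives. -/
theorem mul_deriv_mem_iff {S : Set ℝ} {W : ℝ → ℂ} (hm : IsGauge G u z m g)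
    (hn : IsCogauge G u z n h) (hW : HasSpectrum G S W) :
    density m n * deriv W ∈ meanZero G ↔
      (cst z * (m - n) + g * (1 + n) - h * (1 + m)) * W ∈ meanZero G := by
  have h1 := (hasSpectrum_density hm hn).deriv_mul_mem hW
  rw [← deriv_density_eq hm hn, mul_assoc, cst_mul_mem_iff Complex.I_ne_zero]
  constructor
  · intro h2
    have := sub_mem h1 h2
    rwa [add_sub_cancel_right] at this
  · intro h2
    have := sub_mem h1 h2
    rwa [add_sub_cancel_left] at this

/-- After integration by parts the products of u with 1 + n and 1 + m are replaced by means of the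
two equations, and the products g h, of mixed sign, cancel. -/
theorem density_translation_mem {S : Set ℝ} (hu : HasSpectrum G S u) (hm : IsGauge G u z m g)
    (hn : IsCogauge G u z n h) : density m n * deriv u ∈ meanZero G := by
  rw [mul_deriv_mem_iff hm hn hu]
  have e : (cst z * (m - n) + g * (1 + n) - h * (1 + m)) * u = cst z * (u * (m - n)) +
      cst Complex.I * (g * deriv n) + cst z * (g * n) + cst Complex.I * (h * deriv m) -
      cst z * (h * m) := by
    linear_combination g * hn.eq - h * hm.eq
  rw [e]
  exact sub_mem (add_mem (add_mem (add_mem (cst_mul_mem _ (pairing_sub_mem hm hn))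
    (cst_mul_mem _ (mem_of_neg hm.rest hn.spec.deriv_nonpos.neg_nonpos)))
    (cst_mul_mem _ (mem_of_neg hm.rest hn.spec)))
    (cst_mul_mem _ (mem_of_pos hn.rest hm.spec.deriv_nonneg.pos_nonneg)))
    (cst_mul_mem _ (mem_of_pos hn.rest hm.spec))

/-- With u = v + w split into nonnegative and negative frequencies, the gradient is -iv' + iw' - u².
The remainders k = (1 + n) v - h and l = (1 + m) w - g turn out to have nonpositive and nonnegative
spectrum. In terms of them, the integrand is a sum of twenty terms, each a total derivative, a
product of one-signed spectrum, or a multiple of u (m - n). -/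
theorem density_BO_mem {v w : ℝ → ℂ} (hv : HasSpectrum G (Set.Ici 0) v)
    (hw : HasSpectrum G (Set.Iio 0) w) (hu : u = v + w) (hm : IsGauge G u z m g)
    (hn : IsCogauge G u z n h) :
    density m n * deriv (-(cst Complex.I * deriv v) + cst Complex.I * deriv w - u * u) ∈
      meanZero G := by
  have hv' := hv.deriv_nonneg
  have hw' := hw.neg_nonpos.deriv_nonpos
  have hm' := hm.spec.deriv_nonneg
  have hn' := hn.spec.deriv_nonpos
  have hus : HasSpectrum G Set.univ u := hu ▸ hv.toUniv.add hw.toUniv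
  have hL : HasSpectrum G Set.univ
      (-(cst Complex.I * deriv v) + cst Complex.I * deriv w - u * u) := by
    have : -(cst Complex.I * deriv v) + cst Complex.I * deriv w - u * u =
      cst Complex.I * deriv w - cst Complex.I * deriv v - u * u := by ring
    rw [this]
    exact ((hw'.toUniv.cst_mul _).sub (hv'.toUniv.cst_mul _)).sub (hus.mul_univ hus)
  rw [mul_deriv_mem_iff hm hn hL]
  -- Subtracting h removes the positive frequencies: by the equation for n what is left is in' + zn
  -- - (1 + n) w, a combination of functions with no positive frequencies.
  have hk : HasSpectrum G (Set.Iic 0) ((1 + n) * v - h) := by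
    have : (1 + n) * v - h = cst Complex.I * deriv n + cst z * n - (w + w * n) := by
      linear_combination hn.eq - (1 + n) * hu
    rw [this]
    exact ((hn'.neg_nonpos.cst_mul _).add (hn.spec.cst_mul _)).sub
      (hw.neg_nonpos.add (hw.mul_neg hn.spec).neg_nonpos)
  have hl : HasSpectrum G (Set.Ici 0) ((1 + m) * w - g) := by
    have : (1 + m) * w - g = cst z * m - cst Complex.I * deriv m - (v + v * m) := by
      linear_combination hm.eq - (1 + m) * hu
    rw [this]
    exact ((hm.spec.cst_mul _).sub (hm'.pos_nonneg.cst_mul _)).sub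
      (hv.add (hv.mul_nonneg hm.spec))
  have hnv : HasSpectrum G Set.univ (v + n * v) := hv.toUniv.add (hn.spec.mul_univ hv)
  have hmw : HasSpectrum G Set.univ (w + m * w) := hw.toUniv.add (hm.spec.mul_univ hw)
  have dk : deriv ((1 + n) * v - h) = deriv n * v + (1 + n) * deriv v - deriv h := by
    rw [add_mul, one_mul, hnv.deriv_sub hn.rest, hv.toUniv.deriv_add (hn.spec.mul_univ hv),
      hn.spec.deriv_mul hv]
    ring
  have dl : deriv ((1 + m) * w - g) = deriv m * w + (1 + m) * deriv w - deriv g := by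
    rw [add_mul, one_mul, hmw.deriv_sub hm.rest, hw.toUniv.deriv_add (hm.spec.mul_univ hw),
      hm.spec.deriv_mul hw]
    ring
  set k := (1 + n) * v - h with hkd
  set l := (1 + m) * w - g with hld
  have e : (cst z * (m - n) + g * (1 + n) - h * (1 + m)) *
      (-(cst Complex.I * deriv v) + cst Complex.I * deriv w - u * u) =
      cst (-Complex.I) * (deriv g * h + g * deriv h)
      + cst (-Complex.I) * (g * deriv k) + cst (-Complex.I) * (h * deriv l)
      + cst Complex.I * (g * (deriv w + deriv w * n)) + cst Complex.I * (h * (deriv v + deriv v * m))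
      + cst (-Complex.I) * (g * (w * deriv n)) + cst (-Complex.I) * (h * (v * deriv m))
      + cst (-z) * (g * (w * n)) + cst (-z) * (g * k) + cst z * (h * (v * m)) + cst z * (h * l)
      + cst (-(Complex.I * z)) * (deriv v * m) + cst (-(Complex.I * z)) * (deriv w * n)
      + cst (Complex.I * z) * (deriv m * v) + cst (Complex.I * z) * (deriv n * w)
      + cst (Complex.I * z) * (deriv m * w + m * deriv w)
      + cst (Complex.I * z) * (deriv n * v + n * deriv v)
      + cst (-(z * z)) * (u * (m - n)) + cst (-z) * (g * w) + cst z * (h * v) := by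
    rw [show cst (-Complex.I) = -cst Complex.I from rfl, show cst (-z) = -cst z from rfl,
      show cst (-(Complex.I * z)) = -(cst Complex.I * cst z) from rfl,
      show cst (Complex.I * z) = cst Complex.I * cst z from rfl,
      show cst (-(z * z)) = -(cst z * cst z) from rfl]
    rw [dk, dl, hkd, hld]
    subst hu
    linear_combination ((v + w) * h - cst z * (v + w)) * hm.eq + (cst z * (v + w) - (v + w) * g) * hn.eq
  rw [e]
  have hgk := mem_of_neg hm.rest hk
  have hhl := mem_of_pos hn.rest hl
  refine add_mem (add_mem (add_mem (add_mem (add_mem (add_mem (add_mem (add_mem (add_mem (add_mem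
    (add_mem (add_mem (add_mem (add_mem (add_mem (add_mem (add_mem (add_mem (add_mem
    ?_ ?_) ?_) ?_) ?_) ?_) ?_) ?_) ?_) ?_) ?_) ?_) ?_) ?_) ?_) ?_) ?_) ?_) ?_) ?_
  all_goals refine cst_mul_mem _ ?_
  · exact hm.rest.deriv_mul_mem hn.rest
  · exact mem_of_neg hm.rest hk.deriv_nonpos.neg_nonpos
  · exact mem_of_pos hn.rest hl.deriv_nonneg.pos_nonneg
  · exact mem_of_neg hm.rest (hw'.neg_nonpos.add (hw'.mul_neg hn.spec).neg_nonpos)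
  · exact mem_of_pos hn.rest (hv'.pos_nonneg.add (hv'.mul_pos hm.spec).pos_nonneg)
  · exact mem_of_neg hm.rest (hw.mul_neg hn'.neg_nonpos).neg_nonpos
  · exact mem_of_pos hn.rest (hv.mul_nonneg hm'.pos_nonneg)
  · exact mem_of_neg hm.rest (hw.mul_neg hn.spec).neg_nonpos
  · exact hgk
  · exact mem_of_pos hn.rest (hv.mul_nonneg hm.spec)
  · exact hhl
  · exact mem_of_pos hv' hm.spec
  · exact mem_of_neg hw' hn.spec
  · exact mem_of_pos hm' hv
  · exact mem_of_neg hn' hw.neg_nonpos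
  · exact hm.spec.deriv_mul_mem hw
  · exact hn.spec.deriv_mul_mem hv
  · exact pairing_sub_mem hm hn
  · exact mem_of_neg hm.rest hw.neg_nonpos
  · exact mem_of_pos hn.rest hv

end Commutation

/-! ### Zero modes, and commutation of β(z) with β(κ). -/

section Commutation

variable {G : Geometry} {u m g n h : ℝ → ℂ} {z : ℂ}

theorem mem_of_const_pos {F : ℝ → ℂ} {c : ℂ} (hc : HasSpectrum G {0} (cst c))
    (hF : HasSpectrum G (Set.Ioi 0) F) : cst c * F ∈ meanZero G :=
  hc.mul_mem hF fun x hx y hy => by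
    simp only [Set.mem_singleton_iff, Set.mem_Ioi] at *; rw [hx, zero_add]; exact hy.ne'

theorem mem_of_const_neg {F : ℝ → ℂ} {c : ℂ} (hc : HasSpectrum G {0} (cst c))
    (hF : HasSpectrum G (Set.Iio 0) F) : cst c * F ∈ meanZero G :=
  hc.mul_mem hF fun x hx y hy => by
    simp only [Set.mem_singleton_iff, Set.mem_Iio] at *; rw [hx, zero_add]; exact hy.ne

/-- Multiply the identity behind `pairing_sub_mem` by a constant d supported at frequency zero: all
terms but d z (m₀ - n₀) integrate to zero. Taking d conjugate to m₀ - n₀ keeps every product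
integrable on the line, where these constants vanish. -/
theorem mode_eq (hz : z ≠ 0) (hm : IsGauge G u z m g) (hn : IsCogauge G u z n h) {m₀ n₀ : ℂ}
    (hm0 : HasSpectrum G {0} (cst m₀)) (hn0 : HasSpectrum G {0} (cst n₀))
    (hm1 : HasSpectrum G (Set.Ioi 0) (m - cst m₀)) (hn1 : HasSpectrum G (Set.Iio 0) (n - cst n₀)) :
    m₀ = n₀ := by
  have hd : HasSpectrum G {0} (cst (conj (m₀ - n₀))) :=
    (hm0.sub hn0).star fun x hx => by simpa using hx
  set d := conj (m₀ - n₀) with hdd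
  have e : cst (d * (z * (m₀ - n₀))) = cst d * (u * (m - n))
      + cst Complex.I * (cst d * deriv m) + cst Complex.I * (cst d * deriv n)
      - cst d * g + cst d * h - cst z * (cst d * (m - cst m₀)) + cst z * (cst d * (n - cst n₀)) := by
    rw [show cst (d * (z * (m₀ - n₀))) = cst d * (cst z * (cst m₀ - cst n₀)) from rfl]
    linear_combination cst d * hn.eq - cst d * hm.eq
  have h1 : cst (d * (z * (m₀ - n₀))) ∈ meanZero G := by
    rw [e]
    exact add_mem (sub_mem (add_mem (sub_mem (add_mem (add_mem
      (cst_mul_mem _ (pairing_sub_mem hm hn))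
      (cst_mul_mem _ (mem_of_const_pos hd hm.spec.deriv_nonneg)))
      (cst_mul_mem _ (mem_of_const_neg hd hn.spec.deriv_nonpos)))
      (mem_of_const_neg hd hm.rest)) (mem_of_const_pos hd hn.rest))
      (cst_mul_mem _ (mem_of_const_pos hd hm1))) (cst_mul_mem _ (mem_of_const_neg hd hn1))
  have h2 := eq_zero_of_cst_mem h1
  rw [hdd, mul_eq_zero, mul_eq_zero, map_eq_zero] at h2
  rw [← sub_eq_zero]
  tauto

/-- A resolvent identity: combining the four equations, (z - κ)(na - mb) equals u (m - n) + u (a -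
b) up to total derivatives and products of one-signed spectrum. -/
theorem cross_sub_mem {a p b e : ℝ → ℂ} {κ : ℂ} (hzκ : z ≠ κ)
    (hm : IsGauge G u z m g) (hn : IsCogauge G u z n h) (ha : IsGauge G u κ a p)
    (hb : IsCogauge G u κ b e) : n * a - m * b ∈ meanZero G := by
  rw [← cst_mul_mem_iff (sub_ne_zero.2 hzκ)]
  have e1 : cst (z - κ) * (n * a - m * b) = u * (m - n) + u * (a - b)
      - cst Complex.I * (deriv m * b + m * deriv b) - cst Complex.I * (deriv a * n + a * deriv n)
      - e * m + g * b - h * a + p * n := by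
    rw [show cst (z - κ) = cst z - cst κ from rfl]
    linear_combination n * ha.eq + b * hm.eq - a * hn.eq - m * hb.eq
  rw [e1]
  exact add_mem (sub_mem (add_mem (sub_mem (sub_mem (sub_mem (add_mem (pairing_sub_mem hm hn)
    (pairing_sub_mem ha hb)) (cst_mul_mem _ (hm.spec.deriv_mul_mem hb.spec)))
    (cst_mul_mem _ (ha.spec.deriv_mul_mem hn.spec))) (mem_of_pos hb.rest hm.spec))
    (mem_of_neg hm.rest hb.spec)) (mem_of_pos hn.rest ha.spec)) (mem_of_neg ha.rest hn.spec)

/-- The equations for m and b give an identity between an expression with nonnegative frequencies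
and one with negative frequencies, so both vanish. The outcome is a first-order equation for r, the
nonnegative part of (1 + b) m, in which u no longer occurs. -/
theorem gauge_product_eq {b e r r' : ℝ → ℂ} {κ a₀ : ℂ} (hm : IsGauge G u z m g)
    (hb : IsCogauge G u κ b e) (ha0 : HasSpectrum G {0} (cst a₀))
    (hb1 : HasSpectrum G (Set.Iio 0) (b - cst a₀)) (hr : HasSpectrum G (Set.Ici 0) r)
    (hr' : HasSpectrum G (Set.Iio 0) r') (he : (1 + b) * m = r + r') :
    -(cst Complex.I * deriv r) + (cst z - cst κ) * r = e * (1 + m) - cst κ * (m - cst a₀) := by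
  have ha0' : HasSpectrum G (Set.Ici 0) (cst a₀) := ha0.mono (by simp)
  have hd : deriv r + deriv r' = deriv m + (deriv b * m + b * deriv m) := by
    rw [← hr.toUniv.deriv_add hr'.toUniv, ← he, add_mul, one_mul,
      hm.spec.toUniv.deriv_add (hb.spec.mul_univ hm.spec), hb.spec.deriv_mul hm.spec]
  have hX : cst Complex.I * deriv r - (cst z - cst κ) * r - cst κ * m + e * m + cst κ * cst a₀ + e =
      (cst z - cst κ) * r' + (g + g * b) - cst Complex.I * deriv r' - cst Complex.I * deriv b
        - cst κ * (b - cst a₀) := by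
    linear_combination cst Complex.I * hd + (cst z - cst κ) * he + (1 + b) * hm.eq
      - (1 + m) * hb.eq
  have h1 : HasSpectrum G (Set.Ici 0)
      (cst Complex.I * deriv r - (cst z - cst κ) * r - cst κ * m + e * m + cst κ * cst a₀ + e) := by
    rw [show cst z - cst κ = cst (z - κ) from rfl]
    exact (((((hr.deriv_nonneg.pos_nonneg.cst_mul _).sub (hr.cst_mul _)).sub
      (hm.spec.cst_mul _)).add (hb.rest.mul_pos hm.spec).pos_nonneg).add (ha0'.cst_mul _)).add
      hb.rest.pos_nonneg
  have h2 : HasSpectrum G (Set.Iio 0)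
      (cst Complex.I * deriv r - (cst z - cst κ) * r - cst κ * m + e * m + cst κ * cst a₀ + e) := by
    rw [hX, show cst z - cst κ = cst (z - κ) from rfl]
    exact ((((hr'.cst_mul _).add (hm.rest.add (hm.rest.mul_neg hb.spec))).sub
      (hr'.neg_nonpos.deriv_nonpos.cst_mul _)).sub (hb.spec.deriv_nonpos.cst_mul _)).sub
      (hb1.cst_mul _)
  have h3 := h1.eq_zero h2 (Set.disjoint_left.2 fun x hx hx' => (Set.mem_Ici.1 hx).not_gt (Set.mem_Iio.1 hx'))
  linear_combination -h3

theorem cogauge_product_eq {a p r r' : ℝ → ℂ} {κ a₀ : ℂ} (hn : IsCogauge G u z n h)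
    (ha : IsGauge G u κ a p) (ha0 : HasSpectrum G {0} (cst a₀))
    (ha1 : HasSpectrum G (Set.Ioi 0) (a - cst a₀)) (hr : HasSpectrum G (Set.Iic 0) r)
    (hr' : HasSpectrum G (Set.Ioi 0) r') (he : (1 + a) * n = r + r') :
    cst Complex.I * deriv r + (cst z - cst κ) * r = p * (1 + n) - cst κ * (n - cst a₀) := by
  have ha0' : HasSpectrum G (Set.Iic 0) (cst a₀) := ha0.mono (by simp)
  have hd : deriv r + deriv r' = deriv n + (deriv a * n + a * deriv n) := by
    rw [← hr.toUniv.deriv_add hr'.toUniv, ← he, add_mul, one_mul,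
      hn.spec.toUniv.deriv_add (ha.spec.mul_univ hn.spec), ha.spec.deriv_mul hn.spec]
  have hX : cst Complex.I * deriv r + (cst z - cst κ) * r + cst κ * n - p * n - cst κ * cst a₀ - p =
      -((cst z - cst κ) * r' + (h + h * a)) - cst Complex.I * deriv r' - cst Complex.I * deriv a
        + cst κ * (a - cst a₀) := by
    linear_combination cst Complex.I * hd - (cst z - cst κ) * he - (1 + a) * hn.eq
      + (1 + n) * ha.eq
  have h1 : HasSpectrum G (Set.Iic 0)
      (cst Complex.I * deriv r + (cst z - cst κ) * r + cst κ * n - p * n - cst κ * cst a₀ - p) := by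
    rw [show cst z - cst κ = cst (z - κ) from rfl]
    exact (((((hr.deriv_nonpos.neg_nonpos.cst_mul _).add (hr.cst_mul _)).add
      (hn.spec.cst_mul _)).sub (ha.rest.mul_neg hn.spec).neg_nonpos).sub (ha0'.cst_mul _)).sub
      ha.rest.neg_nonpos
  have h2 : HasSpectrum G (Set.Ioi 0)
      (cst Complex.I * deriv r + (cst z - cst κ) * r + cst κ * n - p * n - cst κ * cst a₀ - p) := by
    rw [hX, show cst z - cst κ = cst (z - κ) from rfl, ← neg_one_mul,
      show (-1 : ℝ → ℂ) = cst (-1) from rfl]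
    exact (((((hr'.cst_mul _).add (hn.rest.add (hn.rest.mul_pos ha.spec))).cst_mul _).sub
      (hr'.pos_nonneg.deriv_nonneg.cst_mul _)).sub (ha.spec.deriv_nonneg.cst_mul _)).add
      (ha1.cst_mul _)
  have h3 := h1.eq_zero h2 (Set.disjoint_left.2 fun x hx hx' => (Set.mem_Iic.1 hx).not_gt (Set.mem_Ioi.1 hx'))
  linear_combination h3

/-- The core of the integrand is (1 + b) m S - (1 + a) n T. Splitting the products as r + r' and ρ +
ρ', the terms r'S and ρ'T have one-signed spectrum. By the equations for r and ρ, the difference rS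
- ρT is i(rρ)', because the terms (z - κ) rρ cancel. -/
theorem density_gauge_mem {a p b e : ℝ → ℂ} {κ : ℂ} (hz : z ≠ 0) (hκ : κ ≠ 0) (hzκ : z ≠ κ)
    (hm : IsGauge G u z m g) (hn : IsCogauge G u z n h) (ha : IsGauge G u κ a p)
    (hb : IsCogauge G u κ b e) : density m n * deriv (density a b) ∈ meanZero G := by
  obtain ⟨m₀, hm0, hm1⟩ := hm.spec.exists_mode_nonneg
  obtain ⟨n₀, hn0, hn1⟩ := hn.spec.exists_mode_nonpos
  obtain ⟨a₀, ha0, ha1⟩ := ha.spec.exists_mode_nonneg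
  obtain ⟨b₀, hb0, hb1⟩ := hb.spec.exists_mode_nonpos
  obtain rfl := mode_eq hz hm hn hm0 hn0 hm1 hn1
  obtain rfl := mode_eq hκ ha hb ha0 hb0 ha1 hb1
  obtain ⟨r, r', hr, hr', her⟩ := (hm.spec.toUniv.add (hb.spec.mul_univ hm.spec)).split
    (measurableSet_Ici (a := (0 : ℝ)))
  obtain ⟨ρ', ρ, hρ', hρ, heρ⟩ := (hn.spec.toUniv.add (ha.spec.mul_univ hn.spec)).split
    (measurableSet_Ioi (a := (0 : ℝ)))
  rw [Set.compl_Ici] at hr'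
  rw [Set.compl_Ioi] at hρ
  have her' : (1 + b) * m = r + r' := by rw [← her]; ring
  have heρ' : (1 + a) * n = ρ + ρ' := by rw [add_comm ρ, ← heρ]; ring
  have hT := gauge_product_eq hm hb ha0 hb1 hr hr' her'
  have hS := cogauge_product_eq hn ha ha0 ha1 hρ hρ' heρ'
  have hTs : HasSpectrum G (Set.Ici 0) (e * (1 + m) - cst κ * (m - cst a₀)) := by
    rw [mul_add, mul_one]
    exact (hb.rest.pos_nonneg.add (hb.rest.mul_pos hm.spec).pos_nonneg).sub
      ((hm.spec.sub (ha0.mono (by simp))).cst_mul _)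
  have hSs : HasSpectrum G (Set.Iic 0) (p * (1 + n) - cst κ * (n - cst a₀)) := by
    rw [mul_add, mul_one]
    exact (ha.rest.neg_nonpos.add (ha.rest.mul_neg hn.spec).neg_nonpos).sub
      ((hn.spec.sub (ha0.mono (by simp))).cst_mul _)
  set S := p * (1 + n) - cst κ * (n - cst a₀) with hSd
  set T := e * (1 + m) - cst κ * (m - cst a₀) with hTd
  have hx := cross_sub_mem hzκ hm hn ha hb
  rw [← cst_mul_mem_iff Complex.I_ne_zero]
  -- The common zero modes are split off from b, a, m and n, so that the remaining factors have
  -- strictly signed spectrum and pair to zero with S, T and constants.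
  have e1 : cst Complex.I * (density m n * deriv (density a b)) =
      cst κ * (n * a - m * b)
      + cst κ * (cst a₀ * (n * a - m * b) + cst a₀ * (n - cst m₀) - cst a₀ * (m - cst m₀)
        + cst a₀ * (a - cst a₀) - cst a₀ * (b - cst a₀))
      + (b - cst a₀) * S - (a - cst a₀) * T
      + (cst a₀ * (p + p * n) - cst a₀ * (e + e * m)
        - cst κ * (cst a₀ * (n - cst m₀) - cst a₀ * (m - cst m₀)))
      + r' * S - ρ' * T + cst Complex.I * (deriv r * ρ + r * deriv ρ)
      + p * (n - b) - e * (m - a) := by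
    rw [mul_left_comm, deriv_density_eq ha hb, density]
    linear_combination S * her' - T * heρ' - r * hS + ρ * hT + (1 + b) * (1 + m) * hSd
      - (1 + a) * (1 + n) * hTd
  rw [e1]
  have hpn : HasSpectrum G (Set.Iio 0) (p + p * n) := ha.rest.add (ha.rest.mul_neg hn.spec)
  have hem : HasSpectrum G (Set.Ioi 0) (e + e * m) := hb.rest.add (hb.rest.mul_pos hm.spec)
  have c1 := mem_of_const_neg ha0 hn1
  have c2 := mem_of_const_pos ha0 hm1
  exact sub_mem (add_mem (add_mem (sub_mem (add_mem (add_mem (sub_mem (add_mem (add_mem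
    (cst_mul_mem _ hx)
    (cst_mul_mem _ (sub_mem (add_mem (sub_mem (add_mem (cst_mul_mem _ hx) c1) c2)
      (mem_of_const_pos ha0 ha1)) (mem_of_const_neg ha0 hb1))))
    (mem_of_neg hb1 hSs)) (mem_of_pos ha1 hTs))
    (sub_mem (sub_mem (mem_of_const_neg ha0 hpn) (mem_of_const_pos ha0 hem))
      (cst_mul_mem _ (sub_mem c1 c2))))
    (mem_of_neg hr' hSs)) (mem_of_pos hρ' hTs)) (cst_mul_mem _ (hr.deriv_mul_mem hρ)))
    (mem_of_neg ha.rest (hn.spec.sub hb.spec))) (mem_of_pos hb.rest (hm.spec.sub ha.spec))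

end Commutation

/-! ### Continuous families of smooth functions -/

/-- A family of functions which is continuous with values in `H^∞`, in Fourier variables. -/
def IsSmoothFamily (G : Geometry) (I : Set ℝ) (Φ : ℝ → ℝ → ℂ) : Prop :=
  ∀ σ : ℝ, ∃ v : ℝ → Sob G σ, ContinuousOn v I ∧ ∀ t ∈ I, v t =ᵐ[freq G] Φ t

section Family

variable {G : Geometry} {I : Set ℝ} {Φ Ψ : ℝ → ℝ → ℂ}

theorem IsSmoothFamily.isSmooth (h : IsSmoothFamily G I Φ) {t : ℝ} (ht : t ∈ I) :
    IsSmooth G (Φ t) := fun σ => by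
  obtain ⟨v, -, hv⟩ := h σ
  exact (Lp.memLp (v t)).ae_eq (ae_sobMeasure_iff.2 (hv t ht))

theorem isSmoothFamily_of_nonneg
    (h : ∀ σ : ℝ, 0 ≤ σ → ∃ v : ℝ → Sob G σ, ContinuousOn v I ∧ ∀ t ∈ I, v t =ᵐ[freq G] Φ t) :
    IsSmoothFamily G I Φ := fun σ => by
  obtain ⟨v, hv, hv'⟩ := h (max σ 0) (le_max_right _ _)
  exact ⟨fun t => incl (le_max_left σ 0) (v t), (incl _).continuous.comp_continuousOn hv,
    fun t ht => (coeFn_incl _ _).trans (hv' t ht)⟩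

theorem IsSmoothFamily.mono {J : Set ℝ} (h : IsSmoothFamily G I Φ) (hJ : J ⊆ I) :
    IsSmoothFamily G J Φ := fun σ => by
  obtain ⟨v, hv, hv'⟩ := h σ
  exact ⟨v, hv.mono hJ, fun t ht => hv' t (hJ ht)⟩

theorem IsSmoothFamily.congr (h : IsSmoothFamily G I Φ) (he : ∀ t ∈ I, Φ t =ᵐ[freq G] Ψ t) :
    IsSmoothFamily G I Ψ := fun σ => by
  obtain ⟨v, hv, hv'⟩ := h σ
  exact ⟨v, hv, fun t ht => (hv' t ht).trans (he t ht)⟩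

theorem IsSmoothFamily.add (hΦ : IsSmoothFamily G I Φ) (hΨ : IsSmoothFamily G I Ψ) :
    IsSmoothFamily G I fun t => Φ t + Ψ t := fun σ => by
  obtain ⟨v, hv, hv'⟩ := hΦ σ
  obtain ⟨w, hw, hw'⟩ := hΨ σ
  exact ⟨fun t => v t + w t, hv.add hw, fun t ht =>
    (Sob.coeFn_add _ _).trans ((hv' t ht).add (hw' t ht))⟩

theorem IsSmoothFamily.smul {c : ℝ → ℂ} (hc : ContinuousOn c I) (hΦ : IsSmoothFamily G I Φ) :
    IsSmoothFamily G I fun t => c t • Φ t := fun σ => by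
  obtain ⟨v, hv, hv'⟩ := hΦ σ
  exact ⟨fun t => c t • v t, hc.smul hv, fun t ht =>
    (Sob.coeFn_smul _ _).trans ((hv' t ht).const_smul (c t))⟩

theorem IsSmoothFamily.sub (hΦ : IsSmoothFamily G I Φ) (hΨ : IsSmoothFamily G I Ψ) :
    IsSmoothFamily G I fun t => Φ t - Ψ t :=
  (hΦ.add (hΨ.smul (c := fun _ => -1) continuousOn_const)).congr fun t _ =>
    Eventually.of_forall fun ξ => by simp [sub_eq_add_neg]

theorem IsSmoothFamily.conv (hΦ : IsSmoothFamily G I Φ) (hΨ : IsSmoothFamily G I Ψ) :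
    IsSmoothFamily G I fun t => conv G (Φ t) (Ψ t) := by
  refine isSmoothFamily_of_nonneg fun σ hσ => ?_
  obtain ⟨v, hv, hv'⟩ := hΦ (σ + 1)
  obtain ⟨w, hw, hw'⟩ := hΨ σ
  exact ⟨fun t => convCLM G hσ (v t) (w t),
    ((convCLM G hσ).continuous.comp_continuousOn hv).clm_apply hw, fun t ht =>
    (coeFn_convCLM hσ _ _).trans (conv_congr (hv' t ht) (hw' t ht))⟩

theorem IsSmoothFamily.mul_of_le (hΦ : IsSmoothFamily G I Φ) {a : ℝ → ℂ} (ha : Measurable a)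
    {C k : ℝ} (hC : 0 ≤ C) (h : ∀ ξ, ‖a ξ‖ ≤ C * (|ξ| + 1) ^ k) :
    IsSmoothFamily G I fun t ξ => a ξ * Φ t ξ := fun σ => by
  obtain ⟨v, hv, hv'⟩ := hΦ (σ + k)
  have hm : IsMultiplier (sobMeasure G (σ + k)) (sobMeasure G σ) a C :=
    isMultiplier_sob ha hC (by simpa using h)
  refine ⟨fun t => hm.clm (v t), hm.clm.continuous.comp_continuousOn hv, fun t ht => ?_⟩
  filter_upwards [ae_sobMeasure_iff.1 (hm.coeFn_clm (v t)), hv' t ht] with ξ h1 h2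
  rw [h1, h2]

theorem IsSmoothFamily.dx (hΦ : IsSmoothFamily G I Φ) : IsSmoothFamily G I fun t => dx (Φ t) := by
  refine hΦ.mul_of_le (a := fun ξ => Complex.I * (ξ : ℂ)) (C := 1) (k := 1) (by fun_prop)
    zero_le_one fun ξ => ?_
  rw [Real.rpow_one, norm_mul, Complex.norm_I, Complex.norm_real, Real.norm_eq_abs]
  linarith

theorem IsSmoothFamily.hilbert (hΦ : IsSmoothFamily G I Φ) :
    IsSmoothFamily G I fun t => hilbert (Φ t) :=
  hΦ.mul_of_le measurable_hilbertSymbol zero_le_one norm_hilbertSymbol_le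

theorem lintegral_reflConj {σ : ℝ} {φ : ℝ → ℂ} (hφ : AEStronglyMeasurable φ (freq G)) :
    ∫⁻ ξ, ‖reflConj φ ξ‖ₑ ^ 2 ∂(sobMeasure G σ) = ∫⁻ ξ, ‖φ ξ‖ₑ ^ 2 ∂(sobMeasure G σ) := by
  have hw : Measurable fun ξ : ℝ => ENNReal.ofReal ((|ξ| + 1) ^ (2 * σ)) := by fun_prop
  have h := lintegral_comp_measurePreserving (measurePreserving_neg_freq G)
    (f := fun ξ => ENNReal.ofReal ((|ξ| + 1) ^ (2 * σ)) * ‖φ ξ‖ₑ ^ 2)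
    (hw.aemeasurable.mul (hφ.enorm.pow_const 2))
  rw [lintegral_sobMeasure, lintegral_sobMeasure, ← h]
  simp only [abs_neg, reflConj, RCLike.enorm_conj]

theorem memLp_reflConj {σ : ℝ} (φ : Sob G σ) : MemLp (reflConj φ) 2 (sobMeasure G σ) := by
  have hm : AEStronglyMeasurable (reflConj φ) (freq G) :=
    Complex.continuous_conj.comp_aestronglyMeasurable
      (φ.aestronglyMeasurable.comp_measurePreserving (measurePreserving_neg_freq G))
  rw [memLp_two_iff_lintegral (hm.mono_ac (sobMeasure_ac G σ)),
    lintegral_reflConj φ.aestronglyMeasurable]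
  exact (memLp_two_iff_lintegral (Lp.memLp φ).1).1 (Lp.memLp φ)

theorem reflConj_congr {φ ψ : ℝ → ℂ} (h : φ =ᵐ[freq G] ψ) :
    reflConj φ =ᵐ[freq G] reflConj ψ := by
  filter_upwards [(measurePreserving_neg_freq G).quasiMeasurePreserving.ae h] with ξ hξ
  rw [reflConj, reflConj, hξ]

/-- Conjugation is antilinear, so its continuity comes from its being an isometry instead of a
complex linear map. -/
theorem isometry_reflConj (σ : ℝ) :
    Isometry fun φ : Sob G σ => ((memLp_reflConj φ).toLp : Sob G σ) := by
  refine Isometry.of_dist_eq fun φ ψ => ?_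
  have h : (memLp_reflConj φ).toLp - (memLp_reflConj ψ).toLp =
      ((memLp_reflConj (φ - ψ)).toLp : Sob G σ) := by
    refine Sob.ae_eq ?_
    have h1 : ((memLp_reflConj φ).toLp - (memLp_reflConj ψ).toLp : Sob G σ) =ᵐ[freq G] _ :=
      ae_sobMeasure_iff.1 (Lp.coeFn_sub _ _)
    have h2 : (φ - ψ : Sob G σ) =ᵐ[freq G] ⇑φ - ⇑ψ := ae_sobMeasure_iff.1 (Lp.coeFn_sub _ _)
    filter_upwards [h1, Sob.coeFn_toLp (memLp_reflConj φ), Sob.coeFn_toLp (memLp_reflConj ψ),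
      Sob.coeFn_toLp (memLp_reflConj (φ - ψ)), reflConj_congr h2] with ξ h1 h3 h4 h5 h6
    rw [h1, Pi.sub_apply, h3, h4, h5, h6]
    simp [reflConj]
  have hn : ∀ χ : Sob G σ, ‖((memLp_reflConj χ).toLp : Sob G σ)‖ₑ ^ 2 = ‖χ‖ₑ ^ 2 := fun χ => by
    rw [Lp_enorm_sq, Lp_enorm_sq, ← lintegral_reflConj χ.aestronglyMeasurable]
    refine lintegral_congr_ae ?_
    filter_upwards [(memLp_reflConj χ).coeFn_toLp] with ξ h1
    rw [h1]
  rw [dist_eq_norm, dist_eq_norm, h, ← toReal_enorm, ← toReal_enorm]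
  congr 1
  exact le_antisymm ((ENNReal.pow_le_pow_left_iff two_ne_zero).1 (hn _).le)
    ((ENNReal.pow_le_pow_left_iff two_ne_zero).1 (hn _).ge)

theorem IsSmoothFamily.reflConj (hΦ : IsSmoothFamily G I Φ) :
    IsSmoothFamily G I fun t => reflConj (Φ t) := fun σ => by
  obtain ⟨v, hv, hv'⟩ := hΦ σ
  exact ⟨fun t => (memLp_reflConj (v t)).toLp,
    (isometry_reflConj σ).continuous.comp_continuousOn hv, fun t ht =>
    (Sob.coeFn_toLp _).trans (reflConj_congr (hv' t ht))⟩

theorem IsSmoothFamily.continuousOn {s : ℝ} {u : ℝ → Sob G s}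
    (h : IsSmoothFamily G I fun t => u t) : ContinuousOn u I := by
  obtain ⟨v, hv, hv'⟩ := h s
  exact hv.congr fun t ht => (Sob.ae_eq (hv' t ht)).symm

end Family

/-! ### Regularity of the gauge -/

section Gauge

variable {G : Geometry} {s : ℝ} [hs : Fact (-(1 / 2) < s ∧ s < 0)]

/-- The symbol of `C₊ (-i∂ + z)⁻¹`. -/
def resolventSymbol (z : ℂ) : ℝ → ℂ := Set.indicator (Set.Ici 0) fun ξ => ((ξ : ℂ) + z)⁻¹

omit hs in
theorem measurable_resolventSymbol (z : ℂ) : Measurable (resolventSymbol z) :=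
  Measurable.indicator (by fun_prop) measurableSet_Ici

omit hs in
theorem norm_resolventSymbol_le {z : ℂ} (hz : 0 < z.re) (ξ : ℝ) :
    ‖resolventSymbol z ξ‖ ≤ (min 1 z.re)⁻¹ * (|ξ| + 1) ^ (-1 : ℝ) := by
  have hc : 0 < min 1 z.re := lt_min one_pos hz
  have hb := bracket_pos ξ
  by_cases h : 0 ≤ ξ
  · rw [resolventSymbol, Set.indicator_of_mem (by simpa using h), norm_inv, Real.rpow_neg_one,
      ← mul_inv]
    refine inv_anti₀ (by positivity) ?_
    have h1 : ξ + z.re ≤ ‖(ξ : ℂ) + z‖ := by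
      have := Complex.re_le_norm ((ξ : ℂ) + z)
      simpa using this
    rw [abs_of_nonneg h]
    have h2 : min 1 z.re ≤ 1 := min_le_left _ _
    have h3 : min 1 z.re ≤ z.re := min_le_right _ _
    nlinarith
  · rw [resolventSymbol, Set.indicator_of_notMem (by simpa using h), norm_zero]
    positivity

/-- Undoing the weights gives the fixed-point form m = C₊(-i∂ + z)⁻¹(qm + q), in which the right
side gains a derivative. -/
theorem gaugeM_eq_resolvent {q : Sob G s} {z : ℂ} (hz : 0 < z.re) (h : IsUnit (laxT q z)) :
    ∀ᵐ ξ ∂(freq G), gaugeM G q z ξ =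
      resolventSymbol z ξ * (conv G q (gaugeM G q z) ξ + q ξ) := by
  set H := gaugeH q z with hH
  have hM : gaugeM G q z = lift G (1 / 2) H := gaugeM_eq q z
  have hhardy : IsHardy G (gaugeM G q z) := hM ▸ isHardy_lift H
  have hpos : ∀ᵐ ξ ∂(posFreq G), gaugeM G q z ξ =
      (((|ξ| + 1) ^ (-(1 / 2) : ℝ) : ℝ) : ℂ) * H ξ := hM ▸ coeFn_lift_pos H
  have hconv : ∀ ξ, ∫ η, q (ξ - η) * gaugeM G q z η ∂(posFreq G) =
      ∫ η, q (ξ - η) * gaugeM G q z η ∂(freq G) := by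
    intro ξ
    refine setIntegral_eq_integral_of_ae_compl_eq_zero ?_
    filter_upwards [hhardy] with η hη hη'
    rw [hη (by simpa using hη'), mul_zero]
  have h1 : ∀ᵐ ξ ∂(posFreq G), gaugeM G q z ξ =
      resolventSymbol z ξ * (conv G q (gaugeM G q z) ξ + q ξ) := by
    have h2 := laxT_gaugeH h
    have h3 := coeFn_laxT q z H
    rw [hH, h2, ← hH] at h3
    filter_upwards [h3, coeFn_source q, coeFn_potOp q H, hpos, ae_posFreq_mem G]
      with ξ h3 h4 h5 h6 h7
    rw [h5, kerFn_integral_eq q (gaugeM G q z) H ξ hpos, hconv, h4] at h3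
    have hsq : (((|ξ| + 1) ^ (-(1 / 2) : ℝ) : ℝ) : ℂ) * (((|ξ| + 1) ^ (-(1 / 2) : ℝ) : ℝ) : ℂ) =
        (((|ξ| + 1)⁻¹ : ℝ) : ℂ) := by
      rw [← Complex.ofReal_mul, ← Real.rpow_add (bracket_pos ξ)]
      norm_num [Real.rpow_neg_one]
    have hw : (((|ξ| + 1)⁻¹ : ℝ) : ℂ) * ((ξ : ℂ) + 1) = 1 := by
      rw [abs_of_nonneg h7]
      have : ξ + 1 ≠ 0 := by positivity
      rw [← Complex.ofReal_one, ← Complex.ofReal_add, ← Complex.ofReal_mul, inv_mul_cancel₀ this]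
    have hne : (ξ : ℂ) + z ≠ 0 := by
      intro h0
      have := congrArg Complex.re h0
      simp at this
      linarith
    rw [resolventSymbol, Set.indicator_of_mem (by simpa using h7), conv]
    refine (eq_inv_mul_iff_mul_eq₀ hne).2 ?_
    rw [h6]
    set W := (((|ξ| + 1) ^ (-(1 / 2) : ℝ) : ℝ) : ℂ)
    rw [← hsq] at h3 hw
    linear_combination (-(W * (ξ + 1))) * h3 + (q ξ + (fourierConst G : ℂ) * (∫ η,
      q (ξ - η) * gaugeM G q z η ∂(freq G)) - (z - 1) * (W * H ξ)) * hw
  rw [ae_posFreq_iff] at h1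
  filter_upwards [h1, hhardy] with ξ h2 h3
  by_cases h0 : 0 ≤ ξ
  · exact h2 h0
  · rw [h3 (not_le.1 h0), resolventSymbol, Set.indicator_of_notMem (by simpa using h0), zero_mul]

/-- Elliptic bootstrap: multiplication by a smooth potential preserves H^n and the free resolvent
maps H^n into H^{n+1}, both continuously. The induction starts from continuity of the inverse, which
gives continuity in H^{1/2} and hence in L². -/
theorem isSmoothFamily_gaugeM {I : Set ℝ} {u : ℝ → Sob G s} {z : ℂ} (hz : 0 < z.re)
    (hu : IsSmoothFamily G I fun t => u t) (h : ∀ t ∈ I, IsUnit (laxT (u t) z)) :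
    IsSmoothFamily G I fun t => gaugeM G (u t) z := by
  have hnat : ∀ n : ℕ, ∃ v : ℝ → Sob G (n : ℝ), ContinuousOn v I ∧
      ∀ t ∈ I, v t =ᵐ[freq G] gaugeM G (u t) z := by
    intro n
    induction n with
    | zero =>
      refine ⟨fun t => incl (by norm_num) (gaugeM G (u t) z), ?_, fun t _ => coeFn_incl _ _⟩
      have h1 : ContinuousOn (fun t => gaugeM G (u t) z) I := by
        simp only [gaugeM_eq]
        refine (lift G (1 / 2)).continuous.comp_continuousOn fun t ht => ?_
        exact (ContinuousAt.comp_continuousWithinAt (f := fun t => (u t, z))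
          (continuousAt_gaugeH (h t ht))
          ((hu.continuousOn t ht).prodMk continuousWithinAt_const))
      exact (incl _).continuous.comp_continuousOn h1
    | succ n ih =>
      obtain ⟨v, hv, hv'⟩ := ih
      obtain ⟨w, hw, hw'⟩ := hu ((n : ℝ) + 1)
      obtain ⟨w₀, hw₀, hw₀'⟩ := hu (n : ℝ)
      have hn : (0 : ℝ) ≤ n := n.cast_nonneg
      have hm : IsMultiplier (sobMeasure G (n : ℝ)) (sobMeasure G ((n + 1 : ℕ) : ℝ))
          (resolventSymbol z) (min 1 z.re)⁻¹ := by
        refine isMultiplier_sob (measurable_resolventSymbol z)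
          (inv_nonneg.2 (le_min zero_le_one hz.le)) fun ξ => ?_
        rw [show (n : ℝ) - ((n + 1 : ℕ) : ℝ) = -1 by push_cast; ring]
        exact norm_resolventSymbol_le hz ξ
      refine ⟨fun t => hm.clm (convCLM G hn (w t) (v t) + w₀ t), hm.clm.continuous.comp_continuousOn
        ((((convCLM G hn).continuous.comp_continuousOn hw).clm_apply hv).add hw₀), fun t ht => ?_⟩
      filter_upwards [ae_sobMeasure_iff.1 (hm.coeFn_clm (convCLM G hn (w t) (v t) + w₀ t)),
        Sob.coeFn_add (convCLM G hn (w t) (v t)) (w₀ t), coeFn_convCLM hn (w t) (v t),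
        conv_congr (hw' t ht) (hv' t ht), hw₀' t ht, gaugeM_eq_resolvent hz (h t ht)]
        with ξ h1 h2 h3 h4 h5 h6
      rw [h1, h2, Pi.add_apply, h3, h4, h5, h6]
  refine fun σ => ?_
  obtain ⟨n, hn⟩ := exists_nat_ge σ
  obtain ⟨v, hv, hv'⟩ := hnat n
  exact ⟨fun t => incl hn (v t), (incl _).continuous.comp_continuousOn hv,
    fun t ht => (coeFn_incl _ _).trans (hv' t ht)⟩

theorem isSmooth_gaugeM {q : Sob G s} {z : ℂ} (hz : 0 < z.re) (hq : IsSmooth G q)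
    (h : IsUnit (laxT q z)) : IsSmooth G (gaugeM G q z) := by
  have hu : IsSmoothFamily G {(0 : ℝ)} fun _ => (q : ℝ → ℂ) := fun σ =>
    ⟨fun _ => (hq σ).toLp, continuousOn_const, fun _ _ => Sob.coeFn_toLp _⟩
  exact (isSmoothFamily_gaugeM (u := fun _ => q) hz hu fun _ _ => h).isSmooth rfl

/-- The function g is the residual of the unprojected equation; the fixed-point equation says that
it has no nonnegative frequencies. -/
theorem exists_isGauge {q : Sob G s} {z : ℂ} (hz : 0 < z.re) (hq : IsSmooth G q)
    (h : IsUnit (laxT q z)) :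
    ∃ g, IsGauge G (synth G q) z (synth G (gaugeM G q z)) g := by
  have hm := isSmooth_gaugeM hz hq h
  set m : ℝ → ℂ := ⇑(gaugeM G q z) with hmd
  have hhardy : IsHardy G m := by
    rw [hmd, gaugeM_eq]; exact isHardy_lift _
  have hgs : IsSmooth G (⇑q + conv G q m + Complex.I • dx m - z • m) :=
    ((hq.add (hq.conv hm)).add (hm.dx.smul _)).sub (hm.smul _)
  refine ⟨synth G (⇑q + conv G q m + Complex.I • dx m - z • m), ⟨m, hm, ?_, rfl⟩,
    ⟨_, hgs, ?_, rfl⟩, ?_⟩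
  · filter_upwards [hhardy] with ξ h1 h2
    exact h1 (by simpa using h2)
  · filter_upwards [gaugeM_eq_resolvent hz h] with ξ h1 h2
    have h0 : 0 ≤ ξ := by simpa using h2
    have hne : (ξ : ℂ) + z ≠ 0 := by
      intro h3
      have := congrArg Complex.re h3
      simp at this
      linarith
    rw [resolventSymbol, Set.indicator_of_mem (by simpa using h0), eq_inv_mul_iff_mul_eq₀ hne] at h1
    simp only [Pi.add_apply, Pi.sub_apply, Pi.smul_apply, smul_eq_mul, dx]
    linear_combination -h1 + ξ * m ξ * Complex.I_mul_I
  · rw [synth_sub ((hq.add (hq.conv hm)).add (hm.dx.smul _)).integrable (hm.smul _).integrable,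
      synth_add (hq.add (hq.conv hm)).integrable (hm.dx.smul _).integrable,
      synth_add hq.integrable (hq.conv hm).integrable, synth_smul, synth_smul, hm.deriv_synth]
    funext x
    simp only [Pi.mul_apply, Pi.add_apply, Pi.sub_apply, Pi.smul_apply, Pi.neg_apply, Pi.one_apply,
      smul_eq_mul, synth_conv hq.integrable hm.integrable]
    ring

end Gauge

/-! ### Pointwise time derivatives -/

section TimeDerivative

variable {G : Geometry}

theorem lintegral_enorm_sq_le (φ : Sob G 1) :
    (∫⁻ ξ, ‖φ ξ‖ₑ ∂(freq G)) ^ 2 ≤ ENNReal.ofReal (wienerConst G) * ‖φ‖ₑ ^ 2 := by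
  have h := lintegral_weight_le (σ := 0) φ.aestronglyMeasurable
  simp only [zero_add, Real.rpow_zero, ENNReal.ofReal_one, one_mul] at h
  rwa [← Lp_enorm_sq] at h

theorem norm_synth_le (φ : Sob G 1) (x : ℝ) :
    ‖synth G φ x‖ ≤ Real.sqrt (wienerConst G) * ‖φ‖ := by
  have h1 : ‖synth G φ x‖ₑ ≤ ∫⁻ ξ, ‖φ ξ‖ₑ ∂(freq G) := by
    rw [synth, enorm_mul, ← one_mul (∫⁻ ξ, ‖φ ξ‖ₑ ∂(freq G))]
    refine mul_le_mul' (fourierConst_enorm_le G) ((enorm_integral_le_lintegral_enorm _).trans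
      (le_of_eq (lintegral_congr fun ξ => ?_)))
    rw [enorm_mul, ← ofReal_norm (Complex.exp _), norm_exp_mul, ENNReal.ofReal_one, one_mul]
  have h0 : 0 ≤ wienerConst G := ENNReal.toReal_nonneg
  have h2 := (pow_le_pow_left' h1 2).trans (lintegral_enorm_sq_le φ)
  rw [← ofReal_norm, ← ofReal_norm, ← ENNReal.ofReal_pow (norm_nonneg _),
    ← ENNReal.ofReal_pow (norm_nonneg _), ← ENNReal.ofReal_mul h0,
    ENNReal.ofReal_le_ofReal_iff (by positivity)] at h2
  refine le_of_sq_le_sq ?_ (by positivity)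
  rwa [mul_pow, Real.sq_sqrt h0]

variable (G) in
/-- Point evaluation on `H^1`. -/
def evalCLM (x : ℝ) : Sob G 1 →L[ℂ] ℂ :=
  LinearMap.mkContinuous
    { toFun := fun φ => synth G φ x
      map_add' := fun φ ψ => by
        rw [synth_congr (Sob.coeFn_add φ ψ), synth_add (φ.integrable le_rfl) (ψ.integrable le_rfl)]
        rfl
      map_smul' := fun c φ => by
        rw [synth_congr (Sob.coeFn_smul c φ), synth_smul]; rfl }
    (Real.sqrt (wienerConst G)) fun φ => norm_synth_le φ x

theorem evalCLM_apply (x : ℝ) (φ : Sob G 1) : evalCLM G x φ = synth G φ x := rfl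

/-- The integral of a smooth family over `[a, t]` is a smooth family, with the expected time
derivative. -/
theorem IsSmoothFamily.exists_integral {W : ℝ → ℝ → ℂ} {a b : ℝ} (hab : a ≤ b)
    (hW : IsSmoothFamily G (Set.Icc a b) W) : ∃ V w : ℝ → Sob G 1, V a = 0 ∧
      (∀ t, IsSmooth G (V t)) ∧ (∀ t, HasDerivAt V (w t) t) ∧
      ∀ t ∈ Set.Icc a b, w t =ᵐ[freq G] W t := by
  -- Extending the integrand by constants outside [a, b] makes the integral differentiable at every
  -- time, endpoints included.
  have hext : ∀ σ : ℝ, ∃ w : ℝ → Sob G σ, Continuous w ∧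
      ∀ t, w t =ᵐ[freq G] W (Set.projIcc a b hab t) := fun σ => by
    obtain ⟨v, hv, hv'⟩ := hW σ
    exact ⟨Set.IccExtend hab ((Set.Icc a b).domRestrict v),
      (continuousOn_iff_continuous_domRestrict.1 hv).Icc_extend', fun t => hv' _ (Subtype.prop _)⟩
  obtain ⟨w, hw, hw'⟩ := hext 1
  refine ⟨fun t => ∫ τ in a..t, w τ, w, intervalIntegral.integral_same, fun t σ => ?_, fun t =>
    intervalIntegral.integral_hasDerivAt_right (hw.intervalIntegrable _ _)
      (hw.stronglyMeasurableAtFilter _ _) hw.continuousAt, fun t ht => ?_⟩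
  · obtain ⟨v, hv, hv'⟩ := hext (max σ 1)
    -- The integral formed in the stronger space embeds to the one formed in H¹, so the latter lies
    -- in every H^σ.
    have h1 : incl (le_max_right σ 1) (∫ τ in a..t, v τ) = ∫ τ in a..t, w τ := by
      rw [← ContinuousLinearMap.intervalIntegral_comp_comm _ (hv.intervalIntegrable _ _)]
      congr 1
      funext τ
      exact Sob.ae_eq (((coeFn_incl _ _).trans (hv' τ)).trans (hw' τ).symm)
    have h2 := coeFn_incl (le_max_right σ 1) (∫ τ in a..t, v τ)
    rw [h1] at h2
    exact (memLp_sob_mono (le_max_left σ 1) (Lp.memLp (∫ τ in a..t, v τ))).ae_eq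
      (ae_sobMeasure_iff.2 h2.symm)
  · have h := hw' t
    rwa [Set.projIcc_of_mem hab ht] at h

/-- Upgrades pointwise time derivatives to a derivative in H^s. At each x the difference between
u(τ) and the integral of W has zero derivative, so it is constant; functions are determined by their
point values, and u is u(a) plus that integral. -/
theorem hasDerivWithinAt_of_synth {s : ℝ} (hs : s ≤ 1) {u : ℝ → Sob G s} {W : ℝ → ℝ → ℂ} {a b : ℝ}
    (hab : a ≤ b) (hu : IsSmoothFamily G (Set.Icc a b) fun t => u t)
    (hW : IsSmoothFamily G (Set.Icc a b) W)
    (h : ∀ t ∈ Set.Icc a b, ∀ x, HasDerivWithinAt (fun τ => synth G (u τ) x) (synth G (W t) x)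
      (Set.Icc a b) t) {t : ℝ} (ht : t ∈ Set.Icc a b) :
    ∃ w : Sob G s, w =ᵐ[freq G] W t ∧ HasDerivWithinAt u w (Set.Icc a b) t := by
  obtain ⟨v, hv, hv'⟩ := hu 1
  obtain ⟨V, w, hVa, hVs, hV, hw⟩ := hW.exists_integral hab
  have hpt : ∀ τ ∈ Set.Icc a b, ∀ x, synth G (v τ) x = synth G (v a) x + synth G (V τ) x := by
    intro τ hτ x
    have hd : ∀ r ∈ Set.Icc a b, HasDerivWithinAt
        (fun r => synth G (v r) x - evalCLM G x (V r)) 0 (Set.Icc a b) r := fun r hr => by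
      have h1 := (h r hr x).congr (f₁ := fun r => synth G (v r) x)
        (fun r hr => by rw [synth_congr (hv' r hr)]) (by rw [synth_congr (hv' r hr)])
      have h2 := ((evalCLM G x).restrictScalars ℝ).hasFDerivAt.comp_hasDerivAt r (hV r)
      have h3 := h1.sub h2.hasDerivWithinAt
      rwa [ContinuousLinearMap.coe_restrictScalars', evalCLM_apply, synth_congr (hw r hr),
        sub_self] at h3
    have hc := constant_of_has_deriv_right_zero (fun r hr => (hd r hr).continuousWithinAt)
      (fun r hr => (hd r ⟨hr.1, hr.2.le⟩).mono_of_mem_nhdsWithin (Icc_mem_nhdsGE_of_mem hr)) τ hτ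
    rw [hVa, map_zero, sub_zero, evalCLM_apply] at hc
    rw [← hc]; ring
  have ha : a ∈ Set.Icc a b := ⟨le_rfl, hab⟩
  have hsm : ∀ τ ∈ Set.Icc a b, IsSmooth G (v τ) := fun τ hτ =>
    (hu.isSmooth hτ).congr (hv' τ hτ).symm
  have heq : ∀ τ ∈ Set.Icc a b, u τ = incl hs (v a + V τ) := fun τ hτ => by
    refine Sob.ae_eq ((hv' τ hτ).symm.trans (Filter.EventuallyEq.trans ?_ (coeFn_incl _ _).symm))
    refine (ae_eq_of_synth (hsm τ hτ) ((hsm a ha).add (hVs τ)) fun x => ?_).trans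
      (Sob.coeFn_add _ _).symm
    rw [synth_add (hsm a ha).integrable (hVs τ).integrable, hpt τ hτ x]; rfl
  refine ⟨incl hs (w t), (coeFn_incl _ _).trans (hw t ht), ?_⟩
  refine HasDerivWithinAt.congr (f := fun τ => incl hs (v a + V τ)) ?_ heq (heq t ht)
  exact (((incl hs).restrictScalars ℝ).hasFDerivAt.comp_hasDerivAt t ((hV t).const_add (v a))).hasDerivWithinAt

end TimeDerivative

/-! ### The derivative of `β` -/

section BetaDerivative

variable {G : Geometry} {s : ℝ} [hs : Fact (-(1 / 2) < s ∧ s < 0)]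

theorem laxT_symmetric {q : Sob G s} (hq : IsReal G q) (z : ℂ) (f g : Hardy G) :
    inner ℂ (laxT q (conj z) f) g = inner ℂ f (laxT q z g) := by
  simp only [laxT, sub_apply, add_apply, smul_apply, one_apply_eq_self, inner_sub_left,
    inner_sub_right, inner_add_left, inner_add_right, inner_smul_left, inner_smul_right,
    potOp_symmetric hq, weightOp_symmetric, map_sub, map_one, Complex.conj_conj]

/-- Selfadjointness: the adjoint of the resolvent at z is the resolvent at z̄. -/
theorem inner_source_inverse {q : Sob G s} (hq : IsReal G q) {z : ℂ} (h : IsUnit (laxT q z))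
    (h' : IsUnit (laxT q (conj z))) (y : Hardy G) :
    inner ℂ (source G s q) (Ring.inverse (laxT q z) y) = inner ℂ (gaugeH q (conj z)) y := by
  have h1 := Ring.mul_inverse_cancel _ h
  rw [← laxT_gaugeH h', laxT_symmetric hq, ← mul_apply_eq_comp, h1, one_apply_eq_self]

theorem hasDerivWithinAt_laxT {u : ℝ → Sob G s} {w : Sob G s} {I : Set ℝ} {t : ℝ} (z : ℂ)
    (hu : HasDerivWithinAt u w I t) :
    HasDerivWithinAt (fun τ => laxT (u τ) z) (-potOp G s w) I t := by
  have h := ((potOp G s).restrictScalars ℝ).hasFDerivAt.comp_hasDerivWithinAt t hu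
  exact h.const_sub _

/-- Product rule, with the derivative of the inverse being the perturbation sandwiched between two
resolvents. The left resolvent is moved onto q₊, where it produces the gauge at z̄. -/
theorem hasDerivWithinAt_beta_inner {u : ℝ → Sob G s} {w : Sob G s} {I : Set ℝ} {t : ℝ} {z : ℂ}
    (hu : HasDerivWithinAt u w I t) (hq : IsReal G (u t)) (h : IsUnit (laxT (u t) z))
    (h' : IsUnit (laxT (u t) (conj z))) :
    HasDerivWithinAt (fun τ => beta G (u τ) z)
      (inner ℂ (source G s w) (gaugeH (u t) z) + inner ℂ (gaugeH (u t) (conj z)) (source G s w) +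
        inner ℂ (gaugeH (u t) (conj z)) (potOp G s w (gaugeH (u t) z))) I t := by
  have hsrc : HasDerivWithinAt (fun τ => source G s (u τ)) (source G s w) I t :=
    ((source G s).restrictScalars ℝ).hasFDerivAt.comp_hasDerivWithinAt t hu
  have hinv : HasDerivWithinAt (fun τ => Ring.inverse (laxT (u τ) z))
      (Ring.inverse (laxT (u t) z) * potOp G s w * Ring.inverse (laxT (u t) z)) I t := by
    obtain ⟨T, hT⟩ := h
    have h1 : HasFDerivAt Ring.inverse _ (laxT (u t) z) := hT ▸ hasFDerivAt_ringInverse (𝕜 := ℝ) T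
    have h2 := h1.comp_hasDerivWithinAt t (hasDerivWithinAt_laxT z hu)
    rw [← hT, Ring.inverse_unit]
    refine h2.congr_deriv ?_
    change -((↑T⁻¹ : Hardy G →L[ℂ] Hardy G) * -potOp G s w * ↑T⁻¹) = _
    rw [mul_neg, neg_mul, neg_neg]
  have hg : HasDerivWithinAt (fun τ => gaugeH (u τ) z)
      (Ring.inverse (laxT (u t) z) (potOp G s w (gaugeH (u t) z)) +
        Ring.inverse (laxT (u t) z) (source G s w)) I t := by
    have h1 : HasDerivWithinAt (fun τ => ((Ring.inverse (laxT (u τ) z)).restrictScalars ℝ))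
      ((Ring.inverse (laxT (u t) z) * potOp G s w *
        Ring.inverse (laxT (u t) z)).restrictScalars ℝ) I t :=
      (ContinuousLinearMap.restrictScalarsL ℂ (Hardy G) (Hardy G) ℝ ℝ).hasFDerivAt.comp_hasDerivWithinAt
        t hinv
    exact h1.clm_apply hsrc
  simp only [beta_eq]
  refine (hsrc.inner ℂ hg).congr_deriv ?_
  rw [inner_add_right, inner_source_inverse hq h h', inner_source_inverse hq h h']
  ring

omit hs in
theorem pairPlus_of_right {φ ψ : ℝ → ℂ} (hψ : IsHardy G ψ) :
    pairPlus G φ ψ = ∫ ξ, conj (φ ξ) * ψ ξ ∂(freq G) := by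
  refine setIntegral_eq_integral_of_ae_compl_eq_zero ?_
  filter_upwards [hψ] with ξ h1 h2
  rw [h1 (by simpa using h2), mul_zero]

omit hs in
theorem pairPlus_of_left {φ ψ : ℝ → ℂ} (hφ : IsHardy G φ) :
    pairPlus G φ ψ = ∫ ξ, conj (φ ξ) * ψ ξ ∂(freq G) := by
  refine setIntegral_eq_integral_of_ae_compl_eq_zero ?_
  filter_upwards [hφ] with ξ h1 h2
  rw [h1 (by simpa using h2), map_zero, zero_mul]

theorem isHardy_gaugeM (q : Sob G s) (z : ℂ) : IsHardy G (gaugeM G q z) := by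
  rw [gaugeM_eq]; exact isHardy_lift _

theorem inner_source_gaugeH (w q : Sob G s) (z : ℂ) :
    inner ℂ (source G s w) (gaugeH q z) = ∫ ξ, conj (w ξ) * gaugeM G q z ξ ∂(freq G) := by
  rw [← pairPlus_of_right (isHardy_gaugeM q z), gaugeM_eq]
  exact (pairPlus_left_eq_inner _ (coeFn_source w)).symm

theorem inner_gaugeH_source (w q : Sob G s) (z : ℂ) :
    inner ℂ (gaugeH q z) (source G s w) = ∫ ξ, conj (gaugeM G q z ξ) * w ξ ∂(freq G) := by
  rw [← pairPlus_of_left (isHardy_gaugeM q z), pairPlus_eq_inner _ (coeFn_source w), gaugeM_eq,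
    restr_lift]

theorem inner_gaugeH_potOp (w q : Sob G s) (z y : ℂ) :
    inner ℂ (gaugeH q y) (potOp G s w (gaugeH q z)) =
      ∫ ξ, conj (gaugeM G q y ξ) * conv G w (gaugeM G q z) ξ ∂(freq G) := by
  have h1 : ∀ᵐ ξ ∂(posFreq G), potOp G s w (gaugeH q z) ξ =
      (((|ξ| + 1) ^ (-(1 / 2) : ℝ) : ℝ) : ℂ) * conv G w (gaugeM G q z) ξ := by
    filter_upwards [coeFn_potOp w (gaugeH q z)] with ξ h1
    rw [h1, kerFn_integral_eq w (gaugeM G q z) (gaugeH q z) ξ (gaugeM_eq q z ▸ coeFn_lift_pos _),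
      conv, posFreq, setIntegral_eq_integral_of_ae_compl_eq_zero]
    filter_upwards [isHardy_gaugeM q z] with η h2 h3
    rw [h2 (by simpa using h3), mul_zero]
  rw [← pairPlus_of_left (isHardy_gaugeM q y), pairPlus_eq_inner _ h1, gaugeM_eq q y, restr_lift]

/-- The functional derivative of `β(z; ·)`. -/
def betaDensity (G : Geometry) (q : ℝ → ℂ) (z : ℂ) : ℝ → ℂ :=
  density (synth G (gaugeM G q z)) (star (synth G (gaugeM G q (conj z))))

/-- Plancherel turns the three pairings into the integrals of wm, wn and wmn, reality of w being
used in the first. -/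
theorem hasDerivWithinAt_beta {u : ℝ → Sob G s} {w : Sob G s} {I : Set ℝ} {t : ℝ} {z : ℂ}
    (hz : 0 < z.re) (hu : HasDerivWithinAt u w I t) (hq : IsReal G (u t)) (hqs : IsSmooth G (u t))
    (hw : IsReal G w) (hws : IsSmooth G w) (h : IsUnit (laxT (u t) z))
    (h' : IsUnit (laxT (u t) (conj z))) :
    HasDerivWithinAt (fun τ => beta G (u τ) z)
      (∫ x, betaDensity G (u t) z x * synth G w x ∂(space G)) I t := by
  refine (hasDerivWithinAt_beta_inner hu hq h h').congr_deriv ?_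
  have hm := isSmooth_gaugeM hz hqs h
  have hn := isSmooth_gaugeM (z := conj z) (by simpa using hz) hqs h'
  obtain ⟨i1, e1⟩ := plancherel hws hm
  obtain ⟨i2, e2⟩ := plancherel hn hws
  obtain ⟨i3, e3⟩ := plancherel hn (hws.conv hm)
  have e4 := integral_add (i1.add i2) i3
  simp only [Pi.add_apply] at e4
  rw [inner_source_gaugeH, inner_gaugeH_source, inner_gaugeH_potOp, ← e1, ← e2, ← e3,
    ← integral_add i1 i2, ← e4]
  refine integral_congr_ae (Eventually.of_forall fun x => ?_)
  simp only [betaDensity, density, Pi.add_apply, Pi.mul_apply, Pi.star_apply, RCLike.star_def,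
    hw.conj_synth, synth_conv hws.integrable hm.integrable]
  ring

end BetaDerivative

/-! ### Functional derivatives -/

section Reality

variable {G : Geometry} {φ ψ : ℝ → ℂ}

theorem dx_congr (h : φ =ᵐ[freq G] ψ) : dx φ =ᵐ[freq G] dx ψ := by
  filter_upwards [h] with ξ hξ
  rw [dx, dx, hξ]

theorem hilbert_congr (h : φ =ᵐ[freq G] ψ) : hilbert φ =ᵐ[freq G] hilbert ψ := by
  filter_upwards [h] with ξ hξ
  rw [hilbert, hilbert, hξ]

theorem phys_congr (h : φ =ᵐ[freq G] ψ) : phys G φ = phys G ψ := by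
  funext x
  rw [phys, phys, synth_congr h]

theorem isReal_of_synth (hφ : IsSmooth G φ) (h : ∀ x, conj (synth G φ x) = synth G φ x) :
    IsReal G φ :=
  isReal_iff.2 (ae_eq_of_synth hφ.reflConj hφ fun x => by rw [← conj_synth, h])

theorem IsReal.congr (hφ : IsReal G φ) (h : φ =ᵐ[freq G] ψ) : IsReal G ψ :=
  isReal_iff.2 ((reflConj_congr h.symm).trans ((isReal_iff.1 hφ).trans h))

theorem IsReal.add (hφ : IsReal G φ) (hψ : IsReal G ψ) : IsReal G (φ + ψ) := by
  filter_upwards [hφ, hψ] with ξ h1 h2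
  rw [Pi.add_apply, Pi.add_apply, h1, h2, map_add]

theorem IsReal.sub (hφ : IsReal G φ) (hψ : IsReal G ψ) : IsReal G (φ - ψ) := by
  filter_upwards [hφ, hψ] with ξ h1 h2
  rw [Pi.sub_apply, Pi.sub_apply, h1, h2, map_sub]

theorem IsReal.smul (c : ℝ) (hφ : IsReal G φ) : IsReal G ((c : ℂ) • φ) := by
  filter_upwards [hφ] with ξ h1
  rw [Pi.smul_apply, Pi.smul_apply, h1, smul_eq_mul, smul_eq_mul, map_mul, Complex.conj_ofReal]

theorem IsReal.dx (hφ : IsReal G φ) : IsReal G (dx φ) := by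
  filter_upwards [hφ] with ξ h1
  rw [BenjaminOno.dx, BenjaminOno.dx, h1]
  simp

theorem IsReal.hilbert (hφ : IsReal G φ) : IsReal G (hilbert φ) := by
  filter_upwards [hφ] with ξ h1
  rw [BenjaminOno.hilbert, BenjaminOno.hilbert, h1]
  simp [Real.sign_neg]

theorem IsReal.conv (hφr : IsReal G φ) (hψr : IsReal G ψ) (hφ : IsSmooth G φ) (hψ : IsSmooth G ψ) :
    IsReal G (conv G φ ψ) :=
  isReal_of_synth (hφ.conv hψ) fun x => by
    rw [synth_conv hφ.integrable hψ.integrable, map_mul, hφr.conj_synth, hψr.conj_synth]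

theorem phys_conv (hφr : IsReal G φ) (hφ : IsSmooth G φ) (hψ : IsSmooth G ψ) (x : ℝ) :
    phys G (conv G φ ψ) x = phys G φ x * phys G ψ x := by
  rw [phys, synth_conv hφ.integrable hψ.integrable, ← hφr.ofReal_phys, Complex.re_ofReal_mul, phys,
    phys]

theorem phys_add_smul (hφ : IsSmooth G φ) (hψ : IsSmooth G ψ) (θ x : ℝ) :
    phys G (φ + (θ : ℂ) • ψ) x = phys G φ x + θ * phys G ψ x := by
  rw [phys, synth_add hφ.integrable (hψ.smul _).integrable, synth_smul, Pi.add_apply, Pi.smul_apply,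
    smul_eq_mul, Complex.add_re, Complex.re_ofReal_mul, phys, phys]

theorem integrable_phys_mul (hφr : IsReal G φ) (hφ : IsSmooth G φ) (hψ : IsSmooth G ψ) :
    Integrable (fun x => phys G φ x * phys G ψ x) (space G) :=
  (integrable_synth_mul hφ hψ).re.congr (Eventually.of_forall fun x => by
    simp only [← hφr.ofReal_phys]
    exact Complex.re_ofReal_mul _ _)

theorem ofReal_integral_phys_mul (hφr : IsReal G φ) (hψr : IsReal G ψ) :
    ((∫ x, phys G φ x * phys G ψ x ∂(space G) : ℝ) : ℂ) =
      ∫ x, synth G φ x * synth G ψ x ∂(space G) := by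
  rw [← integral_complex_ofReal]
  simp only [Complex.ofReal_mul, hφr.ofReal_phys, hψr.ofReal_phys]

theorem ofReal_integral_phys_mul_eq (hφr : IsReal G φ) (hψr : IsReal G ψ) (hφ : IsSmooth G φ)
    (hψ : IsSmooth G ψ) : ((∫ x, phys G φ x * phys G ψ x ∂(space G) : ℝ) : ℂ) =
      ∫ ξ, conj (φ ξ) * ψ ξ ∂(freq G) := by
  rw [ofReal_integral_phys_mul hφr hψr, ← (plancherel hφ hψ).2]
  simp only [hφr.conj_synth]

theorem hilbert_dx (φ : ℝ → ℂ) (ξ : ℝ) : hilbert (dx φ) ξ = (|ξ| : ℝ) * φ ξ := by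
  have h : ((Real.sign ξ : ℝ) : ℂ) * ξ = (|ξ| : ℝ) := by
    rw [← Complex.ofReal_mul]
    congr 1
    rcases lt_trichotomy ξ 0 with h | h | h
    · rw [Real.sign_of_neg h, abs_of_neg h]; ring
    · simp [h]
    · rw [Real.sign_of_pos h, abs_of_pos h, one_mul]
  rw [hilbert, dx, ← h]
  linear_combination (-(Real.sign ξ : ℂ) * ξ * φ ξ) * Complex.I_mul_I

/-- In frequency H∂ₓ is multiplication by the real symbol |ξ|, hence symmetric. -/
theorem integral_mul_hilbert_dx (hφr : IsReal G φ) (hψr : IsReal G ψ) (hφ : IsSmooth G φ)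
    (hψ : IsSmooth G ψ) : ∫ x, phys G φ x * phys G (hilbert (dx ψ)) x ∂(space G) =
      ∫ x, phys G ψ x * phys G (hilbert (dx φ)) x ∂(space G) := by
  have h1 := ofReal_integral_phys_mul_eq hφr hψr.dx.hilbert hφ hψ.dx.hilbert
  have h2 := ofReal_integral_phys_mul_eq hψr hφr.dx.hilbert hψ hφ.dx.hilbert
  have h3 := congrArg conj h2
  rw [Complex.conj_ofReal, ← integral_conj] at h3
  have h4 := h1.trans (Eq.trans (integral_congr_ae (Eventually.of_forall fun ξ => ?_)) h3.symm)
  · exact_mod_cast h4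
  · simp only [hilbert_dx, map_mul, Complex.conj_conj, Complex.conj_ofReal]
    ring

/-- Momentum and energy are polynomials of degree at most three along a line q + θf, so their
derivatives are read off without differentiating under the integral. -/
theorem hasDerivAt_integral_cubic {μ : Measure ℝ} {A B C D : ℝ → ℝ} (hA : Integrable A μ)
    (hB : Integrable B μ) (hC : Integrable C μ) (hD : Integrable D μ) :
    HasDerivAt (fun θ : ℝ => ∫ x, (A x + θ * B x + θ ^ 2 * C x + θ ^ 3 * D x) ∂μ)
      (∫ x, B x ∂μ) 0 := by
  have h : ∀ θ : ℝ, ∫ x, (A x + θ * B x + θ ^ 2 * C x + θ ^ 3 * D x) ∂μ =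
      ∫ x, A x ∂μ + θ * ∫ x, B x ∂μ + θ ^ 2 * ∫ x, C x ∂μ + θ ^ 3 * ∫ x, D x ∂μ := fun θ => by
    have hB' := hB.const_mul θ
    have hC' := hC.const_mul (θ ^ 2)
    have hD' := hD.const_mul (θ ^ 3)
    rw [integral_add (by exact (hA.add hB').add hC') hD', integral_add (by exact hA.add hB') hC',
      integral_add hA hB', integral_const_mul, integral_const_mul, integral_const_mul]
  simp only [h]
  have h1 := ((((hasDerivAt_id (0 : ℝ)).mul_const (∫ x, B x ∂μ)).const_add (∫ x, A x ∂μ)).add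
    (((hasDerivAt_id (0 : ℝ)).pow 2).mul_const (∫ x, C x ∂μ))).add
    (((hasDerivAt_id (0 : ℝ)).pow 3).mul_const (∫ x, D x ∂μ))
  refine h1.congr_deriv ?_
  simp

end Reality

/-! ### Weak gradients; the momentum and the Benjamin–Ono energy. -/

section Gradient

variable {G : Geometry} {s : ℝ}

theorem Sob.coeFn_add_smul (q f : Sob G s) (θ : ℝ) :
    (q + θ • f : Sob G s) =ᵐ[freq G] ⇑q + (θ : ℂ) • ⇑f := by
  have h1 : ((θ • f : Sob G s)) =ᵐ[freq G] θ • ⇑f := ae_sobMeasure_iff.1 (Lp.coeFn_smul θ f)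
  filter_upwards [Sob.coeFn_add q (θ • f), h1] with ξ h2 h3
  rw [h2, Pi.add_apply, h3]
  simp

theorem phys_sob_add_smul {q f : Sob G s} (hq : IsSmooth G q) (hf : IsSmooth G f) (θ x : ℝ) :
    phys G (q + θ • f : Sob G s) x = phys G q x + θ * phys G f x := by
  rw [phys_congr (Sob.coeFn_add_smul q f θ), phys_add_smul hq hf]

/-- `γ` represents the derivative of `F` at `q` in the directions `∂ₓ g`. -/
structure IsWeakGradient (G : Geometry) {s : ℝ} (F : (ℝ → ℂ) → ℝ) (q : Sob G s) (γ : ℝ → ℂ) :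
    Prop where
  isReal : IsReal G γ
  isSmooth : IsSmooth G γ
  hasDerivAt : ∀ (f : Sob G s) (g : ℝ → ℂ), IsReal G f → IsSmooth G f → f =ᵐ[freq G] dx g →
    HasDerivAt (fun θ : ℝ => F (q + θ • f : Sob G s)) (∫ x, phys G γ x * phys G f x ∂(space G)) 0

theorem IsGradient.isWeakGradient {F : (ℝ → ℂ) → ℝ} {q γ : Sob G s} (h : IsGradient G F q γ) :
    IsWeakGradient G F q γ := ⟨h.1, h.2.1, fun f _ hf hf' _ => h.2.2 f hf hf'⟩

/-- Testing with f = ∂ₓ²(γ - γ') produces the squared L² norm of ∂ₓ(γ - γ'). Only ∂ₓγ enters the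
flow, so derivatives in exact directions suffice to determine it. -/
theorem IsWeakGradient.dx_ae_eq {F : (ℝ → ℂ) → ℝ} {q : Sob G s} {γ γ' : ℝ → ℂ}
    (h : IsWeakGradient G F q γ) (h' : IsWeakGradient G F q γ') : dx γ =ᵐ[freq G] dx γ' := by
  set χ := γ - γ' with hχ
  have hχr : IsReal G χ := h.isReal.sub h'.isReal
  have hχs : IsSmooth G χ := h.isSmooth.sub h'.isSmooth
  have hfs : IsSmooth G (dx (dx χ)) := hχs.dx.dx
  set f : Sob G s := (hfs s).toLp with hf
  have hfe : f =ᵐ[freq G] dx (dx χ) := Sob.coeFn_toLp _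
  have hfr : IsReal G f := hχr.dx.dx.congr hfe.symm
  have hfs' : IsSmooth G f := hfs.congr hfe.symm
  have h1 := (h.hasDerivAt f _ hfr hfs' hfe).unique (h'.hasDerivAt f _ hfr hfs' hfe)
  have h2 := congrArg (fun r : ℝ => (r : ℂ)) h1
  rw [ofReal_integral_phys_mul_eq h.isReal hfr h.isSmooth hfs',
    ofReal_integral_phys_mul_eq h'.isReal hfr h'.isSmooth hfs', ← sub_eq_zero, ← integral_sub] at h2
  rotate_left
  · exact h.isSmooth.memLp.star.integrable_mul hfs'.memLp
  · exact h'.isSmooth.memLp.star.integrable_mul hfs'.memLp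
  have h3 : (∫ ξ, ((‖dx χ ξ‖ ^ 2 : ℝ) : ℂ) ∂(freq G)) = 0 := by
    rw [← neg_eq_zero, ← integral_neg, ← h2]
    refine integral_congr_ae ?_
    filter_upwards [hfe] with ξ hξ
    rw [hξ, ← Complex.normSq_eq_norm_sq, ← Complex.mul_conj]
    simp only [dx, hχ, Pi.sub_apply, map_mul, map_sub, Complex.conj_I, Complex.conj_ofReal]
    ring_nf
  rw [integral_complex_ofReal, Complex.ofReal_eq_zero,
    integral_eq_zero_iff_of_nonneg (fun ξ => by positivity) hχs.dx.memLp.norm.integrable_sq] at h3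
  filter_upwards [h3] with ξ hξ
  simp only [Pi.zero_apply, ne_eq, OfNat.ofNat_ne_zero, not_false_eq_true, pow_eq_zero_iff,
    norm_eq_zero] at hξ
  simp only [dx, hχ, Pi.sub_apply] at hξ ⊢
  linear_combination hξ

theorem IsWeakGradient.comb {F H : (ℝ → ℂ) → ℝ} {q : Sob G s} {γ η : ℝ → ℂ}
    (hF : IsWeakGradient G F q γ) (hH : IsWeakGradient G H q η) (c d : ℝ) :
    IsWeakGradient G (fun v => c * F v + d * H v) q ((c : ℂ) • γ + (d : ℂ) • η) where
  isReal := (hF.isReal.smul c).add (hH.isReal.smul d)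
  isSmooth := (hF.isSmooth.smul _).add (hH.isSmooth.smul _)
  hasDerivAt := fun f g hf hfs hfg => by
    refine (((hF.hasDerivAt f g hf hfs hfg).const_mul c).add
      ((hH.hasDerivAt f g hf hfs hfg).const_mul d)).congr_deriv ?_
    have hγ := (integrable_phys_mul hF.isReal hF.isSmooth hfs).const_mul c
    have hη := (integrable_phys_mul hH.isReal hH.isSmooth hfs).const_mul d
    rw [← integral_const_mul, ← integral_const_mul, ← integral_add hγ hη]
    refine integral_congr_ae (Eventually.of_forall fun x => ?_)
    have e1 : phys G ((c : ℂ) • γ) x = c * phys G γ x := by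
      rw [phys, synth_smul, Pi.smul_apply, smul_eq_mul, Complex.re_ofReal_mul, phys]
    simp only [phys_add_smul (hF.isSmooth.smul _) hH.isSmooth, e1]
    ring

theorem isWeakGradient_momentum {q : Sob G s} (hq : IsReal G q) (hqs : IsSmooth G q) :
    IsWeakGradient G (momentum G) q q where
  isReal := hq
  isSmooth := hqs
  hasDerivAt := fun f g hf hfs _ => by
    have h := hasDerivAt_integral_cubic ((integrable_phys_mul hq hqs hqs).const_mul (1 / 2))
      (integrable_phys_mul hq hqs hfs) ((integrable_phys_mul hf hfs hfs).const_mul (1 / 2))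
      (integrable_zero ℝ ℝ (space G))
    refine h.congr_of_eventuallyEq (Eventually.of_forall fun θ => ?_)
    refine integral_congr_ae (Eventually.of_forall fun x => ?_)
    simp only [phys_sob_add_smul hqs hfs, Pi.zero_apply]
    ring

theorem isWeakGradient_hamBO {q : Sob G s} (hq : IsReal G q) (hqs : IsSmooth G q) :
    IsWeakGradient G (hamBO G) q (hilbert (dx q) - conv G q q) where
  isReal := hq.dx.hilbert.sub (hq.conv hq hqs hqs)
  isSmooth := hqs.dx.hilbert.sub (hqs.conv hqs)
  hasDerivAt := fun f g hf hfs _ => by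
    have hq3 := integrable_phys_mul (hq.conv hq hqs hqs) (hqs.conv hqs) hqs
    have hq2 := integrable_phys_mul (hq.conv hq hqs hqs) (hqs.conv hqs) hfs
    have hq1 := integrable_phys_mul (hf.conv hf hfs hfs) (hfs.conv hfs) hqs
    have hf3 := integrable_phys_mul (hf.conv hf hfs hfs) (hfs.conv hfs) hfs
    have iqf := integrable_phys_mul hq hqs hfs.dx.hilbert
    have ifq := integrable_phys_mul hf hfs hqs.dx.hilbert
    have iqq := integrable_phys_mul hq hqs hqs.dx.hilbert
    have iff' := integrable_phys_mul hf hfs hfs.dx.hilbert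
    have h := hasDerivAt_integral_cubic ((iqq.const_mul (1 / 2)).sub (hq3.const_mul (1 / 3)))
      (((ifq.const_mul (1 / 2)).add (iqf.const_mul (1 / 2))).sub hq2)
      ((iff'.const_mul (1 / 2)).sub hq1) (hf3.const_mul (-(1 / 3)))
    refine (h.congr_of_eventuallyEq (Eventually.of_forall fun θ => ?_)).congr_deriv ?_
    · refine integral_congr_ae (Eventually.of_forall fun x => ?_)
      have e : hilbert (dx (q + θ • f : Sob G s)) =ᵐ[freq G]
          hilbert (dx q) + (θ : ℂ) • hilbert (dx f) := by
        filter_upwards [hilbert_congr (dx_congr (Sob.coeFn_add_smul q f θ))] with ξ hξ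
        rw [hξ]
        simp only [hilbert, dx, Pi.add_apply, Pi.smul_apply, smul_eq_mul]
        ring
      simp only [phys_sob_add_smul hqs hfs, phys_congr e,
        phys_add_smul hqs.dx.hilbert hfs.dx.hilbert, Pi.sub_apply, Pi.add_apply,
        phys_conv hq hqs hqs, phys_conv hf hfs hfs]
      ring
    · have e : ∀ x, phys G (hilbert (dx q) - conv G q q) x =
          phys G (hilbert (dx q)) x - phys G q x * phys G q x := fun x => by
        rw [phys, synth_sub hqs.dx.hilbert.integrable (hqs.conv hqs).integrable, Pi.sub_apply,
          Complex.sub_re, ← phys_conv hq hqs hqs, phys, phys]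
      have e1 := integral_mul_hilbert_dx hq hf hqs hfs
      have e2 : ∫ x, phys G (hilbert (dx q) - conv G q q) x * phys G f x ∂(space G) =
          ∫ x, (phys G f x * phys G (hilbert (dx q)) x - phys G (conv G q q) x * phys G f x)
            ∂(space G) := by
        refine integral_congr_ae (Eventually.of_forall fun x => ?_)
        simp only [e, phys_conv hq hqs hqs]
        ring
      simp only [Pi.sub_apply, Pi.add_apply]
      rw [e2, integral_sub ifq hq2, integral_sub (by exact (ifq.const_mul _).add (iqf.const_mul _))
        hq2, integral_add (ifq.const_mul _) (iqf.const_mul _), integral_const_mul,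
        integral_const_mul, e1]
      ring

end Gradient

/-! ### The gradient of the regularized Hamiltonian -/

section BetaGradient

variable {G : Geometry} {s : ℝ} [hs : Fact (-(1 / 2) < s ∧ s < 0)]

/-- The Fourier transform of the functional derivative of `β(κ; ·)`, for real `κ`. -/
def betaGradient (G : Geometry) (q : ℝ → ℂ) (κ : ℝ) : ℝ → ℂ :=
  gaugeM G q κ + reflConj (gaugeM G q κ) + conv G (gaugeM G q κ) (reflConj (gaugeM G q κ))

theorem isSmooth_betaGradient {q : Sob G s} {κ : ℝ} (hκ : 0 < κ) (hq : IsSmooth G q)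
    (h : IsUnit (laxT q (κ : ℂ))) : IsSmooth G (betaGradient G q κ) := by
  have ha := isSmooth_gaugeM (z := (κ : ℂ)) (by simpa using hκ) hq h
  exact (ha.add ha.reflConj).add (ha.conv ha.reflConj)

theorem synth_betaGradient {q : Sob G s} {κ : ℝ} (hκ : 0 < κ) (hq : IsSmooth G q)
    (h : IsUnit (laxT q (κ : ℂ))) : synth G (betaGradient G q κ) = betaDensity G q κ := by
  have ha := isSmooth_gaugeM (z := (κ : ℂ)) (by simpa using hκ) hq h
  rw [betaGradient, synth_add (ha.add ha.reflConj).integrable (ha.conv ha.reflConj).integrable,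
    synth_add ha.integrable ha.reflConj.integrable, betaDensity, Complex.conj_ofReal]
  funext x
  simp only [density, Pi.add_apply, Pi.mul_apply, Pi.star_apply, RCLike.star_def, conj_synth,
    synth_conv ha.integrable ha.reflConj.integrable]

theorem isReal_betaGradient {q : Sob G s} {κ : ℝ} (hκ : 0 < κ) (hq : IsSmooth G q)
    (h : IsUnit (laxT q (κ : ℂ))) : IsReal G (betaGradient G q κ) := by
  refine isReal_of_synth (isSmooth_betaGradient hκ hq h) fun x => ?_
  rw [synth_betaGradient hκ hq h, betaDensity, Complex.conj_ofReal]
  simp only [density, Pi.add_apply, Pi.mul_apply, Pi.star_apply, RCLike.star_def, map_add, map_mul,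
    Complex.conj_conj]
  ring

theorem isWeakGradient_beta {q : Sob G s} {κ : ℝ} (hκ : 0 < κ) (hq : IsReal G q)
    (hqs : IsSmooth G q) (h : IsUnit (laxT q (κ : ℂ))) :
    IsWeakGradient G (fun v => (beta G v κ).re) q (betaGradient G q κ) where
  isReal := isReal_betaGradient hκ hqs h
  isSmooth := isSmooth_betaGradient hκ hqs h
  hasDerivAt := fun f g hf hfs _ => by
    have hu : HasDerivAt (fun θ : ℝ => q + θ • f) f 0 := by
      simpa using ((hasDerivAt_id (0 : ℝ)).smul_const f).const_add q
    have h0 : q + (0 : ℝ) • f = q := by simp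
    have h1 := hasDerivWithinAt_beta (u := fun θ : ℝ => q + θ • f) (z := (κ : ℂ)) (t := 0)
      (by simpa using hκ) hu.hasDerivWithinAt (I := Set.univ) (by rwa [h0]) (by rwa [h0]) hf hfs
      (by rwa [h0]) (by rwa [h0, Complex.conj_ofReal])
    rw [hasDerivWithinAt_univ, h0, ← synth_betaGradient hκ hqs h,
      ← ofReal_integral_phys_mul (isReal_betaGradient hκ hqs h) hf] at h1
    have h2 := Complex.reCLM.hasFDerivAt.comp_hasDerivAt (0 : ℝ) h1
    exact h2.congr_deriv (Complex.ofReal_re _)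

variable (G) in
/-- The coefficient of the translation part of the flow of `H_κ`. -/
def transport (κ : ℝ) (q : ℝ → ℂ) : ℝ :=
  match G with
  | .line => κ
  | .circle => κ + ∫ x, phys .circle q x ∂(space .circle)

omit hs in
theorem integral_phys_circle {φ : ℝ → ℂ} (hφ : IsSmooth .circle φ) :
    ∫ x, phys .circle φ x ∂(space .circle) = (φ 0).re := by
  have hi : Integrable (synth .circle φ) (space .circle) :=
    hφ.continuous_synth.integrableOn_Ioc (a := 0) (b := 1) (μ := volume)
  have h : (∫ x, synth .circle φ x ∂(space .circle)).re = _ := (integral_re hi).symm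
  rw [← integral_synth_circle hφ.integrable, h]
  rfl

omit hs in
theorem ae_freq_circle_zero {p : ℝ → Prop} (h : ∀ᵐ ξ ∂(freq .circle), p ξ) : p 0 := by
  simpa using ae_freq_circle.1 h 0

omit hs in
-- A derivative has vanishing zero mode, so such variations leave the mean unchanged.
theorem integral_phys_add_smul {q f : Sob .circle s} (hq : IsSmooth .circle q)
    (hf : IsSmooth .circle f) {g : ℝ → ℂ} (hg : f =ᵐ[freq .circle] dx g) (θ : ℝ) :
    ∫ x, phys .circle (q + θ • f : Sob .circle s) x ∂(space .circle) =
      ∫ x, phys .circle q x ∂(space .circle) := by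
  have h0 : f 0 = 0 := by
    rw [ae_freq_circle_zero hg, dx]
    simp
  rw [integral_phys_circle hq, phys_congr (Sob.coeFn_add_smul q f θ),
    integral_phys_circle (hq.add (hf.smul _)), Pi.add_apply, Pi.smul_apply, h0, smul_zero, add_zero]

/-- Along variations of mean zero the powers of the mean are constants, and H_κ is a constant
multiple of the momentum minus κ²β plus a constant, also on the circle. -/
theorem isWeakGradient_hamK {q : Sob G s} {κ : ℝ} (hκ : 0 < κ) (hq : IsReal G q)
    (hqs : IsSmooth G q) (h : IsUnit (laxT q (κ : ℂ))) :
    IsWeakGradient G (hamK G κ) q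
      ((transport G κ q : ℂ) • ⇑q + ((-κ ^ 2 : ℝ) : ℂ) • betaGradient G q κ) := by
  have h1 := (isWeakGradient_momentum hq hqs).comb (isWeakGradient_beta hκ hq hqs h)
    (transport G κ q) (-κ ^ 2)
  refine ⟨h1.isReal, h1.isSmooth, fun f g hf hfs hfg => ?_⟩
  have h2 := h1.hasDerivAt f g hf hfs hfg
  cases G with
  | line =>
    refine h2.congr_of_eventuallyEq (Eventually.of_forall fun θ => ?_)
    simp only [hamK, transport]
    ring
  | circle =>
    refine (h2.add_const (κ / 2 * (∫ x, phys .circle q x ∂(space .circle)) ^ 2 +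
      1 / 6 * (∫ x, phys .circle q x ∂(space .circle)) ^ 3)).congr_of_eventuallyEq
      (Eventually.of_forall fun θ => ?_)
    simp only [hamK, transport, integral_phys_add_smul hqs hfs hfg]
    ring

theorem isSmoothFamily_betaGradient {u : ℝ → Sob G s} {I : Set ℝ} {κ : ℝ} (hκ : 0 < κ)
    (hu : IsSmoothFamily G I fun t => u t) (h : ∀ t ∈ I, IsUnit (laxT (u t) (κ : ℂ))) :
    IsSmoothFamily G I fun t => betaGradient G (u t) κ := by
  have ha := isSmoothFamily_gaugeM (z := (κ : ℂ)) (by simpa using hκ) hu h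
  exact (ha.add ha.reflConj).add (ha.conv ha.reflConj)

omit hs in
theorem synth_indicator_zero {φ : ℝ → ℂ} (hφ : IsSmooth .circle φ) :
    synth .circle (fun ξ => Set.indicator {0} 1 ξ * φ ξ) 0 = φ 0 := by
  have hs : IsSmooth .circle fun ξ => Set.indicator {0} 1 ξ * φ ξ :=
    (hφ.indicator (measurableSet_singleton 0)).congr (Eventually.of_forall fun ξ => by
      simp only [Set.indicator_apply]
      split_ifs <;> simp)
  have hc : ∀ x, synth .circle (fun ξ => Set.indicator {0} 1 ξ * φ ξ) x =
      synth .circle (fun ξ => Set.indicator {0} 1 ξ * φ ξ) 0 := fun x => by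
    rw [synth, synth]
    congr 1
    refine integral_congr_ae (Eventually.of_forall fun ξ => ?_)
    by_cases h : ξ = 0 <;> simp [h]
  have h1 := integral_synth_circle hs.integrable
  simp only [hc] at h1
  simpa [space] using h1

omit hs in
theorem continuousOn_transport {u : ℝ → Sob G s} {I : Set ℝ} (κ : ℝ)
    (hu : IsSmoothFamily G I fun t => u t) : ContinuousOn (fun t => transport G κ (u t)) I := by
  cases G with
  | line => exact continuousOn_const
  | circle =>
    refine continuousOn_const.add ?_
    obtain ⟨v, hv, hv'⟩ := hu.mul_of_le (a := Set.indicator {0} 1)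
      (measurable_one.indicator (measurableSet_singleton 0)) (C := 1) (k := 0) zero_le_one
      (fun ξ => by
        rw [Real.rpow_zero, mul_one]
        exact (norm_indicator_le_norm_self _ _).trans (by simp)) 1
    refine (Complex.continuous_re.comp_continuousOn
      ((evalCLM .circle 0).continuous.comp_continuousOn hv)).congr fun t ht => ?_
    rw [integral_phys_circle (hu.isSmooth ht)]
    simp only [Function.comp_apply]
    rw [evalCLM_apply, synth_congr (hv' t ht), synth_indicator_zero (hu.isSmooth ht)]

end BetaGradient

/-! ### Conservation of `β` -/

section Conservation

variable {G : Geometry} {s : ℝ} [hs : Fact (-(1 / 2) < s ∧ s < 0)]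

/-- The flow of `∂ₓ γ` at `q` does not change `β`, to first order. -/
def Preserves (G : Geometry) (q γ : ℝ → ℂ) : Prop :=
  ∀ z : ℂ, z.im ≠ 0 → 0 < z.re → betaDensity G q z * deriv (synth G γ) ∈ meanZero G

omit hs in
theorem Preserves.comb {q γ η : ℝ → ℂ} (hγ : Preserves G q γ) (hη : Preserves G q η)
    (hγs : IsSmooth G γ) (hηs : IsSmooth G η) (c d : ℂ) : Preserves G q (c • γ + d • η) := by
  intro z hz hz'
  have e : betaDensity G q z * deriv (synth G (c • γ + d • η)) =
      cst c * (betaDensity G q z * deriv (synth G γ)) +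
        cst d * (betaDensity G q z * deriv (synth G η)) := by
    have h1 : dx (c • γ + d • η) = c • dx γ + d • dx η := funext fun ξ => by
      simp only [dx, Pi.add_apply, Pi.smul_apply, smul_eq_mul]
      ring
    rw [((hγs.smul c).add (hηs.smul d)).deriv_synth, h1,
      synth_add (hγs.dx.smul c).integrable (hηs.dx.smul d).integrable, synth_smul, synth_smul,
      hγs.deriv_synth, hηs.deriv_synth]
    funext x
    simp only [Pi.mul_apply, Pi.add_apply, Pi.smul_apply, smul_eq_mul]
    ring
  rw [e]
  exact add_mem (cst_mul_mem c (hγ z hz hz')) (cst_mul_mem d (hη z hz hz'))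

theorem exists_isGauge_isCogauge {q : Sob G s} (hq : IsReal G q) (hqs : IsSmooth G q) {z : ℂ}
    (hz : 0 < z.re) (h : IsUnit (laxT q z)) (h' : IsUnit (laxT q (conj z))) :
    ∃ g e, IsGauge G (synth G q) z (synth G (gaugeM G q z)) g ∧
      IsCogauge G (synth G q) z (star (synth G (gaugeM G q (conj z)))) e := by
  obtain ⟨g, hg⟩ := exists_isGauge hz hqs h
  obtain ⟨e, he⟩ := exists_isGauge (z := conj z) (by simpa using hz) hqs h'
  exact ⟨g, star e, hg, he.isCogauge (funext fun x => hq.conj_synth x)⟩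

theorem exists_isGauge_of_im_ne_zero {q : Sob G s} (hq : IsReal G q) (hqs : IsSmooth G q) {z : ℂ}
    (hz : z.im ≠ 0) (hz' : 0 < z.re) :
    ∃ g e, IsGauge G (synth G q) z (synth G (gaugeM G q z)) g ∧
      IsCogauge G (synth G q) z (star (synth G (gaugeM G q (conj z)))) e :=
  exists_isGauge_isCogauge hq hqs hz' (isUnit_laxT_of_im_ne_zero hq hz)
    (isUnit_laxT_of_im_ne_zero hq (by simpa using hz))

theorem preserves_translation {q : Sob G s} (hq : IsReal G q) (hqs : IsSmooth G q) :
    Preserves G q q := by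
  intro z hz hz'
  obtain ⟨g, e, hm, hn⟩ := exists_isGauge_of_im_ne_zero hq hqs hz hz'
  exact density_translation_mem (S := Set.univ) ⟨q, hqs, by simp, rfl⟩ hm hn

/-- H∂ₓ acts as -i∂ₓ on nonnegative and as i∂ₓ on negative frequencies, which puts the gradient into
the form treated in `density_BO_mem`. -/
theorem preserves_BO {q : Sob G s} (hq : IsReal G q) (hqs : IsSmooth G q) :
    Preserves G q (hilbert (dx q) - conv G q q) := by
  intro z hz hz'
  obtain ⟨g, e, hm, hn⟩ := exists_isGauge_of_im_ne_zero hq hqs hz hz'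
  have hv := hqs.indicator (S := Set.Ici 0) measurableSet_Ici
  have hw := hqs.indicator (S := Set.Iio 0) measurableSet_Iio
  have hu : synth G q = synth G ((Set.Ici 0).indicator q) + synth G ((Set.Iio 0).indicator q) := by
    rw [← synth_add hv.integrable hw.integrable, ← Set.compl_Ici, Set.indicator_self_add_compl]
  have h1 := density_BO_mem (v := synth G ((Set.Ici 0).indicator q))
    (w := synth G ((Set.Iio 0).indicator q))
    ⟨_, hv, Eventually.of_forall fun ξ h => Set.indicator_of_notMem h _, rfl⟩
    ⟨_, hw, Eventually.of_forall fun ξ h => Set.indicator_of_notMem h _, rfl⟩ hu hm hn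
  have h2 : hilbert (dx q) = (-Complex.I) • dx ((Set.Ici 0).indicator q) +
      Complex.I • dx ((Set.Iio 0).indicator q) := funext fun ξ => by
    rw [hilbert_dx]
    simp only [Pi.add_apply, Pi.smul_apply, smul_eq_mul, dx]
    rcases le_or_gt 0 ξ with h | h
    · rw [Set.indicator_of_mem (Set.mem_Ici.2 h), Set.indicator_of_notMem (by simpa using h),
        abs_of_nonneg h]
      linear_combination (ξ * q ξ) * Complex.I_mul_I
    · rw [Set.indicator_of_notMem (by simpa using h), Set.indicator_of_mem (Set.mem_Iio.2 h),
        abs_of_neg h]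
      push_cast
      linear_combination (-ξ * q ξ) * Complex.I_mul_I
  have h3 : synth G (hilbert (dx q) - conv G q q) =
      -(cst Complex.I * deriv (synth G ((Set.Ici 0).indicator q))) +
        cst Complex.I * deriv (synth G ((Set.Iio 0).indicator q)) - synth G q * synth G q := by
    rw [synth_sub hqs.dx.hilbert.integrable (hqs.conv hqs).integrable, h2,
      synth_add (hv.dx.smul _).integrable (hw.dx.smul _).integrable, synth_smul, synth_smul,
      hv.deriv_synth, hw.deriv_synth]
    funext x
    simp only [Pi.mul_apply, Pi.add_apply, Pi.sub_apply, Pi.smul_apply, Pi.neg_apply, smul_eq_mul,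
      synth_conv hqs.integrable hqs.integrable]
    ring
  rw [h3]
  exact h1

theorem preserves_betaGradient {q : Sob G s} {κ : ℝ} (hκ : 0 < κ) (hq : IsReal G q)
    (hqs : IsSmooth G q) (h : IsUnit (laxT q (κ : ℂ))) :
    Preserves G q (betaGradient G q κ) := by
  intro z hz hz'
  obtain ⟨g, e, hm, hn⟩ := exists_isGauge_of_im_ne_zero hq hqs hz hz'
  obtain ⟨p, r, ha, hb⟩ := exists_isGauge_isCogauge (z := (κ : ℂ)) hq hqs (by simpa using hκ) h
    (by rwa [Complex.conj_ofReal])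
  rw [synth_betaGradient hκ hqs h]
  refine density_gauge_mem (fun h0 => hz (by simp [h0])) (by simpa using hκ.ne') (fun h0 => hz ?_)
    hm hn ha hb
  simp [h0]

omit hs in
theorem IsSmooth.hasDerivAt_phys {φ : ℝ → ℂ} (hφ : IsSmooth G φ) (x : ℝ) :
    HasDerivAt (phys G φ) (phys G (BenjaminOno.dx φ) x) x :=
  Complex.reCLM.hasFDerivAt.comp_hasDerivAt x (hφ.hasDerivAt_synth x)

/-- At each nonreal z the function β(z; u(t)) is differentiable in t with derivative zero, hence
constant. Nonreal z suffice by `sameBeta_of_nonreal`. -/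
theorem sameBeta_of_hasDerivWithinAt {u : ℝ → Sob G s} {Γ : ℝ → ℝ → ℂ} {a b : ℝ} (hab : a ≤ b)
    (hur : ∀ t ∈ Set.Icc a b, IsReal G (u t)) (hu : IsSmoothFamily G (Set.Icc a b) fun t => u t)
    (hΓr : ∀ t ∈ Set.Icc a b, IsReal G (Γ t)) (hΓ : IsSmoothFamily G (Set.Icc a b) Γ)
    (hd : ∀ t ∈ Set.Icc a b, ∀ x, HasDerivWithinAt (fun τ => phys G (u τ) x)
      (phys G (dx (Γ t)) x) (Set.Icc a b) t)
    (hc : ∀ t ∈ Set.Icc a b, Preserves G (u t) (Γ t)) {t : ℝ} (ht : t ∈ Set.Icc a b) :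
    SameBeta G (u t) (u a) := by
  have ha : a ∈ Set.Icc a b := ⟨le_rfl, hab⟩
  have hds : ∀ t ∈ Set.Icc a b, ∀ x, HasDerivWithinAt (fun τ => synth G (u τ) x)
      (synth G (dx (Γ t)) x) (Set.Icc a b) t := fun t ht x => by
    have h := Complex.ofRealCLM.hasFDerivAt.comp_hasDerivWithinAt t (hd t ht x)
    have h' := h.congr (f₁ := fun τ => synth G (u τ) x)
      (fun τ hτ => ((hur τ hτ).ofReal_phys x).symm) ((hur t ht).ofReal_phys x).symm
    exact h'.congr_deriv ((hΓr t ht).dx.ofReal_phys x)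
  refine sameBeta_of_nonreal (hur t ht) (hur a ha) fun z hz hz' => ?_
  have hb : ∀ τ ∈ Set.Icc a b, HasDerivWithinAt (fun τ => beta G (u τ) z) 0 (Set.Icc a b) τ := by
    intro τ hτ
    obtain ⟨w, hw, hw'⟩ := hasDerivWithinAt_of_synth (hs.out.2.le.trans zero_le_one) hab hu hΓ.dx
      hds hτ
    have h := hasDerivWithinAt_beta hz' hw' (hur τ hτ) (hu.isSmooth hτ)
      ((hΓr τ hτ).dx.congr hw.symm) ((hΓ.isSmooth hτ).dx.congr hw.symm)
      (isUnit_laxT_of_im_ne_zero (hur τ hτ) hz)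
      (isUnit_laxT_of_im_ne_zero (hur τ hτ) (by simpa using hz))
    refine h.congr_deriv ?_
    rw [synth_congr hw, ← (hΓ.isSmooth hτ).deriv_synth]
    exact (hc τ hτ z hz hz').2
  exact constant_of_has_deriv_right_zero (fun r hr => (hb r hr).continuousWithinAt)
    (fun r hr => (hb r ⟨hr.1, hr.2.le⟩).mono_of_mem_nhdsWithin (Icc_mem_nhdsGE_of_mem hr)) t ht

theorem mem_betaOrbit_of_hasDerivWithinAt {u : ℝ → Sob G s} {Γ : ℝ → ℝ → ℂ} {a b : ℝ}
    (hab : a ≤ b) (hur : ∀ t ∈ Set.Icc a b, IsReal G (u t))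
    (hu : IsSmoothFamily G (Set.Icc a b) fun t => u t)
    (hΓr : ∀ t ∈ Set.Icc a b, IsReal G (Γ t)) (hΓ : IsSmoothFamily G (Set.Icc a b) Γ)
    (hd : ∀ t ∈ Set.Icc a b, ∀ x, HasDerivWithinAt (fun τ => phys G (u τ) x)
      (phys G (dx (Γ t)) x) (Set.Icc a b) t)
    (hc : ∀ t ∈ Set.Icc a b, Preserves G (u t) (Γ t)) {Q : Set (Sob G s)} (hQ : u a ∈ Q) :
    u b ∈ betaOrbit G Q :=
  ⟨a, b, u, hab, hu.continuousOn, hur, hQ,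
    fun _ ht => sameBeta_of_hasDerivWithinAt hab hur hu hΓr hΓ hd hc ht, rfl⟩

/-- The gradient in the definition of a solution is some γ at each time, with no continuity assumed.
Its derivative ∂ₓγ coincides with that of an explicit weak gradient, which is a smooth family in
time and preserves β. -/
theorem jointOrbit_subset_betaOrbit {κ₀ : ℝ} (hκ₀ : 0 < κ₀) (Q : Set (Sob G s)) :
    jointOrbit G κ₀ Q ⊆ betaOrbit G Q := by
  rintro p ⟨q, hq, t₁, t₂, κ, hκ, u, ⟨⟨hur, hu⟩, hsol⟩, hinv, rfl, rfl⟩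
  have hκ0 : 0 < κ := hκ₀.trans_le hκ
  have hus : IsSmoothFamily G (Set.Icc 0 1) fun t => u t := hu
  have hBO : IsSmoothFamily G (Set.Icc 0 1) fun t => hilbert (dx (u t)) - conv G (u t) (u t) :=
    hus.dx.hilbert.sub (hus.conv hus)
  obtain ⟨Γ, hΓ, hw, hp⟩ : ∃ Γ : ℝ → ℝ → ℂ, IsSmoothFamily G (Set.Icc 0 1) Γ ∧
      (∀ t ∈ Set.Icc (0 : ℝ) 1,
        IsWeakGradient G (fun v => t₁ * hamBO G v + t₂ * hamK G κ v) (u t) (Γ t)) ∧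
      ∀ t ∈ Set.Icc (0 : ℝ) 1, Preserves G (u t) (Γ t) := by
    by_cases h2 : t₂ = 0
    · subst h2
      -- When t₂ = 0 the trajectory may leave the domain of H_κ, so a zero multiple of the momentum
      -- stands in for it.
      refine ⟨fun t => (t₁ : ℂ) • (hilbert (dx (u t)) - conv G (u t) (u t)) + ((0 : ℝ) : ℂ) • ⇑(u t),
        (hBO.smul continuousOn_const).add (hus.smul continuousOn_const), fun t ht => ?_,
        fun t ht => ?_⟩
      · have h := (isWeakGradient_hamBO (hur t ht) (hus.isSmooth ht)).comb
          (isWeakGradient_momentum (hur t ht) (hus.isSmooth ht)) t₁ 0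
        simp only [zero_mul] at h ⊢
        exact h
      · exact (preserves_BO (hur t ht) (hus.isSmooth ht)).comb
          (preserves_translation (hur t ht) (hus.isSmooth ht)) (hBO.isSmooth ht)
          (hus.isSmooth ht) _ _
    · have hunit : ∀ t ∈ Set.Icc (0 : ℝ) 1, IsUnit (laxT (u t) (κ : ℂ)) := fun t ht =>
        (laxInvertible_iff _ _).1 (hinv h2 t ht)
      have hβ := isSmoothFamily_betaGradient hκ0 hus hunit
      have hK : IsSmoothFamily G (Set.Icc 0 1) fun t => (transport G κ (u t) : ℂ) • ⇑(u t) +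
          ((-κ ^ 2 : ℝ) : ℂ) • betaGradient G (u t) κ :=
        (hus.smul (Complex.continuous_ofReal.comp_continuousOn (continuousOn_transport κ hus))).add
          (hβ.smul continuousOn_const)
      refine ⟨fun t => (t₁ : ℂ) • (hilbert (dx (u t)) - conv G (u t) (u t)) +
        (t₂ : ℂ) • ((transport G κ (u t) : ℂ) • ⇑(u t) + ((-κ ^ 2 : ℝ) : ℂ) •
          betaGradient G (u t) κ), (hBO.smul continuousOn_const).add (hK.smul continuousOn_const),
        fun t ht => ?_, fun t ht => ?_⟩
      · exact (isWeakGradient_hamBO (hur t ht) (hus.isSmooth ht)).comb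
          (isWeakGradient_hamK hκ0 (hur t ht) (hus.isSmooth ht) (hunit t ht)) t₁ t₂
      · exact (preserves_BO (hur t ht) (hus.isSmooth ht)).comb
          ((preserves_translation (hur t ht) (hus.isSmooth ht)).comb
            (preserves_betaGradient hκ0 (hur t ht) (hus.isSmooth ht) (hunit t ht))
            (hus.isSmooth ht) (hβ.isSmooth ht) _ _) (hBO.isSmooth ht) (hK.isSmooth ht) _ _
  refine mem_betaOrbit_of_hasDerivWithinAt zero_le_one hur hus (fun t ht => (hw t ht).isReal) hΓ
    (fun t ht x => ?_) hp hq
  obtain ⟨γ, hγ, hγ'⟩ := hsol t ht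
  refine (hγ' x).congr_deriv ?_
  rw [(hγ.2.1.hasDerivAt_phys x).deriv, phys_congr (hγ.isWeakGradient.dx_ae_eq (hw t ht))]

omit hs in
theorem phys_dx_BO {q : Sob G s} (hq : IsReal G q) (hqs : IsSmooth G q) (x : ℝ) :
    phys G (dx (hilbert (dx q) - conv G q q)) x =
      phys G (hilbert (dx (dx q))) x - 2 * phys G q x * deriv (phys G q) x := by
  have h1 := ((hqs.dx.hilbert.sub (hqs.conv hqs)).hasDerivAt_phys x)
  have h2 := hqs.dx.hilbert.hasDerivAt_phys x
  have h3 := (hqs.hasDerivAt_phys x).mul (hqs.hasDerivAt_phys x)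
  have e1 : phys G (hilbert (dx q) - conv G q q) =
      phys G (hilbert (dx q)) - phys G q * phys G q := funext fun y => by
    rw [phys, synth_sub hqs.dx.hilbert.integrable (hqs.conv hqs).integrable, Pi.sub_apply,
      Complex.sub_re, Pi.sub_apply, Pi.mul_apply, ← phys_conv hq hqs hqs, phys, phys]
  have e2 : dx (hilbert (dx q)) = hilbert (dx (dx q)) := funext fun ξ => by
    simp only [dx, hilbert]
    ring
  rw [e1] at h1
  rw [h1.unique (h2.sub h3), e2, (hqs.hasDerivAt_phys x).deriv]
  ring

theorem IsBOSolution.mem_betaOrbit_of_le {u : ℝ → Sob G s} (h : IsBOSolution G Set.univ u)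
    {a b : ℝ} (hab : a ≤ b) : u b ∈ betaOrbit G {u a} := by
  obtain ⟨⟨hur, hu⟩, hsol⟩ := h
  have hus : IsSmoothFamily G (Set.Icc a b) fun t => u t :=
    IsSmoothFamily.mono (I := Set.univ) hu (Set.subset_univ _)
  refine mem_betaOrbit_of_hasDerivWithinAt hab (fun t _ => hur t trivial) hus
    (Γ := fun t => hilbert (dx (u t)) - conv G (u t) (u t)) (fun t ht => ?_)
    (hus.dx.hilbert.sub (hus.conv hus)) (fun t ht x => ?_) (fun t ht => ?_) rfl
  · exact (isWeakGradient_hamBO (hur t trivial) (hus.isSmooth ht)).isReal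
  · rw [phys_dx_BO (hur t trivial) (hus.isSmooth ht)]
    exact (hsol t trivial x).mono (Set.subset_univ _)
  · exact preserves_BO (hur t trivial) (hus.isSmooth ht)

theorem IsBOSolution.mem_betaOrbit {u : ℝ → Sob G s} (h : IsBOSolution G Set.univ u) (a b : ℝ) :
    u b ∈ betaOrbit G {u a} := by
  rcases le_total a b with hab | hab
  · exact h.mem_betaOrbit_of_le hab
  · exact betaOrbit_symm (h.mem_betaOrbit_of_le hab)

end Conservation

end BenjaminOno

end

/-! ### Assembly of the corollary. -/

theorem corollary5p3 (G : Geometry) (s : ℝ) (hs : -(1 / 2) < s) (hs0 : s < 0) :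
    ∃ C : ℝ, 0 < C ∧
      (∀ A : ℝ, 0 < A → ∃ κ₀ : ℝ, 1 ≤ κ₀ ∧
        (∀ κ : ℝ, κ₀ ≤ κ → ∀ q ∈ betaOrbit G (realBall G s A), LaxInvertible G q κ) ∧
        ∀ Q : Set (Sob G s), Q ⊆ realBall G s A → (∀ q ∈ Q, IsSmooth G q) →
          jointOrbit G κ₀ Q ⊆ betaOrbit G Q ∧
          Bornology.IsBounded (jointOrbit G κ₀ Q) ∧
          (IsEquicontinuous Q → IsEquicontinuous (jointOrbit G κ₀ Q))) ∧
      (∀ A : ℝ, 0 < A → ∀ q₀ ∈ realBall G s A, ∀ q ∈ betaOrbit G {q₀}, TwoSidedBound C q₀ q) ∧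
      (∀ u : ℝ → Sob G s, IsBOSolution G Set.univ u → ∀ t : ℝ, TwoSidedBound C (u 0) (u t)) := by
  have : Fact (-(1 / 2) < s ∧ s < 0) := ⟨hs, hs0⟩
  have hC : 0 < upperConst G s := zero_lt_one.trans_le one_le_upperConst
  refine ⟨upperConst G s * 2 ^ (-2 * s / (1 + 2 * s)), by positivity, fun A hA => ?_,
    fun A _ q₀ _ q hq => twoSidedBound_of_mem_betaOrbit hq,
    fun u hu t => twoSidedBound_of_mem_betaOrbit (hu.mem_betaOrbit 0 t)⟩
  -- This is the threshold of `isSmall_along_curve`, made uniform over the ball by replacing the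
  -- initial norm with A.
  obtain ⟨κ₀, hκ₀, hκ⟩ := exists_threshold hs (8 * hsConst G s * cmpConst s * A ^ 2)
  refine ⟨κ₀, hκ₀, fun κ hκκ q hq => ?_, fun Q hQ _ => ?_⟩
  · obtain ⟨q₀, hq₀, hq⟩ := mem_betaOrbit_iff.1 hq
    have hκ1 : 1 ≤ κ := hκ₀.trans hκκ
    have hh := hsConst_pos G s
    have hcm : 1 ≤ cmpConst s := one_le_cmpConst
    refine (laxInvertible_iff q κ).2 (IsSmall.isUnit_laxT hκ1
      (isSmall_of_mem_betaOrbit hκ1 hq (le_trans ?_ (hκ κ hκκ))).1)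
    gcongr
    exact hq₀.2
  · have hsub := jointOrbit_subset_betaOrbit (zero_lt_one.trans_le hκ₀) Q
    have hb : Bornology.IsBounded Q :=
      isBounded_iff_forall_norm_le.2 ⟨A, fun q hq => (hQ hq).2⟩
    exact ⟨hsub, (isBounded_betaOrbit hb).subset hsub,
      fun hE => (isEquicontinuous_betaOrbit hE).subset hsub⟩
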